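/- Let $d\ge 1$, $0<\alpha<1$, $0<s<\min\{1,d/2\}$, and let $m\in C^\infty([0,\infty))$ satisfy $\inf m>0$ and $m''\le 0$. Let $\mathcal P(\mathbb R^d)$ be the set of Borel probability measures on $\mathbb R^d$, let $\mathcal P_2(\mathbb R^d)$ be the set of those with finite second moment, and for $u\in\mathcal P(\mathbb R^d)$ put $$\|u\|_{\dot H^{-s}}^2=\frac1{(2\pi)^d}\int_{\mathbb R^d}|\xi|^{-2s}|\hat u(\xi)|^2\,d\xi\in[0,\infty],\qquad \hat u(\xi)=\int_{\mathbb R^d} e^{-ix\cdot\xi}\,du(x).$$ For nonnegative Radon measures $\gamma^0,\gamma^1$ on $\mathbb R^d$ let $\mathcal{CE}(\gamma^0\to\gamma^1)$ be the set of pairs $((\mu_t)_{t\in[0,1]},(\nu_t)_{t\in[0,1]})$ such that: the $\mu_t$ are nonnegative Radon measures, $t\mapsto\mu_t$ is weakly* continuous (tested against $C_c(\mathbb R^d)$), $\mu_0=\gamma^0$ and $\mu_1=\gamma^1$; $(\nu_t)$ is a Borel family of $\mathbb R^d$-valued Radon measures with $\int_0^1|\nu_t|(B_R)\,dt<\infty$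 for every ball $B_R=\{|x|<R\}$, $R>0$; and $\partial_t\mu_t+\nabla\cdot\nu_t=0$ in the sense of distributions on $\mathbb R^d\times(0,1)$. With the Lebesgue decompositions $\mu=\sigma\mathcal L^d+\mu^\perp$ and $\nu=\varrho\mathcal L^d+\nu^\perp$, let $\mathcal S(\mu,\nu)=\int_{\mathbb R^d}\frac{|\varrho|^2}{m(\sigma)}\,dx$ if $\nu^\perp=0$, and $\mathcal S(\mu,\nu)=+\infty$ otherwise. The modified Wasserstein distance is $$W_m(\gamma^0,\gamma^1)=\inf_{(\mu,\nu)\in\mathcal{CE}(\gamma^0\to\gamma^1)}\Big(\int_0^1\mathcal S(\mu_t,\nu_t)\,dt\Big)^{1/2},$$ which is $+\infty$ if $\mathcal{CE}(\gamma^0\to\gamma^1)=\emptyset$. For $k\ge1$ let $b^{(k)}_0=1$, $b^{(k)}_i=(i+1)^{1-\alpha}+(i-1)^{1-\alpha}-2i^{1-\alpha}$ for $1\le i\le k-1$, and $b^{(k)}_k=(k-1)^{1-\alpha}-k^{1-\alpha}$; and let $C_\alpha=1/\Gamma(2-\alpha)$. **Theorem.** Let $u_0\in\mathcal P_2(\mathbb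 R^d)$ with $\|u_0\|_{\dot H^{-s}}<\infty$. Then for every $\tau>0$ the JKO scheme $$u^0=u_0,\qquad u^k\in\operatorname*{argmin}_{u\in\mathcal P(\mathbb R^d)}\Big\{\frac{C_\alpha}{2\tau^\alpha}W_m^2(u,\bar u^{k-1})+\frac12\|u\|^2_{\dot H^{-s}}\Big\},\qquad \bar u^{k-1}=\sum_{i=0}^{k-1}\big(-b^{(k)}_{k-i}\big)u^i\qquad(k\ge1)$$ has a unique solution. That is, whenever $u^0=u_0,u^1,\dots,u^{k-1}$ are successive minimizers, the $k$-th minimization problem has exactly one minimizer; and there is exactly one sequence $(u^k)_{k\ge0}$ solving the scheme. -/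

import Mathlib

open MeasureTheory Set
open scoped ENNReal

noncomputable section

namespace JKO

/-- The Euclidean space `ℝ^d`. -/
abbrev E (d : ℕ) : Type := EuclideanSpace ℝ (Fin d)

/-- An `ℝ^d`-valued Radon measure `ν` on `ℝ^d`, given by its polar decomposition `ν = dir · |ν|`:
a locally finite Borel measure `variation = |ν|` and a Borel field of unit vectors. -/
structure VectorRadon (d : ℕ) where
  variation : Measure (E d)
  dir : E d → E d
  locallyFinite : IsLocallyFiniteMeasure variation
  measurable_dir : Measurable dir
  norm_dir : ∀ᵐ x ∂variation, ‖dir x‖ = 1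

/-- The value `ν(B)`, for bounded Borel sets `B`. -/
def VectorRadon.eval {d : ℕ} (ν : VectorRadon d) (B : Set (E d)) : E d :=
  ∫ x in B, ν.dir x ∂ν.variation

/-- The integral `∫ F · dν` of a vector field. -/
def VectorRadon.pairing {d : ℕ} (ν : VectorRadon d) (F : E d → E d) : ℝ :=
  ∫ x, inner ℝ (F x) (ν.dir x) ∂ν.variation

/-- The density `ϱ` of the absolutely continuous part in the Lebesgue decomposition
`ν = ϱ 𝓛^d + ν^⊥`. -/
def VectorRadon.density {d : ℕ} (ν : VectorRadon d) (x : E d) : E d :=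
  (ν.variation.rnDeriv volume x).toReal • ν.dir x

/-- `C_c^1(ℝ^d × (0,1))`. -/
structure IsTestFunction {d : ℕ} (φ : E d × ℝ → ℝ) : Prop where
  contDiff : ContDiff ℝ 1 φ
  hasCompactSupport : HasCompactSupport φ
  tsupport_subset : tsupport φ ⊆ univ ×ˢ Ioo (0 : ℝ) 1

/-- The set `CE(γ₀ → γ₁)` of solutions of `∂ₜμₜ + ∇ · νₜ = 0` on `ℝ^d × (0,1)` joining
`γ₀` to `γ₁`. Only the times `t ∈ [0,1]` matter. -/
structure IsContinuityPath {d : ℕ} (γ₀ γ₁ : Measure (E d))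
    (μ : ℝ → Measure (E d)) (ν : ℝ → VectorRadon d) : Prop where
  /-- each `μₜ` is a nonnegative Radon measure -/
  locallyFinite : ∀ t ∈ Icc (0 : ℝ) 1, IsLocallyFiniteMeasure (μ t)
  /-- `t ↦ μₜ` is weakly* continuous -/
  weakStar_continuous : ∀ f : E d → ℝ, Continuous f → HasCompactSupport f →
    ContinuousOn (fun t => ∫ x, f x ∂(μ t)) (Icc (0 : ℝ) 1)
  /-- `(νₜ)` is a Borel family -/
  borel_family : ∀ B : Set (E d), MeasurableSet B → Bornology.IsBounded B →
    Measurable (fun t : Icc (0 : ℝ) 1 => (ν t).eval B)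
  /-- the flux is locally integrable -/
  flux_finite : ∀ R : ℝ, 0 < R →
    ∫⁻ t in Icc (0 : ℝ) 1, (ν t).variation (Metric.ball 0 R) < ⊤
  /-- the continuity equation holds in the sense of distributions -/
  continuity_eq : ∀ φ : E d × ℝ → ℝ, IsTestFunction φ →
    (∫ t in Icc (0 : ℝ) 1, ∫ x, deriv (fun r => φ (x, r)) t ∂(μ t)) +
      (∫ t in Icc (0 : ℝ) 1, (ν t).pairing (fun x => gradient (fun y => φ (y, t)) x)) = 0
  init : μ 0 = γ₀
  final : μ 1 = γ₁

/-- The action density `ζ(r, w) = |w|² / m(r)`. -/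
def actionDensity {d : ℕ} (m : ℝ → ℝ) (r : ℝ) (w : E d) : ℝ := ‖w‖ ^ 2 / m r

open Classical in
/-- The action `𝒮(μ, ν) = ∫ ζ(σ, ϱ) dx` if `ν^⊥ = 0`, and `+∞` otherwise, where `σ`, `ϱ` are the
densities of the absolutely continuous parts. -/
def action {d : ℕ} (m : ℝ → ℝ) (μ : Measure (E d)) (ν : VectorRadon d) : ℝ≥0∞ :=
  if ν.variation ≪ volume then
    ∫⁻ x, ENNReal.ofReal (actionDensity m (μ.rnDeriv volume x).toReal (ν.density x))
  else ⊤

/-- The modified Wasserstein distance `W_m(γ₀, γ₁)`; it is `+∞` if `CE(γ₀ → γ₁)` is empty. -/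
def modifiedWasserstein {d : ℕ} (m : ℝ → ℝ) (γ₀ γ₁ : Measure (E d)) : ℝ≥0∞ :=
  ⨅ (μ : ℝ → Measure (E d)) (ν : ℝ → VectorRadon d) (_ : IsContinuityPath γ₀ γ₁ μ ν),
    (∫⁻ t in Icc (0 : ℝ) 1, action m (μ t) (ν t)) ^ (1 / 2 : ℝ)

/-- The Fourier transform `û(ξ) = ∫ e^{-i x·ξ} du(x)`. -/
def fourierTransform {d : ℕ} (u : Measure (E d)) (ξ : E d) : ℂ :=
  ∫ x, Complex.exp (-Complex.I * ((inner ℝ x ξ : ℝ) : ℂ)) ∂u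

/-- The squared homogeneous Sobolev norm `‖u‖²_{Ḣ^r} = (2π)^{-d} ∫ |ξ|^{2r} |û(ξ)|² dξ`. -/
def homSobolevNormSq {d : ℕ} (r : ℝ) (u : Measure (E d)) : ℝ≥0∞ :=
  ENNReal.ofReal (((2 * Real.pi) ^ d)⁻¹) *
    ∫⁻ ξ : E d, ENNReal.ofReal (‖ξ‖ ^ (2 * r) * ‖fourierTransform u ξ‖ ^ 2)

/-- The set `𝒫(ℝ^d)` of Borel probability measures. -/
def probMeasures (d : ℕ) : Set (Measure (E d)) := {u | IsProbabilityMeasure u}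

/-- The set `𝒫₂(ℝ^d)` of Borel probability measures with finite second moment. -/
def probMeasures₂ (d : ℕ) : Set (Measure (E d)) :=
  {u | u ∈ probMeasures d ∧ ∫⁻ x, ENNReal.ofReal (‖x‖ ^ 2) ∂u < ⊤}

/-- The coefficients `b^{(k)}_i` of the L1 approximation, `0 ≤ i ≤ k`, `k ≥ 1`. -/
def coeffB (α : ℝ) (k i : ℕ) : ℝ :=
  if i = 0 then 1
  else if i < k then
    ((i : ℝ) + 1) ^ (1 - α) + ((i : ℝ) - 1) ^ (1 - α) - 2 * (i : ℝ) ^ (1 - α)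
  else ((k : ℝ) - 1) ^ (1 - α) - (k : ℝ) ^ (1 - α)

/-- The average `ū^{k-1} = ∑_{i=0}^{k-1} (-b^{(k)}_{k-i}) u^i`, for `k ≥ 1`
(the weights are nonnegative). -/
def timeAverage {d : ℕ} (α : ℝ) (u : ℕ → Measure (E d)) (k : ℕ) : Measure (E d) :=
  ∑ i ∈ Finset.range k, ENNReal.ofReal (-coeffB α k (k - i)) • u i

/-- `C_α = 1 / Γ(2 - α)`. -/
def constC (α : ℝ) : ℝ := 1 / Real.Gamma (2 - α)

/-- The functional `u ↦ C_α / (2 τ^α) W_m²(u, ū) + ½ ‖u‖²_{Ḣ^{-s}}`. -/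
def functional {d : ℕ} (m : ℝ → ℝ) (α s τ : ℝ) (ubar u : Measure (E d)) : ℝ≥0∞ :=
  ENNReal.ofReal (constC α / (2 * τ ^ α)) * modifiedWasserstein m u ubar ^ 2 +
    2⁻¹ * homSobolevNormSq (-s) u

/-- `v` minimizes the functional with reference measure `ubar` over `𝒫(ℝ^d)`. -/
def IsStepMinimizer {d : ℕ} (m : ℝ → ℝ) (α s τ : ℝ) (ubar v : Measure (E d)) : Prop :=
  v ∈ probMeasures d ∧ IsMinOn (functional m α s τ ubar) (probMeasures d) v

/-- `u 0, …, u n` are the initial measure and the first `n` steps of the scheme. -/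
def IsSchemeUpTo {d : ℕ} (m : ℝ → ℝ) (α s τ : ℝ) (u₀ : Measure (E d))
    (n : ℕ) (u : ℕ → Measure (E d)) : Prop :=
  u 0 = u₀ ∧ ∀ k, 1 ≤ k → k ≤ n → IsStepMinimizer m α s τ (timeAverage α u k) (u k)

/-- The sequence `u` is a solution of the scheme. -/
def IsSchemeSolution {d : ℕ} (m : ℝ → ℝ) (α s τ : ℝ) (u₀ : Measure (E d))
    (u : ℕ → Measure (E d)) : Prop :=
  u 0 = u₀ ∧ ∀ k, 1 ≤ k → IsStepMinimizer m α s τ (timeAverage α u k) (u k)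

end JKO

end

open MeasureTheory Set Filter Topology
open scoped ENNReal
open ENNReal (ofReal ofReal_mul ofReal_ne_top one_lt_top ofReal_le_ofReal ofReal_lt_top mul_ne_top
  mul_lt_top ofReal_add toReal_ofReal rpow_mul ofReal_one mul_top lt_add_right continuous_ofReal
  add_lt_top rpow_natCast toReal_mono add_ne_top ofReal_pow toReal_mul mul_rpow_of_nonneg
  rpow_ne_top_of_nonneg one_ne_top toReal_add ofReal_zero ofReal_pos)
open Real (exp norm_of_nonneg smoothTransition rpow_add norm_eq_abs dist_eq mul_rpow rpow_pos_of_pos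
  zero_rpow rpow_two Gamma)
open Complex (norm_exp_ofReal_mul_I exp_add ofReal_exp)
open Finset (mem_filter sum_congr)

noncomputable section

namespace JKO

/-! Write q = 1/(1-s). A Gamma integral over the scale t turns the Sobolev norm into a constant
times the integral of t^(q-2) |u * G_{t^q}|² over space and scale, where G_r is a Gaussian
(`homSobolevNormSq_eq`). In this form the energy is a quadratic form which is monotone in the
measure, does not increase under mollification and separates finite measures. The same weight
appears when every point of u is spread over a ball of radius (lt)^(q/2): the action of this flow is
at most C·l times the energy of u (`flowCost_mollify_le`). A measure of finite energy is thus joined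
to its own mollifications at small cost, and such bridges pay for every regularization below.

The functional is first studied on flows, that is, on pairs of Lebesgue densities of bounded mass
solving the continuity equation, and the minimization is relaxed to subprobability measures, which
are vaguely compact. The energy obeys the parallelogram identity and |w|²/m(σ) is jointly convex
because m is concave. Hence minimizing sequences approach each other in the energy distance, and all
of them converge to one measure γ (`Problem.exists_limit`). Mollified near-minimizing flows are
bounded in L²; choosing them with nearly least L² norm makes them converge strongly. Fatou's lemma
then yields a flow between the mollifications of γ and of the reference measure, and a bridge at
each end shows that γ attains the infimum (`Problem.IsLimit.total_le`).

Relation to W_m. A flow of finite mass is realized by a solution of the continuity equation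
(`modifiedWasserstein_sq_le_flowCost`). Conversely, a path admitted in W_m may run through measures
of infinite mass, so its mollification is a flow without mass bound. A Hahn-Banach argument
(`exists_multiplier_of_cone`) finds a factor a with values in [0,1] such that (aσ, aw) is a flow of
mass at most one with the same final measure and an initial measure below the given one. Concavity
of m shows that the action does not grow (`IsFlow.exists_truncation`), and monotonicity that the
energy does not grow. So the relaxed infimum is at most the functional of any probability measure
(`Problem.value_le_pathTotal`).

Mass of γ (`Problem.measure_univ_eq_one`). For d ≤ 2 a flow of finite action conserves mass, since m
grows at most linearly. For d ≥ 3 mass can come from infinity at finite cost, but this is never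
optimal: if γ has mass 1 - Δ < 1, add to it e times minus the Laplacian of the potential (R² +
|x|²)^(-(d-2)/2) and subtract e times the gradient of the potential from the flux. The action then
changes by R^(-(d-2)) times a quantity tending to a negative constant for small e, while the energy
grows by a smaller power of R, so a large R contradicts minimality.

Uniqueness. For a minimizing probability measure u, truncation yields minimizing competitors below
mollifications of u. They converge to γ, so the Gaussian regularizations of γ are at most those of
u, and equality of mass forces γ = u (`Problem.IsLimit.eq_of_pathTotal_le`).

The scheme follows by induction, since the weights -b are nonnegative with sum one and every
minimizer has finite energy. -/

/-- Space-time. -/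
abbrev Q (d : ℕ) : Type := E d × ℝ

variable {d : ℕ} {g m : ℝ → ℝ} {C M R T b c e l q r t ε κ : ℝ} {G σ σ' φ ψ : Q d → ℝ}
  {u v γ γ' γ₀ γ₁ : Measure (E d)} {f ρ : E d → ℝ} {n : ℕ} {A B N : ℝ≥0∞} {w w' : Q d → E d}
  {x z : E d} {p : Q d}

/-! ### Mobilities and the convexity of the action density. -/

/-- The properties of a mobility which the proof uses. -/
structure IsMobility (m : ℝ → ℝ) : Prop where
  continuous : Continuous m
  concaveOn : ConcaveOn ℝ (Ici 0) m
  pos : ∀ r, 0 < m r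
  zero_le : ∀ r, m 0 ≤ m r
  monotone : Monotone m
  le_linear : ∃ B : ℝ, 0 ≤ B ∧ ∀ r, 0 ≤ r → m r ≤ m 0 + B * r

/-- If the function decreased strictly from x to y, concavity would force at least the same rate of
decrease after y, and the lower bound would be crossed. -/
lemma concave_bddBelow_monotoneOn (hc : ConcaveOn ℝ (Ici 0) m)
    (h : ∀ z, 0 ≤ z → c ≤ m z) : MonotoneOn m (Ici 0) := by
  intro x hx y hy hxy
  by_contra hlt
  push Not at hlt
  have hxy' := lt_of_le_of_ne hxy (by rintro rfl; exact lt_irrefl _ hlt)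
  set k := (m x - m y) / (y - x) with hk
  have hkpos : 0 < k := div_pos (by linarith) (by linarith)
  -- Beyond the point where the line of slope -k through (y, m y) meets the level c; the extra 1
  -- makes m z at most c - k.
  set z := y + (m y - c) / k + 1 with hz
  have hmy : 0 ≤ (m y - c) / k := div_nonneg (by linarith [h y hy]) hkpos.le
  have hyz : y < z := by linarith
  have hz0 : z ∈ Ici (0 : ℝ) := le_trans hy hyz.le
  have hs := hc.slope_anti_adjacent hx hz0 hxy' hyz
  have h1 : (m z - m y) ≤ -k * (z - y) := by
    have : (m y - m x) / (y - x) = -k := by rw [hk, ← neg_div]; ring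
    rw [this, div_le_iff₀ (by linarith)] at hs
    exact hs
  have h2 : k * (z - y) = (m y - c) + k := by rw [hz]; field_simp; ring
  have := h z hz0
  nlinarith

/-- Extending m by its value at 0 to the negative axis makes continuity and monotonicity hold on all
of ℝ, so that compositions with densities need no sign conditions. The action sees only nonnegative
densities and does not notice the extension. -/
lemma isMobility_max (hm_smooth : ContDiffOn ℝ ((⊤ : ℕ∞) : WithTop ℕ∞) m (Set.Ici 0))
    (hm_pos : ∃ c : ℝ, 0 < c ∧ ∀ z : ℝ, 0 ≤ z → c ≤ m z)
    (hm_concave : ∀ z : ℝ, 0 ≤ z → iteratedDerivWithin 2 m (Set.Ici 0) z ≤ 0) :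
    IsMobility (fun r => m (max r 0)) := by
  obtain ⟨c, hc, hcm⟩ := hm_pos
  have hcont := hm_smooth.continuousOn
  have htop := WithTop.coe_le_coe.2 (le_top : (2 : ℕ∞) ≤ ⊤)
  have hconc : ConcaveOn ℝ (Ici 0) m := by
    apply concaveOn_of_deriv2_nonpos (convex_Ici 0) hcont
    · rw [interior_Ici]
      exact (hm_smooth.differentiableOn (by simp)).mono Ioi_subset_Ici_self
    · rw [interior_Ici]
      have h2 := (hm_smooth.mono Ioi_subset_Ici_self).of_le htop
      have := h2.deriv_of_isOpen (m := 1) isOpen_Ioi (by norm_num)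
      exact this.differentiableOn (by simp)
    · rw [interior_Ici]
      intro x hx
      have h2 := ((hm_smooth.mono Ioi_subset_Ici_self).of_le htop).contDiffAt (Ioi_mem_nhds hx)
      have h := hm_concave x (mem_Ioi.1 hx).le
      rw [← iteratedDeriv_eq_iterate]
      have := iteratedDerivWithin_eq_iteratedDeriv (uniqueDiffOn_Ici 0) h2 (mem_Ici.2 (mem_Ioi.1 hx).le)
      rwa [← this]
  have hmono := concave_bddBelow_monotoneOn hconc hcm
  have hmax : ∀ r : ℝ, 0 ≤ max r 0 := fun r => le_max_right _ _
  refine ⟨?_, ?_, fun r => lt_of_lt_of_le hc (hcm _ (hmax r)), fun r => ?_, fun a b hab => ?_, ?_⟩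
  · exact hcont.comp_continuous (by fun_prop) hmax
  · refine hconc.congr fun r hr => ?_
    simp [max_eq_left (show 0 ≤ r from hr)]
  · exact hmono (by simp) (hmax r) (by simp)
  · exact hmono (hmax a) (hmax b) (max_le_max_right 0 hab)
  -- The slope of the linear bound is the right derivative at 0: a concave function lies below its
  -- tangent.
  · refine ⟨derivWithin m (Ici 0) 0, ?_, fun r hr => ?_⟩
    · exact hmono.derivWithin_nonneg
    · have hd : DifferentiableWithinAt ℝ m (Ici 0) 0 := (hm_smooth.differentiableOn (by simp)) 0 (by simp)
      rcases hr.eq_or_lt with rfl | hr'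
      · simp
      have := hconc.slope_le_of_hasDerivWithinAt (by simp) hr hr' hd.hasDerivWithinAt
      rw [slope_def_field, div_le_iff₀ (by linarith)] at this
      simp only [max_eq_left hr, max_self]
      linarith

lemma modifiedWasserstein_congr {m' : ℝ → ℝ} (h : ∀ r, 0 ≤ r → m r = m' r)
    (γ₀ γ₁ : Measure (E d)) : modifiedWasserstein m γ₀ γ₁ = modifiedWasserstein m' γ₀ γ₁ := by
  have : ∀ (μ : Measure (E d)) (ν : VectorRadon d), action m μ ν = action m' μ ν := by
    intro μ ν
    unfold action actionDensity
    simp only [h _ ENNReal.toReal_nonneg]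
  unfold modifiedWasserstein
  simp only [this]

/-- The integrand of the action, with values in `[0, ∞]`. -/
def actE (m : ℝ → ℝ) (r : ℝ) (w : E d) : ℝ≥0∞ := ofReal (actionDensity m r w)

lemma IsMobility.measurable_actE (hm : IsMobility m) {X : Type*}
    [MeasurableSpace X] {σ : X → ℝ} {w : X → E d} (hσ : Measurable σ) (hw : Measurable w) :
    Measurable fun x => actE m (σ x) (w x) := by
  unfold actE actionDensity
  have := hm.continuous.measurable
  fun_prop

lemma IsMobility.actE_anti (hm : IsMobility m) {r' : ℝ} (h : r ≤ r')
    (w : E d) : actE m r' w ≤ actE m r w := by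
  apply ofReal_le_ofReal
  exact div_le_div_of_nonneg_left (by positivity) (hm.pos r) (hm.monotone h)

lemma IsMobility.ofReal_normSq_eq (hm : IsMobility m) (r : ℝ) (w : E d) :
    ofReal (‖w‖ ^ 2) = ofReal (m r) * actE m r w := by
  unfold actE actionDensity
  rw [← ofReal_mul (hm.pos r).le]
  congr 1
  field_simp [(hm.pos r).ne']

/-- Concavity and m 0 > 0 give a·m(r) ≤ m(ar), hence a²/m(ar) ≤ 1/m(r) for a in [0,1]. This is why
multiplying a flow by a factor in [0,1] does not increase its action. -/
lemma IsMobility.actE_smul_le (hm : IsMobility m) {a : ℝ} (h0 : 0 ≤ a)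
    (h1 : a ≤ 1) (hr : 0 ≤ r) (w : E d) : actE m (a * r) (a • w) ≤ actE m r w := by
  unfold actE actionDensity
  apply ofReal_le_ofReal
  have hc := hm.concaveOn.2 hr (show 0 ∈ Ici 0 by simp) h0 (show 0 ≤ 1 - a by linarith) (by ring)
  simp at hc
  have h3 : a * m r ≤ m (a * r) := by nlinarith [hm.pos 0]
  rw [norm_smul, norm_of_nonneg h0, div_le_div_iff₀ (hm.pos _) (hm.pos _)]
  have h4 : a ^ 2 * m r ≤ m (a * r) := by
    have := mul_nonneg h0 (hm.pos r).le
    nlinarith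
  calc (a * ‖w‖) ^ 2 * m r = ‖w‖ ^ 2 * (a ^ 2 * m r) := by ring
    _ ≤ ‖w‖ ^ 2 * m (a * r) := by gcongr

/-- Cauchy-Schwarz for |w| = m(σ)^(1/2) · (|w|²/m(σ))^(1/2), followed by Jensen's inequality for the
concave function m. No integrability of w is required: the norm of its integral is at most the
integral of its norm in any case. -/
lemma IsMobility.jensen (hm : IsMobility m) {X : Type*} [MeasurableSpace X]
    (P : Measure X) [IsProbabilityMeasure P] {σ : X → ℝ} {w : X → E d} (hσ : Integrable σ P)
    (hσ0 : ∀ x, 0 ≤ σ x) (hw : AEMeasurable w P) :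
    actE m (∫ x, σ x ∂P) (∫ x, w x ∂P) ≤ ∫⁻ x, actE m (σ x) (w x) ∂P := by
  set I := ∫⁻ x, actE m (σ x) (w x) ∂P
  obtain ⟨B, hB0, hB⟩ := hm.le_linear
  have hmσ : Integrable (fun x => m (σ x)) P := by
    refine Integrable.mono' ((integrable_const (m 0)).add (hσ.const_mul B)) ?_ ?_
    · exact hm.continuous.comp_aestronglyMeasurable hσ.1
    · filter_upwards with x
      rw [norm_of_nonneg (hm.pos _).le]
      exact hB _ (hσ0 x)
  have hJ : ∫ x, m (σ x) ∂P ≤ m (∫ x, σ x ∂P) :=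
    hm.concaveOn.le_map_integral hm.continuous.continuousOn isClosed_Ici (.of_forall hσ0) hσ hmσ
  have hJ' : ∫⁻ x, ofReal (m (σ x)) ∂P ≤ ofReal (m (∫ x, σ x ∂P)) := by
    rw [← ofReal_integral_eq_lintegral_ofReal hmσ (.of_forall fun x => (hm.pos _).le)]
    exact ofReal_le_ofReal hJ
  have hmeas1 : AEMeasurable (fun x => (actE m (σ x) (w x)) ^ (1 / 2 : ℝ)) P := by
    have h1 := hm.continuous.measurable.comp_aemeasurable hσ.1.aemeasurable
    exact (((hw.norm.pow_const 2).div h1).ennreal_ofReal).pow_const _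
  have hmeas2 : AEMeasurable (fun x => (ofReal (m (σ x))) ^ (1 / 2 : ℝ)) P :=
    ((hm.continuous.measurable.comp_aemeasurable hσ.1.aemeasurable).ennreal_ofReal).pow_const _
  have key : ofReal (‖∫ x, w x ∂P‖ ^ 2) ≤ ofReal (m (∫ x, σ x ∂P)) * I := by
    have h2 : ∫⁻ x, ‖w x‖ₑ ∂P = ∫⁻ x, ((fun x => (ofReal (m (σ x))) ^ (1 / 2 : ℝ)) *
      (fun x => (actE m (σ x) (w x)) ^ (1 / 2 : ℝ))) x ∂P := by
      apply lintegral_congr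
      intro x
      simp only [Pi.mul_apply]
      rw [← mul_rpow_of_nonneg _ _ (by norm_num), ← hm.ofReal_normSq_eq,
        ENNReal.ofReal_rpow_of_nonneg (by positivity) (by norm_num), ← Real.sqrt_eq_rpow,
        Real.sqrt_sq (norm_nonneg _), ofReal_norm]
    have h3 := ENNReal.lintegral_mul_le_Lp_mul_Lq P Real.HolderConjugate.two_two hmeas2 hmeas1
    have h4 : ∀ f : X → ℝ≥0∞, (∫⁻ x, (f x ^ (1 / 2 : ℝ)) ^ (2 : ℝ) ∂P) = ∫⁻ x, f x ∂P := by
      intro f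
      apply lintegral_congr
      intro x
      rw [← rpow_mul]; norm_num
    rw [h4, h4, ← h2] at h3
    have h5 := (enorm_integral_le_lintegral_enorm _).trans h3
    rw [(show ofReal (‖∫ x, w x ∂P‖ ^ 2) = ‖∫ x, w x ∂P‖ₑ ^ (2 : ℝ) by norm_num)]
    calc ‖∫ x, w x ∂P‖ₑ ^ (2 : ℝ) ≤ ((∫⁻ x, ofReal (m (σ x)) ∂P) ^ (1 / 2 : ℝ) *
        (∫⁻ x, actE m (σ x) (w x) ∂P) ^ (1 / 2 : ℝ)) ^ (2 : ℝ) := by gcongr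
      _ = (∫⁻ x, ofReal (m (σ x)) ∂P) * I := by
        rw [← mul_rpow_of_nonneg _ _ (by norm_num), ← rpow_mul]; norm_num
        rfl
      _ ≤ _ := by gcongr
  rw [hm.ofReal_normSq_eq (∫ x, σ x ∂P)] at key
  exact (ENNReal.mul_le_mul_iff_right (by simpa using hm.pos _) ofReal_ne_top).1 key

/-- Joint convexity of |w|²/m(r): the two-term Cauchy-Schwarz inequality (a+b)² ≤ (a²/m + b²/m')(m +
m') and the concavity of m. -/
lemma IsMobility.actE_midpoint (hm : IsMobility m) {r' : ℝ} (hr : 0 ≤ r) (hr' : 0 ≤ r') (w w' : E d) :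
    actE m ((1 / 2) * (r + r')) ((1 / 2 : ℝ) • (w + w')) ≤ 2⁻¹ * (actE m r w + actE m r' w') := by
  have hinv : 2⁻¹ = ofReal (1 / 2) := by simp
  unfold actE actionDensity
  have hp := hm.pos r
  have hp' := hm.pos r'
  rw [hinv, ← ofReal_add (by positivity) (by positivity), ← ofReal_mul (by norm_num)]
  apply ofReal_le_ofReal
  have hc := hm.concaveOn.2 hr hr'
    (show 0 ≤ 1 / 2 by norm_num) (show (0 : ℝ) ≤ 1 / 2 by norm_num) (by norm_num)
  have hc' : (1 / 2) * (m r + m r') ≤ m ((1 / 2) * (r + r')) := by rw [mul_add, mul_add]; exact hc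
  rw [norm_smul, norm_of_nonneg (by norm_num), div_le_iff₀ (hm.pos _)]
  have hn : ‖w + w'‖ ≤ ‖w‖ + ‖w'‖ := norm_add_le _ _
  set a := ‖w‖
  set b := ‖w'‖
  have h1 : (1 / 2 * ‖w + w'‖) ^ 2 ≤ (1 / 4) * (a + b) ^ 2 := by
    have : ‖w + w'‖ ^ 2 ≤ (a + b) ^ 2 := by gcongr
    nlinarith
  have h2 : (a + b) ^ 2 ≤ (a ^ 2 / m r + b ^ 2 / m r') * (m r + m r') := by
    have : (a ^ 2 / m r + b ^ 2 / m r') * (m r + m r') - (a + b) ^ 2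
      = (a * m r' - b * m r) ^ 2 / (m r * m r') := by
      field_simp; ring
    have h3 : 0 ≤ (a * m r' - b * m r) ^ 2 / (m r * m r') := by positivity
    linarith
  calc (1 / 2 * ‖w + w'‖) ^ 2 ≤ (1 / 4) * (a + b) ^ 2 := h1
    _ ≤ (1 / 4) * ((a ^ 2 / m r + b ^ 2 / m r') * (m r + m r')) := by gcongr
    _ = 1 / 2 * (a ^ 2 / m r + b ^ 2 / m r') * ((1 / 2) * (m r + m r')) := by ring
    _ ≤ _ := by gcongr

/-! ### Mollifiers. -/

/-- The unnormalized tent function. -/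
def tent (z : E d) : ℝ := max (1 - ‖z‖) 0

lemma continuous_tent : Continuous (tent (d := d)) := by unfold tent; fun_prop

lemma tent_nonneg (z : E d) : 0 ≤ tent z := le_max_right _ _

lemma tent_le_one (z : E d) : tent z ≤ 1 := max_le (by linarith [norm_nonneg z]) zero_le_one

lemma tent_eq_zero (h : 1 ≤ ‖z‖) : tent z = 0 := max_eq_right (by linarith)

lemma hasCompactSupport_tent : HasCompactSupport (tent (d := d)) := by
  apply HasCompactSupport.intro (isCompact_closedBall 0 1)
  intro x hx
  apply tent_eq_zero
  simp at hx
  exact hx.le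

lemma integral_tent_pos : 0 < ∫ z : E d, tent z := by
  apply (integral_pos_iff_support_of_nonneg tent_nonneg
    (continuous_tent.integrable_of_hasCompactSupport hasCompactSupport_tent)).2
  exact continuous_tent.isOpen_support.measure_pos volume ⟨0, by simp [tent]⟩

/-- A compactly supported probability density on the unit ball. -/
def bump (z : E d) : ℝ := tent z / ∫ z : E d, tent z

/-- The rescaled density. -/
def bumpK (ε : ℝ) (x : E d) : ℝ := (ε ^ d)⁻¹ * bump (ε⁻¹ • x)

/-- The law with density `bump`, rescaled by `ε`. -/
def bumpLaw (d : ℕ) (ε : ℝ) : Measure (E d) :=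
  (volume.withDensity fun z => ofReal (bump z)).map (fun z => ε • z)

/-- Mollification of a measure. -/
def mollify (ε : ℝ) (γ : Measure (E d)) : Measure (E d) := γ.conv (bumpLaw d ε)

lemma continuous_bump : Continuous (bump (d := d)) := continuous_tent.div_const _

lemma bump_nonneg (z : E d) : 0 ≤ bump z := div_nonneg (tent_nonneg z) integral_tent_pos.le

lemma bump_eq_zero (h : 1 ≤ ‖z‖) : bump z = 0 := by simp [bump, tent_eq_zero h]

lemma bumpK_nonneg (hε : 0 ≤ ε) (z : E d) : 0 ≤ bumpK ε z := mul_nonneg (by positivity) (bump_nonneg _)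

lemma continuous_bumpK (ε : ℝ) : Continuous (bumpK (d := d) ε) := by
  exact continuous_const.mul (continuous_bump.comp (by fun_prop))

lemma bumpK_eq_zero (hε : 0 < ε) (h : ε ≤ ‖z‖) : bumpK ε z = 0 := by
  unfold bumpK
  rw [bump_eq_zero, mul_zero]
  rw [norm_smul, norm_inv, norm_of_nonneg hε.le]
  rw [le_inv_mul_iff₀ hε]; simpa using h

lemma hasCompactSupport_bumpK (hε : 0 < ε) : HasCompactSupport (bumpK (d := d) ε) := by
  apply HasCompactSupport.intro (isCompact_closedBall 0 ε)
  intro x hx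
  apply bumpK_eq_zero hε
  simp at hx
  exact hx.le

/-- An upper bound of the density `bump`. -/
def bumpMax (d : ℕ) : ℝ := 1 / ∫ z : E d, tent z

lemma bumpMax_pos : 0 < bumpMax d := one_div_pos.2 integral_tent_pos

lemma bump_le (z : E d) : bump z ≤ bumpMax d := by
  unfold bump bumpMax
  gcongr
  · exact integral_tent_pos.le
  · exact tent_le_one z

lemma bumpK_le (hε : 0 < ε) (z : E d) : bumpK ε z ≤ (ε ^ d)⁻¹ * bumpMax d := by
  unfold bumpK
  gcongr
  exact bump_le _

lemma integral_bump : ∫ z : E d, bump z = 1 := by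
  unfold bump
  rw [integral_div, div_self integral_tent_pos.ne']

lemma lintegral_bump : ∫⁻ z : E d, ofReal (bump z) = 1 := by
  have hi : Integrable (bump (d := d)) :=
    (continuous_tent.integrable_of_hasCompactSupport hasCompactSupport_tent).div_const _
  rw [← ofReal_integral_eq_lintegral_ofReal hi (.of_forall bump_nonneg), integral_bump, ofReal_one]

/-- As an image measure the law has mass one for every real ε, including ε = 0, where it is the
Dirac mass at the origin. Only the description by the density `bumpK ε` needs ε > 0. -/
instance (ε : ℝ) : IsProbabilityMeasure (bumpLaw d ε) := by
  have : IsProbabilityMeasure (volume.withDensity fun z : E d => ofReal (bump z)) :=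
    ⟨by simp [lintegral_bump]⟩
  exact Measure.isProbabilityMeasure_map (by fun_prop)

lemma lintegral_bumpLaw_eq (ε : ℝ) {f : E d → ℝ≥0∞} (hf : Measurable f) :
    ∫⁻ z, f z ∂bumpLaw d ε = ∫⁻ z, f (ε • z) * ofReal (bump z) := by
  unfold bumpLaw
  rw [lintegral_map hf (by fun_prop),
    lintegral_withDensity_eq_lintegral_mul _ continuous_bump.measurable.ennreal_ofReal
      (show Measurable fun z => f (ε • z) from hf.comp (by fun_prop))]
  apply lintegral_congr
  intro z
  simp [mul_comm]

lemma bumpLaw_eq_withDensity (hε : 0 < ε) : bumpLaw d ε = volume.withDensity fun z => ofReal (bumpK ε z) := by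
  apply Measure.ext_of_lintegral
  intro f hf
  rw [lintegral_bumpLaw_eq ε hf,
    lintegral_withDensity_eq_lintegral_mul _ ((continuous_bumpK ε).measurable.ennreal_ofReal) hf]
  have hg : Measurable fun z => ofReal (bumpK ε z) * f z :=
    ((continuous_bumpK ε).measurable.ennreal_ofReal).mul hf
  have h := lintegral_map (μ := (volume : Measure (E d))) hg (show Measurable fun z => ε • z by fun_prop)
  rw [Measure.map_addHaar_smul _ hε.ne', lintegral_smul_measure, finrank_euclideanSpace_fin,
    abs_of_pos (by positivity), smul_eq_mul] at h
  have hpos : 0 < ε ^ d := by positivity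
  have h2 : ∀ z, f (ε • z) * ofReal (bump z) = ofReal (ε ^ d) * (ofReal (bumpK ε (ε • z)) * f (ε • z)) := by
    intro z
    rw [← mul_assoc, ← ofReal_mul hpos.le, mul_comm (f _), bumpK, smul_smul,
      inv_mul_cancel₀ hε.ne', one_smul, ← mul_assoc, mul_inv_cancel₀ hpos.ne', one_mul]
  simp_rw [h2]
  rw [lintegral_const_mul' _ _ ofReal_ne_top, ← h, ← mul_assoc,
    ← ofReal_mul hpos.le, mul_inv_cancel₀ hpos.ne', ofReal_one, one_mul]
  rfl

lemma ae_bumpLaw_norm_le (hε : 0 ≤ ε) : ∀ᵐ z ∂bumpLaw d ε, ‖z‖ ≤ ε := by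
  unfold bumpLaw
  rw [ae_map_iff (by fun_prop) (measurableSet_le (by fun_prop) (by fun_prop)),
    ae_withDensity_iff continuous_bump.measurable.ennreal_ofReal]
  filter_upwards with z hz
  rw [norm_smul, norm_of_nonneg hε]
  by_contra h
  have h1 : 1 ≤ ‖z‖ := by
    by_contra h1
    push Not at h1 h
    nlinarith
  exact hz (by simp [bump_eq_zero h1])

lemma mollify_univ (ε : ℝ) (γ : Measure (E d)) [SFinite γ] : mollify ε γ univ = γ univ := by
  unfold mollify
  rw [← lintegral_one, Measure.lintegral_conv (by fun_prop)]
  simp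

instance (ε : ℝ) (γ : Measure (E d)) [IsProbabilityMeasure γ] :
    IsProbabilityMeasure (mollify ε γ) := ⟨by rw [mollify_univ]; exact measure_univ⟩

instance (ε : ℝ) (γ : Measure (E d)) [IsFiniteMeasure γ] :
    IsFiniteMeasure (mollify ε γ) := ⟨by rw [mollify_univ]; exact measure_lt_top _ _⟩

lemma lintegral_mollify (ε : ℝ) (γ : Measure (E d)) [SFinite γ] {f : E d → ℝ≥0∞} (hf : Measurable f) :
    ∫⁻ x, f x ∂(mollify ε γ) = ∫⁻ y, ∫⁻ z, f (y + z) ∂bumpLaw d ε ∂γ :=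
  Measure.lintegral_conv hf

lemma integral_mollify (ε : ℝ) (γ : Measure (E d)) [IsFiniteMeasure γ]
    (hf : Continuous f) (hC : ∀ x, |f x| ≤ C) :
    ∫ x, f x ∂(mollify ε γ) = ∫ y, ∫ z, f (y + z) ∂bumpLaw d ε ∂γ := by
  unfold mollify
  apply integral_conv
  exact Integrable.of_bound hf.aestronglyMeasurable C (.of_forall hC)

/-! ### Averages of test functions, dual to mollification. -/

/-- Averaging a function over translations in the space variable. -/
def avg (κ : Measure (E d)) (φ : Q d → ℝ) (p : Q d) : ℝ := ∫ z, φ (p.1 + z, p.2) ∂κ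

section

variable {κ : Measure (E d)}

lemma tendsto_zero_of_le {ι : Type*} {l : Filter ι} {f g : ι → ℝ≥0∞} (hg : Tendsto g l (𝓝 0))
    (h : ∀ i, f i ≤ g i) : Tendsto f l (𝓝 0) :=
  tendsto_of_tendsto_of_tendsto_of_le_of_le tendsto_const_nhds hg (fun _ => zero_le) h

lemma integrable_slice (hφ : Continuous φ) (hc : HasCompactSupport φ) (t : ℝ)
    (γ : Measure (E d)) [IsFiniteMeasure γ] : Integrable (fun x => φ (x, t)) γ := by
  obtain ⟨C, hC⟩ := hφ.bounded_above_of_compact_support hc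
  exact Integrable.of_bound (hφ.comp (by fun_prop)).aestronglyMeasurable C (.of_forall fun x => hC _)

lemma hasCompactSupport_slice (hc : HasCompactSupport φ) (t : ℝ) : HasCompactSupport fun y => φ (y, t) := by
  exact HasCompactSupport.of_support_subset_isCompact (hc.isCompact.image continuous_fst)
    fun y hy => ⟨(y, t), subset_tsupport _ hy, rfl⟩

lemma measurable_fderiv_apply {X : Type*} [MeasurableSpace X] {a b : X → Q d} (hφ : ContDiff ℝ 1 φ)
    (ha : Measurable a) (hb : Measurable b) : Measurable fun x => fderiv ℝ φ (a x) (b x) :=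
  isBoundedBilinearMap_apply.continuous.measurable.comp
    (((hφ.continuous_fderiv one_ne_zero).measurable.comp ha).prodMk hb)

lemma exists_bound_fderiv (hφ : ContDiff ℝ 1 φ) (hc : HasCompactSupport φ) :
    ∃ C, 0 ≤ C ∧ ∀ p, ‖fderiv ℝ φ p‖ ≤ C := by
  obtain ⟨C, hC⟩ := (hφ.continuous_fderiv (by norm_num)).bounded_above_of_compact_support (hc.fderiv ℝ)
  exact ⟨C, (norm_nonneg _).trans (hC 0), hC⟩

lemma hasFDerivAt_avg [IsProbabilityMeasure κ] (hφ : ContDiff ℝ 1 φ) (hc : HasCompactSupport φ) (p : Q d) :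
    HasFDerivAt (avg κ φ) (∫ z, fderiv ℝ φ (p.1 + z, p.2) ∂κ) p := by
  obtain ⟨C, hC0, hC⟩ := exists_bound_fderiv hφ hc
  obtain ⟨C', hC'⟩ := hφ.continuous.bounded_above_of_compact_support hc
  have hcont := hφ.continuous
  refine hasFDerivAt_integral_of_dominated_of_fderiv_le (𝕜 := ℝ) (F' := fun p z => fderiv ℝ φ (p.1 + z, p.2))
    (bound := fun _ => C) univ_mem ?_ ?_ ?_ ?_ (integrable_const _) ?_
  · filter_upwards with q
    exact (hcont.comp (by fun_prop)).aestronglyMeasurable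
  · exact Integrable.of_bound (hcont.comp (by fun_prop)).aestronglyMeasurable C' (.of_forall fun z => hC' _)
  · fun_prop
  · filter_upwards with z q _ using hC _
  · filter_upwards with z q _
    have h2 : HasFDerivAt (fun q => (q.1 + z, q.2)) (ContinuousLinearMap.id ℝ (Q d)) q := by
      have := (hasFDerivAt_id (𝕜 := ℝ) q).add_const (z, 0)
      refine this.congr_of_eventuallyEq (.of_forall fun x => ?_)
      ext <;> simp
    have h3 := ((hφ.differentiable (by norm_num) _).hasFDerivAt).comp q h2
    exact h3

lemma fderiv_avg [IsProbabilityMeasure κ] (hφ : ContDiff ℝ 1 φ) (hc : HasCompactSupport φ) (p v : Q d) :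
    fderiv ℝ (avg κ φ) p v = ∫ z, fderiv ℝ φ (p.1 + z, p.2) v ∂κ := by
  obtain ⟨C, hC0, hC⟩ := exists_bound_fderiv hφ hc
  have hdcont := hφ.continuous_fderiv one_ne_zero
  rw [(hasFDerivAt_avg hφ hc p).fderiv, ContinuousLinearMap.integral_apply]
  exact Integrable.of_bound (hdcont.comp (by fun_prop)).aestronglyMeasurable C (.of_forall fun z => hC _)

lemma contDiff_avg [IsProbabilityMeasure κ] (hφ : ContDiff ℝ 1 φ) (hc : HasCompactSupport φ) :
    ContDiff ℝ 1 (avg κ φ) := by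
  obtain ⟨C, hC0, hC⟩ := exists_bound_fderiv hφ hc
  have hdcont := hφ.continuous_fderiv one_ne_zero
  rw [contDiff_one_iff_hasFDerivAt]
  refine ⟨_, ?_, fun p => hasFDerivAt_avg hφ hc p⟩
  refine continuous_of_dominated (bound := fun _ => C) ?_ ?_ (integrable_const _) ?_
  · fun_prop
  · intro q
    filter_upwards with z using hC _
  · filter_upwards with z
    exact hdcont.comp (by fun_prop)

lemma hasCompactSupport_avg (hc : HasCompactSupport φ) (hκ : ∀ᵐ z ∂κ, ‖z‖ ≤ R) :
    HasCompactSupport (avg κ φ) := by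
  obtain ⟨M, hM⟩ := hc.isBounded.subset_closedBall (0 : Q d)
  apply HasCompactSupport.intro (isCompact_closedBall (0 : Q d) (M + |R|))
  intro p hp
  apply integral_eq_zero_of_ae
  filter_upwards [hκ] with z hz
  by_contra h
  have h1 := hM (subset_tsupport _ h)
  apply hp
  simp only [Metric.mem_closedBall, dist_zero_right] at h1 ⊢
  rw [(show p = (p.1 + z, p.2) - (z, 0) by ext <;> simp)]
  refine (norm_sub_le _ _).trans ?_
  have : ‖(z, (0 : ℝ))‖ ≤ |R| := by
    simp only [Prod.norm_def, norm_zero]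
    exact max_le (hz.trans (le_abs_self R)) (abs_nonneg _)
  linarith

end

-- Gaussian regularization and a Plancherel identity for measures.

local notation "wave(" x ", " y ")" => Complex.exp (-Complex.I * ((inner ℝ x y : ℝ) : ℂ))

/-- The Gaussian of variance proportional to `r`, normalized to have mass independent of `r`. -/
def gaus (r : ℝ) (x : E d) : ℝ := r ^ (-(d : ℝ) / 2) * exp (-(1 / (4 * r)) * ‖x‖ ^ 2)

lemma gaus_pos (hr : 0 < r) (x : E d) : 0 < gaus r x := by unfold gaus; positivity

lemma gaus_nonneg (hr : 0 ≤ r) (x : E d) : 0 ≤ gaus r x := by unfold gaus; positivity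

lemma continuous_gaus (r : ℝ) : Continuous (gaus (d := d) r) := by unfold gaus; fun_prop

lemma measurable_gaus : Measurable fun p : ℝ × E d => gaus p.1 p.2 := by unfold gaus; fun_prop

lemma gaus_le (hr : 0 ≤ r) (x : E d) : gaus r x ≤ r ^ (-(d : ℝ) / 2) := by
  unfold gaus
  apply mul_le_of_le_one_right (by positivity)
  rw [Real.exp_le_one_iff]
  have : 0 ≤ 1 / (4 * r) * ‖x‖ ^ 2 := by positivity
  linarith

lemma integrable_exp_neg_sq (hb : 0 < b) : Integrable fun x : E d => exp (-b * ‖x‖ ^ 2) := by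
  have h := (GaussianFourier.integrable_cexp_neg_mul_sq_norm_add (V := E d) (b := b)
    (by simpa using hb) 0 0).norm
  refine h.congr (.of_forall fun x => ?_)
  simp only [zero_mul, add_zero, Complex.norm_exp]
  congr 1
  rw [show (-b * ‖x‖ ^ 2) = ((-b * ‖x‖ ^ 2 : ℝ) : ℂ) by push_cast; ring, Complex.ofReal_re]

lemma integrable_gaus (hr : 0 < r) : Integrable (gaus (d := d) r) :=
  (integrable_exp_neg_sq (by positivity)).const_mul _

lemma integral_gaus (hr : 0 < r) : ∫ x : E d, gaus r x = (4 * Real.pi) ^ ((d : ℝ) / 2) := by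
  unfold gaus
  rw [integral_const_mul, GaussianFourier.integral_rexp_neg_mul_sq_norm (by positivity),
    finrank_euclideanSpace_fin, show Real.pi / (1 / (4 * r)) = (4 * Real.pi) * r by field_simp,
    mul_rpow (by positivity) hr.le, mul_comm, mul_assoc, ← rpow_add hr]
  rw [show d / 2 + -(d : ℝ) / 2 = 0 by ring, Real.rpow_zero, mul_one]

/-- The convolution of `u` with the Gaussian. -/
def smooth (r : ℝ) (u : Measure (E d)) (x : E d) : ℝ := ∫ y, gaus r (x - y) ∂u

lemma integrable_gaus_sub (hr : 0 ≤ r) (u : Measure (E d)) [IsFiniteMeasure u] (x : E d) :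
    Integrable (fun y => gaus r (x - y)) u := by
  refine Integrable.of_bound ((continuous_gaus r).comp (by fun_prop)).aestronglyMeasurable
    (r ^ (-(d : ℝ) / 2)) (.of_forall fun y => ?_)
  rw [norm_of_nonneg (gaus_nonneg hr _)]
  exact gaus_le hr _

lemma smooth_nonneg (hr : 0 ≤ r) (u : Measure (E d)) (x : E d) : 0 ≤ smooth r u x :=
  integral_nonneg fun _ => gaus_nonneg hr _

lemma ofReal_smooth (hr : 0 ≤ r) (u : Measure (E d)) [IsFiniteMeasure u] (x : E d) :
    ofReal (smooth r u x) = ∫⁻ y, ofReal (gaus r (x - y)) ∂u :=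
  ofReal_integral_eq_lintegral_ofReal (integrable_gaus_sub hr u x) (.of_forall fun _ => gaus_nonneg hr _)

lemma stronglyMeasurable_smooth (u : Measure (E d)) [IsFiniteMeasure u] :
    StronglyMeasurable fun p : Q d => smooth p.2 u p.1 := by
  have : StronglyMeasurable fun z : (Q d) × E d => gaus z.1.2 (z.1.1 - z.2) :=
    (measurable_gaus.comp (by fun_prop :
      Measurable fun z : (Q d) × E d => (z.1.2, z.1.1 - z.2))).stronglyMeasurable
  exact this.integral_prod_right

lemma continuous_smooth (hr : 0 ≤ r) (u : Measure (E d)) [IsFiniteMeasure u] : Continuous (smooth r u) := by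
  refine continuous_of_dominated (bound := fun _ => r ^ (-(d : ℝ) / 2)) ?_ ?_ (integrable_const _) ?_
  · intro x
    exact ((continuous_gaus r).comp (by fun_prop)).aestronglyMeasurable
  · intro x
    filter_upwards with y
    rw [norm_of_nonneg (gaus_nonneg hr _)]
    exact gaus_le hr _
  · filter_upwards with y
    exact (continuous_gaus r).comp (by fun_prop)

/-- The parallelogram law at the midpoint of y and y' separates the variable x from y - y'. The
constant is left in the shape that reappears in `integral_exp_mul_fourier`. -/
lemma integral_gaus_mul_gaus (hr : 0 < r) (y y' : E d) : ∫ x, gaus r (x - y) * gaus r (x - y') =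
  2 ^ d * ((Real.pi / (2 * r)) ^ ((d : ℝ) / 2) * exp (-(1 / (8 * r)) * ‖y - y'‖ ^ 2)) := by
  have h1 : ∀ x, gaus r (x - y) * gaus r (x - y') =
    (r ^ (-(d : ℝ) / 2) * r ^ (-(d : ℝ) / 2)) * exp (-(1 / (8 * r)) * ‖y - y'‖ ^ 2) *
      exp (-(1 / (2 * r)) * ‖x - (1 / 2 : ℝ) • (y + y')‖ ^ 2) := by
    intro x
    unfold gaus
    rw [mul_mul_mul_comm, ← Real.exp_add, mul_assoc (_ * _) (exp _), ← Real.exp_add]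
    congr 2
    have hp := parallelogram_law_with_norm ℝ (x - y) (x - y')
    have e1 : (x - y) + (x - y') = (2 : ℝ) • (x - (1 / 2 : ℝ) • (y + y')) := by
      rw [smul_sub, smul_smul, two_smul]; norm_num; abel
    have e2 : (x - y) - (x - y') = -(y - y') := by abel
    rw [e1, e2, norm_neg, norm_smul, norm_of_nonneg (by norm_num)] at hp
    field_simp
    nlinarith
  simp_rw [h1]
  rw [integral_const_mul, integral_sub_right_eq_self (fun x => exp (-(1 / (2 * r)) * ‖x‖ ^ 2)),
    GaussianFourier.integral_rexp_neg_mul_sq_norm (by positivity), finrank_euclideanSpace_fin]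
  have h3 : (Real.pi / (1 / (2 * r))) ^ ((d : ℝ) / 2) =
    2 ^ d * r ^ (d : ℝ) * (Real.pi / (2 * r)) ^ ((d : ℝ) / 2) := by
    rw [show Real.pi / (1 / (2 * r)) = (2 * r) ^ (2 : ℝ) * (Real.pi / (2 * r)) by
      norm_num; field_simp,
      mul_rpow (by positivity) (by positivity), ← Real.rpow_mul (by positivity),
      show (2 : ℝ) * ((d : ℝ) / 2) = d by ring, mul_rpow (by norm_num) hr.le,
      Real.rpow_natCast 2]
  rw [h3, ← rpow_add hr, show -(d : ℝ) / 2 + -(d : ℝ) / 2 = -(d : ℝ) by ring]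
  have h4 : r ^ (-(d : ℝ)) * r ^ (d : ℝ) = 1 := by rw [← rpow_add hr]; simp
  linear_combination (2 ^ d * (Real.pi / (2 * r)) ^ ((d : ℝ) / 2) * exp (-(1 / (8 * r)) * ‖y - y'‖ ^ 2)) * h4

lemma integral_exp_mul_fourier (hr : 0 < r) (y y' : E d) :
    ∫ ξ : E d, (exp (-(2 * r) * ‖ξ‖ ^ 2) : ℂ) * (wave(y, ξ) *
      Complex.exp (Complex.I * ((inner ℝ y' ξ : ℝ) : ℂ))) =
      (((Real.pi / (2 * r)) ^ ((d : ℝ) / 2) * exp (-(1 / (8 * r)) * ‖y - y'‖ ^ 2) : ℝ) : ℂ) := by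
  have h := GaussianFourier.integral_cexp_neg_mul_sq_norm_add (V := E d) (b := ((2 * r : ℝ) : ℂ))
    (by simpa using hr) (-Complex.I) (y - y')
  rw [finrank_euclideanSpace_fin] at h
  convert h using 1
  · apply integral_congr_ae
    filter_upwards with ξ
    rw [ofReal_exp, ← exp_add, ← exp_add, inner_sub_left]
    congr 1
    push_cast
    ring
  · rw [Complex.ofReal_mul, Complex.ofReal_cpow (by positivity), ofReal_exp]
    congr 1
    · push_cast; rfl
    · congr 1
      norm_num
      ring

/-- Writing |û|² as an integral over u ⊗ u makes Fubini's theorem applicable to a measure without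
density. -/
lemma normSq_fourier_eq (u : Measure (E d)) [IsFiniteMeasure u] (ξ : E d) :
    ((‖fourierTransform u ξ‖ ^ 2 : ℝ) : ℂ) = ∫ p : E d × E d, (wave(p.1, ξ) *
      Complex.exp (Complex.I * ((inner ℝ p.2 ξ : ℝ) : ℂ))) ∂(u.prod u) := by
  rw [integral_prod_mul (fun y => wave(y, ξ)) (fun y => Complex.exp (Complex.I * ((inner ℝ y ξ : ℝ) : ℂ)))]
  have : ∫ y, Complex.exp (Complex.I * ((inner ℝ y ξ : ℝ) : ℂ)) ∂u =
    (starRingEnd ℂ) (fourierTransform u ξ) := by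
    unfold fourierTransform
    rw [← integral_conj]
    congr 1
    ext y
    rw [← Complex.exp_conj]
    simp
  rw [this]
  change _ = fourierTransform u ξ * _
  rw [Complex.mul_conj, Complex.normSq_eq_norm_sq]

lemma continuous_fourierTransform (u : Measure (E d)) [IsFiniteMeasure u] :
    Continuous (fourierTransform u) := by
  refine continuous_of_dominated (bound := fun _ => 1) ?_ ?_ (integrable_const _) ?_
  · fun_prop
  · intro ξ
    filter_upwards with y
    rw [show -Complex.I * ((inner ℝ y ξ : ℝ) : ℂ) = ((-(inner ℝ y ξ : ℝ) : ℝ) : ℂ) * Complex.I by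
      push_cast; ring, norm_exp_ofReal_mul_I]
  · filter_upwards with y
    fun_prop

/-- Plancherel for the convolution of a finite measure with a Gaussian. Both sides are integrals
over u ⊗ u of the same Gaussian kernel in y - y', obtained by integrating in x on one side and in ξ
on the other. -/
lemma lintegral_smooth_sq (hr : 0 < r) (u : Measure (E d)) [IsFiniteMeasure u] :
    ∫⁻ x, ofReal (smooth r u x ^ 2) = ofReal (2 ^ d) *
      ∫⁻ ξ, ofReal (exp (-(2 * r) * ‖ξ‖ ^ 2) * ‖fourierTransform u ξ‖ ^ 2) := by
  set k : E d × E d → ℝ := fun p => (Real.pi / (2 * r)) ^ ((d : ℝ) / 2) *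
    exp (-(1 / (8 * r)) * ‖p.1 - p.2‖ ^ 2) with hk
  have hkc : Continuous k := by rw [hk]; fun_prop
  have hk0 : ∀ p, 0 ≤ k p := fun p => by positivity
  have hmg : Measurable fun z : E d × E d => ofReal (gaus r (z.1 - z.2)) :=
    ((continuous_gaus r).comp (by fun_prop)).measurable.ennreal_ofReal
  have h1 : ∫⁻ x, ofReal (smooth r u x ^ 2) = ofReal (2 ^ d) * ∫⁻ p, ofReal (k p) ∂(u.prod u) := by
    have e : ∀ x, ofReal (smooth r u x ^ 2) = ∫⁻ p : E d × E d,
      ofReal (gaus r (x - p.1) * gaus r (x - p.2)) ∂(u.prod u) := by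
      intro x
      rw [ofReal_pow (smooth_nonneg hr.le u x), ofReal_smooth hr.le, sq, ← lintegral_prod_mul]
      · apply lintegral_congr
        intro p
        rw [ofReal_mul (gaus_nonneg hr.le _)]
      · exact (((continuous_gaus r).comp (by fun_prop)).measurable.ennreal_ofReal).aemeasurable
      · exact (((continuous_gaus r).comp (by fun_prop)).measurable.ennreal_ofReal).aemeasurable
    simp_rw [e]
    rw [lintegral_lintegral_swap, ← lintegral_const_mul' _ _ ofReal_ne_top]
    · apply lintegral_congr
      intro p
      rw [← ofReal_mul (by positivity), hk]
      simp only
      rw [← integral_gaus_mul_gaus hr, ofReal_integral_eq_lintegral_ofReal]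
      · refine ((integrable_gaus hr).comp_sub_right p.1).mul_bdd (c := r ^ (-(d : ℝ) / 2))
          ((continuous_gaus r).comp (by fun_prop)).aestronglyMeasurable
          (.of_forall fun x => ?_)
        rw [norm_of_nonneg (gaus_nonneg hr.le _)]
        exact gaus_le hr.le _
      · exact .of_forall fun x => mul_nonneg (gaus_nonneg hr.le _) (gaus_nonneg hr.le _)
    · refine Measurable.aemeasurable (Measurable.ennreal_ofReal ?_)
      have hc := continuous_gaus (d := d) r
      exact ((hc.comp (by fun_prop : Continuous fun a : E d × (E d × E d) => a.1 - a.2.1)).mul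
        (hc.comp (by fun_prop : Continuous fun a : E d × (E d × E d) => a.1 - a.2.2))).measurable
  rw [h1]
  congr 1
  have hint : Integrable (fun ξ => exp (-(2 * r) * ‖ξ‖ ^ 2) * ‖fourierTransform u ξ‖ ^ 2) := by
    refine (integrable_exp_neg_sq (by positivity : 0 < 2 * r)).mul_bdd (c := (u.real univ) ^ 2)
      ((continuous_fourierTransform u).norm.pow 2).aestronglyMeasurable
      (.of_forall fun ξ => ?_)
    rw [norm_of_nonneg (by positivity)]
    gcongr
    unfold fourierTransform
    refine (norm_integral_le_of_norm_le_const (C := 1) (.of_forall fun y => ?_)).trans (by simp)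
    rw [show -Complex.I * ((inner ℝ y ξ : ℝ) : ℂ) = ((-(inner ℝ y ξ : ℝ) : ℝ) : ℂ) * Complex.I by
      push_cast; ring, norm_exp_ofReal_mul_I]
  have hkint : Integrable k (u.prod u) := by
    refine Integrable.of_bound hkc.aestronglyMeasurable ((Real.pi / (2 * r)) ^ ((d : ℝ) / 2))
      (.of_forall fun p => ?_)
    rw [norm_of_nonneg (hk0 p)]
    apply mul_le_of_le_one_right (by positivity)
    rw [Real.exp_le_one_iff]
    have : 0 ≤ 1 / (8 * r) * ‖p.1 - p.2‖ ^ 2 := by positivity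
    linarith
  rw [← ofReal_integral_eq_lintegral_ofReal hkint (.of_forall hk0),
    ← ofReal_integral_eq_lintegral_ofReal hint (.of_forall fun ξ => by positivity)]
  congr 1
  apply Complex.ofReal_injective
  rw [← integral_complex_ofReal, ← integral_complex_ofReal]
  simp_rw [Complex.ofReal_mul, normSq_fourier_eq, ← integral_const_mul]
  rw [integral_integral_swap]
  · apply integral_congr_ae
    filter_upwards with p
    rw [integral_exp_mul_fourier hr, hk]
  · refine Integrable.mono'
      ((integrable_exp_neg_sq (by positivity : 0 < 2 * r)).mul_prod (integrable_const (1 : ℝ))) ?_ ?_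
    · fun_prop
    · filter_upwards with z
      simp only [Function.uncurry]
      rw [norm_mul, norm_mul, Complex.norm_real, norm_of_nonneg (by positivity),
        show -Complex.I * ((inner ℝ z.2.1 z.1 : ℝ) : ℂ) =
          ((-(inner ℝ z.2.1 z.1 : ℝ) : ℝ) : ℂ) * Complex.I by push_cast; ring,
        norm_exp_ofReal_mul_I, mul_comm Complex.I, norm_exp_ofReal_mul_I]
      simp

/-! ### The Sobolev norm as an energy over space and scale. -/

/-- The space-scale measure `t^(q-2) dx dt`. -/
def scaleM (d : ℕ) (q : ℝ) : Measure (Q d) := (volume : Measure (E d)).prod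
    ((volume.restrict (Ioi 0)).withDensity fun t => ofReal (t ^ (q - 2)))

/-- The Gaussian regularization of `u` at scale `t ^ q`. -/
def heat (q : ℝ) (u : Measure (E d)) (p : Q d) : ℝ := smooth (p.2 ^ q) u p.1

/-- The Gaussian form of the Sobolev energy. -/
def energy (q : ℝ) (u : Measure (E d)) : ℝ≥0∞ := ∫⁻ p, ofReal (heat q u p ^ 2) ∂scaleM d q

lemma measurable_heat (q : ℝ) (u : Measure (E d)) [IsFiniteMeasure u] : Measurable (heat q u) :=
  (stronglyMeasurable_smooth u).measurable.comp (by fun_prop : Measurable fun p : Q d => (p.1, p.2 ^ q))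

lemma lintegral_scaleM (q : ℝ) {f : Q d → ℝ≥0∞} (hf : Measurable f) : ∫⁻ p, f p ∂scaleM d q =
  ∫⁻ t in Ioi (0 : ℝ), ofReal (t ^ (q - 2)) * ∫⁻ x, f (x, t) := by
  unfold scaleM
  rw [lintegral_prod_symm' _ hf, lintegral_withDensity_eq_lintegral_mul]
  · rfl
  · fun_prop
  · fun_prop

/-- The constant relating the Gaussian energy and the Sobolev norm. -/
def energyConst (d : ℕ) (s : ℝ) : ℝ := ((2 * Real.pi) ^ d)⁻¹ * (2 ^ d * (2 ^ (-s) * (1 - s) * Gamma s))⁻¹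

lemma energyConst_pos {s : ℝ} (hs0 : 0 < s) (hs1 : s < 1) : 0 < energyConst d s := by
  unfold energyConst
  positivity

/-- By Plancherel at each scale, it remains to integrate t^(q-2) exp(-2|ξ|² t^q) over t > 0. This is
a Gamma integral, equal to a constant times |ξ|^(-2s) because (q-1)/q = s. -/
lemma homSobolevNormSq_eq {s : ℝ} (hd : 0 < d) (hs0 : 0 < s) (hs1 : s < 1) (u : Measure (E d))
    [IsFiniteMeasure u] :
    homSobolevNormSq (-s) u = ofReal (energyConst d s) * energy (1 / (1 - s)) u := by
  set q := 1 / (1 - s) with hq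
  have h1s : 0 < 1 - s := by linarith
  have hq0 : 0 < q := by positivity
  have hqs : (q - 2 + 1) / q = s := by rw [hq]; field_simp; ring
  set c := 2 ^ (-s) * (1 - s) * Gamma s with hc
  have hcpos : 0 < c := by positivity
  have hmf := (continuous_fourierTransform u).norm.measurable
  have hE : energy q u = ofReal (2 ^ d) * (ofReal c *
    ∫⁻ ξ : E d, ofReal (‖ξ‖ ^ (2 * -s) * ‖fourierTransform u ξ‖ ^ 2)) := by
    unfold energy
    rw [lintegral_scaleM q ((measurable_heat q u).pow_const 2).ennreal_ofReal]
    have e1 : ∀ t ∈ Ioi 0, ofReal (t ^ (q - 2)) * ∫⁻ x, ofReal (heat q u (x, t) ^ 2) = ofReal (2 ^ d) *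
      ∫⁻ ξ, ofReal (t ^ (q - 2) * exp (-(2 * ‖ξ‖ ^ 2) * t ^ q)) * ofReal (‖fourierTransform u ξ‖ ^ 2) := by
      intro t ht
      have ht : 0 < t := ht
      unfold heat
      simp only
      rw [lintegral_smooth_sq (by positivity) u, mul_left_comm, ← lintegral_const_mul' _ _ ofReal_ne_top]
      congr 1
      apply lintegral_congr
      intro ξ
      rw [ofReal_mul (by positivity), ofReal_mul (by positivity), mul_assoc]
      congr 4
      ring
    rw [setLIntegral_congr_fun measurableSet_Ioi e1, lintegral_const_mul' _ _ ofReal_ne_top]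
    congr 1
    rw [lintegral_lintegral_swap, ← lintegral_const_mul' _ _ ofReal_ne_top]
    · apply lintegral_congr_ae
      -- In positive dimension the origin is a null set; at ξ = 0 the Gamma integral does not have
      -- the stated value.
      have : Nonempty (Fin d) := ⟨⟨0, hd⟩⟩
      filter_upwards [Measure.ae_ne volume (0 : E d)] with ξ hξ
      rw [lintegral_mul_const _ (by fun_prop), ofReal_mul (p := ‖ξ‖ ^ (2 * -s)) (by positivity), ← mul_assoc]
      congr 1
      have hI := integral_rpow_mul_exp_neg_mul_rpow (p := q) (q := q - 2) (b := 2 * ‖ξ‖ ^ 2) hq0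
        (by have : 1 < q := by rw [hq, lt_div_iff₀ h1s]; linarith
            linarith) (by positivity)
      rw [← ofReal_integral_eq_lintegral_ofReal, hI, ← ofReal_mul hcpos.le, hqs]
      · congr 1
        rw [show -(q - 2 + 1) / q = -s by rw [neg_div, hqs],
          mul_rpow (by norm_num) (by positivity), ← Real.rpow_natCast ‖ξ‖ 2,
          ← Real.rpow_mul (norm_pos_iff.2 hξ).le, hc, hq]
        push_cast
        field_simp
      -- The formula for the integral already implies integrability: otherwise the integral would be
      -- 0 by convention, while its value is positive.
      · by_contra hni
        rw [integral_undef hni] at hI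
        have : 0 < (2 * ‖ξ‖ ^ 2) ^ (-(q - 2 + 1) / q) * (1 / q) *
          Gamma ((q - 2 + 1) / q) := by rw [hqs]; positivity
        linarith
      · filter_upwards [ae_restrict_mem measurableSet_Ioi] with t ht
        have ht : 0 < t := ht
        positivity
    · refine Measurable.aemeasurable (Measurable.mul (Measurable.ennreal_ofReal ?_)
        (Measurable.ennreal_ofReal ((hmf.comp measurable_snd).pow_const 2)))
      fun_prop
  rw [hE, homSobolevNormSq, energyConst, ← hc, ofReal_mul (by positivity), mul_assoc]
  congr 1
  have h2c : 0 < 2 ^ d * c := by positivity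
  rw [← mul_assoc (ofReal (2 ^ d)), ← ofReal_mul (by positivity), ← mul_assoc,
    ← ofReal_mul (by positivity), inv_mul_cancel₀ h2c.ne', ofReal_one, one_mul]

/-! ### Monotonicity, convexity and regularization properties of the energy. -/

/-- The squared distance associated with the energy. -/
def energyDist (q : ℝ) (u v : Measure (E d)) : ℝ≥0∞ :=
  ∫⁻ p, ofReal ((heat q u p - heat q v p) ^ 2) ∂scaleM d q

lemma ae_snd_pos_scaleM (q : ℝ) : ∀ᵐ p ∂scaleM d q, 0 < p.2 := by
  refine Measure.quasiMeasurePreserving_snd.ae ?_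
  refine (withDensity_absolutelyContinuous _ _).ae_le ?_
  exact ae_restrict_mem measurableSet_Ioi

lemma ae_ae_of_ae_scaleM {P : Q d → Prop} (h : ∀ᵐ p ∂scaleM d q, P p) :
    ∀ᵐ t ∂(volume.restrict (Ioi (0 : ℝ))), ∀ᵐ x : E d, P (x, t) := by
  have h2 := Measure.ae_ae_of_ae_prod (Measure.measurePreserving_swap.quasiMeasurePreserving.ae h)
  rw [ae_withDensity_iff (by fun_prop)] at h2
  filter_upwards [h2, ae_restrict_mem measurableSet_Ioi] with t ht ht0
  apply ht
  have : 0 < t ^ (q - 2) := rpow_pos_of_pos ht0 _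
  simpa using this

lemma smooth_mono (hr : 0 ≤ r) [IsFiniteMeasure v] (h : u ≤ v) (x : E d) : smooth r u x ≤ smooth r v x :=
  integral_mono_measure h (.of_forall fun _ => gaus_nonneg hr _) (integrable_gaus_sub hr v x)

/-- Gaussian kernels are positive. This order property, invisible on the Fourier side, is what
allows competitors to be truncated. -/
lemma energy_mono [IsFiniteMeasure v] (h : u ≤ v) : energy q u ≤ energy q v := by
  apply lintegral_mono_ae
  filter_upwards [ae_snd_pos_scaleM q] with p hp
  apply ofReal_le_ofReal
  have hr : 0 ≤ p.2 ^ q := by positivity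
  exact pow_le_pow_left₀ (smooth_nonneg hr u p.1) (smooth_mono hr h p.1) 2

lemma heat_add [IsFiniteMeasure u] [IsFiniteMeasure v]
    (hp : 0 < p.2) : heat q (u + v) p = heat q u p + heat q v p :=
  integral_add_measure (integrable_gaus_sub (by positivity) u p.1) (integrable_gaus_sub (by positivity) v p.1)

lemma heat_smul (c : ℝ≥0∞) (p : Q d) : heat q (c • u) p = c.toReal * heat q u p := integral_smul_measure _ c

/-- The midpoint of two measures. -/
def mid (u v : Measure (E d)) : Measure (E d) := (2⁻¹ : ℝ≥0∞) • (u + v)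

instance (u v : Measure (E d)) [IsFiniteMeasure u] [IsFiniteMeasure v] : IsFiniteMeasure (mid u v) := by
  unfold mid
  exact Measure.smul_finite _ (by simp)

lemma heat_mid [IsFiniteMeasure u] [IsFiniteMeasure v]
    (hp : 0 < p.2) : heat q (mid u v) p = (1 / 2) * (heat q u p + heat q v p) := by
  unfold mid
  rw [heat_smul, heat_add hp]
  norm_num

lemma ofReal_half : ofReal (1 / 2) = 2⁻¹ := by rw [one_div, ENNReal.ofReal_inv_of_pos (by norm_num)]; simp

lemma ofReal_quarter : ofReal (1 / 4) = 4⁻¹ := by rw [one_div, ENNReal.ofReal_inv_of_pos (by norm_num)]; simp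

/-- The parallelogram identity. The defect term is the source both of the Cauchy property of
minimizing sequences and of uniqueness. -/
lemma energy_mid (u v : Measure (E d)) [IsFiniteMeasure u] [IsFiniteMeasure v] :
    energy q (mid u v) + 4⁻¹ * energyDist q u v = 2⁻¹ * (energy q u + energy q v) := by
  unfold energy energyDist
  have hu := measurable_heat q u
  have hv := measurable_heat q v
  have hm := measurable_heat q (mid u v)
  rw [← lintegral_const_mul _ (by fun_prop), ← lintegral_add_left (by fun_prop),
    ← lintegral_add_left (by fun_prop), ← lintegral_const_mul _ (by fun_prop)]
  apply lintegral_congr_ae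
  filter_upwards [ae_snd_pos_scaleM q] with p hp
  rw [heat_mid hp, ← ofReal_half, ← ofReal_quarter, ← ofReal_mul (by norm_num),
    ← ofReal_add (by positivity) (by positivity),
    ← ofReal_add (by positivity) (by positivity), ← ofReal_mul (by norm_num)]
  congr 1
  ring

lemma energyDist_triangle (q : ℝ) (u v w : Measure (E d)) [IsFiniteMeasure u] [IsFiniteMeasure v]
    [IsFiniteMeasure w] :
    energyDist q u w ≤ 2 * (energyDist q u v + energyDist q v w) := by
  unfold energyDist
  have hu := measurable_heat q u
  have hv := measurable_heat q v
  have hw := measurable_heat q w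
  rw [← lintegral_add_left (by fun_prop), ← lintegral_const_mul _ (by fun_prop)]
  apply lintegral_mono
  intro p
  simp only
  rw [← ofReal_add (by positivity) (by positivity), ← ENNReal.ofReal_ofNat 2, ← ofReal_mul (by norm_num)]
  apply ofReal_le_ofReal
  nlinarith [sq_nonneg ((heat q u p - heat q v p) - (heat q v p - heat q w p))]

lemma energy_add_le (q : ℝ) (u v : Measure (E d)) [IsFiniteMeasure u] [IsFiniteMeasure v] :
    energy q (u + v) ≤ 2 * (energy q u + energy q v) := by
  unfold energy
  have hu := measurable_heat q u
  have hv := measurable_heat q v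
  rw [← lintegral_add_left (by fun_prop), ← lintegral_const_mul _ (by fun_prop)]
  apply lintegral_mono_ae
  filter_upwards [ae_snd_pos_scaleM q] with p hp
  rw [heat_add hp, ← ofReal_add (by positivity) (by positivity), ← ENNReal.ofReal_ofNat 2,
    ← ofReal_mul (by norm_num)]
  apply ofReal_le_ofReal
  nlinarith [sq_nonneg (heat q u p - heat q v p)]

lemma energy_smul (q : ℝ) (u : Measure (E d)) (c : ℝ≥0∞) :
    energy q (c • u) = ofReal (c.toReal ^ 2) * energy q u := by
  unfold energy
  rw [← lintegral_const_mul' _ _ ofReal_ne_top]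
  apply lintegral_congr
  intro p
  rw [heat_smul, mul_pow, ofReal_mul (by positivity)]

lemma energy_sum_lt_top (q : ℝ) {ι : Type*} (S : Finset ι) (c : ι → ℝ≥0∞) (u : ι → Measure (E d))
    (hc : ∀ i ∈ S, c i ≠ ⊤) (hu : ∀ i ∈ S, IsFiniteMeasure (u i))
    (h : ∀ i ∈ S, energy q (u i) < ⊤) :
    IsFiniteMeasure (∑ i ∈ S, c i • u i) ∧ energy q (∑ i ∈ S, c i • u i) < ⊤ := by
  classical
  induction S using Finset.induction_on with
  | empty =>
    simp
    refine ⟨inferInstance, ?_⟩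
    simp [energy, heat, smooth]
  | insert a S ha ih =>
    obtain ⟨h1, h2⟩ := ih (fun i hi => hc i (by simp [hi])) (fun i hi => hu i (by simp [hi]))
      (fun i hi => h i (by simp [hi]))
    rw [Finset.sum_insert ha]
    have := hu a (by simp)
    have h3 : IsFiniteMeasure (c a • u a) := Measure.smul_finite _ (hc a (by simp))
    refine ⟨inferInstance, ?_⟩
    refine (energy_add_le q _ _).trans_lt ?_
    refine mul_lt_top (by simp) (add_lt_top.2 ⟨?_, h2⟩)
    rw [energy_smul]
    exact mul_lt_top ofReal_lt_top (h a (by simp))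

lemma sq_lintegral_le {X : Type*} [MeasurableSpace X] (P : Measure X) [IsProbabilityMeasure P]
    {f : X → ℝ≥0∞} (hf : AEMeasurable f P) : (∫⁻ x, f x ∂P) ^ 2 ≤ ∫⁻ x, f x ^ 2 ∂P := by
  have h := ENNReal.lintegral_mul_le_Lp_mul_Lq P Real.HolderConjugate.two_two hf (aemeasurable_const (b := 1))
  simp only [Pi.mul_apply, mul_one, ENNReal.one_rpow, lintegral_one, measure_univ] at h
  calc (∫⁻ x, f x ∂P) ^ 2 ≤ ((∫⁻ x, f x ^ (2 : ℝ) ∂P) ^ (1 / 2 : ℝ)) ^ 2 := by gcongr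
    _ = ∫⁻ x, f x ^ 2 ∂P := by
      rw [← rpow_natCast, ← rpow_mul]
      simp

lemma ofReal_smooth_mollify (hr : 0 ≤ r) (ε : ℝ) (u : Measure (E d)) [IsFiniteMeasure u]
    (x : E d) : ofReal (smooth r (mollify ε u) x) = ∫⁻ z, ofReal (smooth r u (x - z)) ∂bumpLaw d ε := by
  have hc := continuous_gaus (d := d) r
  rw [ofReal_smooth hr, lintegral_mollify _ _ (f := fun y => ofReal (gaus r (x - y)))
    ((hc.comp (by fun_prop)).measurable.ennreal_ofReal), lintegral_lintegral_swap]
  · apply lintegral_congr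
    intro z
    rw [ofReal_smooth hr]
    apply lintegral_congr
    intro y
    rw [sub_sub, add_comm]
  · fun_prop

/-- The regularization of a mollified measure is an average of translates; the squared average is at
most the average of squares, and Lebesgue measure is translation invariant. -/
lemma energy_mollify_le (q ε : ℝ) (u : Measure (E d)) [IsFiniteMeasure u] :
    energy q (mollify ε u) ≤ energy q u := by
  unfold energy
  rw [lintegral_scaleM q ((measurable_heat q _).pow_const 2).ennreal_ofReal,
    lintegral_scaleM q ((measurable_heat q _).pow_const 2).ennreal_ofReal]
  apply setLIntegral_mono' measurableSet_Ioi
  intro t ht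
  refine mul_le_mul_right ?_ _
  have hr : (0 : ℝ) ≤ t ^ q := Real.rpow_nonneg (le_of_lt ht) _
  unfold heat
  simp only
  have hcs := continuous_smooth hr u
  calc ∫⁻ x, ofReal (smooth (t ^ q) (mollify ε u) x ^ 2)
      ≤ ∫⁻ x, ∫⁻ z, ofReal (smooth (t ^ q) u (x - z) ^ 2) ∂bumpLaw d ε := by
        apply lintegral_mono
        intro x
        simp only
        rw [ofReal_pow (smooth_nonneg hr _ _), ofReal_smooth_mollify hr]
        refine (sq_lintegral_le _ ?_).trans (le_of_eq ?_)
        · fun_prop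
        · apply lintegral_congr
          intro z
          rw [ofReal_pow (smooth_nonneg hr _ _)]
    _ = ∫⁻ z, (∫⁻ x, ofReal (smooth (t ^ q) u (x - z) ^ 2)) ∂bumpLaw d ε := by
      have hm := ((hcs.comp (by fun_prop : Continuous fun p : E d × E d =>
        p.1 - p.2)).pow 2).measurable.ennreal_ofReal
      exact lintegral_lintegral_swap (μ := volume) hm.aemeasurable
    _ = ∫⁻ x, ofReal (smooth (t ^ q) u x ^ 2) := by
      have h : ∀ z, ∫⁻ x, ofReal (smooth (t ^ q) u (x - z) ^ 2) =
        ∫⁻ x, ofReal (smooth (t ^ q) u x ^ 2) := fun z =>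
        lintegral_sub_right_eq_self (fun x => ofReal (smooth (t ^ q) u x ^ 2)) z
      exact (lintegral_congr h).trans (by simp)

lemma tendsto_smooth_mollify (hr : 0 ≤ r) (u : Measure (E d)) [IsFiniteMeasure u]
    (x : E d) {ε : ℕ → ℝ} (hε0 : ∀ n, 0 ≤ ε n) (hε : Tendsto ε atTop (𝓝 0)) :
    Tendsto (fun n => smooth r (mollify (ε n) u) x) atTop (𝓝 (smooth r u x)) := by
  rw [Metric.tendsto_atTop]
  intro δ hδ
  obtain ⟨η, hη, hball⟩ := Metric.continuousAt_iff.1 ((continuous_smooth hr u).continuousAt (x := x))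
    (δ / 2) (half_pos hδ)
  obtain ⟨N, hN⟩ := Metric.tendsto_atTop.1 hε η hη
  refine ⟨N, fun n hn => ?_⟩
  have h1 : smooth r (mollify (ε n) u) x = ∫ z, smooth r u (x - z) ∂(bumpLaw d (ε n)) := by
    have h := ofReal_smooth_mollify hr (ε n) u x
    rw [integral_eq_lintegral_of_nonneg_ae (.of_forall fun z => smooth_nonneg hr _ _)
      ((continuous_smooth hr u).comp (by fun_prop)).aestronglyMeasurable, ← h,
      toReal_ofReal (smooth_nonneg hr _ _)]
  have hb : ∀ᵐ z ∂(bumpLaw d (ε n)), ‖smooth r u (x - z) - smooth r u x‖ ≤ δ / 2 := by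
    filter_upwards [ae_bumpLaw_norm_le (hε0 n)] with z hz
    have := hN n hn
    rw [Real.dist_0_eq_abs, abs_of_nonneg (hε0 n)] at this
    have := hball (x := x - z) (by simpa [dist_eq_norm] using hz.trans_lt this)
    exact this.le
  have hint : Integrable (fun z => smooth r u (x - z)) (bumpLaw d (ε n)) := by
    refine Integrable.of_bound ((continuous_smooth hr u).comp (by fun_prop)).aestronglyMeasurable
      (‖smooth r u x‖ + δ / 2) ?_
    filter_upwards [hb] with z hz
    have := norm_add_le (smooth r u x) (smooth r u (x - z) - smooth r u x)
    rw [add_sub_cancel] at this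
    linarith
  rw [h1, dist_eq_norm]
  have h2 : ∫ z, smooth r u (x - z) ∂(bumpLaw d (ε n)) - smooth r u x =
    ∫ z, (smooth r u (x - z) - smooth r u x) ∂(bumpLaw d (ε n)) := by
    rw [integral_sub hint (integrable_const _)]; simp
  rw [h2]
  refine (norm_integral_le_of_norm_le_const hb).trans_lt ?_
  simp
  linarith

lemma lintegral_smooth (hr : 0 < r) (u : Measure (E d)) [IsFiniteMeasure u] :
    ∫⁻ x, ofReal (smooth r u x) = ofReal ((4 * Real.pi) ^ ((d : ℝ) / 2)) * u univ := by
  simp_rw [ofReal_smooth hr.le]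
  rw [lintegral_lintegral_swap]
  · have : ∀ y : E d, ∫⁻ x, ofReal (gaus r (x - y)) = ofReal ((4 * Real.pi) ^ ((d : ℝ) / 2)) := by
      intro y
      rw [lintegral_sub_right_eq_self (fun x => ofReal (gaus r x)),
        ← ofReal_integral_eq_lintegral_ofReal (integrable_gaus hr)
        (.of_forall fun _ => gaus_nonneg hr.le _), integral_gaus hr]
    simp_rw [this]
    simp
  · exact (((continuous_gaus (d := d) r).comp (by fun_prop : Continuous fun p : E d × E d =>
      p.1 - p.2)).measurable.ennreal_ofReal).aemeasurable

lemma fourier_smooth (hr : 0 < r) (u : Measure (E d)) [IsFiniteMeasure u] (ξ : E d) :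
    ∫ x, (smooth r u x : ℂ) * wave(x, ξ) = (∫ x : E d, (gaus r x : ℂ) * wave(x, ξ)) *
      fourierTransform u ξ := by
  have hc := continuous_gaus (d := d) r
  unfold smooth
  have e : ∀ x, ((∫ y, gaus r (x - y) ∂u : ℝ) : ℂ) * wave(x, ξ) = ∫ y, (gaus r (x - y) : ℂ) *
    wave(x, ξ) ∂u := by
    intro x
    rw [← integral_complex_ofReal, ← integral_mul_const]
  simp_rw [e]
  rw [integral_integral_swap]
  · unfold fourierTransform
    rw [← integral_const_mul (∫ x, (gaus r x : ℂ) * wave(x, ξ))]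
    congr 1
    ext y
    rw [← integral_mul_const, ← integral_sub_right_eq_self (fun x => (gaus r x : ℂ) * wave(x, ξ) *
      wave(y, ξ)) y]
    congr 1
    ext x
    rw [mul_assoc, ← exp_add, inner_sub_left]
    push_cast
    ring
  · have hf : Integrable (fun p : E d × E d => gaus r (p.1 - p.2)) (volume.prod u) := by
      refine ⟨(hc.comp (by fun_prop)).aestronglyMeasurable, ?_⟩
      rw [hasFiniteIntegral_iff_ofReal (.of_forall fun p => gaus_nonneg hr.le _),
        lintegral_prod (fun p : E d × E d => ofReal (gaus r (p.1 - p.2))) ((hc.comp (by fun_prop :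
        Continuous fun p : E d × E d => p.1 - p.2)).measurable.ennreal_ofReal).aemeasurable]
      simp_rw [← ofReal_smooth hr.le]
      rw [lintegral_smooth hr]
      exact mul_lt_top ofReal_lt_top (measure_lt_top _ _)
    refine hf.mono' ?_ (.of_forall fun p => ?_)
    · fun_prop
    · simp only [Function.uncurry]
      rw [norm_mul, Complex.norm_real, norm_of_nonneg (gaus_nonneg hr.le _),
        show -Complex.I * ((inner ℝ p.1 ξ : ℝ) : ℂ) =
          ((-(inner ℝ p.1 ξ : ℝ) : ℝ) : ℂ) * Complex.I by push_cast; ring,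
        norm_exp_ofReal_mul_I, mul_one]

/-- The Fourier transform of a Gaussian has no zeros, so it can be divided out; then the
characteristic functions agree. -/
lemma eq_of_smooth_ae_eq (hr : 0 < r) [IsFiniteMeasure u]
    [IsFiniteMeasure v] (h : ∀ᵐ x, smooth r u x = smooth r v x) : u = v := by
  have hg : ∀ ξ, (∫ x : E d, (gaus r x : ℂ) * wave(x, ξ)) ≠ 0 := by
    intro ξ
    have h := GaussianFourier.integral_cexp_neg_mul_sq_norm_add (V := E d)
      (b := ((1 / (4 * r) : ℝ) : ℂ)) (by rw [Complex.ofReal_re]; positivity) (-Complex.I) ξ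
    have h2 : (∫ x : E d, (gaus r x : ℂ) * wave(x, ξ)) =
      ((r ^ (-(d : ℝ) / 2) : ℝ) : ℂ) * ∫ x : E d, Complex.exp (-((1 / (4 * r) : ℝ) : ℂ) * ‖x‖ ^ 2 +
        -Complex.I * ((inner ℝ ξ x : ℝ) : ℂ)) := by
      rw [← integral_const_mul]
      congr 1
      ext x
      unfold gaus
      rw [Complex.ofReal_mul, mul_assoc, ofReal_exp, ← exp_add, real_inner_comm]
      push_cast
      rfl
    rw [h2, h]
    refine mul_ne_zero ?_ (mul_ne_zero ?_ (Complex.exp_ne_zero _))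
    · exact_mod_cast (by positivity : r ^ (-(d : ℝ) / 2) ≠ 0)
    · rw [Complex.cpow_ne_zero_iff]
      left
      refine div_ne_zero (by exact_mod_cast Real.pi_ne_zero) ?_
      exact_mod_cast (by positivity : (1 / (4 * r) : ℝ) ≠ 0)
  have hF : ∀ ξ, fourierTransform u ξ = fourierTransform v ξ := by
    intro ξ
    apply mul_left_cancel₀ (hg ξ)
    rw [← fourier_smooth hr, ← fourier_smooth hr]
    apply integral_congr_ae
    filter_upwards [h] with x hx
    rw [hx]
  apply Measure.ext_of_charFun
  ext ξ
  have := hF (-ξ)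
  unfold fourierTransform at this
  rw [charFun_apply, charFun_apply]
  convert this using 4 <;>
  · rw [inner_neg_right]; push_cast; ring

/-- Equality of the regularizations at a single scale is enough. -/
lemma eq_of_energyDist_eq_zero [IsFiniteMeasure u]
    [IsFiniteMeasure v] (h : energyDist q u v = 0) : u = v := by
  unfold energyDist at h
  have hu := measurable_heat q u
  have hv := measurable_heat q v
  rw [lintegral_eq_zero_iff (by fun_prop)] at h
  have : (ae (volume.restrict (Ioi (0 : ℝ)))).NeBot := by
    rw [ae_neBot]; intro h0; simpa using congrArg (fun μ => μ univ) h0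
  obtain ⟨t, ht, ht0⟩ := ((ae_ae_of_ae_scaleM h).and (ae_restrict_mem measurableSet_Ioi)).exists
  refine eq_of_smooth_ae_eq (r := t ^ q) (rpow_pos_of_pos ht0 _) ?_
  filter_upwards [ht] with x hx
  simp only [Pi.zero_apply, ENNReal.ofReal_eq_zero] at hx
  have := pow_eq_zero_iff (by norm_num) |>.1 (le_antisymm hx (sq_nonneg _))
  exact sub_eq_zero.1 this

/-! ### Flows with densities: definition, time reversal and midpoints. -/

section

/-- Lebesgue measure on the unit time interval. -/
def timeM : Measure ℝ := volume.restrict (Icc (0 : ℝ) 1)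

instance : IsProbabilityMeasure timeM := ⟨by simp [timeM]⟩

/-- Lebesgue measure on `ℝ^d × [0,1]`. -/
def slab (d : ℕ) : Measure (Q d) := (volume : Measure (E d)).prod timeM

instance : SigmaFinite (slab d) := by unfold slab; infer_instance

/-- The vertical cylinder over the ball of radius `R`. -/
def cyl (d : ℕ) (R : ℝ) : Set (Q d) := Metric.ball 0 R ×ˢ univ

lemma mem_cyl : p ∈ cyl d R ↔ ‖p.1‖ < R := by simp [cyl]

lemma measurableSet_cyl (R : ℝ) : MeasurableSet (cyl d R) :=
  Metric.isOpen_ball.measurableSet.prod MeasurableSet.univ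

lemma slab_cyl_lt_top (R : ℝ) : slab d (cyl d R) < ⊤ := by
  unfold slab cyl
  rw [Measure.prod_prod]
  exact mul_lt_top measure_ball_lt_top (measure_lt_top _ _)

/-- Flows: densities `σ` and fluxes `w` solving `∂ₜσ + ∇ · w = 0` weakly, from `γ₀` to `γ₁`, with
mass at most `N`. -/
structure IsFlow (N : ℝ≥0∞) (γ₀ γ₁ : Measure (E d)) (σ : Q d → ℝ) (w : Q d → E d) :
    Prop where
  meas_density : Measurable σ
  meas_flux : Measurable w
  density_nonneg : ∀ p, 0 ≤ σ p
  mass_le : ∀ᵐ t ∂timeM, ∫⁻ x, ofReal (σ (x, t)) ≤ N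
  int_density : ∀ R, IntegrableOn σ (cyl d R) (slab d)
  int_flux : ∀ R, IntegrableOn w (cyl d R) (slab d)
  -- The test functions need not vanish at times 0 and 1, so the end measures enter the equation
  -- directly and no trace in time is needed.
  continuity_eq : ∀ φ : Q d → ℝ, ContDiff ℝ 1 φ → HasCompactSupport φ →
    ∫ p, fderiv ℝ φ p (w p, σ p) ∂slab d = ∫ x, φ (x, 1) ∂γ₁ - ∫ x, φ (x, 0) ∂γ₀

def flowAction (m : ℝ → ℝ) (σ : Q d → ℝ) (w : Q d → E d) : ℝ≥0∞ := ∫⁻ p, actE m (σ p) (w p) ∂slab d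

/-- The analogue of the squared distance, restricted to paths with Lebesgue densities and mass at
most `N`. The mass bound matters: paths in the modified distance may have infinite mass. -/
def flowCost (m : ℝ → ℝ) (N : ℝ≥0∞) (γ₀ γ₁ : Measure (E d)) : ℝ≥0∞ :=
  ⨅ (σ : Q d → ℝ) (w : Q d → E d) (_ : IsFlow N γ₀ γ₁ σ w), flowAction m σ w

lemma flowCost_le (h : IsFlow N γ₀ γ₁ σ w) : flowCost m N γ₀ γ₁ ≤ flowAction m σ w :=
  iInf_le_of_le σ (iInf_le_of_le w (iInf_le _ h))

lemma exists_of_flowCost_lt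
    (h : flowCost m N γ₀ γ₁ < A) : ∃ σ w, IsFlow N γ₀ γ₁ σ w ∧ flowAction m σ w < A := by
  simp only [flowCost, iInf_lt_iff, exists_prop] at h
  exact h

lemma exists_cyl {F : Type*} [Zero F] {φ : Q d → F}
    (hc : HasCompactSupport φ) : ∃ R, 0 < R ∧ ∀ p, p ∉ cyl d R → φ p = 0 := by
  obtain ⟨R, hR⟩ := hc.isBounded.subset_ball (0 : Q d)
  refine ⟨max R 1, by simp, fun p hp => ?_⟩
  by_contra h
  have h1 := hR (subset_tsupport _ h)
  apply hp
  simp only [Metric.mem_ball, dist_zero_right, mem_cyl] at h1 ⊢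
  exact ((norm_fst_le p).trans_lt h1).trans_le (le_max_left _ _)

lemma integrable_of_cyl {F : Type*} [NormedAddCommGroup F] {f : Q d → F}
    {V : Q d → ℝ} (hV : IntegrableOn V (cyl d R) (slab d))
    (hf : AEStronglyMeasurable f (slab d)) (hfV : ∀ p, ‖f p‖ ≤ C * V p)
    (h0 : ∀ p, p ∉ cyl d R → f p = 0) : Integrable f (slab d) := by
  rw [← integrableOn_iff_integrable_of_support_subset]
  · exact (hV.const_mul C).mono' hf.restrict (.of_forall hfV)
  · intro p hp
    by_contra h
    exact hp (h0 p h)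

variable {γ₂ : Measure (E d)}

lemma integrable_fderiv_apply (hσm : Measurable σ) (hwm : Measurable w)
    (hσ : ∀ R, IntegrableOn σ (cyl d R) (slab d)) (hw : ∀ R, IntegrableOn w (cyl d R) (slab d))
    (hφ : ContDiff ℝ 1 φ) (hc : HasCompactSupport φ) :
    Integrable (fun p => fderiv ℝ φ p (w p, σ p)) (slab d) := by
  obtain ⟨C, hC0, hC⟩ := exists_bound_fderiv hφ hc
  obtain ⟨R, hR, h0⟩ := exists_cyl (hc.fderiv ℝ)
  have hcont := hφ.continuous_fderiv one_ne_zero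
  refine integrable_of_cyl (C := C) (V := fun p => ‖w p‖ + ‖σ p‖) ((hw R).norm.add (hσ R).norm) ?_ ?_ ?_
  · fun_prop
  · intro p
    refine ((fderiv ℝ φ p).le_opNorm _).trans ?_
    refine mul_le_mul (hC p) ?_ (norm_nonneg _) hC0
    exact max_le (by linarith [norm_nonneg (σ p)]) (by linarith [norm_nonneg (w p)])
  · intro p hp
    simp [h0 p hp]

lemma IsFlow.integrable_fderiv (h : IsFlow N γ₀ γ₁ σ w) (hφ : ContDiff ℝ 1 φ) (hc : HasCompactSupport φ) :
    Integrable (fun p => fderiv ℝ φ p (w p, σ p)) (slab d) :=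
  integrable_fderiv_apply h.meas_density h.meas_flux h.int_density h.int_flux hφ hc

lemma IsFlow.mono (h : IsFlow N γ₀ γ₁ σ w) {N' : ℝ≥0∞} (hN : N ≤ N') : IsFlow N' γ₀ γ₁ σ w where
  __ := h
  mass_le := h.mass_le.mono fun _ ht => ht.trans hN

/-! ### Affine changes of time -/

lemma contDiff_time_affine (hφ : ContDiff ℝ 1 φ) (a b : ℝ) :
    ContDiff ℝ 1 fun p : Q d => φ (p.1, a + b * p.2) :=
  hφ.comp (by fun_prop)

lemma hasCompact_time_affine (hc : HasCompactSupport φ) (a : ℝ)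
    (hb : b ≠ 0) : HasCompactSupport fun p : Q d => φ (p.1, a + b * p.2) := by
  let e : Q d ≃ₜ Q d := (Homeomorph.refl _).prodCongr
    ((Homeomorph.mulLeft₀ b hb).trans (Homeomorph.addLeft a))
  exact hc.comp_homeomorph e

lemma fderiv_time_affine (hφ : ContDiff ℝ 1 φ) (a b : ℝ) (p : Q d)
    (v : E d) (r : ℝ) : fderiv ℝ (fun p : Q d => φ (p.1, a + b * p.2)) p (v, r) =
      fderiv ℝ φ (p.1, a + b * p.2) (v, b * r) := by
  have h1 := (hφ.differentiable (by norm_num) (p.1, a + b * p.2)).hasFDerivAt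
  have h2 : HasFDerivAt (fun p => (p.1, a + b * p.2))
    ((ContinuousLinearMap.fst ℝ (E d) ℝ).prod (b • ContinuousLinearMap.snd ℝ (E d) ℝ)) p :=
    HasFDerivAt.prodMk hasFDerivAt_fst ((hasFDerivAt_snd.const_mul b).const_add a)
  have h3 : HasFDerivAt (fun p : Q d => φ (p.1, a + b * p.2)) _ p := HasFDerivAt.comp p h1 h2
  rw [h3.fderiv]
  simp

/-- Reversal is written 1 + (-1)t so as to be an instance of the affine changes of time a + bt. -/
lemma measurePreserving_reverse_time : MeasurePreserving (fun t : ℝ => 1 + (-1) * t) timeM timeM := by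
  have h1 : MeasurePreserving (fun t : ℝ => 1 + (-1) * t) volume volume := by
    have := (volume : Measure ℝ).measurePreserving_sub_left 1
    convert this using 2
    ring
  have := h1.restrict_preimage (measurableSet_Icc (a := (0 : ℝ)) (b := 1))
  rwa [show (fun t : ℝ => 1 + (-1) * t) ⁻¹' Icc (0 : ℝ) 1 = Icc 0 1 by
    ext t
    constructor <;> rintro ⟨h, h'⟩ <;> constructor <;> linarith] at this

lemma measurePreserving_reverse :
    MeasurePreserving (fun p : Q d => (p.1, 1 + (-1) * p.2)) (slab d) (slab d) :=
  (MeasurePreserving.id volume).prod measurePreserving_reverse_time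

lemma IsFlow.reverse (h : IsFlow N γ₀ γ₁ σ w) :
    IsFlow N γ₁ γ₀ (fun p => σ (p.1, 1 + (-1) * p.2)) (fun p => -w (p.1, 1 + (-1) * p.2)) where
  meas_density := h.meas_density.comp (by fun_prop)
  meas_flux := (h.meas_flux.comp (by fun_prop)).neg
  density_nonneg p := h.density_nonneg _
  mass_le := measurePreserving_reverse_time.quasiMeasurePreserving.ae h.mass_le
  int_density R := by
    have := measurePreserving_reverse.restrict_preimage (measurableSet_cyl (d := d) R)
    exact this.integrable_comp_of_integrable (h.int_density R)
  int_flux R := by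
    have := measurePreserving_reverse.restrict_preimage (measurableSet_cyl (d := d) R)
    exact (this.integrable_comp_of_integrable (h.int_flux R)).neg
  continuity_eq φ hφ hc := by
    have h1 := h.continuity_eq _ (contDiff_time_affine hφ 1 (-1)) (hasCompact_time_affine hc 1 (by norm_num))
    have h2 : ∫ p, fderiv ℝ (fun p => φ (p.1, 1 + (-1) * p.2)) p (w p, σ p) ∂slab d =
      - ∫ p, fderiv ℝ φ p (-w (p.1, 1 + (-1) * p.2), σ (p.1, 1 + (-1) * p.2)) ∂slab d := by
      rw [← integral_neg]
      have hinv : ∀ p, ((p.1, 1 + (-1) * (1 + (-1) * p.2)) : Q d) = p := by intro p; ext <;> simp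
      have hme := (MeasurableEquiv.mk ⟨fun p : Q d => (p.1, 1 + (-1) * p.2),
        fun p : Q d => (p.1, 1 + (-1) * p.2), hinv, hinv⟩ (by simp; fun_prop)
        (by simp; fun_prop)).measurableEmbedding
      rw [← (measurePreserving_reverse (d := d)).integral_comp hme]
      apply integral_congr_ae
      filter_upwards with p
      rw [fderiv_time_affine hφ, hinv p, ← map_neg]
      simp
    rw [h2] at h1
    norm_num at h1
    norm_num
    linarith

lemma flowAction_reverse (m : ℝ → ℝ) (hm : IsMobility m) (hσ : Measurable σ) (hw : Measurable w) :
    flowAction m (fun p => σ (p.1, 1 + (-1) * p.2)) (fun p => -w (p.1, 1 + (-1) * p.2)) =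
      flowAction m σ w := by
  unfold flowAction
  rw [← measurePreserving_reverse.lintegral_comp (hm.measurable_actE hσ hw)]
  simp [actE, actionDensity]

lemma flowCost_comm (hm : IsMobility m) (N : ℝ≥0∞) (γ₀ γ₁ : Measure (E d)) :
    flowCost m N γ₀ γ₁ = flowCost m N γ₁ γ₀ := by
  apply le_antisymm <;>
  · refine le_iInf fun σ => le_iInf fun w => le_iInf fun h => ?_
    rw [← flowAction_reverse m hm h.meas_density h.meas_flux]
    exact flowCost_le h.reverse

/-! ### Midpoints -/

lemma IsFlow.midpoint {γ₀' γ₁' : Measure (E d)}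
    [IsFiniteMeasure γ₀] [IsFiniteMeasure γ₁] [IsFiniteMeasure γ₀'] [IsFiniteMeasure γ₁']
    (h : IsFlow N γ₀ γ₁ σ w) (h' : IsFlow N γ₀' γ₁' σ' w') :
    IsFlow N (mid γ₀ γ₀') (mid γ₁ γ₁') (fun p => (1 / 2) * (σ p + σ' p))
      (fun p => (1 / 2 : ℝ) • (w p + w' p)) where
  meas_density := by have := h.meas_density; have := h'.meas_density; fun_prop
  meas_flux := by have := h.meas_flux; have := h'.meas_flux; fun_prop
  density_nonneg p := by have := h.density_nonneg p; have := h'.density_nonneg p; positivity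
  mass_le := by
    filter_upwards [h.mass_le, h'.mass_le] with t ht ht'
    have hm := h.meas_density
    have hm' := h'.meas_density
    calc ∫⁻ x, ofReal ((1 / 2) * (σ (x, t) + σ' (x, t)))
        = 2⁻¹ * ((∫⁻ x, ofReal (σ (x, t))) + ∫⁻ x, ofReal (σ' (x, t))) := by
          rw [← lintegral_add_left (by fun_prop), ← lintegral_const_mul _ (by fun_prop)]
          apply lintegral_congr
          intro x
          rw [ofReal_mul (by norm_num), ofReal_half, ofReal_add (h.density_nonneg _) (h'.density_nonneg _)]
      _ ≤ 2⁻¹ * (N + N) := mul_le_mul_right (add_le_add ht ht') _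
      _ = N := by rw [← two_mul, ← mul_assoc, ENNReal.inv_mul_cancel (by simp) (by simp), one_mul]
  int_density R := ((h.int_density R).add (h'.int_density R)).const_mul _
  int_flux R := ((h.int_flux R).add (h'.int_flux R)).smul (1 / 2 : ℝ)
  continuity_eq φ hφ hc := by
    have h1 : ∀ p, fderiv ℝ φ p ((1 / 2 : ℝ) • (w p + w' p), (1 / 2) * (σ p + σ' p)) =
      (1 / 2) * (fderiv ℝ φ p (w p, σ p) + fderiv ℝ φ p (w' p, σ' p)) := by
      intro p
      rw [← map_add, ← smul_eq_mul (1 / 2 : ℝ) (fderiv ℝ φ p _), ← map_smul]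
      simp
    have hb := integrable_slice hφ.continuous hc
    have h2 : ∀ t (γ γ' : Measure (E d)) [IsFiniteMeasure γ] [IsFiniteMeasure γ'],
      ∫ x, φ (x, t) ∂(mid γ γ') = (1 / 2) * (∫ x, φ (x, t) ∂γ + ∫ x, φ (x, t) ∂γ') := by
      intro t γ γ' _ _
      unfold mid
      rw [integral_smul_measure, integral_add_measure (hb t γ) (hb t γ')]
      simp
    simp_rw [h1]
    rw [integral_const_mul, integral_add (h.integrable_fderiv hφ hc) (h'.integrable_fderiv hφ hc),
      h.continuity_eq φ hφ hc, h'.continuity_eq φ hφ hc, h2, h2]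
    ring

lemma flowAction_midpoint_le (hm : IsMobility m) (hσm : Measurable σ) (hwm : Measurable w) (hσ : ∀ p, 0 ≤ σ p)
    (hσ' : ∀ p, 0 ≤ σ' p) :
    flowAction m (fun p => (1 / 2) * (σ p + σ' p)) (fun p => (1 / 2 : ℝ) • (w p + w' p)) ≤
      2⁻¹ * (flowAction m σ w + flowAction m σ' w') := by
  unfold flowAction
  rw [← lintegral_add_left (hm.measurable_actE hσm hwm), ← lintegral_const_mul' _ _ (by simp)]
  exact lintegral_mono fun p => hm.actE_midpoint (hσ p) (hσ' p) _ _

lemma mid_self (γ : Measure (E d)) : mid γ γ = γ := by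
  unfold mid
  rw [smul_add, ← add_smul, ENNReal.inv_two_add_inv_two, one_smul]

/-- Average two nearly optimal flows that share their final measure; the average has the same final
measure by `mid_self`. -/
lemma flowCost_midpoint_le (hm : IsMobility m) {γ₀' : Measure (E d)}
    [IsFiniteMeasure γ₀] [IsFiniteMeasure γ₁] [IsFiniteMeasure γ₀'] :
    flowCost m N (mid γ₀ γ₀') γ₁ ≤ 2⁻¹ * (flowCost m N γ₀ γ₁ + flowCost m N γ₀' γ₁) := by
  by_cases h1 : flowCost m N γ₀ γ₁ = ⊤
  · simp [h1, mul_top]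
  by_cases h2 : flowCost m N γ₀' γ₁ = ⊤
  · simp [h2, mul_top]
  refine ENNReal.le_of_forall_pos_le_add fun ε hε _ => ?_
  have hε' : (ε : ℝ≥0∞) ≠ 0 := by exact_mod_cast hε.ne'
  obtain ⟨σ, w, hf, ha⟩ := exists_of_flowCost_lt (lt_add_right h1 hε')
  obtain ⟨σ', w', hf', ha'⟩ := exists_of_flowCost_lt (lt_add_right h2 hε')
  have h3 := hf.midpoint hf'
  rw [mid_self] at h3
  refine (flowCost_le h3).trans ((flowAction_midpoint_le hm hf.meas_density
    hf.meas_flux hf.density_nonneg hf'.density_nonneg).trans ?_)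
  calc 2⁻¹ * (flowAction m σ w + flowAction m σ' w')
      ≤ 2⁻¹ * ((flowCost m N γ₀ γ₁ + ε) + (flowCost m N γ₀' γ₁ + ε)) := by gcongr
    _ = 2⁻¹ * (flowCost m N γ₀ γ₁ + flowCost m N γ₀' γ₁) + 2⁻¹ * (ε + ε) := by ring
    _ = _ := by
      rw [← two_mul, ← mul_assoc, ENNReal.inv_mul_cancel (by simp) (by simp), one_mul]

end

/-! ### Concatenation of flows in time. -/

lemma ae_timeM : ∀ᵐ t ∂timeM, t ∈ Ioo (0 : ℝ) 1 := by
  unfold timeM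
  rw [← Measure.restrict_congr_set Ioo_ae_eq_Icc]
  exact ae_restrict_mem measurableSet_Ioo

lemma ae_slab_of_ae_timeM {P : ℝ → Prop} (h : ∀ᵐ t ∂timeM, P t) : ∀ᵐ p ∂slab d, P p.2 :=
  Measure.quasiMeasurePreserving_snd.ae h

lemma ae_slab_mem_Ioo : ∀ᵐ p ∂slab d, p.2 ∈ Ioo (0 : ℝ) 1 := ae_slab_of_ae_timeM ae_timeM

lemma smul_map_affine_timeM (a : ℝ) (hb : 0 < b) :
    ofReal b • timeM.map (fun t => a + b * t) = volume.restrict (Icc a (a + b)) := by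
  have h1 : ofReal b • Measure.map (fun t => a + b * t) (volume : Measure ℝ) = volume := by
    have h := Real.smul_map_volume_mul_left hb.ne'
    rw [abs_of_pos hb] at h
    have h2 : Measure.map (fun t => a + b * t) (volume : Measure ℝ) =
      Measure.map (fun t => a + t) (Measure.map (fun t => b * t) volume) := by
      rw [Measure.map_map (by fun_prop) (by fun_prop)]
      rfl
    rw [h2, ← Measure.map_smul, h, map_add_left_eq_self]
  have h2 : (fun t => a + b * t) ⁻¹' Icc a (a + b) = Icc 0 1 := by
    ext t
    constructor
    · rintro ⟨h, h'⟩
      constructor <;> nlinarith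
    · rintro ⟨h, h'⟩
      constructor <;> nlinarith
  conv_rhs => rw [← h1]
  rw [Measure.restrict_smul, Measure.restrict_map (by fun_prop) measurableSet_Icc, h2]
  rfl

lemma timeM_split (h0 : 0 < κ) (h1 : κ < 1) : timeM = ofReal κ • timeM.map (fun t => 0 + κ * t) +
  ofReal (1 - κ) • timeM.map (fun t => κ + (1 - κ) * t) := by
  rw [smul_map_affine_timeM 0 h0, smul_map_affine_timeM κ (sub_pos.2 h1)]
  unfold timeM
  rw [zero_add, add_sub_cancel, ← Measure.restrict_congr_set (Ico_ae_eq_Icc (b := κ)),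
    ← Measure.restrict_union _ measurableSet_Icc, Ico_union_Icc_eq_Icc h0.le h1.le]
  rw [Set.disjoint_left]
  rintro x ⟨_, hx⟩ ⟨hx', _⟩
  linarith

lemma slab_split (h0 : 0 < κ) (h1 : κ < 1) : slab d = ofReal κ • (slab d).map (fun p => (p.1, 0 + κ * p.2)) +
      ofReal (1 - κ) • (slab d).map (fun p => (p.1, κ + (1 - κ) * p.2)) := by
  have h : ∀ a b : ℝ, (slab d).map (fun p => (p.1, a + b * p.2)) =
    (volume : Measure (E d)).prod (timeM.map (fun t => a + b * t)) := by
    intro a b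
    have := Measure.map_prod_map (volume : Measure (E d)) timeM (g := fun t => a + b * t)
      measurable_id (by fun_prop)
    rw [Measure.map_id] at this
    rw [this]
    rfl
  rw [h, h]
  unfold slab
  conv_lhs => rw [timeM_split h0 h1]
  rw [Measure.prod_add, Measure.prod_smul_right, Measure.prod_smul_right]

section

variable {F : Type*}

/-- Concatenation in time of two functions on `ℝ^d × [0,1]`. -/
def cat (κ : ℝ) (f g : Q d → F) (p : Q d) : F :=
  if p.2 < κ then f (p.1, κ⁻¹ * p.2) else g (p.1, (1 - κ)⁻¹ * (p.2 - κ))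

/-- Concatenation of fluxes. -/
abbrev catFlux (κ : ℝ) (w w' : Q d → E d) : Q d → E d :=
  cat κ (fun p => κ⁻¹ • w p) (fun p => (1 - κ)⁻¹ • w' p)

lemma measurable_cat [MeasurableSpace F] {f g : Q d → F} (hf : Measurable f)
    (hg : Measurable g) : Measurable (cat κ f g) :=
  Measurable.ite (measurableSet_lt measurable_snd measurable_const)
    (hf.comp (by fun_prop)) (hg.comp (by fun_prop))

lemma cat_left (h0 : 0 < κ) (f g : Q d → F) : ∀ᵐ p ∂slab d, cat κ f g (p.1, 0 + κ * p.2) = f p := by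
  filter_upwards [ae_slab_mem_Ioo] with p hp
  have : 0 + κ * p.2 < κ := by nlinarith [hp.2]
  simp only [cat, this, if_true]
  rw [zero_add, ← mul_assoc, inv_mul_cancel₀ h0.ne', one_mul]

lemma cat_right (h0 : 0 < κ) (h1 : κ < 1) (f g : Q d → F) :
    ∀ᵐ p ∂slab d, cat κ f g (p.1, κ + (1 - κ) * p.2) = g p := by
  filter_upwards [ae_slab_mem_Ioo] with p hp
  have : ¬ (κ + (1 - κ) * p.2 < κ) := by nlinarith [hp.1]
  simp only [cat, this, if_false]
  rw [add_sub_cancel_left, ← mul_assoc, inv_mul_cancel₀ (sub_pos.2 h1).ne', one_mul]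

lemma catFlux_left (h0 : 0 < κ) (w w' : Q d → E d) :
    ∀ᵐ p ∂slab d, catFlux κ w w' (p.1, 0 + κ * p.2) = κ⁻¹ • w p := cat_left h0 _ _

lemma catFlux_right (h0 : 0 < κ) (h1 : κ < 1) (w w' : Q d → E d) :
    ∀ᵐ p ∂slab d, catFlux κ w w' (p.1, κ + (1 - κ) * p.2) = (1 - κ)⁻¹ • w' p :=
  cat_right h0 h1 _ _

lemma lintegral_slab_split (h0 : 0 < κ) (h1 : κ < 1) {f : Q d → ℝ≥0∞} (hf : Measurable f) :
    ∫⁻ p, f p ∂slab d = ofReal κ * ∫⁻ p, f (p.1, 0 + κ * p.2) ∂slab d +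
      ofReal (1 - κ) * ∫⁻ p, f (p.1, κ + (1 - κ) * p.2) ∂slab d := by
  conv_lhs => rw [slab_split h0 h1]
  rw [lintegral_add_measure, lintegral_smul_measure, lintegral_smul_measure,
    lintegral_map hf (by fun_prop), lintegral_map hf (by fun_prop)]
  rfl

lemma integrable_slab_split [NormedAddCommGroup F] (h0 : 0 < κ) (h1 : κ < 1) {f : Q d → F}
    (hf : StronglyMeasurable f) (hl : Integrable (fun p : Q d => f (p.1, 0 + κ * p.2)) (slab d))
    (hr : Integrable (fun p : Q d => f (p.1, κ + (1 - κ) * p.2)) (slab d)) :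
    Integrable f (slab d) := by
  rw [slab_split h0 h1, integrable_add_measure]
  constructor
  · refine Integrable.smul_measure ?_ (by simp)
    exact (integrable_map_measure hf.aestronglyMeasurable (by fun_prop)).2 hl
  · refine Integrable.smul_measure ?_ (by simp)
    exact (integrable_map_measure hf.aestronglyMeasurable (by fun_prop)).2 hr

lemma integral_slab_split (h0 : 0 < κ) (h1 : κ < 1) {f : Q d → ℝ}
    (hf : StronglyMeasurable f) (hi : Integrable f (slab d)) :
    ∫ p, f p ∂slab d = κ * ∫ p, f (p.1, 0 + κ * p.2) ∂slab d +
      (1 - κ) * ∫ p, f (p.1, κ + (1 - κ) * p.2) ∂slab d := by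
  rw [slab_split h0 h1, integrable_add_measure] at hi
  conv_lhs => rw [slab_split h0 h1]
  rw [integral_add_measure hi.1 hi.2, integral_smul_measure, integral_smul_measure,
    integral_map (by fun_prop) hf.aestronglyMeasurable,
    integral_map (by fun_prop) hf.aestronglyMeasurable, toReal_ofReal h0.le,
    toReal_ofReal (sub_pos.2 h1).le]
  rfl

lemma integrableOn_cat [NormedAddCommGroup F] [MeasurableSpace F] [BorelSpace F]
    [SecondCountableTopology F] (h0 : 0 < κ) (h1 : κ < 1) {f g : Q d → F}
    (hfm : Measurable f) (hgm : Measurable g) (hf : IntegrableOn f (cyl d R) (slab d))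
    (hg : IntegrableOn g (cyl d R) (slab d)) : IntegrableOn (cat κ f g) (cyl d R) (slab d) := by
  rw [← integrable_indicator_iff (measurableSet_cyl R)] at *
  have hm := (measurable_cat (κ := κ) hfm hgm).stronglyMeasurable
  refine integrable_slab_split h0 h1 (hm.indicator (measurableSet_cyl R)) (hf.congr ?_) (hg.congr ?_)
  · filter_upwards [cat_left h0 f g] with p hp
    have : ((p.1, 0 + κ * p.2) ∈ cyl d R) ↔ p ∈ cyl d R := by simp [cyl]
    by_cases hpc : p ∈ cyl d R
    · rw [indicator_of_mem hpc, indicator_of_mem (this.2 hpc), hp]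
    · rw [indicator_of_notMem hpc, indicator_of_notMem (mt this.1 hpc)]
  · filter_upwards [cat_right h0 h1 f g] with p hp
    have : ((p.1, κ + (1 - κ) * p.2) ∈ cyl d R) ↔ p ∈ cyl d R := by simp [cyl]
    by_cases hpc : p ∈ cyl d R
    · rw [indicator_of_mem hpc, indicator_of_mem (this.2 hpc), hp]
    · rw [indicator_of_notMem hpc, indicator_of_notMem (mt this.1 hpc)]

variable {γ₂ : Measure (E d)}

/-- Each half is tested with φ reparametrized to its own unit time interval; the boundary terms at
the intermediate measure cancel. -/
lemma IsFlow.concat (h : IsFlow N γ₀ γ₁ σ w) (h' : IsFlow N γ₁ γ₂ σ' w') (h0 : 0 < κ)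
    (h1 : κ < 1) : IsFlow N γ₀ γ₂ (cat κ σ σ') (catFlux κ w w') := by
  have hσm := measurable_cat (κ := κ) h.meas_density h'.meas_density
  have hwm := measurable_cat (κ := κ) (h.meas_flux.const_smul κ⁻¹) (h'.meas_flux.const_smul (1 - κ)⁻¹)
  have hσi : ∀ R, IntegrableOn (cat κ σ σ') (cyl d R) (slab d) := fun R =>
    integrableOn_cat h0 h1 h.meas_density h'.meas_density (h.int_density R) (h'.int_density R)
  have hwi : ∀ R, IntegrableOn (catFlux κ w w') (cyl d R) (slab d) := fun R =>
    integrableOn_cat h0 h1 (h.meas_flux.const_smul κ⁻¹)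
      (h'.meas_flux.const_smul (1 - κ)⁻¹) ((h.int_flux R).smul κ⁻¹)
      ((h'.int_flux R).smul (1 - κ)⁻¹)
  have hκ1 := (sub_pos.2 h1).ne'
  refine ⟨hσm, hwm, ?_, ?_, hσi, hwi, ?_⟩
  · intro p
    unfold cat
    split_ifs
    · exact h.density_nonneg _
    · exact h'.density_nonneg _
  · have hS : MeasurableSet {t : ℝ | ∫⁻ x, ofReal (cat κ σ σ' (x, t)) ≤ N} := by
      refine measurableSet_le ?_ measurable_const
      exact (hσm.ennreal_ofReal.comp measurable_swap).lintegral_prod_right'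
    rw [timeM_split h0 h1, ae_add_measure_iff]
    constructor
    · refine Measure.ae_smul_measure ?_ _
      rw [ae_map_iff (by fun_prop) hS]
      filter_upwards [h.mass_le, ae_timeM] with t ht ht1
      refine le_trans (le_of_eq (lintegral_congr fun x => ?_)) ht
      have : 0 + κ * t < κ := by nlinarith [ht1.2]
      simp only [cat, this, if_true]
      rw [zero_add, ← mul_assoc, inv_mul_cancel₀ h0.ne', one_mul]
    · refine Measure.ae_smul_measure ?_ _
      rw [ae_map_iff (by fun_prop) hS]
      filter_upwards [h'.mass_le, ae_timeM] with t ht ht1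
      refine le_trans (le_of_eq (lintegral_congr fun x => ?_)) ht
      have : ¬ (κ + (1 - κ) * t < κ) := by nlinarith [ht1.1]
      simp only [cat, this, if_false]
      rw [add_sub_cancel_left, ← mul_assoc, inv_mul_cancel₀ hκ1, one_mul]
  · intro φ hφ hc
    have hi := integrable_fderiv_apply hσm hwm hσi hwi hφ hc
    have hmeas : Measurable fun p => fderiv ℝ φ p (catFlux κ w w' p, cat κ σ σ' p) := by fun_prop
    rw [integral_slab_split h0 h1 hmeas.stronglyMeasurable hi]
    have e1 := h.continuity_eq _ (contDiff_time_affine hφ 0 κ) (hasCompact_time_affine hc 0 h0.ne')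
    have e2 := h'.continuity_eq _ (contDiff_time_affine hφ κ (1 - κ)) (hasCompact_time_affine hc κ hκ1)
    have f1 : κ * ∫ p, fderiv ℝ φ (p.1, 0 + κ * p.2) (catFlux κ w w' (p.1, 0 + κ * p.2),
      cat κ σ σ' (p.1, 0 + κ * p.2)) ∂slab d =
      ∫ p, fderiv ℝ (fun p : Q d => φ (p.1, 0 + κ * p.2)) p (w p, σ p) ∂slab d := by
      rw [← integral_const_mul]
      apply integral_congr_ae
      filter_upwards [cat_left h0 σ σ', catFlux_left h0 w w'] with p hp hp'
      rw [hp, hp', fderiv_time_affine hφ, ← smul_eq_mul, ← map_smul]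
      simp [smul_smul, mul_inv_cancel₀ h0.ne']
    have f2 : (1 - κ) * ∫ p, fderiv ℝ φ (p.1, κ + (1 - κ) * p.2)
      (catFlux κ w w' (p.1, κ + (1 - κ) * p.2), cat κ σ σ' (p.1, κ + (1 - κ) * p.2)) ∂slab d =
      ∫ p, fderiv ℝ (fun p : Q d => φ (p.1, κ + (1 - κ) * p.2)) p (w' p, σ' p) ∂slab d := by
      rw [← integral_const_mul]
      apply integral_congr_ae
      filter_upwards [cat_right h0 h1 σ σ', catFlux_right h0 h1 w w'] with p hp hp'
      rw [hp, hp', fderiv_time_affine hφ, ← smul_eq_mul, ← map_smul]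
      simp [smul_smul, mul_inv_cancel₀ hκ1]
    rw [f1, f2, e1, e2]
    simp

lemma actE_smul (c r : ℝ) (v : E d) : actE m r (c • v) = ofReal (c ^ 2) * actE m r v := by
  unfold actE actionDensity
  rw [← ofReal_mul (by positivity), norm_smul, mul_pow, norm_eq_abs, sq_abs, mul_div_assoc]

lemma IsFlow.flowAction_concat (hm : IsMobility m) (h : IsFlow N γ₀ γ₁ σ w)
    (h' : IsFlow N γ₁ γ₂ σ' w') (h0 : 0 < κ) (h1 : κ < 1) :
    flowAction m (cat κ σ σ') (catFlux κ w w') =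
      ofReal κ⁻¹ * flowAction m σ w + ofReal (1 - κ)⁻¹ * flowAction m σ' w' := by
  have hσm := measurable_cat (κ := κ) h.meas_density h'.meas_density
  have hwm : Measurable (catFlux κ w w') := measurable_cat (h.meas_flux.const_smul κ⁻¹)
    (h'.meas_flux.const_smul (1 - κ)⁻¹)
  have hκ1 := sub_pos.2 h1
  have hc : ∀ c, 0 < c → ofReal c⁻¹ = ofReal c * ofReal (c⁻¹ ^ 2) := by
    intro c hc
    rw [← ofReal_mul hc.le]
    congr 1
    field_simp
  unfold flowAction
  rw [lintegral_slab_split h0 h1 (hm.measurable_actE hσm hwm), hc κ h0, hc _ hκ1, mul_assoc,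
    mul_assoc, ← lintegral_const_mul _ (hm.measurable_actE h.meas_density h.meas_flux),
    ← lintegral_const_mul _ (hm.measurable_actE h'.meas_density h'.meas_flux)]
  congr 2
  · apply lintegral_congr_ae
    filter_upwards [cat_left h0 σ σ', catFlux_left h0 w w'] with p hp hp'
    rw [hp, hp', actE_smul]
  · apply lintegral_congr_ae
    filter_upwards [cat_right h0 h1 σ σ', catFlux_right h0 h1 w w'] with p hp hp'
    rw [hp, hp', actE_smul]

/-- A flow run in a fraction κ of the time has its flux multiplied by κ⁻¹, and hence its action by
κ⁻¹ as well. The fraction stays free: a detour whose action is of order x² can be run in time x, at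
a cost of order x. -/
lemma flowCost_concat_le (hm : IsMobility m) (h0 : 0 < κ) (h1 : κ < 1) :
    flowCost m N γ₀ γ₂ ≤ ofReal κ⁻¹ * flowCost m N γ₀ γ₁ + ofReal (1 - κ)⁻¹ * flowCost m N γ₁ γ₂ := by
  by_cases h2 : flowCost m N γ₀ γ₁ = ⊤
  · rw [h2, mul_top (by simpa using h0), top_add]
    exact le_top
  by_cases h3 : flowCost m N γ₁ γ₂ = ⊤
  · rw [h3, mul_top (by simpa using h1), add_top]
    exact le_top
  have key : ∀ ε : ℝ≥0∞, ε ≠ 0 → flowCost m N γ₀ γ₂ ≤ ofReal κ⁻¹ * (flowCost m N γ₀ γ₁ + ε) +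
    ofReal (1 - κ)⁻¹ * (flowCost m N γ₁ γ₂ + ε) := by
    intro ε hε
    obtain ⟨σ, w, hf, ha⟩ := exists_of_flowCost_lt (lt_add_right h2 hε)
    obtain ⟨σ', w', hf', ha'⟩ := exists_of_flowCost_lt (lt_add_right h3 hε)
    refine (flowCost_le (hf.concat hf' h0 h1)).trans ?_
    rw [hf.flowAction_concat hm hf' h0 h1]
    gcongr
  have ht : Tendsto (fun ε : ℝ≥0∞ => ofReal κ⁻¹ * (flowCost m N γ₀ γ₁ + ε) +
    ofReal (1 - κ)⁻¹ * (flowCost m N γ₁ γ₂ + ε)) (𝓝[>] 0)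
    (𝓝 (ofReal κ⁻¹ * (flowCost m N γ₀ γ₁ + 0) + ofReal (1 - κ)⁻¹ * (flowCost m N γ₁ γ₂ + 0))) := by
    refine Tendsto.mono_left ?_ nhdsWithin_le_nhds
    refine Tendsto.add ?_ ?_
    · exact ENNReal.Tendsto.const_mul (tendsto_const_nhds.add tendsto_id) (Or.inr (by simp))
    · exact ENNReal.Tendsto.const_mul (tendsto_const_nhds.add tendsto_id) (Or.inr (by simp))
  rw [add_zero, add_zero] at ht
  refine ge_of_tendsto ht ?_
  filter_upwards [self_mem_nhdsWithin] with ε hε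
  exact key ε (ne_of_gt hε)

end

/-! ### Spatial mollification of flows. -/

section

lemma measurable_shift {X : Type*} [MeasurableSpace X] {f : Q d → X} (hf : Measurable f) :
    Measurable fun q : (Q d) × E d => f (q.1.1 - q.2, q.1.2) :=
  hf.comp (by fun_prop)

variable {F : Type*} [NormedAddCommGroup F]

/-- Spatial mollification of a function on `ℝ^d × [0,1]`. -/
def moll [NormedSpace ℝ F] (ε : ℝ) (f : Q d → F) (p : Q d) : F := ∫ z, f (p.1 - z, p.2) ∂bumpLaw d ε

lemma stronglyMeasurable_moll [NormedSpace ℝ F] {f : Q d → F} (hf : StronglyMeasurable f) :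
    StronglyMeasurable (moll ε f) := by
  have : StronglyMeasurable fun q : (Q d) × E d => f (q.1.1 - q.2, q.1.2) := hf.comp_measurable (by fun_prop)
  exact this.integral_prod_right

lemma measurePreserving_translate (z : E d) :
    MeasurePreserving (fun p : Q d => (p.1 - z, p.2)) (slab d) (slab d) :=
  (measurePreserving_sub_right volume z).prod (MeasurePreserving.id timeM)

lemma measurePreserving_shear (ε : ℝ) : MeasurePreserving (fun q : E d × Q d => (q.1, (q.2.1 - q.1, q.2.2)))
      ((bumpLaw d ε).prod (slab d)) ((bumpLaw d ε).prod (slab d)) :=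
  (MeasurePreserving.id (bumpLaw d ε)).skew_product
    (by fun_prop) (.of_forall fun z => (measurePreserving_translate z).map_eq)

/-- The shear moving p by z preserves the product measure. After it the integrand is dominated by f
on the cylinder enlarged by ε, because the law only charges vectors of norm at most ε. -/
lemma integrable_shear (hε : 0 ≤ ε) {G : Type*} [NormedAddCommGroup G] {f : Q d → G} {H : E d × Q d → F}
    (hf : ∀ R, IntegrableOn f (cyl d R) (slab d)) (hH : StronglyMeasurable H)
    (hb : ∀ z p, ‖H (z, (p.1 + z, p.2))‖ ≤ C * ‖f p‖) (h0 : ∀ z p, p ∉ cyl d R → H (z, p) = 0) :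
    Integrable H ((bumpLaw d ε).prod (slab d)) := by
  have h1 : Integrable (fun q : E d × Q d => H (q.1, (q.2.1 + q.1, q.2.2)))
    ((bumpLaw d ε).prod (slab d)) := by
    have h2 : Integrable (fun p => (cyl d (R + ε)).indicator (fun p => C * ‖f p‖) p) (slab d) := by
      rw [integrable_indicator_iff (measurableSet_cyl _)]
      exact (hf _).norm.const_mul C
    have h3 := h2.comp_snd (bumpLaw d ε)
    refine h3.mono' (hH.comp_measurable (by fun_prop)).aestronglyMeasurable ?_
    filter_upwards [(Measure.quasiMeasurePreserving_fst.ae (ae_bumpLaw_norm_le hε))] with q hq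
    by_cases hp : q.2 ∈ cyl d (R + ε)
    · rw [indicator_of_mem hp]
      exact hb _ _
    · rw [indicator_of_notMem hp, h0, norm_zero]
      intro h
      apply hp
      simp only [mem_cyl] at h ⊢
      calc ‖q.2.1‖ = ‖(q.2.1 + q.1) - q.1‖ := by rw [add_sub_cancel_right]
        _ ≤ ‖q.2.1 + q.1‖ + ‖q.1‖ := norm_sub_le _ _
        _ < R + ε := by linarith
  have h5 := (measurePreserving_shear (d := d) ε).integrable_comp_of_integrable h1
  refine h5.congr (.of_forall fun q => ?_)
  simp

lemma integrable_indicator_shift (hε : 0 ≤ ε) {f : Q d → F} (hfm : StronglyMeasurable f)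
    (hf : ∀ R, IntegrableOn f (cyl d R) (slab d)) (R : ℝ) :
    Integrable (fun q : E d × Q d => (cyl d R).indicator
      (fun p => f (p.1 - q.1, p.2)) q.2) ((bumpLaw d ε).prod (slab d)) := by
  refine integrable_shear (C := 1) (R := R) hε hf ?_ ?_ ?_
  · exact (hfm.comp_measurable (by fun_prop)).indicator (measurable_snd (measurableSet_cyl R))
  · intro z p
    refine (norm_indicator_le_norm_self _ _).trans ?_
    simp
  · intro z p hp
    exact indicator_of_notMem hp _

lemma ae_integrable_shift (hε : 0 ≤ ε) {f : Q d → F} (hfm : StronglyMeasurable f)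
    (hf : ∀ R, IntegrableOn f (cyl d R) (slab d)) :
    ∀ᵐ p ∂slab d, Integrable (fun z => f (p.1 - z, p.2)) (bumpLaw d ε) := by
  have h1 : ∀ n : ℕ, ∀ᵐ p ∂slab d, Integrable (fun z => (cyl d n).indicator
    (fun p => f (p.1 - z, p.2)) p) (bumpLaw d ε) := fun n =>
    (integrable_indicator_shift hε hfm hf n).prod_left_ae
  filter_upwards [ae_all_iff.2 h1] with p hp
  obtain ⟨n, hn⟩ := exists_nat_gt ‖p.1‖
  refine (hp n).congr (.of_forall fun z => ?_)
  apply indicator_of_mem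
  simpa [cyl] using hn

lemma integrableOn_moll [NormedSpace ℝ F] (hε : 0 ≤ ε) {f : Q d → F} (hfm : StronglyMeasurable f)
    (hf : ∀ R, IntegrableOn f (cyl d R) (slab d)) (R : ℝ) :
    IntegrableOn (moll ε f) (cyl d R) (slab d) := by
  rw [← integrable_indicator_iff (measurableSet_cyl R)]
  refine (integrable_indicator_shift hε hfm hf R).integral_prod_right.congr (.of_forall fun p => ?_)
  simp only [indicator, moll]
  split_ifs <;> simp

lemma moll_nonneg (hσ : ∀ p, 0 ≤ σ p) (p : Q d) : 0 ≤ moll ε σ p := integral_nonneg fun _ => hσ _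

/-- Only an inequality is claimed, so that it holds at every p: where the translates are not
integrable the Bochner integral is 0. -/
lemma ofReal_moll_le (hσ : ∀ p, 0 ≤ σ p) (p : Q d) :
    ofReal (moll ε σ p) ≤ ∫⁻ z, ofReal (σ (p.1 - z, p.2)) ∂bumpLaw d ε := by
  have h := enorm_integral_le_lintegral_enorm (μ := bumpLaw d ε) fun z => σ (p.1 - z, p.2)
  change ‖moll ε σ p‖ₑ ≤ _ at h
  rw [Real.enorm_of_nonneg (moll_nonneg hσ p)] at h
  refine h.trans (le_of_eq (lintegral_congr fun z => ?_))
  rw [Real.enorm_of_nonneg (hσ _)]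

lemma lintegral_moll_le (hσm : Measurable σ) (hσ : ∀ p, 0 ≤ σ p) (t : ℝ) :
    ∫⁻ x, ofReal (moll ε σ (x, t)) ≤ ∫⁻ x, ofReal (σ (x, t)) := by
  calc ∫⁻ x, ofReal (moll ε σ (x, t))
      ≤ ∫⁻ x, ∫⁻ z, ofReal (σ (x - z, t)) ∂bumpLaw d ε := lintegral_mono fun x => ofReal_moll_le hσ (x, t)
    _ = ∫⁻ z, (∫⁻ x, ofReal (σ (x - z, t))) ∂bumpLaw d ε := by
      have hm : Measurable fun p : E d × E d => ofReal (σ (p.1 - p.2, t)) :=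
        (hσm.comp (by fun_prop)).ennreal_ofReal
      exact lintegral_lintegral_swap (μ := volume) hm.aemeasurable
    _ = ∫⁻ x, ofReal (σ (x, t)) := by
      have h : ∀ z, ∫⁻ x, ofReal (σ (x - z, t)) = ∫⁻ x, ofReal (σ (x, t)) := fun z =>
        lintegral_sub_right_eq_self (fun x => ofReal (σ (x, t))) z
      exact (lintegral_congr h).trans (by simp)

/-- The kernel is bounded and the slice has mass at most M. This pointwise bound turns mass and
action bounds into L² bounds for mollified flows. -/
lemma moll_le (hε : 0 < ε) (hσm : Measurable σ) (hσ : ∀ p, 0 ≤ σ p) (x : E d) (hM : 0 ≤ M)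
    (ht : ∫⁻ x, ofReal (σ (x, t)) ≤ ofReal M) :
    moll ε σ (x, t) ≤ (ε ^ d)⁻¹ * bumpMax d * M := by
  have hb := (bumpMax_pos (d := d)).le
  have hm : Measurable fun z => ofReal (σ (x - z, t)) := (hσm.comp (by fun_prop)).ennreal_ofReal
  rw [← ENNReal.ofReal_le_ofReal_iff (by positivity)]
  refine (ofReal_moll_le hσ _).trans ?_
  rw [bumpLaw_eq_withDensity hε, lintegral_withDensity_eq_lintegral_mul _
    (continuous_bumpK ε).measurable.ennreal_ofReal hm]
  calc ∫⁻ z, ofReal (bumpK ε z) * ofReal (σ (x - z, t))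
      ≤ ∫⁻ z, ofReal ((ε ^ d)⁻¹ * bumpMax d) * ofReal (σ (x - z, t)) := by
        refine lintegral_mono fun z => ?_
        gcongr
        exact bumpK_le hε z
    _ = ofReal ((ε ^ d)⁻¹ * bumpMax d) * ∫⁻ z, ofReal (σ (z, t)) := by
      rw [lintegral_const_mul _ hm]
      congr 1
      exact lintegral_sub_left_eq_self (fun z => ofReal (σ (z, t))) x
    _ ≤ ofReal ((ε ^ d)⁻¹ * bumpMax d) * ofReal M := by gcongr
    _ = _ := by rw [← ofReal_mul (by positivity)]

/-- Mollifying the flow is adjoint to averaging the test function, whence the opposite signs of z in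
`moll` and `avg`. -/
lemma integral_fderiv_moll (hε : 0 ≤ ε) (hσm : Measurable σ) (hwm : Measurable w)
    (hσ : ∀ R, IntegrableOn σ (cyl d R) (slab d)) (hw : ∀ R, IntegrableOn w (cyl d R) (slab d))
    (hφ : ContDiff ℝ 1 φ) (hc : HasCompactSupport φ) :
    ∫ p, fderiv ℝ φ p (moll ε w p, moll ε σ p) ∂slab d =
      ∫ p, fderiv ℝ (avg (bumpLaw d ε) φ) p (w p, σ p) ∂slab d := by
  obtain ⟨C, hC0, hC⟩ := exists_bound_fderiv hφ hc
  obtain ⟨R, hR, h0⟩ := exists_cyl (hc.fderiv ℝ)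
  let H : E d × Q d → ℝ := fun q => fderiv ℝ φ q.2 (w (q.2.1 - q.1, q.2.2), σ (q.2.1 - q.1, q.2.2))
  have hHm : StronglyMeasurable H := by
    exact (measurable_fderiv_apply hφ measurable_snd (by fun_prop)).stronglyMeasurable
  have hH : Integrable H ((bumpLaw d ε).prod (slab d)) := by
    refine integrable_shear (C := C) (R := R) hε (fun R => (hw R).prodMk (hσ R)) hHm ?_ ?_
    · intro z p
      simp only [H, add_sub_cancel_right]
      exact ((fderiv ℝ φ _).le_opNorm _).trans (by gcongr; exact hC _)
    · intro z p hp
      simp [H, h0 p hp]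
  have e1 : ∫ p, fderiv ℝ φ p (moll ε w p, moll ε σ p) ∂slab d = ∫ p, ∫ z, H (z, p) ∂bumpLaw d ε ∂slab d := by
    apply integral_congr_ae
    filter_upwards [ae_integrable_shift hε hwm.stronglyMeasurable hw,
      ae_integrable_shift hε hσm.stronglyMeasurable hσ] with p h1 h2
    have h3 : (moll ε w p, moll ε σ p) = ∫ z, (w (p.1 - z, p.2), σ (p.1 - z, p.2)) ∂bumpLaw d ε :=
      (integral_pair h1 h2).symm
    rw [h3, ← ContinuousLinearMap.integral_comp_comm _ (h1.prodMk h2)]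
  have e2 : ∫ p, fderiv ℝ (avg (bumpLaw d ε) φ) p (w p, σ p) ∂slab d =
    ∫ p, ∫ z, H (z, (p.1 + z, p.2)) ∂bumpLaw d ε ∂slab d := by
    apply integral_congr_ae
    filter_upwards with p
    rw [fderiv_avg hφ hc]
    simp only [H, add_sub_cancel_right]
  have hH' : Integrable (fun q : E d × Q d => H (q.1, (q.2.1 + q.1, q.2.2)))
    ((bumpLaw d ε).prod (slab d)) := by
    have hms : MeasurePreserving (fun q : E d × Q d => (q.1, (q.2.1 + q.1, q.2.2)))
      ((bumpLaw d ε).prod (slab d)) ((bumpLaw d ε).prod (slab d)) :=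
      (MeasurePreserving.id (bumpLaw d ε)).skew_product (g := fun z (p : Q d) => (p.1 + z, p.2))
        (by fun_prop) (.of_forall fun z =>
          ((measurePreserving_add_right volume z).prod (MeasurePreserving.id timeM)).map_eq)
    exact hms.integrable_comp_of_integrable hH
  rw [e1, e2, ← integral_prod_symm _ hH, ← integral_prod_symm _ hH', integral_prod _ hH, integral_prod _ hH']
  apply integral_congr_ae
  filter_upwards with z
  have hme := ((Homeomorph.subRight z).prodCongr (Homeomorph.refl ℝ)).measurableEmbedding
  rw [← (measurePreserving_translate z).integral_comp hme fun p => H (z, (p.1 + z, p.2))]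
  simp

/-- Jensen's inequality for the jointly convex action density, then translation invariance of the
slab. -/
lemma flowAction_moll_le (hm : IsMobility m) (hε : 0 ≤ ε) (hσm : Measurable σ)
    (hwm : Measurable w) (hσ0 : ∀ p, 0 ≤ σ p) (hσ : ∀ R, IntegrableOn σ (cyl d R) (slab d)) :
    flowAction m (moll ε σ) (moll ε w) ≤ flowAction m σ w := by
  have hact := hm.measurable_actE hσm hwm
  unfold flowAction
  calc ∫⁻ p, actE m (moll ε σ p) (moll ε w p) ∂slab d
      ≤ ∫⁻ p, ∫⁻ z, actE m (σ (p.1 - z, p.2)) (w (p.1 - z, p.2)) ∂bumpLaw d ε ∂slab d := by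
        apply lintegral_mono_ae
        filter_upwards [ae_integrable_shift hε hσm.stronglyMeasurable hσ] with p h1
        exact hm.jensen _ h1 (fun z => hσ0 _)
          (hwm.comp (by fun_prop : Measurable fun z => (p.1 - z, p.2))).aemeasurable
    _ = ∫⁻ z, (∫⁻ p, actE m (σ (p.1 - z, p.2)) (w (p.1 - z, p.2)) ∂slab d) ∂bumpLaw d ε := by
      refine lintegral_lintegral_swap ?_
      exact (measurable_shift hact).aemeasurable
    _ = ∫⁻ p, actE m (σ p) (w p) ∂slab d := by
      have h : ∀ z, ∫⁻ p, actE m (σ (p.1 - z, p.2)) (w (p.1 - z, p.2)) ∂slab d =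
        ∫⁻ p, actE m (σ p) (w p) ∂slab d := fun z =>
        (measurePreserving_translate z).lintegral_comp hact
      exact (lintegral_congr h).trans (by simp)

lemma integral_avg_eq [IsFiniteMeasure γ₀] (hφ : ContDiff ℝ 1 φ) (hc : HasCompactSupport φ) (t : ℝ) :
    ∫ x, avg (bumpLaw d ε) φ (x, t) ∂γ₀ = ∫ x, φ (x, t) ∂(mollify ε γ₀) := by
  obtain ⟨C, hC⟩ := hφ.continuous.bounded_above_of_compact_support hc
  rw [integral_mollify ε γ₀ (f := fun x => φ (x, t)) (hφ.continuous.comp (by fun_prop)) (fun x => hC _)]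
  rfl

lemma IsFlow.mollify [IsFiniteMeasure γ₀] [IsFiniteMeasure γ₁] (h : IsFlow N γ₀ γ₁ σ w)
    (hε : 0 ≤ ε) : IsFlow N (mollify ε γ₀) (mollify ε γ₁) (moll ε σ) (moll ε w) where
  meas_density := (stronglyMeasurable_moll h.meas_density.stronglyMeasurable).measurable
  meas_flux := (stronglyMeasurable_moll h.meas_flux.stronglyMeasurable).measurable
  density_nonneg := moll_nonneg h.density_nonneg
  mass_le := h.mass_le.mono fun t ht => (lintegral_moll_le h.meas_density h.density_nonneg t).trans ht
  int_density := integrableOn_moll hε h.meas_density.stronglyMeasurable h.int_density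
  int_flux := integrableOn_moll hε h.meas_flux.stronglyMeasurable h.int_flux
  continuity_eq φ hφ hc := by
    rw [integral_fderiv_moll hε h.meas_density h.meas_flux h.int_density
      h.int_flux hφ hc, h.continuity_eq _ (contDiff_avg hφ hc)
      (hasCompactSupport_avg hc (ae_bumpLaw_norm_le hε)), integral_avg_eq hφ hc,
      integral_avg_eq hφ hc]

end

/-! ### The flow that spreads a measure to its mollification. -/

section

lemma measurable_bumpK : Measurable fun p : ℝ × E d => bumpK p.1 p.2 := by
  unfold bumpK
  have := (continuous_bump (d := d)).measurable
  fun_prop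

lemma bumpLaw_eq_map (ε : ℝ) : bumpLaw d ε = (bumpLaw d 1).map fun z => ε • z := by
  unfold bumpLaw
  congr 1
  ext z
  simp

lemma integral_bumpLaw_eq (ε : ℝ) (hf : Continuous f) :
    ∫ z, f z ∂bumpLaw d ε = ∫ z, f (ε • z) ∂bumpLaw d 1 := by
  rw [bumpLaw_eq_map ε, integral_map (by fun_prop) hf.aestronglyMeasurable]

lemma integral_bumpK_mul (hε : 0 < ε) (y : E d) (f : E d → ℝ) (hf : Continuous f) :
    ∫ x, bumpK ε (x - y) * f x = ∫ z, f (y + ε • z) ∂bumpLaw d 1 := by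
  have h1 : ∫ x, bumpK ε (x - y) * f x = ∫ z, bumpK ε z * f (y + z) := by
    rw [← integral_add_right_eq_self (fun x => bumpK ε (x - y) * f x) y]
    simp [add_comm]
  have h2 : ∫ z, f (y + ε • z) ∂bumpLaw d 1 = ∫ z, f (y + z) ∂bumpLaw d ε := by
    rw [integral_bumpLaw_eq ε (by fun_prop)]
  rw [h1, h2, bumpLaw_eq_withDensity hε,
    integral_withDensity_eq_integral_toReal_smul (continuous_bumpK ε).measurable.ennreal_ofReal
      (.of_forall fun _ => ofReal_lt_top)]
  apply integral_congr_ae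
  filter_upwards with z
  rw [toReal_ofReal (bumpK_nonneg hε.le _), smul_eq_mul]

lemma lintegral_bumpK_sub (hε : 0 < ε) (y : E d) : ∫⁻ x, ofReal (bumpK ε (x - y)) = 1 := by
  rw [lintegral_sub_right_eq_self (fun x => ofReal (bumpK ε x)) y]
  have h : bumpLaw d ε univ = 1 := measure_univ
  rw [bumpLaw_eq_withDensity hε, withDensity_apply _ MeasurableSet.univ, Measure.restrict_univ] at h
  exact h

/-- Radii `θ` increasing from `0`, with derivative `θ'`. -/
structure IsRadius (θ θ' : ℝ → ℝ) : Prop where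
  measurable : Measurable θ
  measurable_deriv : Measurable θ'
  nonneg : ∀ t, 0 ≤ θ t
  pos : ∀ t ∈ Ioo (0 : ℝ) 1, 0 < θ t
  hasDerivAt : ∀ t ∈ Ioo (0 : ℝ) 1, HasDerivAt θ (θ' t) t
  deriv_nonneg : ∀ t, 0 ≤ θ' t
  continuousOn : ContinuousOn θ (Icc 0 1)
  zero : θ 0 = 0

/-- A nonnegative derivative of a function continuous up to the ends is integrable even if it is
unbounded near 0. -/
lemma IsRadius.integrable_deriv {θ θ' : ℝ → ℝ} (h : IsRadius θ θ') : Integrable θ' timeM := by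
  have h1 := intervalIntegral.integrableOn_deriv_of_nonneg (b := 1) (g' := θ')
    h.continuousOn h.hasDerivAt (fun t _ => h.deriv_nonneg t)
  unfold timeM
  rwa [← Measure.restrict_congr_set Ioc_ae_eq_Icc]

variable {θ θ' : ℝ → ℝ}

def spreadDensity (θ : ℝ → ℝ) (γ : Measure (E d)) (p : Q d) : ℝ := ∫ y, bumpK (θ p.2) (p.1 - y) ∂γ

/-- The mass at y is spread along the trajectories y + θ(t)z, with z distributed by the bump. At the
point x = y + θz the velocity is θ'z = (θ'/θ)(x - y). -/
def spreadFlux (θ θ' : ℝ → ℝ) (γ : Measure (E d)) (p : Q d) : E d :=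
  ∫ y, (θ' p.2 / θ p.2 * bumpK (θ p.2) (p.1 - y)) • (p.1 - y) ∂γ

lemma spreadDensity_nonneg (hθ : IsRadius θ θ') (p : Q d) : 0 ≤ spreadDensity θ γ p :=
  integral_nonneg fun _ => bumpK_nonneg (hθ.nonneg _) _

section

variable [IsFiniteMeasure γ]

lemma measurable_spreadDensity (hθ : IsRadius θ θ') : Measurable (spreadDensity θ γ) := by
  have h : Measurable fun q : (Q d) × E d => bumpK (θ q.1.2) (q.1.1 - q.2) :=
    measurable_bumpK.comp ((hθ.measurable.comp (by fun_prop)).prodMk (by fun_prop))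
  exact h.stronglyMeasurable.integral_prod_right.measurable

lemma measurable_spreadFlux (hθ : IsRadius θ θ') : Measurable (spreadFlux θ θ' γ) := by
  have h : Measurable fun q : (Q d) × E d => bumpK (θ q.1.2) (q.1.1 - q.2) :=
    measurable_bumpK.comp ((hθ.measurable.comp (by fun_prop)).prodMk (by fun_prop))
  have h1 := hθ.measurable
  have h2 := hθ.measurable_deriv
  have h3 : Measurable fun q : (Q d) × E d =>
    (θ' q.1.2 / θ q.1.2 * bumpK (θ q.1.2) (q.1.1 - q.2)) • (q.1.1 - q.2) := by fun_prop
  exact h3.stronglyMeasurable.integral_prod_right.measurable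

lemma integrable_bumpK_sub (hε : 0 < ε) (x : E d) : Integrable (fun y => bumpK ε (x - y)) γ := by
  refine Integrable.of_bound ((continuous_bumpK ε).comp (by fun_prop)).aestronglyMeasurable
    ((ε ^ d)⁻¹ * bumpMax d) (.of_forall fun y => ?_)
  rw [norm_of_nonneg (bumpK_nonneg hε.le _)]
  exact bumpK_le hε _

/-- On the support of the kernel ‖z‖ < ε. In other words, the speed of the spreading flow is at most
the derivative of the radius. -/
lemma norm_scaled_le (hε : 0 < ε) (hc : 0 ≤ c) (z : E d) : ‖(c / ε * bumpK ε z) • z‖ ≤ c * bumpK ε z := by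
  have hb := bumpK_nonneg hε.le z
  rcases le_or_gt ε ‖z‖ with h | h
  · simp [bumpK_eq_zero hε h]
  · rw [norm_smul, norm_of_nonneg (by positivity)]
    calc c / ε * bumpK ε z * ‖z‖ ≤ c / ε * bumpK ε z * ε := by gcongr
      _ = c * bumpK ε z := by field_simp

lemma norm_spreadFlux_le (hθ : IsRadius θ θ') (ht : t ∈ Ioo (0 : ℝ) 1) (x : E d) :
    ‖spreadFlux θ θ' γ (x, t)‖ ≤ θ' t * spreadDensity θ γ (x, t) := by
  unfold spreadFlux spreadDensity
  rw [← integral_const_mul]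
  exact norm_integral_le_of_norm_le ((integrable_bumpK_sub (hθ.pos t ht) x).const_mul _)
    (.of_forall fun y => norm_scaled_le (hθ.pos t ht) (hθ.deriv_nonneg t) _)

lemma lintegral_bumpK_prod (hε : 0 < ε) : ∫⁻ x, ∫⁻ y, ofReal (bumpK ε (x - y)) ∂γ = γ univ := by
  have hm : Measurable fun p : E d × E d => ofReal (bumpK ε (p.1 - p.2)) :=
    ((continuous_bumpK ε).comp (by fun_prop)).measurable.ennreal_ofReal
  rw [lintegral_lintegral_swap hm.aemeasurable]
  simp_rw [lintegral_bumpK_sub hε]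
  simp

lemma lintegral_spreadDensity (hθ : IsRadius θ θ') (ht : t ∈ Ioo (0 : ℝ) 1) :
    ∫⁻ x, ofReal (spreadDensity θ γ (x, t)) = γ univ := by
  rw [← lintegral_bumpK_prod (hθ.pos t ht)]
  apply lintegral_congr
  exact fun x => ofReal_integral_eq_lintegral_ofReal (integrable_bumpK_sub (hθ.pos t ht) x)
    (.of_forall fun y => bumpK_nonneg (hθ.nonneg t) _)

lemma integrable_spreadDensity_mul (hθ : IsRadius θ θ') (hg : Measurable g) (hgi : Integrable g timeM) :
    Integrable (fun p => g p.2 * spreadDensity θ γ p) (slab d) := by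
  have hm := measurable_spreadDensity (γ := γ) hθ
  have hm2 : Measurable fun p => g p.2 * spreadDensity θ γ p := by fun_prop
  refine ⟨hm2.aestronglyMeasurable, ?_⟩
  unfold HasFiniteIntegral slab
  rw [lintegral_prod_symm _ hm2.enorm.aemeasurable]
  have h1 : ∀ᵐ t ∂timeM, ∫⁻ x, ‖g t * spreadDensity θ γ (x, t)‖ₑ = ‖g t‖ₑ * γ univ := by
    filter_upwards [ae_timeM] with t ht
    rw [← lintegral_spreadDensity hθ ht, ← lintegral_const_mul _ (by fun_prop)]
    apply lintegral_congr
    intro x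
    rw [enorm_mul, Real.enorm_of_nonneg (spreadDensity_nonneg hθ _)]
  rw [lintegral_congr_ae h1, lintegral_mul_const _ hg.enorm]
  exact mul_lt_top hgi.2 (measure_lt_top _ _)

lemma integrable_spreadDensity (hθ : IsRadius θ θ') : Integrable (spreadDensity θ γ) (slab d) := by
  simpa using integrable_spreadDensity_mul (γ := γ) hθ (g := fun _ => 1) measurable_const (integrable_const _)

lemma integrable_spreadFlux (hθ : IsRadius θ θ') : Integrable (spreadFlux θ θ' γ) (slab d) := by
  refine (integrable_spreadDensity_mul (γ := γ) hθ hθ.measurable_deriv hθ.integrable_deriv).mono'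
    (measurable_spreadFlux hθ).aestronglyMeasurable ?_
  filter_upwards [ae_slab_mem_Ioo] with p hp
  exact norm_spreadFlux_le hθ hp p.1

lemma integral_fderiv_spread_slice (hθ : IsRadius θ θ') (hφ : ContDiff ℝ 1 φ)
    (hc : HasCompactSupport φ) (ht : t ∈ Ioo (0 : ℝ) 1) :
    ∫ x, fderiv ℝ φ (x, t) (spreadFlux θ θ' γ (x, t), spreadDensity θ γ (x, t)) =
      ∫ y, ∫ z, fderiv ℝ φ (y + θ t • z, t) (θ' t • z, 1) ∂bumpLaw d 1 ∂γ := by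
  obtain ⟨C, hC0, hC⟩ := exists_bound_fderiv hφ hc
  have hcont := hφ.continuous_fderiv one_ne_zero
  have hpos := hθ.pos t ht
  have hd := hθ.deriv_nonneg t
  let K := fun x y => bumpK (θ t) (x - y) * fderiv ℝ φ (x, t) ((θ' t / θ t) • (x - y), 1)
  have hKc : Continuous fun p : E d × E d => K p.1 p.2 := by
    have := continuous_bumpK (d := d) (θ t)
    fun_prop
  have h1 : ∀ x, fderiv ℝ φ (x, t) (spreadFlux θ θ' γ (x, t), spreadDensity θ γ (x, t)) = ∫ y, K x y ∂γ := by
    intro x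
    have i1 : Integrable (fun y => (θ' t / θ t * bumpK (θ t) (x - y)) • (x - y)) γ := by
      refine ((integrable_bumpK_sub hpos x).const_mul (θ' t)).mono' ?_
        (.of_forall fun y => norm_scaled_le hpos hd _)
      have := continuous_bumpK (d := d) (θ t)
      exact Continuous.aestronglyMeasurable (by fun_prop)
    have i2 := integrable_bumpK_sub (γ := γ) hpos x
    unfold spreadFlux spreadDensity
    simp only
    rw [← integral_pair i1 i2, ← ContinuousLinearMap.integral_comp_comm _ (i1.prodMk i2)]
    apply integral_congr_ae
    filter_upwards with y
    simp only [K]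
    rw [← smul_eq_mul (bumpK (θ t) (x - y)) (fderiv ℝ φ (x, t) _), ← map_smul]
    simp [smul_smul, mul_comm]
  have hKb : ∀ x y, ‖K x y‖ ≤ C * (θ' t + 1) * bumpK (θ t) (x - y) := by
    intro x y
    have hb := bumpK_nonneg hpos.le (x - y)
    simp only [K]
    rcases le_or_gt (θ t) ‖x - y‖ with h | h
    · simp [bumpK_eq_zero hpos h]
    · rw [norm_mul, norm_of_nonneg hb, mul_comm]
      gcongr
      refine ((fderiv ℝ φ _).le_opNorm _).trans ?_
      refine mul_le_mul (hC _) ?_ (norm_nonneg _) hC0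
      simp only [Prod.norm_def, norm_one]
      refine max_le ?_ (by linarith)
      rw [norm_smul, norm_of_nonneg (by positivity)]
      have : θ' t / θ t * ‖x - y‖ ≤ θ' t / θ t * θ t := by gcongr
      rw [div_mul_cancel₀ _ hpos.ne'] at this
      linarith
  have hKi : Integrable (Function.uncurry K) ((volume : Measure (E d)).prod γ) := by
    have hb : Integrable (fun p : E d × E d => bumpK (θ t) (p.1 - p.2))
      ((volume : Measure (E d)).prod γ) := by
      have hbm : Measurable fun p : E d × E d => bumpK (θ t) (p.1 - p.2) :=
        ((continuous_bumpK (θ t)).comp (by fun_prop)).measurable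
      refine ⟨hbm.aestronglyMeasurable, ?_⟩
      unfold HasFiniteIntegral
      rw [lintegral_prod _ hbm.enorm.aemeasurable]
      simp_rw [Real.enorm_of_nonneg (bumpK_nonneg hpos.le _)]
      rw [lintegral_bumpK_prod hpos]
      exact measure_lt_top _ _
    exact (hb.const_mul (C * (θ' t + 1))).mono' hKc.aestronglyMeasurable (.of_forall fun p => hKb p.1 p.2)
  simp_rw [h1]
  rw [integral_integral_swap hKi]
  apply integral_congr_ae
  filter_upwards with y
  rw [integral_bumpK_mul hpos y (fun x => fderiv ℝ φ (x, t) ((θ' t / θ t) • (x - y), 1)) (by fun_prop)]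
  apply integral_congr_ae
  filter_upwards with z
  rw [add_sub_cancel_left, smul_smul, div_mul_cancel₀ _ hpos.ne']

lemma integral_fderiv_path (hθ : IsRadius θ θ') (hφ : ContDiff ℝ 1 φ) (hc : HasCompactSupport φ) (y z : E d) :
    ∫ t, fderiv ℝ φ (y + θ t • z, t) (θ' t • z, 1) ∂timeM = φ (y + θ 1 • z, 1) - φ (y, 0) := by
  obtain ⟨C, hC0, hC⟩ := exists_bound_fderiv hφ hc
  have hm1 := hθ.measurable
  have hm2 := hθ.measurable_deriv
  have hm : Measurable fun t => fderiv ℝ φ (y + θ t • z, t) (θ' t • z, 1) :=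
    measurable_fderiv_apply hφ (by fun_prop) (by fun_prop)
  have hi : Integrable (fun t => fderiv ℝ φ (y + θ t • z, t) (θ' t • z, 1)) timeM := by
    refine (((hθ.integrable_deriv.mul_const ‖z‖).add (integrable_const 1)).const_mul C).mono'
      hm.aestronglyMeasurable (.of_forall fun t => ?_)
    refine ((fderiv ℝ φ _).le_opNorm _).trans (mul_le_mul (hC _) ?_ (norm_nonneg _) hC0)
    have hd := hθ.deriv_nonneg t
    simp only [Prod.norm_def, norm_one, norm_smul, norm_of_nonneg hd, Pi.add_apply]
    have : 0 ≤ θ' t * ‖z‖ := by positivity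
    exact max_le (by linarith) (by linarith)
  have h := intervalIntegral.integral_eq_sub_of_hasDerivAt_of_le (zero_le_one' ℝ)
    (f := fun t => φ (y + θ t • z, t)) (f' := fun t => fderiv ℝ φ (y + θ t • z, t) (θ' t • z, 1))
    ?_ ?_ ?_
  · rw [intervalIntegral.integral_of_le zero_le_one, hθ.zero] at h
    unfold timeM
    rw [← Measure.restrict_congr_set Ioc_ae_eq_Icc, h]
    simp
  · have := hθ.continuousOn
    exact hφ.continuous.comp_continuousOn (by fun_prop)
  · intro t ht
    have h1 := (((hθ.hasDerivAt t ht).smul_const z).const_add y).prodMk (hasDerivAt_id t)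
    exact (hφ.differentiable (by norm_num) _).hasFDerivAt.comp_hasDerivAt t h1
  · rw [intervalIntegrable_iff_integrableOn_Ioc_of_le zero_le_one]
    unfold timeM at hi
    rw [← Measure.restrict_congr_set Ioc_ae_eq_Icc] at hi
    exact hi

/-- Fubini's theorem turns the weak equation into integrals over the trajectories t ↦ y + θ(t)z,
along which it is the fundamental theorem of calculus. -/
lemma isFlow_spread (hθ : IsRadius θ θ') (hN : γ univ ≤ N) :
    IsFlow N γ (mollify (θ 1) γ) (spreadDensity θ γ) (spreadFlux θ θ' γ) where
  meas_density := measurable_spreadDensity hθ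
  meas_flux := measurable_spreadFlux hθ
  density_nonneg := spreadDensity_nonneg hθ
  mass_le := by
    filter_upwards [ae_timeM] with t ht
    exact (lintegral_spreadDensity hθ ht).le.trans hN
  int_density R := (integrable_spreadDensity hθ).integrableOn
  int_flux R := (integrable_spreadFlux hθ).integrableOn
  continuity_eq φ hφ hc := by
    obtain ⟨C, hC0, hC⟩ := exists_bound_fderiv hφ hc
    obtain ⟨B, hB⟩ := hφ.continuous.bounded_above_of_compact_support hc
    have hm1 := hθ.measurable
    have hm2 := hθ.measurable_deriv
    have hi := integrable_fderiv_apply (measurable_spreadDensity (γ := γ) hθ)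
      (measurable_spreadFlux (γ := γ) hθ) (fun R => (integrable_spreadDensity hθ).integrableOn)
      (fun R => (integrable_spreadFlux hθ).integrableOn) hφ hc
    have hz : ∀ᵐ q ∂(γ.prod (bumpLaw d 1)), ‖q.2‖ ≤ 1 :=
      Measure.quasiMeasurePreserving_snd.ae (ae_bumpLaw_norm_le zero_le_one)
    have hDm : Measurable fun q : ℝ × (E d × E d) =>
      fderiv ℝ φ (q.2.1 + θ q.1 • q.2.2, q.1) (θ' q.1 • q.2.2, 1) :=
      measurable_fderiv_apply hφ (by fun_prop) (by fun_prop)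
    have hDb : ∀ᵐ q ∂(timeM.prod (γ.prod (bumpLaw d 1))),
      ‖fderiv ℝ φ (q.2.1 + θ q.1 • q.2.2, q.1) (θ' q.1 • q.2.2, 1)‖ ≤ C * (θ' q.1 + 1) := by
      filter_upwards [Measure.quasiMeasurePreserving_snd.ae hz] with q hq
      refine ((fderiv ℝ φ _).le_opNorm _).trans (mul_le_mul (hC _) ?_ (norm_nonneg _) hC0)
      have hd := hθ.deriv_nonneg q.1
      simp only [Prod.norm_def, norm_one, norm_smul, norm_of_nonneg hd]
      refine max_le ?_ (by linarith)
      have : θ' q.1 * ‖q.2.2‖ ≤ θ' q.1 * 1 := by gcongr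
      linarith
    have hDi : Integrable (fun q : ℝ × (E d × E d) =>
      fderiv ℝ φ (q.2.1 + θ q.1 • q.2.2, q.1) (θ' q.1 • q.2.2, 1))
      (timeM.prod (γ.prod (bumpLaw d 1))) := by
      refine Integrable.mono' ?_ hDm.aestronglyMeasurable hDb
      exact ((hθ.integrable_deriv.add (integrable_const 1)).const_mul C).comp_fst _
    have e1 : ∫ p, fderiv ℝ φ p (spreadFlux θ θ' γ p, spreadDensity θ γ p) ∂slab d =
      ∫ t, ∫ q, fderiv ℝ φ (q.1 + θ t • q.2, t) (θ' t • q.2, 1) ∂(γ.prod (bumpLaw d 1)) ∂timeM := by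
      unfold slab at hi ⊢
      rw [integral_prod_symm _ hi]
      apply integral_congr_ae
      filter_upwards [ae_timeM, hDi.prod_right_ae] with t ht hti
      rw [integral_fderiv_spread_slice hθ hφ hc ht, integral_prod _ hti]
    have hint : ∀ f : E d × E d → E d, Continuous f → ∀ t, Integrable (fun q => φ (f q, t))
      (γ.prod (bumpLaw d 1)) := by
      intro f hf t
      exact Integrable.of_bound (hφ.continuous.comp (by fun_prop)).aestronglyMeasurable B
        (.of_forall fun q => hB _)
    rw [e1, integral_integral_swap hDi]
    simp_rw [integral_fderiv_path hθ hφ hc]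
    rw [integral_sub (hint _ (by fun_prop) 1) (hint _ (by fun_prop) 0),
      integral_prod _ (hint _ (by fun_prop) 1), integral_prod _ (hint _ (by fun_prop) 0)]
    congr 1
    · rw [integral_mollify (θ 1) γ (f := fun x => φ (x, 1)) (hφ.continuous.comp (by fun_prop))
        (fun x => hB _)]
      apply integral_congr_ae
      filter_upwards with y
      rw [integral_bumpLaw_eq (θ 1) (by fun_prop)]
    · simp

end

end

/-! ### The cost of mollification is controlled by the energy. -/

def powRadius (a l t : ℝ) : ℝ := (l * max t 0) ^ a

def powRadiusDeriv (a l t : ℝ) : ℝ := a * l * (l * max t 0) ^ (a - 1)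

lemma isRadius_pow {a : ℝ} (ha : 0 < a) (hl : 0 < l) : IsRadius (powRadius a l) (powRadiusDeriv a l) where
  measurable := by unfold powRadius; fun_prop
  measurable_deriv := by unfold powRadiusDeriv; fun_prop
  nonneg t := by unfold powRadius; positivity
  pos t ht := by
    unfold powRadius
    have := ht.1
    positivity
  hasDerivAt t ht := by
    have h0 := ht.1
    have h1 : HasDerivAt (fun t => (l * t) ^ a) (l * a * (l * t) ^ (a - 1)) t := by
      have h2 : HasDerivAt (fun t => l * t) l t := by simpa using (hasDerivAt_id t).const_mul l
      exact h2.rpow_const (Or.inl (by positivity))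
    have h3 : powRadiusDeriv a l t = l * a * (l * t) ^ (a - 1) := by
      unfold powRadiusDeriv
      rw [max_eq_left h0.le]; ring
    rw [h3]
    refine h1.congr_of_eventuallyEq ?_
    filter_upwards [lt_mem_nhds h0] with x hx
    unfold powRadius
    rw [max_eq_left hx.le]
  deriv_nonneg t := by unfold powRadiusDeriv; positivity
  continuousOn := by
    have h : Continuous fun t => l * max t 0 := by fun_prop
    exact (h.rpow_const fun _ => Or.inr ha.le).continuousOn
  zero := by simp [powRadius, zero_rpow ha.ne']

/-- The bump lives on ‖z‖ < r, where the Gaussian exp(-‖z‖²/(4r²)) is at least exp(-1/4). -/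
lemma bumpK_le_gaus (hr : 0 < r) (z : E d) : bumpK r z ≤ bumpMax d * exp (1 / 4) * gaus (r ^ 2) z := by
  have hg := gaus_pos (show 0 < r ^ 2 by positivity) z
  have hb := bumpMax_pos (d := d)
  rcases le_or_gt r ‖z‖ with h | h
  · rw [bumpK_eq_zero hr h]
    positivity
  · refine (bumpK_le hr z).trans ?_
    unfold gaus
    have h1 : (r ^ 2) ^ (-(d : ℝ) / 2) = (r ^ d)⁻¹ := by
      rw [← Real.rpow_natCast r 2, ← Real.rpow_mul hr.le, ← Real.rpow_natCast r d, ← Real.rpow_neg hr.le]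
      ring
    rw [h1]
    have h2 : 1 ≤ exp (1 / 4) * exp (-(1 / (4 * r ^ 2)) * ‖z‖ ^ 2) := by
      rw [← Real.exp_add, Real.one_le_exp_iff]
      have h3 : 1 / (4 * r ^ 2) * ‖z‖ ^ 2 ≤ 1 / (4 * r ^ 2) * r ^ 2 := by gcongr
      have h4 : 1 / (4 * r ^ 2) * r ^ 2 = 1 / 4 := by field_simp
      linarith
    calc (r ^ d)⁻¹ * bumpMax d = bumpMax d * (r ^ d)⁻¹ * 1 := by ring
      _ ≤ bumpMax d * (r ^ d)⁻¹ *
        (exp (1 / 4) * exp (-(1 / (4 * r ^ 2)) * ‖z‖ ^ 2)) := by gcongr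
      _ = _ := by ring

lemma spreadDensity_le_smooth {θ θ' : ℝ → ℝ} (hθ : IsRadius θ θ')
    [IsFiniteMeasure γ] (ht : t ∈ Ioo (0 : ℝ) 1) (x : E d) :
    spreadDensity θ γ (x, t) ≤ bumpMax d * exp (1 / 4) * smooth (θ t ^ 2) γ x := by
  have hp := hθ.pos t ht
  unfold spreadDensity smooth
  rw [← integral_const_mul]
  refine integral_mono (integrable_bumpK_sub hp x)
    ((integrable_gaus_sub (by positivity) γ x).const_mul _) fun y => ?_
  exact bumpK_le_gaus hp _

lemma lintegral_Ioi_comp_mul (hl : 0 < l) (f : ℝ → ℝ≥0∞) (hf : Measurable f) :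
    ofReal l * ∫⁻ t in Ioi (0 : ℝ), f (l * t) = ∫⁻ t in Ioi (0 : ℝ), f t := by
  have h := Real.smul_map_volume_mul_left hl.ne'
  rw [abs_of_pos hl] at h
  rw [← lintegral_indicator measurableSet_Ioi, ← lintegral_indicator measurableSet_Ioi]
  conv_rhs => rw [← h]
  rw [lintegral_smul_measure, lintegral_map (hf.indicator measurableSet_Ioi) (by fun_prop), smul_eq_mul]
  congr 1
  apply lintegral_congr
  intro t
  simp [indicator, hl]

def connectConst (d : ℕ) (m : ℝ → ℝ) (q : ℝ) : ℝ := (m 0)⁻¹ * ((bumpMax d * exp (1 / 4)) ^ 2 * (q / 2) ^ 2)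

/-- Spread with radius θ(t) = (lt)^(q/2). Then θ² = (lt)^q is the Gaussian scale of `heat q` at lt,
and θ'² is a constant times l²(lt)^(q-2), the weight of `scaleM`. Since the flux is at most θ' times
the density and m ≥ m 0, the action is bounded by the part of the energy with scale parameter in (0,
l]; the change of variables consumes one of the two factors l. -/
lemma flowCost_mollify_le (hm : IsMobility m) (hq : 0 < q) (hl : 0 < l)
    (γ : Measure (E d)) [IsFiniteMeasure γ] (hN : γ univ ≤ N) :
    flowCost m N γ (mollify (l ^ (q / 2)) γ) ≤ ofReal (connectConst d m q) * ofReal l * energy q γ := by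
  set θ := powRadius (q / 2) l with hθd
  set θ' := powRadiusDeriv (q / 2) l with hθd'
  have hθ : IsRadius θ θ' := isRadius_pow (by positivity) hl
  set c := bumpMax d * exp (1 / 4) with hc
  have hm0 := hm.pos 0
  rw [← (show θ 1 = l ^ (q / 2) by simp [θ, powRadius])]
  refine (flowCost_le (isFlow_spread hθ hN)).trans ?_
  have hact := hm.measurable_actE (measurable_spreadDensity (γ := γ) hθ) (measurable_spreadFlux (γ := γ) hθ)
  have hheat := measurable_heat q γ
  unfold flowAction slab
  rw [lintegral_prod_symm' _ hact]
  let f : ℝ → ℝ≥0∞ := fun t => ofReal (t ^ (q - 2)) * ∫⁻ x, ofReal (heat q γ (x, t) ^ 2)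
  have hfm : Measurable f := by fun_prop
  have hE : energy q γ = ∫⁻ t in Ioi (0 : ℝ), f t := by
    unfold energy
    rw [lintegral_scaleM q ((hheat.pow_const 2).ennreal_ofReal)]
  rw [hE, ← lintegral_Ioi_comp_mul hl f hfm]
  have hfl : Measurable fun t => f (l * t) := hfm.comp (by fun_prop)
  rw [← mul_assoc, ← lintegral_const_mul _ hfl]
  have key : ∀ᵐ t ∂timeM, ∫⁻ x, actE m (spreadDensity θ γ (x, t)) (spreadFlux θ θ' γ (x, t)) ≤
    ofReal (connectConst d m q) * ofReal l * ofReal l * f (l * t) := by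
    filter_upwards [ae_timeM] with t ht
    have ht0 := ht.1
    have hlt : 0 < l * t := by positivity
    have hθt : θ t ^ 2 = (l * t) ^ q := by
      simp only [θ, powRadius, max_eq_left ht0.le]
      rw [← Real.rpow_natCast, ← Real.rpow_mul hlt.le]
      congr 1
      push_cast; ring
    have hθt' : θ' t ^ 2 = (q / 2) ^ 2 * l * l * (l * t) ^ (q - 2) := by
      simp only [θ', powRadiusDeriv, max_eq_left ht0.le]
      rw [mul_pow, ← Real.rpow_natCast ((l * t) ^ (q / 2 - 1)), ← Real.rpow_mul hlt.le, show (q / 2 - 1) * ((2 : ℕ) : ℝ) = q - 2 by push_cast; ring]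
      ring
    simp only [f]
    rw [← mul_assoc, ← lintegral_const_mul _ (by fun_prop)]
    apply lintegral_mono
    intro x
    simp only
    have hs := spreadDensity_le_smooth (γ := γ) hθ ht x
    have hd := hθ.deriv_nonneg t
    unfold actE actionDensity
    have hC0 : 0 ≤ connectConst d m q := by unfold connectConst; positivity
    rw [← ofReal_mul hC0, ← ofReal_mul (by positivity),
      ← ofReal_mul (by positivity), ← ofReal_mul (by positivity)]
    apply ofReal_le_ofReal
    unfold heat
    simp only
    rw [hθt, ← hc] at hs
    calc ‖spreadFlux θ θ' γ (x, t)‖ ^ 2 / m (spreadDensity θ γ (x, t))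
        ≤ (θ' t * (c * smooth ((l * t) ^ q) γ x)) ^ 2 / m 0 := by
          refine div_le_div₀ (by positivity) ?_ hm0 (hm.zero_le _)
          have : ‖spreadFlux θ θ' γ (x, t)‖ ≤ θ' t * (c * smooth ((l * t) ^ q) γ x) :=
            (norm_spreadFlux_le (γ := γ) hθ ht x).trans (by gcongr)
          gcongr
      _ = θ' t ^ 2 * (c * smooth ((l * t) ^ q) γ x) ^ 2 / m 0 := by ring
      _ = _ := by
        rw [hθt', connectConst, ← hc]
        ring
  refine (lintegral_mono_ae key).trans ?_
  unfold timeM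
  rw [← Measure.restrict_congr_set Ioc_ae_eq_Icc]
  exact lintegral_mono_set Ioc_subset_Ioi_self

/-! ### Vague limits and a separating family of test functions. -/

open scoped CompactlySupported in
/-- Vague compactness of measures of bounded mass, along an ultrafilter. -/
lemma exists_vague_limit {ι : Type*} (U : Ultrafilter ι) (κ : ι → Measure (E d)) {M : ℝ≥0∞}
    (hM : M ≠ ⊤) (hκ : ∀ i, κ i univ ≤ M) :
    ∃ μ : Measure (E d), μ univ ≤ M ∧ ∀ f : E d → ℝ, Continuous f → HasCompactSupport f →
      Tendsto (fun i => ∫ x, f x ∂κ i) U (𝓝 (∫ x, f x ∂μ)) := by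
  have hfin : ∀ i, IsFiniteMeasure (κ i) := fun i => ⟨(hκ i).trans_lt hM.lt_top⟩
  have hint : ∀ (g : C_c(E d, ℝ)) i, Integrable g (κ i) := fun g i =>
    g.continuous.integrable_of_hasCompactSupport g.hasCompactSupport
  have L (g : C_c(E d, ℝ)) : ∃ x, Tendsto (fun i => ∫ x, g x ∂κ i) U (𝓝 x) := by
    obtain ⟨C, hC⟩ := g.continuous.bounded_above_of_compact_support g.hasCompactSupport
    have hb : ∀ i, ∫ x, g x ∂κ i ∈ Metric.closedBall 0 (C * M.toReal) := by
      intro i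
      rw [mem_closedBall_zero_iff]
      refine (norm_integral_le_of_norm_le_const (.of_forall hC)).trans ?_
      have hC0 := (norm_nonneg _).trans (hC 0)
      gcongr
      exact toReal_mono hM (hκ i)
    -- Bounded reals converge along an ultrafilter, so the limits exist for all test functions at
    -- once and form a positive functional, represented by a measure.
    obtain ⟨x, -, hx⟩ := (isCompact_closedBall 0 (C * M.toReal)).ultrafilter_le_nhds'
      (U.map fun i => ∫ x, g x ∂κ i) (Ultrafilter.mem_map.2 (Eventually.of_forall hb))
    exact ⟨x, hx⟩
  choose Λ hΛ using L
  let Λ' : C_c(E d, ℝ) →ₚ[ℝ] ℝ :=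
  { toFun := Λ
    map_add' g g' := by
      refine tendsto_nhds_unique (hΛ (g + g')) (((hΛ g).add (hΛ g')).congr fun i => ?_)
      rw [← integral_add (hint g i) (hint g' i)]
      rfl
    map_smul' c g := by
      refine tendsto_nhds_unique (hΛ (c • g)) (((hΛ g).const_smul c).congr fun i => ?_)
      rw [← integral_smul]
      rfl
    monotone' g g' hgg' := le_of_tendsto_of_tendsto' (hΛ g) (hΛ g') fun i =>
      integral_mono (hint g i) (hint g' i) hgg' }
  refine ⟨RealRMK.rieszMeasure Λ', ?_, ?_⟩
  · have hball : ∀ n : ℕ, RealRMK.rieszMeasure Λ' (Metric.closedBall 0 n) ≤ M := by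
      intro n
      obtain ⟨f, hf1, -, hfc, hf01⟩ := exists_continuous_one_zero_of_isCompact
        (isCompact_closedBall (0 : E d) n) isClosed_empty (disjoint_empty _)
      let g : C_c(E d, ℝ) := ⟨f, hfc⟩
      refine (RealRMK.rieszMeasure_le_of_eq_one Λ' (f := g) (fun x => (hf01 x).1)
        (isCompact_closedBall (0 : E d) n) (fun x hx => hf1 hx)).trans ?_
      refine ENNReal.ofReal_le_of_le_toReal ?_
      refine le_of_tendsto' (hΛ g) fun i => ?_
      calc ∫ x, g x ∂κ i ≤ ∫ x, (1 : ℝ) ∂κ i :=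
          integral_mono (hint g i) (integrable_const _) fun x => (hf01 x).2
        _ = (κ i univ).toReal := by simp [Measure.real]
        _ ≤ M.toReal := toReal_mono hM (hκ i)
    rw [← (Metric.iUnion_closedBall_nat 0), Monotone.measure_iUnion]
    · exact iSup_le hball
    · intro a b hab
      exact Metric.closedBall_subset_closedBall (by exact_mod_cast hab)
  · intro f hf hfc
    have := RealRMK.integral_rieszMeasure Λ' ⟨⟨f, hf⟩, hfc⟩
    refine (hΛ ⟨⟨f, hf⟩, hfc⟩).trans (le_of_eq ?_)
    congr 1
    exact this.symm

/-- A countable family of `C¹_c` functions separates finite measures. -/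
lemma exists_separating_family : ∃ g : (Finset ℕ × ℕ) × ℕ → E d → ℝ,
    (∀ i, ContDiff ℝ 1 (g i) ∧ HasCompactSupport (g i)) ∧
    ∀ μ ν : Measure (E d), IsFiniteMeasure μ → IsFiniteMeasure ν →
      (∀ i, ∫ x, g i x ∂μ = ∫ x, g i x ∂ν) → μ = ν := by
  obtain ⟨b, hbc, -, hb⟩ := TopologicalSpace.exists_countable_basis (E d)
  have hbn : b.Nonempty := by
    by_contra h
    rw [not_nonempty_iff_eq_empty] at h
    have := hb.sUnion_eq
    rw [h, sUnion_empty] at this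
    exact empty_ne_univ this
  obtain ⟨e, he⟩ := hbc.exists_eq_range hbn
  have heo : ∀ n, IsOpen (e n) := fun n => hb.isOpen (he ▸ mem_range_self n)
  -- Countably many bounded open sets: finite unions of basic sets cut by balls. Every open set is
  -- an increasing union of such sets.
  let O : Finset ℕ × ℕ → Set (E d) := fun F => (⋃ i ∈ F.1, e i) ∩ Metric.ball 0 F.2
  have hO : ∀ F, IsOpen (O F) := fun F => (isOpen_biUnion fun i _ => heo i).inter Metric.isOpen_ball
  choose f hfs hfd hfr using fun F => (hO F).exists_contDiff_support_eq (n := 1)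
  have hf01 : ∀ F x, 0 ≤ f F x ∧ f F x ≤ 1 := fun F x => hfr F (mem_range_self x)
  have hfc : ∀ F, HasCompactSupport (f F) := by
    intro F
    refine HasCompactSupport.of_support_subset_isCompact (isCompact_closedBall 0 F.2) ?_
    rw [hfs]
    exact inter_subset_right.trans Metric.ball_subset_closedBall
  -- For fixed F these functions increase to the indicator of `O F`, because 0 ≤ f F ≤ 1 and f F is
  -- nonzero exactly on `O F`.
  let g : (Finset ℕ × ℕ) × ℕ → E d → ℝ := fun i x => 1 - (1 - f i.1 x) ^ i.2
  have hgd : ∀ i, ContDiff ℝ 1 (g i) := fun i => contDiff_const.sub ((contDiff_const.sub (hfd i.1)).pow i.2)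
  have hgc : ∀ i, HasCompactSupport (g i) := by
    intro i
    refine (hfc i.1).mono fun x hx => ?_
    rw [Function.mem_support] at hx ⊢
    contrapose! hx
    simp [g, hx]
  refine ⟨g, fun i => ⟨hgd i, hgc i⟩, fun μ ν _ _ h => ?_⟩
  have key : ∀ F, μ (O F) = ν (O F) := by
    intro F
    have hlim : ∀ ρ : Measure (E d), IsFiniteMeasure ρ →
      Tendsto (fun n => ∫ x, g (F, n) x ∂ρ) atTop (𝓝 (ρ.real (O F))) := by
      intro ρ _
      have h1 : ρ.real (O F) = ∫ x, (O F).indicator (fun _ => 1) x ∂ρ := by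
        rw [integral_indicator (hO F).measurableSet]
        simp
      rw [h1]
      refine tendsto_integral_of_dominated_convergence (fun _ => 1) ?_ (integrable_const _) ?_ ?_
      · exact fun n => (hgd (F, n)).continuous.aestronglyMeasurable
      · intro n
        filter_upwards with x
        have h2 := hf01 F x
        have h3 : (1 - f F x) ^ n ≤ 1 := pow_le_one₀ (by linarith) (by linarith)
        have h4 : 0 ≤ (1 - f F x) ^ n := pow_nonneg (by linarith) _
        rw [norm_of_nonneg (by linarith)]
        linarith
      · filter_upwards with x
        have h2 := hf01 F x
        by_cases hx : x ∈ O F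
        · rw [indicator_of_mem hx]
          have h3 : f F x ≠ 0 := by rwa [← hfs F] at hx
          have h4 := lt_of_le_of_ne h2.1 h3.symm
          have := (tendsto_pow_atTop_nhds_zero_of_lt_one (by linarith : 0 ≤ 1 - f F x)
            (by linarith)).const_sub 1
          simpa [g] using this
        · rw [indicator_of_notMem hx]
          have h3 : f F x = 0 := by
            by_contra h3
            exact hx (hfs F ▸ h3)
          simp [g, h3]
    have h1 := tendsto_nhds_unique (hlim μ inferInstance)
      ((hlim ν inferInstance).congr fun n => (h (F, n)).symm)
    exact (ENNReal.toReal_eq_toReal_iff' (measure_ne_top _ _) (measure_ne_top _ _)).1 h1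
  have hopen : ∀ s : Set (E d), IsOpen s → μ s = ν s := by
    classical
    intro s hs
    let F := fun n => ((Finset.range n).filter fun i => e i ⊆ s, n)
    have hU : ⋃ n, O (F n) = s := by
      ext x
      simp
      constructor
      · rintro ⟨n, hx, -⟩
        simp only [F, mem_iUnion, mem_filter] at hx
        obtain ⟨i, hi, hxi⟩ := hx
        exact hi.2 hxi
      · intro hx
        obtain ⟨t, ht, hxt, hts⟩ := hb.exists_subset_of_mem_open hx hs
        rw [he] at ht
        obtain ⟨i, rfl⟩ := ht
        obtain ⟨k, hk⟩ := exists_nat_gt ‖x‖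
        refine ⟨max (i + 1) k, ?_, ?_⟩
        · simp only [F, mem_iUnion, mem_filter, Finset.mem_range]
          exact ⟨i, ⟨by omega, hts⟩, hxt⟩
        · simp
          refine hk.trans_le ?_
          exact_mod_cast le_max_right _ _
    have hmono : Monotone fun n => O (F n) := by
      intro a b hab x hx
      obtain ⟨hx1, hx2⟩ := hx
      simp only [F, mem_iUnion, mem_filter, Finset.mem_range] at hx1
      obtain ⟨i, hi, hxi⟩ := hx1
      refine ⟨?_, ?_⟩
      · simp only [F, mem_iUnion, mem_filter, Finset.mem_range]
        exact ⟨i, ⟨by omega, hi.2⟩, hxi⟩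
      · simp at hx2 ⊢
        exact hx2.trans_le (by exact_mod_cast hab)
    rw [← hU, hmono.measure_iUnion, hmono.measure_iUnion]
    simp_rw [key]
  refine ext_of_generate_finite _ (BorelSpace.measurable_eq (α := E d)) isPiSystem_isOpen
    (fun s hs => hopen s hs) (hopen univ isOpen_univ)

/-! ### Traces of flows in time. -/

section

variable {φ : E d → ℝ}

/-- A `C¹` cutoff in time. -/
def timeCutoff : ContDiffBump (1 / 2 : ℝ) := ⟨1, 2, by norm_num, by norm_num⟩

lemma timeCutoff_eventually (ht : t ∈ Icc (0 : ℝ) 1) : ∀ᶠ s in 𝓝 t, timeCutoff s = 1 := by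
  have : Metric.ball (1 / 2) 1 ∈ 𝓝 t := by
    refine Metric.isOpen_ball.mem_nhds ?_
    rw [Metric.mem_ball, dist_eq, abs_lt]
    constructor <;> linarith [ht.1, ht.2]
  filter_upwards [this] with s hs
  exact timeCutoff.one_of_mem_closedBall (Metric.ball_subset_closedBall hs)

lemma fderiv_prod_mul {ρ : ℝ → ℝ} (hρ : ContDiff ℝ 1 ρ) (hφ : ContDiff ℝ 1 φ)
    (p : Q d) (v : E d) (r : ℝ) : fderiv ℝ (fun p : Q d => ρ p.2 * φ p.1) p (v, r) =
      ρ p.2 * fderiv ℝ φ p.1 v + deriv ρ p.2 * r * φ p.1 := by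
  have h1 := (hφ.differentiable (by norm_num) p.1).hasFDerivAt.comp p hasFDerivAt_fst
  have h2 := (hρ.differentiable (by norm_num) p.2).hasDerivAt.comp_hasFDerivAt p (hasFDerivAt_snd (𝕜 := ℝ))
  have h3 : HasFDerivAt (fun p => ρ p.2 * φ p.1) _ p := h2.mul h1
  rw [h3.fderiv]
  simp
  ring

lemma hasCompactSupport_prod_mul {ρ : ℝ → ℝ} (hρ : HasCompactSupport ρ)
    (hφ : HasCompactSupport φ) : HasCompactSupport fun p : Q d => ρ p.2 * φ p.1 := by
  refine HasCompactSupport.of_support_subset_isCompact (hφ.prod hρ) fun p hp => ?_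
  exact ⟨subset_tsupport _ (right_ne_zero_of_mul hp), subset_tsupport _ (left_ne_zero_of_mul hp)⟩

lemma contDiff_prod_mul {ρ : ℝ → ℝ} (hρ : ContDiff ℝ 1 ρ) (hφ : ContDiff ℝ 1 φ) :
    ContDiff ℝ 1 fun p : Q d => ρ p.2 * φ p.1 :=
  (hρ.comp contDiff_snd).mul (hφ.comp contDiff_fst)

lemma exists_ball_of_hasCompactSupport {F : Type*} [Zero F] {g : E d → F}
    (hc : HasCompactSupport g) : ∃ R, ∀ p, p ∉ cyl d R → g p.1 = 0 := by
  obtain ⟨R, hR⟩ := hc.isBounded.subset_ball 0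
  refine ⟨R, fun p hp => ?_⟩
  by_contra h
  exact hp ⟨hR (subset_tsupport _ h), mem_univ _⟩

lemma IsFlow.integrable_fderiv_fst (h : IsFlow N γ₀ γ₁ σ w) (hφ : ContDiff ℝ 1 φ)
    (hc : HasCompactSupport φ) : Integrable (fun p => fderiv ℝ φ p.1 (w p)) (slab d) := by
  have hcont := hφ.continuous_fderiv one_ne_zero
  obtain ⟨C, hC⟩ := hcont.bounded_above_of_compact_support (hc.fderiv ℝ)
  obtain ⟨R, h0⟩ := exists_ball_of_hasCompactSupport (hc.fderiv ℝ)
  refine integrable_of_cyl (C := C) (h.int_flux R).norm ?_ ?_ ?_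
  · have h2 : Continuous fun x : (E d →L[ℝ] ℝ) × (E d) => x.1 x.2 := isBoundedBilinearMap_apply.continuous
    exact (h2.measurable.comp ((hcont.measurable.comp measurable_fst).prodMk
      h.meas_flux)).aestronglyMeasurable
  · intro p
    exact ((fderiv ℝ φ p.1).le_opNorm _).trans (by gcongr; exact hC _)
  · intro p hp
    simp [h0 p hp]

lemma IsFlow.integrable_mul_density (h : IsFlow N γ₀ γ₁ σ w) (hφ : Continuous φ)
    (hc : HasCompactSupport φ) : Integrable (fun p => φ p.1 * σ p) (slab d) := by
  obtain ⟨C, hC⟩ := hφ.bounded_above_of_compact_support hc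
  obtain ⟨R, h0⟩ := exists_ball_of_hasCompactSupport hc
  refine integrable_of_cyl (C := C) (h.int_density R).norm ?_ ?_ ?_
  · have := h.meas_density
    exact Measurable.aestronglyMeasurable (by fun_prop)
  · intro p
    rw [norm_mul]
    gcongr
    exact hC _
  · intro p hp
    simp [h0 p hp]

/-- The flux of `φ` through the flow at a given time. -/
def fluxRate (φ : E d → ℝ) (w : Q d → E d) (t : ℝ) : ℝ := ∫ x, fderiv ℝ φ x (w (x, t))

lemma IsFlow.integrable_fluxRate (h : IsFlow N γ₀ γ₁ σ w) (hφ : ContDiff ℝ 1 φ)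
    (hc : HasCompactSupport φ) : Integrable (fluxRate φ w) timeM :=
  (h.integrable_fderiv_fst hφ hc).integral_prod_right

lemma IsFlow.integrable_mass (h : IsFlow N γ₀ γ₁ σ w) (hφ : Continuous φ)
    (hc : HasCompactSupport φ) : Integrable (fun t => ∫ x, φ x * σ (x, t)) timeM :=
  (h.integrable_mul_density hφ hc).integral_prod_right

lemma integrable_bounded_mul {ρ b : ℝ → ℝ} (hρ : Continuous ρ) (hρc : HasCompactSupport ρ)
    (hb : Integrable b timeM) : Integrable (fun t => ρ t * b t) timeM := by
  obtain ⟨C, hC⟩ := hρ.bounded_above_of_compact_support hρc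
  exact hb.bdd_mul hρ.aestronglyMeasurable (.of_forall hC)

/-- Product test functions ρ(t)φ(x) reduce the equation to a scalar one in time for the pairing with
φ. -/
lemma IsFlow.time_identity (h : IsFlow N γ₀ γ₁ σ w) (hφ : ContDiff ℝ 1 φ)
    (hc : HasCompactSupport φ) {ρ : ℝ → ℝ} (hρ : ContDiff ℝ 1 ρ) (hρc : HasCompactSupport ρ) :
    ∫ t, (ρ t * fluxRate φ w t + deriv ρ t * ∫ x, φ x * σ (x, t)) ∂timeM =
      ρ 1 * ∫ x, φ x ∂γ₁ - ρ 0 * ∫ x, φ x ∂γ₀ := by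
  have h1 := h.continuity_eq _ (contDiff_prod_mul hρ hφ) (hasCompactSupport_prod_mul hρc hc)
  have h2 := h.integrable_fderiv (contDiff_prod_mul hρ hφ) (hasCompactSupport_prod_mul hρc hc)
  simp only [integral_const_mul] at h1
  rw [← h1]
  unfold slab at h2 ⊢
  rw [integral_prod_symm _ h2]
  apply integral_congr_ae
  have i1 := (h.integrable_fderiv_fst hφ hc)
  have i2 := (h.integrable_mul_density hφ.continuous hc)
  filter_upwards [i1.prod_left_ae, i2.prod_left_ae] with t ht1 ht2
  simp only [fderiv_prod_mul hρ hφ, fluxRate]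
  rw [← integral_const_mul, ← integral_const_mul, ← integral_add (ht1.const_mul _) (ht2.const_mul _)]
  congr 1
  ext x
  ring

instance : NullSingletonClass timeM := by unfold timeM; infer_instance

/-- The primitive of the flux rate. -/
def tracePrim (γ₀ : Measure (E d)) (φ : E d → ℝ) (w : Q d → E d) (t : ℝ) : ℝ :=
  ∫ x, φ x ∂γ₀ + ∫ s in (0 : ℝ)..t, fluxRate φ w s ∂timeM

lemma IsFlow.continuous_tracePrim (h : IsFlow N γ₀ γ₁ σ w) (hφ : ContDiff ℝ 1 φ)
    (hc : HasCompactSupport φ) : Continuous (tracePrim γ₀ φ w) :=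
  continuous_const.add ((h.integrable_fluxRate hφ hc).continuous_primitive 0)

lemma tracePrim_zero : tracePrim γ₀ φ w 0 = ∫ x, φ x ∂γ₀ := by simp [tracePrim]

lemma tracePrim_eq (ht : 0 ≤ t) :
    tracePrim γ₀ φ w t = ∫ x, φ x ∂γ₀ + ∫ s, (Iic t).indicator (fluxRate φ w) s ∂timeM := by
  unfold tracePrim
  rw [intervalIntegral.integral_of_le ht, ← integral_indicator measurableSet_Ioc]
  congr 1
  apply integral_congr_ae
  filter_upwards [ae_timeM] with s hs
  simp [indicator, hs.1]

lemma IsFlow.tracePrim_one (h : IsFlow N γ₀ γ₁ σ w) (hφ : ContDiff ℝ 1 φ)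
    (hc : HasCompactSupport φ) : tracePrim γ₀ φ w 1 = ∫ x, φ x ∂γ₁ := by
  have h1 := h.time_identity hφ hc timeCutoff.contDiff timeCutoff.hasCompactSupport
  have e : ∀ t ∈ Icc 0 1, timeCutoff t = 1 := fun t ht => (timeCutoff_eventually ht).self_of_nhds
  have h2 : ∫ t, (timeCutoff t * fluxRate φ w t + deriv timeCutoff t * ∫ x, φ x * σ (x, t)) ∂timeM =
    ∫ s, (Iic 1).indicator (fluxRate φ w) s ∂timeM := by
    apply integral_congr_ae
    filter_upwards [ae_timeM] with t ht
    have ht' := Ioo_subset_Icc_self ht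
    have h3 : deriv timeCutoff t = 0 := by
      have : (timeCutoff : ℝ → ℝ) =ᶠ[𝓝 t] fun _ => 1 := timeCutoff_eventually ht'
      rw [this.deriv_eq]; simp
    rw [e t ht', h3, indicator_of_mem (show t ∈ Iic (1 : ℝ) from ht'.2)]
    ring
  rw [h2, e 1 (by simp), e 0 (by simp)] at h1
  rw [tracePrim_eq (by simp), h1]
  ring

/-- A du Bois-Reymond argument: the difference of the two sides is orthogonal to every smooth
function compactly supported in (0,1). The identity with the initial measure included fixes the
constant of integration. -/
lemma IsFlow.ae_trace (h : IsFlow N γ₀ γ₁ σ w) (hφ : ContDiff ℝ 1 φ)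
    (hc : HasCompactSupport φ) : ∀ᵐ t ∂timeM, ∫ x, φ x * σ (x, t) = tracePrim γ₀ φ w t := by
  have hb := h.integrable_fluxRate hφ hc
  have ha := h.integrable_mass hφ.continuous hc
  have hGi : Integrable (tracePrim γ₀ φ w) timeM :=
    (h.continuous_tracePrim hφ hc).locallyIntegrable.integrableOn_isCompact isCompact_Icc
  set a : ℝ → ℝ := fun t => ∫ x, φ x * σ (x, t) with had
  set b := fluxRate φ w with hbd
  set G := tracePrim γ₀ φ w with hGd
  set c₀ := ∫ x, φ x ∂γ₀ with hc₀
  have hloc : LocallyIntegrableOn (fun t => a t - G t) (Ioo (0 : ℝ) 1) := by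
    refine IntegrableOn.locallyIntegrableOn ?_
    have := ha.sub hGi
    exact IntegrableOn.mono_set this Ioo_subset_Icc_self
  have key := isOpen_Ioo.ae_eq_zero_of_integral_contDiff_smul_eq_zero hloc ?_
  · unfold timeM
    rw [← Measure.restrict_congr_set Ioo_ae_eq_Icc, ae_restrict_iff' measurableSet_Ioo]
    filter_upwards [key] with t ht hti
    exact sub_eq_zero.1 (ht hti)
  · intro g hg hgc hgs
    have hgcont := hg.continuous
    have hg0 : ∀ t, t ∉ Icc (0 : ℝ) 1 → g t = 0 := fun t ht =>
      image_eq_zero_of_notMem_tsupport fun h => ht (Ioo_subset_Icc_self (hgs h))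
    have e0 : ∫ t, g t • (a t - G t) = ∫ t, g t * (a t - G t) ∂timeM := by
      unfold timeM
      rw [setIntegral_eq_integral_of_forall_compl_eq_zero]
      · rfl
      · intro t ht
        rw [hg0 t ht, zero_mul]
    rw [e0]
    -- The primitive that vanishes at time 1, so that the final measure drops out of the identity.
    let ρ₀ := fun t => ∫ s in (1 : ℝ)..t, g s
    have hρ₀d : ∀ t, HasDerivAt ρ₀ (g t) t := fun t =>
      intervalIntegral.integral_hasDerivAt_right (hgcont.intervalIntegrable _ _)
        (hgcont.stronglyMeasurableAtFilter _ _) hgcont.continuousAt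
    have hρ₀ : ContDiff ℝ 1 ρ₀ := by
      rw [contDiff_one_iff_deriv]
      refine ⟨fun t => (hρ₀d t).differentiableAt, ?_⟩
      rwa [show deriv ρ₀ = g from funext fun t => (hρ₀d t).deriv]
    -- The cutoff makes the primitive compactly supported without changing it near [0,1].
    let ρ : ℝ → ℝ := fun t => timeCutoff t * ρ₀ t
    have hρ : ContDiff ℝ 1 ρ := timeCutoff.contDiff.mul hρ₀
    have hρc : HasCompactSupport ρ := timeCutoff.hasCompactSupport.mul_right
    have hρe : ∀ t ∈ Icc (0 : ℝ) 1, ρ =ᶠ[𝓝 t] ρ₀ := by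
      intro t ht
      filter_upwards [timeCutoff_eventually ht] with s hs
      simp [ρ, hs]
    have hid := h.time_identity hφ hc hρ hρc
    have hρ₀eq : ∀ t ∈ Ioo (0 : ℝ) 1, ρ₀ t = -∫ s, (Ici t).indicator g s ∂timeM := by
      intro t ht
      simp only [ρ₀]
      rw [intervalIntegral.integral_symm, intervalIntegral.integral_of_le ht.2.le,
        ← integral_Icc_eq_integral_Ioc, ← integral_indicator measurableSet_Icc]
      unfold timeM
      rw [← integral_indicator measurableSet_Icc]
      congr 2
      ext s
      have := ht.1
      by_cases h1 : t ≤ s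
      · by_cases h2 : s ≤ 1 <;> simp [indicator, h1, h2, this.le.trans h1]
      · simp [indicator, h1]
    have e1 : ∫ t, (ρ t * b t + deriv ρ t * a t) ∂timeM =
      (∫ t, ρ₀ t * b t ∂timeM) + ∫ t, g t * a t ∂timeM := by
      rw [← integral_add]
      · apply integral_congr_ae
        filter_upwards [ae_timeM] with t ht
        have := hρe t (Ioo_subset_Icc_self ht)
        rw [this.deriv_eq, (hρ₀d t).deriv, this.self_of_nhds]
      · refine (integrable_bounded_mul hρ.continuous hρc hb).congr ?_
        filter_upwards [ae_timeM] with t ht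
        rw [(hρe t (Ioo_subset_Icc_self ht)).self_of_nhds]
      · exact integrable_bounded_mul hgcont hgc ha
    have hgi : Integrable g timeM := hgcont.locallyIntegrable.integrableOn_isCompact isCompact_Icc
    have e2 : ∫ t, ρ₀ t * b t ∂timeM = -∫ s, g s * (G s - c₀) ∂timeM := by
      -- Fubini's theorem on the triangle t ≤ s exchanges the primitive of g with the primitive of
      -- the flux rate.
      have hK : Integrable (Function.uncurry fun t s => {p : ℝ × ℝ | p.1 ≤ p.2}.indicator
        (fun p => g p.2 * b p.1) (t, s)) (timeM.prod timeM) := by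
        refine Integrable.indicator ?_ (measurableSet_le measurable_fst measurable_snd)
        simpa [mul_comm] using hb.mul_prod hgi
      have e3 : ∫ t, ρ₀ t * b t ∂timeM = -∫ t, ∫ s, {p : ℝ × ℝ | p.1 ≤ p.2}.indicator
        (fun p => g p.2 * b p.1) (t, s) ∂timeM ∂timeM := by
        rw [← integral_neg]
        apply integral_congr_ae
        filter_upwards [ae_timeM] with t ht
        rw [hρ₀eq t ht, neg_mul, ← integral_mul_const]
        congr 2
        ext s
        by_cases hts : t ≤ s <;> simp [indicator, hts]
      rw [e3, integral_integral_swap hK]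
      congr 1
      apply integral_congr_ae
      filter_upwards [ae_timeM] with s hs
      have hGs := tracePrim_eq (γ₀ := γ₀) (φ := φ) (w := w) hs.1.le
      rw [← hGd, ← hc₀, ← hbd] at hGs
      rw [hGs, add_sub_cancel_left, ← integral_const_mul]
      congr 1
      ext t
      by_cases hts : t ≤ s <;> simp [indicator, hts]
    have e4 : ∫ t, g t * (a t - G t) ∂timeM = ∫ t, g t * a t ∂timeM - ∫ t, g t * G t ∂timeM := by
      simp_rw [mul_sub]
      exact integral_sub (integrable_bounded_mul hgcont hgc ha) (integrable_bounded_mul hgcont hgc hGi)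
    have e5 : ∫ s, g s * (G s - c₀) ∂timeM = ∫ t, g t * G t ∂timeM - (∫ t, g t ∂timeM) * c₀ := by
      simp_rw [mul_sub]
      rw [integral_sub (integrable_bounded_mul hgcont hgc hGi) (hgi.mul_const _), integral_mul_const]
    have e6 : ρ 0 = -∫ t, g t ∂timeM := by
      rw [(hρe 0 (by simp)).self_of_nhds]
      simp only [ρ₀]
      rw [intervalIntegral.integral_symm, intervalIntegral.integral_of_le zero_le_one]
      unfold timeM
      rw [Measure.restrict_congr_set Ioc_ae_eq_Icc]
    have e7 : ρ 1 = 0 := by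
      rw [(hρe 1 (by simp)).self_of_nhds]
      simp [ρ₀]
    rw [e1, e2, e5, e6, e7] at hid
    rw [e4]
    linarith

end

/-- Every time in [0,1], the end points included, is a limit of times taken from any set of full
measure. -/
lemma neBot_nhds_inf_ae_timeM (ht : t ∈ Icc (0 : ℝ) 1) : (𝓝 t ⊓ ae timeM).NeBot := by
  rw [inf_neBot_iff]
  intro U hU A hA
  by_contra hne
  rw [not_nonempty_iff_eq_empty, ← disjoint_iff_inter_eq_empty] at hne
  obtain ⟨ε, hε, hb⟩ := Metric.mem_nhds_iff.1 hU
  have h1 : Ioo (max 0 (t - ε)) (min 1 (t + ε)) ⊆ U ∩ Icc 0 1 := by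
    intro s hs
    simp at hs
    refine ⟨hb ?_, ⟨hs.1.1.le, hs.2.1.le⟩⟩
    rw [Metric.mem_ball, dist_eq, abs_lt]
    constructor <;> linarith [hs.1.2, hs.2.2]
  have h2 : volume (Ioo (max 0 (t - ε)) (min 1 (t + ε))) ≤ 0 := by
    rw [← (measure_mono_null hne.subset_compl_right hA)]
    unfold timeM
    rw [Measure.restrict_apply' measurableSet_Icc]
    exact measure_mono h1
  rw [Real.volume_Ioo, nonpos_iff_eq_zero, ENNReal.ofReal_eq_zero] at h2
  have : max 0 (t - ε) < min 1 (t + ε) := by grind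
  linarith

/-- The time slice of a density, as a measure. -/
def sliceM (σ : Q d → ℝ) (t : ℝ) : Measure (E d) := volume.withDensity fun x => ofReal (σ (x, t))

lemma sliceM_univ (t : ℝ) : sliceM σ t univ = ∫⁻ x, ofReal (σ (x, t)) := by
  unfold sliceM
  rw [withDensity_apply _ MeasurableSet.univ, Measure.restrict_univ]

lemma integral_sliceM (hσm : Measurable σ) (hσ : ∀ p, 0 ≤ σ p) (f : E d → ℝ) (t : ℝ) :
    ∫ x, f x ∂(sliceM σ t) = ∫ x, f x * σ (x, t) := by
  unfold sliceM
  have hm : Measurable fun x => ofReal (σ (x, t)) :=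
    (hσm.comp (by fun_prop : Measurable fun x => (x, t))).ennreal_ofReal
  rw [integral_withDensity_eq_integral_toReal_smul hm (.of_forall fun _ => ofReal_lt_top)]
  apply integral_congr_ae
  filter_upwards with x
  rw [toReal_ofReal (hσ _), smul_eq_mul, mul_comm]

/-- The weakly continuous representative. At each time a vague limit of nearby slices is taken; its
pairings with C¹ functions are the continuous primitives `tracePrim`. By the separating family it
coincides with the slice at almost every time and with the end measures at 0 and 1. -/
lemma IsFlow.exists_trace [IsFiniteMeasure γ₀] [IsFiniteMeasure γ₁] (h : IsFlow N γ₀ γ₁ σ w)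
    (hN : N ≠ ⊤) : ∃ μ : ℝ → Measure (E d), (∀ t ∈ Icc (0 : ℝ) 1, μ t univ ≤ N) ∧
      (∀ φ : E d → ℝ, ContDiff ℝ 1 φ → HasCompactSupport φ → ∀ t ∈ Icc (0 : ℝ) 1,
        ∫ x, φ x ∂(μ t) = tracePrim γ₀ φ w t) ∧
      (∀ᵐ t ∂timeM, μ t = sliceM σ t) ∧ μ 0 = γ₀ ∧ μ 1 = γ₁ := by
  classical
  have hex : ∀ t ∈ Icc 0 1, ∃ μ : Measure (E d), μ univ ≤ N ∧ ∀ φ : E d → ℝ,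
    ContDiff ℝ 1 φ → HasCompactSupport φ → ∫ x, φ x ∂μ = tracePrim γ₀ φ w t := by
    intro t ht
    have := neBot_nhds_inf_ae_timeM ht
    let U := Ultrafilter.of (𝓝 t ⊓ ae timeM)
    have hU1 : (U : Filter ℝ) ≤ 𝓝 t := (Ultrafilter.of_le _).trans inf_le_left
    -- Slices violating the mass bound occur on a null set and are replaced by 0, so that the bound
    -- holds for all s.
    let κ := fun s => if sliceM σ s univ ≤ N then sliceM σ s else 0
    have hκ : ∀ s, κ s univ ≤ N := by
      intro s
      simp only [κ]
      split_ifs with hs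
      · exact hs
      · simp
    obtain ⟨μ, hμ, hlim⟩ := exists_vague_limit U κ hN hκ
    refine ⟨μ, hμ, fun φ hφ hc => ?_⟩
    refine tendsto_nhds_unique (hlim φ hφ.continuous hc) ?_
    refine (((h.continuous_tracePrim hφ hc).tendsto t).mono_left hU1).congr' ?_
    refine Filter.Eventually.filter_mono ((Ultrafilter.of_le _).trans inf_le_right) ?_
    filter_upwards [h.ae_trace hφ hc, h.mass_le] with s hs hm
    rw [← hs, ← integral_sliceM h.meas_density h.density_nonneg]
    simp only [κ]
    rw [sliceM_univ, if_pos hm]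
  choose! μ hμ1 hμ2 using hex
  obtain ⟨g, hg, hsep⟩ := exists_separating_family (d := d)
  have hfin : ∀ t ∈ Icc (0 : ℝ) 1, IsFiniteMeasure (μ t) := fun t ht => ⟨(hμ1 t ht).trans_lt hN.lt_top⟩
  refine ⟨μ, hμ1, fun φ hφ hc t ht => hμ2 t ht φ hφ hc, ?_, ?_, ?_⟩
  · have hall := ae_all_iff.2 fun i => h.ae_trace (hg i).1 (hg i).2
    filter_upwards [hall, h.mass_le, ae_timeM] with t ht hm ht1
    have ht2 := Ioo_subset_Icc_self ht1
    refine hsep _ _ (hfin t ht2) ⟨?_⟩ fun i => ?_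
    · rw [sliceM_univ]
      exact hm.trans_lt hN.lt_top
    · rw [hμ2 t ht2 _ (hg i).1 (hg i).2, ← ht i, integral_sliceM h.meas_density h.density_nonneg]
  · refine hsep _ _ (hfin 0 (by simp)) inferInstance fun i => ?_
    rw [hμ2 0 (by simp) _ (hg i).1 (hg i).2, tracePrim_zero]
  · refine hsep _ _ (hfin 1 (by simp)) inferInstance fun i => ?_
    rw [hμ2 1 (by simp) _ (hg i).1 (hg i).2, h.tracePrim_one (hg i).1 (hg i).2]

/-- Uniform approximation by C¹ functions suffices because the masses are uniformly bounded. -/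
lemma continuousOn_integral_of_contDiff {μ : ℝ → Measure (E d)} (hN : N ≠ ⊤)
    (hμ : ∀ t ∈ Icc (0 : ℝ) 1, μ t univ ≤ N)
    (hcont : ∀ φ : E d → ℝ, ContDiff ℝ 1 φ → HasCompactSupport φ →
      ContinuousOn (fun t => ∫ x, φ x ∂(μ t)) (Icc (0 : ℝ) 1))
    (hf : Continuous f) (hfc : HasCompactSupport f) :
    ContinuousOn (fun t => ∫ x, f x ∂(μ t)) (Icc (0 : ℝ) 1) := by
  refine continuousOn_of_uniform_approx_of_continuousOn fun u hu => ?_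
  obtain ⟨ε, hε, hεu⟩ := Metric.mem_uniformity_dist.1 hu
  obtain ⟨φ, hφ, hφd, hφs⟩ := hf.exists_contDiff_approx 1 (ε := fun _ => ε / (2 * (N.toReal + 1)))
    continuous_const fun _ => (by positivity)
  have hφc := hfc.mono hφs
  refine ⟨_, hcont φ hφ hφc, fun t ht => hεu ?_⟩
  have hfin : IsFiniteMeasure (μ t) := ⟨(hμ t ht).trans_lt hN.lt_top⟩
  rw [dist_eq_norm, ← integral_sub (hf.integrable_of_hasCompactSupport hfc)
    (hφ.continuous.integrable_of_hasCompactSupport hφc)]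
  calc ‖∫ x, (f x - φ x) ∂(μ t)‖ ≤ ε / (2 * (N.toReal + 1)) * (μ t).real univ := by
        refine norm_integral_le_of_norm_le_const (.of_forall fun x => ?_)
        rw [← dist_eq_norm, dist_comm]
        exact (hφd x).le
    _ ≤ ε / (2 * (N.toReal + 1)) * (N.toReal + 1) := by
        gcongr
        have : (μ t).real univ ≤ N.toReal := toReal_mono hN (hμ t ht)
        linarith
    _ = ε / 2 := by field_simp
    _ < ε := half_lt_self hε

/-! ### Flows as solutions of the continuity equation. -/

/-- The vector measure with a given locally integrable density. -/
def densityRadon (v : E d → E d) (hv : Measurable v)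
    (hloc : ∀ n : ℕ, ∫⁻ x in Metric.ball 0 n, ‖v x‖ₑ < ⊤) : VectorRadon d where
  variation := volume.withDensity fun x => ‖v x‖ₑ
  dir x := ‖v x‖⁻¹ • v x
  locallyFinite := by
    refine ⟨fun x => ?_⟩
    obtain ⟨n, hn⟩ := exists_nat_gt ‖x‖
    refine ⟨Metric.ball 0 n, Metric.isOpen_ball.mem_nhds (by simpa using hn), ?_⟩
    rw [withDensity_apply _ Metric.isOpen_ball.measurableSet]
    exact hloc n
  measurable_dir := by fun_prop
  norm_dir := by
    rw [ae_withDensity_iff (by fun_prop)]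
    filter_upwards with x hx
    rw [ne_eq, enorm_eq_zero] at hx
    rw [norm_smul, norm_inv, norm_norm, inv_mul_cancel₀ (norm_ne_zero_iff.2 hx)]

lemma VectorRadon.ext_measure_zero : ∃ ν : VectorRadon d, ν.variation = 0 :=
  ⟨⟨0, fun _ => 0, inferInstance, measurable_const, by simp⟩, rfl⟩

section

variable {v : E d → E d} {hv : Measurable v} {hloc : ∀ n : ℕ, ∫⁻ x in Metric.ball 0 n, ‖v x‖ₑ < ⊤}

lemma integral_densityRadon {G : Type*} [NormedAddCommGroup G] [NormedSpace ℝ G] (f : E d → G) :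
    ∫ x, f x ∂(densityRadon v hv hloc).variation = ∫ x, ‖v x‖ • f x := by
  unfold densityRadon
  rw [integral_withDensity_eq_integral_toReal_smul (by fun_prop) (.of_forall fun _ => enorm_lt_top)]
  simp

lemma norm_smul_inv_smul (a : E d) : ‖a‖ • (‖a‖⁻¹ • a) = a := by
  by_cases h : a = 0
  · simp [h]
  · rw [smul_smul, mul_inv_cancel₀ (norm_ne_zero_iff.2 h), one_smul]

lemma densityRadon_eval {B : Set (E d)} (hB : MeasurableSet B) :
    (densityRadon v hv hloc).eval B = ∫ x in B, v x := by
  unfold VectorRadon.eval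
  rw [← integral_indicator hB, integral_densityRadon, ← integral_indicator hB]
  congr 1
  ext1 x
  by_cases hx : x ∈ B
  · simp only [indicator_of_mem hx, densityRadon, norm_smul_inv_smul]
  · simp [indicator_of_notMem hx]

lemma densityRadon_pairing (F : E d → E d) :
    (densityRadon v hv hloc).pairing F = ∫ x, inner ℝ (F x) (v x) := by
  unfold VectorRadon.pairing
  rw [integral_densityRadon]
  congr 1
  ext1 x
  rw [smul_eq_mul, ← real_inner_smul_right]
  simp only [densityRadon, norm_smul_inv_smul]

lemma densityRadon_density : (densityRadon v hv hloc).density =ᵐ[volume] v := by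
  have h : (densityRadon v hv hloc).variation.rnDeriv volume =ᵐ[volume] fun x => ‖v x‖ₑ :=
    Measure.rnDeriv_withDensity volume (by fun_prop)
  filter_upwards [h] with x hx
  unfold VectorRadon.density
  rw [hx, toReal_enorm]
  exact norm_smul_inv_smul _

lemma action_densityRadon (m : ℝ → ℝ) (hρm : Measurable ρ) (hρ : ∀ x, 0 ≤ ρ x) :
    action m (volume.withDensity fun x => ofReal (ρ x)) (densityRadon v hv hloc) =
      ∫⁻ x, actE m (ρ x) (v x) := by
  unfold action
  have hac : (densityRadon v hv hloc).variation ≪ volume := withDensity_absolutelyContinuous _ _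
  rw [if_pos hac]
  apply lintegral_congr_ae
  filter_upwards [densityRadon_density, Measure.rnDeriv_withDensity volume hρm.ennreal_ofReal] with x hx hx'
  rw [hx, hx', toReal_ofReal (hρ x)]
  rfl

end

lemma fderiv_apply_eq (hφ : ContDiff ℝ 1 φ) (x v : E d) (t r : ℝ) : fderiv ℝ φ (x, t) (v, r) =
      deriv (fun r => φ (x, r)) t * r + inner ℝ (gradient (fun y => φ (y, t)) x) v := by
  have h0 := (hφ.differentiable (by norm_num) (x, t)).hasFDerivAt
  have h1 : HasFDerivAt (fun y => (y, t)) ((ContinuousLinearMap.id ℝ (E d)).prod 0) x :=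
    (hasFDerivAt_id x).prodMk (hasFDerivAt_const t x)
  have h2 := (hasDerivAt_const t x).prodMk (hasDerivAt_id t)
  have h3 : HasFDerivAt (fun y => φ (y, t)) _ x := HasFDerivAt.comp x h0 h1
  have h4 : HasDerivAt (fun r => φ (x, r)) _ t := h0.comp_hasDerivAt t h2
  rw [h4.deriv]
  unfold gradient
  rw [InnerProductSpace.toDual_symm_apply, h3.fderiv]
  simp
  rw [mul_comm, ← smul_eq_mul, ← map_smul, ← map_add]
  simp

/-- Flows of finite mass are realized by solutions of the continuity equation. -/
lemma IsFlow.modifiedWasserstein_le (hm : IsMobility m) [IsFiniteMeasure γ₀]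
    [IsFiniteMeasure γ₁] (h : IsFlow N γ₀ γ₁ σ w) (hN : N ≠ ⊤) :
    modifiedWasserstein m γ₀ γ₁ ^ 2 ≤ flowAction m σ w := by
  classical
  obtain ⟨μ, hμ1, hμ2, hμ3, hμ4, hμ5⟩ := h.exists_trace hN
  obtain ⟨ν₀, hν₀⟩ := VectorRadon.ext_measure_zero (d := d)
  have hws : ∀ t, Measurable fun x => w (x, t) := fun t => h.meas_flux.comp (by fun_prop)
  have hσs : ∀ t, Measurable fun x => σ (x, t) := fun t => h.meas_density.comp (by fun_prop)
  -- At almost every time the flux is locally integrable and defines a Radon measure; at the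
  -- remaining times the zero measure is used.
  let good := fun t => ∀ n : ℕ, ∫⁻ x in Metric.ball 0 n, ‖w (x, t)‖ₑ < ⊤
  have hgoodm : MeasurableSet {t | good t} := by
    have : {t | good t} = ⋂ n : ℕ, {t | ∫⁻ x in Metric.ball 0 n, ‖w (x, t)‖ₑ < ⊤} := by ext t; simp [good]
    rw [this]
    refine MeasurableSet.iInter fun n => measurableSet_lt ?_ measurable_const
    exact (h.meas_flux.enorm.comp measurable_swap).lintegral_prod_right'
  have hgood : ∀ᵐ t ∂timeM, good t := by
    refine ae_all_iff.2 fun n => ?_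
    have h1 := (h.int_flux n).2
    unfold HasFiniteIntegral cyl slab at h1
    rw [← Measure.prod_restrict, Measure.restrict_univ, lintegral_prod_symm' _ h.meas_flux.enorm] at h1
    exact ae_lt_top (h.meas_flux.enorm.comp measurable_swap).lintegral_prod_right' h1.ne
  let ν := fun t =>
    if ht : good t then densityRadon (fun x => w (x, t)) (hws t) ht else ν₀
  have hνg : ∀ t (ht : good t), ν t = densityRadon (fun x => w (x, t)) (hws t) ht := fun t ht => dif_pos ht
  have hνb : ∀ t, ¬ good t → (ν t).variation = 0 := fun t ht => by
    simp only [ν]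
    rw [dif_neg ht, hν₀]
  have hpath : IsContinuityPath γ₀ γ₁ μ ν := by
    refine ⟨?_, ?_, ?_, ?_, ?_, hμ4, hμ5⟩
    · intro t ht
      have : IsFiniteMeasure (μ t) := ⟨(hμ1 t ht).trans_lt hN.lt_top⟩
      infer_instance
    · intro f hf hfc
      refine continuousOn_integral_of_contDiff hN hμ1 (fun φ hφ hc => ?_) hf hfc
      exact (h.continuous_tracePrim hφ hc).continuousOn.congr fun t ht => hμ2 φ hφ hc t ht
    · intro B hB _
      have h1 : Measurable fun t => (ν t).eval B := by
        have h2 : (fun t : ℝ => (ν t).eval B) = {t | good t}.indicator fun t => ∫ x in B, w (x, t) := by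
          ext1 t
          by_cases ht : good t
          · rw [indicator_of_mem (show t ∈ {t | good t} from ht), hνg t ht, densityRadon_eval hB]
          · rw [indicator_of_notMem (show t ∉ {t | good t} from ht), VectorRadon.eval, hνb t ht]
            simp
        rw [h2]
        refine Measurable.indicator ?_ hgoodm
        have h3 : StronglyMeasurable fun q : ℝ × E d => w (q.2, q.1) :=
          (h.meas_flux.comp measurable_swap).stronglyMeasurable
        exact h3.integral_prod_right.measurable
      exact h1.comp measurable_subtype_coe
    · intro R hR
      have h1 := (h.int_flux R).2
      unfold HasFiniteIntegral cyl slab at h1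
      rw [← Measure.prod_restrict, Measure.restrict_univ, lintegral_prod_symm' _ h.meas_flux.enorm] at h1
      refine lt_of_le_of_lt (lintegral_mono fun t => ?_) h1
      by_cases ht : good t
      · rw [hνg t ht]
        simp only [densityRadon]
        rw [withDensity_apply _ Metric.isOpen_ball.measurableSet]
      · rw [hνb t ht]
        simp
    · intro φ hφ
      have h1 := h.continuity_eq φ hφ.contDiff hφ.hasCompactSupport
      have hz : ∀ s, s ∉ Ioo (0 : ℝ) 1 → ∀ x, φ (x, s) = 0 := fun s hs x =>
        image_eq_zero_of_notMem_tsupport fun hx => hs (hφ.tsupport_subset hx).2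
      simp only [hz 0 (by simp), hz 1 (by simp), integral_zero, sub_zero] at h1
      have i1 := integrable_fderiv_apply h.meas_density measurable_const
        h.int_density (fun R => integrableOn_zero) hφ.contDiff hφ.hasCompactSupport
      have i2 := integrable_fderiv_apply measurable_const h.meas_flux
        (fun R => integrableOn_zero) h.int_flux hφ.contDiff hφ.hasCompactSupport
      have e1 : ∫ t in Icc (0 : ℝ) 1, ∫ x, deriv (fun r => φ (x, r)) t ∂(μ t) =
        ∫ p, fderiv ℝ φ p (0, σ p) ∂slab d := by
        unfold slab at i1 ⊢
        rw [integral_prod_symm _ i1]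
        apply integral_congr_ae
        filter_upwards [hμ3] with t ht
        rw [ht, integral_sliceM h.meas_density h.density_nonneg]
        congr 1
        ext1 x
        rw [fderiv_apply_eq hφ.contDiff, inner_zero_right, add_zero]
      have e2 : ∫ t in Icc (0 : ℝ) 1, (ν t).pairing (fun x => gradient (fun y => φ (y, t)) x) =
        ∫ p, fderiv ℝ φ p (w p, 0) ∂slab d := by
        unfold slab at i2 ⊢
        rw [integral_prod_symm _ i2]
        apply integral_congr_ae
        filter_upwards [hgood] with t ht
        rw [hνg t ht, densityRadon_pairing]
        congr 1
        ext1 x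
        rw [fderiv_apply_eq hφ.contDiff, mul_zero, zero_add]
      rw [e1, e2, ← integral_add i1 i2]
      refine Eq.trans ?_ h1
      congr 1
      ext1 p
      rw [← map_add]
      simp
  have hW : modifiedWasserstein m γ₀ γ₁ ≤ (∫⁻ t in Icc (0 : ℝ) 1, action m (μ t) (ν t)) ^ (1 / 2 : ℝ) :=
    iInf_le_of_le μ (iInf_le_of_le ν (iInf_le _ hpath))
  have hact : ∫⁻ t in Icc (0 : ℝ) 1, action m (μ t) (ν t) = flowAction m σ w := by
    unfold flowAction slab
    rw [lintegral_prod_symm' _ (hm.measurable_actE h.meas_density h.meas_flux)]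
    apply lintegral_congr_ae
    filter_upwards [hμ3, hgood] with t ht htg
    rw [ht, hνg t htg]
    exact action_densityRadon m (hσs t) fun x => h.density_nonneg _
  calc modifiedWasserstein m γ₀ γ₁ ^ 2
      ≤ ((∫⁻ t in Icc (0 : ℝ) 1, action m (μ t) (ν t)) ^ (1 / 2 : ℝ)) ^ 2 := by gcongr
    _ = flowAction m σ w := by
      rw [hact, ← rpow_natCast, ← rpow_mul]
      simp

/-- The bound `N` has to be finite because the traces in time are vague limits of slices of bounded
mass. -/
lemma modifiedWasserstein_sq_le_flowCost (hm : IsMobility m) [IsFiniteMeasure γ₀]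
    [IsFiniteMeasure γ₁] (hN : N ≠ ⊤) :
    modifiedWasserstein m γ₀ γ₁ ^ 2 ≤ flowCost m N γ₀ γ₁ :=
  le_iInf fun _ => le_iInf fun _ => le_iInf fun h => h.modifiedWasserstein_le hm hN

/-! ### A Hahn-Banach argument producing a multiplier. -/

lemma integral_abs_le_norm {Z : Type*} [MeasurableSpace Z] (κ : Measure Z) [IsFiniteMeasure κ]
    (f : Lp ℝ 2 κ) : ∫ z, |f z| ∂κ ≤ (κ univ ^ (1 / 2 : ℝ)).toReal * ‖f‖ := by
  have h1 := eLpNorm_le_eLpNorm_mul_rpow_measure_univ (p := 1) (q := 2)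
    (by norm_num) (Lp.aestronglyMeasurable f)
  have h2 : ∫ z, |f z| ∂κ = (eLpNorm f 1 κ).toReal := by
    rw [eLpNorm_one_eq_lintegral_enorm, ← integral_norm_eq_lintegral_enorm (Lp.aestronglyMeasurable f)]
    simp
  rw [h2, Lp.norm_def, mul_comm, ← toReal_mul]
  refine toReal_mono ?_ (h1.trans (le_of_eq ?_))
  · exact mul_ne_top (Lp.eLpNorm_ne_top f) (rpow_ne_top_of_nonneg (by norm_num) (measure_ne_top _ _))
  · norm_num

/-- A Farkas type lemma: a cone of square integrable functions with a linear lower bound on their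
positive parts has a multiplier with values in `[0,1]`. -/
lemma exists_multiplier_of_cone {Z : Type*} [MeasurableSpace Z] (κ : Measure Z)
    [IsFiniteMeasure κ] (C : Set ((Z → ℝ) × ℝ)) (h0 : (0, 0) ∈ C)
    (hadd : ∀ x ∈ C, ∀ y ∈ C, x + y ∈ C) (hsmul : ∀ c : ℝ, 0 < c → ∀ x ∈ C, c • x ∈ C)
    (hL2 : ∀ x ∈ C, MemLp x.1 2 κ) (hC : ∀ x ∈ C, x.2 ≤ ∫ z, max (x.1 z) 0 ∂κ) :
    ∃ a : Z → ℝ, Measurable a ∧ (∀ z, a z ∈ Icc (0 : ℝ) 1) ∧ ∀ x ∈ C, x.2 ≤ ∫ z, a z * x.1 z ∂κ := by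
  have hint : ∀ f : Lp ℝ 2 κ, Integrable f κ := fun f => (Lp.memLp f).integrable (by norm_num)
  have hCint : ∀ x ∈ C, Integrable x.1 κ := fun x hx => (hL2 x hx).integrable (by norm_num)
  have hpos : ∀ (f : Lp ℝ 2 κ), ∀ x ∈ C, Integrable (fun z => max (f z + x.1 z) 0) κ := fun f x hx =>
    ((hint f).add (hCint x hx)).pos_part
  let v : Lp ℝ 2 κ → C → ℝ := fun f x => ∫ z, max (f z + x.1.1 z) 0 ∂κ - x.1.2
  -- A sublinear gauge of the cone; the hypothesis on the positive parts makes it finite, with lower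
  -- bound -∫|f|. A linear functional below it is at most ∫ f⁺, by the zero element of the cone,
  -- hence is integration against a function with values in [0,1].
  let p : Lp ℝ 2 κ → ℝ := fun f => ⨅ x : C, v f x
  have hne : Nonempty C := ⟨⟨_, h0⟩⟩
  have hlow : ∀ f x, -∫ z, |f z| ∂κ ≤ v f x := by
    intro f x
    have h1 := hC x.1 x.2
    have h2 : ∫ z, max (x.1.1 z) 0 ∂κ ≤ ∫ z, (max (f z + x.1.1 z) 0 + |f z|) ∂κ := by
      refine integral_mono (hCint x.1 x.2).pos_part ((hpos f x.1 x.2).add (hint f).abs) fun z => ?_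
      refine max_le ?_ (by positivity)
      have := le_max_left (f z + x.1.1 z) 0
      have := neg_abs_le (f z)
      linarith
    rw [integral_add (hpos f x.1 x.2) (hint f).abs] at h2
    simp only [v]
    linarith
  have hbdd : ∀ f, BddBelow (range (v f)) := fun f => ⟨_, by rintro _ ⟨x, rfl⟩; exact hlow f x⟩
  have hle : ∀ f (x : C), p f ≤ v f x := fun f x => ciInf_le (hbdd f) x
  have hhom : ∀ c : ℝ, 0 < c → ∀ f, p (c • f) = c * p f := by
    have hone : ∀ c, 0 < c → ∀ f, p (c • f) ≤ c * p f := by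
      intro c hc f
      rw [← div_le_iff₀' hc]
      refine le_ciInf fun x => ?_
      rw [div_le_iff₀' hc]
      refine (hle (c • f) ⟨c • x.1, hsmul c hc _ x.2⟩).trans (le_of_eq ?_)
      simp only [v, Prod.smul_fst, Prod.smul_snd, Pi.smul_apply, smul_eq_mul, mul_sub]
      rw [← integral_const_mul]
      congr 1
      apply integral_congr_ae
      filter_upwards [Lp.coeFn_smul c f] with z hz
      rw [hz, Pi.smul_apply, smul_eq_mul, ← mul_add, mul_max_of_nonneg _ _ hc.le, mul_zero]
    intro c hc f
    refine le_antisymm (hone c hc f) ?_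
    have h1 := hone c⁻¹ (inv_pos.2 hc) (c • f)
    rw [smul_smul, inv_mul_cancel₀ hc.ne', one_smul] at h1
    rwa [le_inv_mul_iff₀ hc] at h1
  have hsub : ∀ f g, p (f + g) ≤ p f + p g := by
    intro f g
    rw [← sub_le_iff_le_add]
    refine le_ciInf fun x => ?_
    rw [sub_le_iff_le_add', ← sub_le_iff_le_add]
    refine le_ciInf fun y => ?_
    rw [sub_le_iff_le_add]
    refine (hle (f + g) ⟨x.1 + y.1, hadd _ x.2 _ y.2⟩).trans ?_
    have h2 : ∫ z, max ((f + g : Lp ℝ 2 κ) z + (x.1.1 z + y.1.1 z)) 0 ∂κ ≤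
      ∫ z, (max (f z + x.1.1 z) 0 + max (g z + y.1.1 z) 0) ∂κ := by
      refine integral_mono_ae (hpos (f + g) _ (hadd _ x.2 _ y.2)) ((hpos f _ x.2).add (hpos g _ y.2)) ?_
      filter_upwards [Lp.coeFn_add f g] with z hz
      rw [hz, Pi.add_apply]
      have e1 := le_max_left (f z + x.1.1 z) 0
      have e2 := le_max_left (g z + y.1.1 z) 0
      have e3 := le_max_right (f z + x.1.1 z) 0
      have e4 := le_max_right (g z + y.1.1 z) 0
      exact max_le (by linarith) (by linarith)
    rw [integral_add (hpos f _ x.2) (hpos g _ y.2)] at h2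
    simp only [v, Prod.fst_add, Prod.snd_add, Pi.add_apply]
    linarith
  have hp0 : 0 ≤ p 0 := by
    refine le_ciInf fun x => ?_
    have h1 := hC x.1 x.2
    have h2 : ∫ z, max ((0 : Lp ℝ 2 κ) z + x.1.1 z) 0 ∂κ = ∫ z, max (x.1.1 z) 0 ∂κ := by
      apply integral_congr_ae
      filter_upwards [Lp.coeFn_zero ℝ 2 κ] with z hz
      rw [hz, Pi.zero_apply, zero_add]
    simp only [v]
    linarith
  -- Hahn-Banach extension from the zero subspace, where the only condition is 0 ≤ p 0.
  obtain ⟨g, -, hg⟩ := exists_extension_of_le_sublinear (⟨⊥, 0⟩ : Lp ℝ 2 κ →ₗ.[ℝ] ℝ) p hhom hsub (by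
    rintro ⟨x, hx⟩
    have hx0 : x = 0 := (Submodule.mem_bot ℝ).1 hx
    subst hx0
    simpa using hp0)
  have hgle : ∀ f, g f ≤ ∫ z, max (f z) 0 ∂κ := by
    intro f
    refine (hg f).trans ((hle f ⟨_, h0⟩).trans (le_of_eq ?_))
    simp [v]
  have hgabs : ∀ f, ‖g f‖ ≤ (κ univ ^ (1 / 2 : ℝ)).toReal * ‖f‖ := by
    have h1 : ∀ f, g f ≤ (κ univ ^ (1 / 2 : ℝ)).toReal * ‖f‖ := by
      intro f
      refine (hgle f).trans (le_trans ?_ (integral_abs_le_norm κ f))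
      exact integral_mono (hint f).pos_part (hint f).abs fun z => max_le (le_abs_self _) (abs_nonneg _)
    intro f
    rw [norm_eq_abs, abs_le]
    refine ⟨?_, h1 f⟩
    have := h1 (-f)
    rw [map_neg, norm_neg] at this
    linarith
  let a₀ := (InnerProductSpace.toDual ℝ (Lp ℝ 2 κ)).symm (g.mkContinuous _ hgabs)
  have ha₀ : ∀ f : Lp ℝ 2 κ, g f = ∫ z, a₀ z * f z ∂κ := by
    intro f
    have h1 : inner ℝ a₀ f = g f := by
      rw [InnerProductSpace.toDual_symm_apply]
      rfl
    rw [← h1, L2.inner_def]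
    apply integral_congr_ae
    filter_upwards with z
    simp [mul_comm]
  have hind : ∀ (S : Set Z) (hSm : MeasurableSet S) (hS : κ S ≠ ⊤) (c : ℝ),
    g (c • indicatorConstLp 2 hSm hS (1 : ℝ)) = c * ∫ z in S, a₀ z ∂κ := by
    intro S hSm hS c
    rw [map_smul, smul_eq_mul, ha₀, ← integral_indicator hSm]
    congr 1
    apply integral_congr_ae
    filter_upwards [indicatorConstLp_coeFn (p := 2) (hs := hSm) (hμs := hS) (c := (1 : ℝ))] with z hz
    rw [hz]
    by_cases h : z ∈ S <;> simp [h]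
  have hnonneg : 0 ≤ᵐ[κ] a₀ := by
    refine ae_nonneg_of_forall_setIntegral_nonneg (hint a₀) fun S hSm hS => ?_
    have h1 := hgle ((-1 : ℝ) • indicatorConstLp 2 hSm hS.ne (1 : ℝ))
    rw [hind S hSm hS.ne (-1)] at h1
    have h2 : ∫ z, max (((-1 : ℝ) • indicatorConstLp 2 hSm hS.ne (1 : ℝ) : Lp ℝ 2 κ) z) 0 ∂κ = 0 := by
      apply integral_eq_zero_of_ae
      filter_upwards [indicatorConstLp_coeFn (p := 2) (c := (1 : ℝ)),
        Lp.coeFn_smul (-1 : ℝ) (indicatorConstLp 2 hSm hS.ne (1 : ℝ))] with z hz hz'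
      rw [hz', Pi.smul_apply, hz]
      by_cases h : z ∈ S <;> simp [h]
    rw [h2] at h1
    linarith
  have hle1 : a₀ ≤ᵐ[κ] fun _ => (1 : ℝ) := by
    have : 0 ≤ᵐ[κ] fun z => 1 - a₀ z := by
      refine ae_nonneg_of_forall_setIntegral_nonneg ((integrable_const 1).sub (hint a₀)) fun S hSm hS => ?_
      have h1 := hgle ((1 : ℝ) • indicatorConstLp 2 hSm hS.ne (1 : ℝ))
      rw [hind S hSm hS.ne 1] at h1
      have h2 : ∫ z, max (((1 : ℝ) • indicatorConstLp 2 hSm hS.ne (1 : ℝ) : Lp ℝ 2 κ) z) 0 ∂κ =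
        ∫ z in S, (1 : ℝ) ∂κ := by
        rw [← integral_indicator hSm]
        apply integral_congr_ae
        filter_upwards [indicatorConstLp_coeFn (p := 2) (hs := hSm) (hμs := hS.ne) (c := (1 : ℝ))] with z hz
        rw [one_smul, hz]
        by_cases h : z ∈ S <;> simp [h]
      rw [integral_sub (integrable_const _).integrableOn (hint a₀).integrableOn]
      linarith
    filter_upwards [this] with z hz
    simpa using hz
  refine ⟨fun z => max 0 (min 1 (a₀ z)), by fun_prop, fun z => ⟨le_max_left _ _,
    max_le zero_le_one (min_le_left _ _)⟩, fun x hx => ?_⟩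
  -- Testing the gauge at minus the first component of x, with x itself as the element of the cone,
  -- makes the positive part vanish; what remains is the claimed inequality.
  have h1 := (hg (-(hL2 x hx).toLp x.1)).trans (hle _ ⟨x, hx⟩)
  have h2 : ∫ z, max ((-(hL2 x hx).toLp x.1 : Lp ℝ 2 κ) z + x.1 z) 0 ∂κ = 0 := by
    apply integral_eq_zero_of_ae
    filter_upwards [Lp.coeFn_neg ((hL2 x hx).toLp x.1), (hL2 x hx).coeFn_toLp] with z hz hz'
    rw [hz, Pi.neg_apply, hz']
    simp
  simp only [v] at h1
  rw [h2, map_neg, ha₀] at h1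
  have h3 : ∫ z, a₀ z * (hL2 x hx).toLp x.1 z ∂κ = ∫ z, max 0 (min 1 (a₀ z)) * x.1 z ∂κ := by
    apply integral_congr_ae
    filter_upwards [hnonneg, hle1, (hL2 x hx).coeFn_toLp] with z e1 e2 e3
    rw [e3, min_eq_right e2, max_eq_right (show (0 : ℝ) ≤ a₀ z from e1)]
  linarith

/-! ### Truncation of flows to mass at most one. -/

/-- A `C¹` regularization of the positive part. -/
def softPos (κ s : ℝ) : ℝ := ∫ r in (0 : ℝ)..s, max 0 (min 1 (r / κ))

lemma hasDerivAt_softPos (κ s : ℝ) : HasDerivAt (softPos κ) (max 0 (min 1 (s / κ))) s := by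
  have hc : Continuous fun r => max 0 (min 1 (r / κ)) := by fun_prop
  exact intervalIntegral.integral_hasDerivAt_right (hc.intervalIntegrable _ _)
    (hc.stronglyMeasurableAtFilter _ _) hc.continuousAt

lemma contDiff_softPos (κ : ℝ) : ContDiff ℝ 1 (softPos κ) := by
  rw [contDiff_one_iff_deriv]
  refine ⟨fun t => (hasDerivAt_softPos κ t).differentiableAt, ?_⟩
  rw [show deriv (softPos κ) = fun s => max 0 (min 1 (s / κ)) from
    funext fun t => (hasDerivAt_softPos κ t).deriv]
  fun_prop

lemma softPos_of_nonpos {s : ℝ} (hκ : 0 < κ) (hs : s ≤ 0) : softPos κ s = 0 := by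
  unfold softPos
  rw [intervalIntegral.integral_congr (g := fun _ => 0)]
  · simp
  · intro r hr
    rw [uIcc_of_ge hs] at hr
    simp only
    have := div_nonpos_of_nonpos_of_nonneg hr.2 hκ.le
    rw [max_eq_left]
    exact (min_le_right _ _).trans this

lemma softPos_nonneg (hκ : 0 < κ) (s : ℝ) : 0 ≤ softPos κ s := by
  rcases le_total s 0 with h | h
  · rw [softPos_of_nonpos hκ h]
  · exact intervalIntegral.integral_nonneg h fun r _ => le_max_left _ _

lemma softPos_le (hκ : 0 < κ) (s : ℝ) : softPos κ s ≤ max s 0 := by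
  rcases le_total s 0 with h | h
  · rw [softPos_of_nonpos hκ h]
    exact le_max_right _ _
  · rw [max_eq_left h]
    unfold softPos
    have hc : Continuous fun r => max 0 (min 1 (r / κ)) := by fun_prop
    have := intervalIntegral.integral_mono_on h (hc.intervalIntegrable 0 s)
      (intervalIntegrable_const (μ := volume)) fun r _ =>
        (max_le zero_le_one (min_le_left _ _) : max 0 (min 1 (r / κ)) ≤ 1)
    simpa using this

lemma sub_le_softPos (hκ : 0 < κ) (s : ℝ) : s - κ ≤ softPos κ s := by
  rcases le_total s κ with h | h
  · exact (sub_nonpos.2 h).trans (softPos_nonneg hκ s)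
  · unfold softPos
    have hc : Continuous fun r => max 0 (min 1 (r / κ)) := by fun_prop
    rw [← intervalIntegral.integral_add_adjacent_intervals (hc.intervalIntegrable 0 κ)
      (hc.intervalIntegrable κ s)]
    have h1 : 0 ≤ ∫ r in (0 : ℝ)..κ, max 0 (min 1 (r / κ)) :=
      intervalIntegral.integral_nonneg hκ.le fun r _ => le_max_left _ _
    have h2 : ∫ r in κ..s, max 0 (min 1 (r / κ)) = ∫ r in κ..s, (1 : ℝ) := by
      apply intervalIntegral.integral_congr
      intro r hr
      rw [uIcc_of_le h] at hr
      have := (one_le_div hκ).2 hr.1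
      simp [this]
    rw [h2, intervalIntegral.integral_const, smul_eq_mul, mul_one]
    linarith

/-- The duality inequality behind the truncation of flows. -/
lemma IsFlow.integral_final_le [IsFiniteMeasure γ₀] [IsFiniteMeasure γ₁]
    (h : IsFlow N γ₀ γ₁ σ w) (h1 : γ₁ univ ≤ 1)
    (hφ : ContDiff ℝ 1 φ) (hc : HasCompactSupport φ) (hg : Continuous g)
    (hg0 : ∀ t, 0 ≤ g t) (hgz : ∀ t ≤ 0, g t = 0) :
    ∫ x, φ (x, 1) ∂γ₁ ≤ ∫ x, max (φ (x, 0)) 0 ∂γ₀ +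
      ∫ p, max (fderiv ℝ φ p (w p, σ p) - σ p * g p.2) 0 ∂slab d + ∫ t, g t ∂timeM := by
  -- The flow is tested with the soft positive part of φ - b(t). Since b ≥ 0, this function is
  -- compactly supported although b is not.
  let b := fun t => ∫ s in 0..t, g s
  have hbd : ∀ t, HasDerivAt b (g t) t := fun t =>
    intervalIntegral.integral_hasDerivAt_right (hg.intervalIntegrable _ _)
      (hg.stronglyMeasurableAtFilter _ _) hg.continuousAt
  have hb : ContDiff ℝ 1 b := by
    rw [contDiff_one_iff_deriv]
    refine ⟨fun t => (hbd t).differentiableAt, ?_⟩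
    rwa [show deriv b = g from funext fun t => (hbd t).deriv]
  have hb0 : ∀ t, 0 ≤ b t := by
    intro t
    rcases le_total t 0 with ht | ht
    · simp only [b]
      rw [intervalIntegral.integral_congr (g := fun _ => 0)]
      · simp
      · intro r hr
        rw [uIcc_of_ge ht] at hr
        exact hgz r hr.2
    · exact intervalIntegral.integral_nonneg ht fun r _ => hg0 r
  have hb1 : b 1 = ∫ t, g t ∂timeM := by
    simp only [b]
    rw [intervalIntegral.integral_of_le zero_le_one]
    unfold timeM
    rw [Measure.restrict_congr_set Ioc_ae_eq_Icc]
  have hDi := h.integrable_fderiv hφ hc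
  have hposi : Integrable (fun p => max (fderiv ℝ φ p (w p, σ p) - σ p * g p.2) 0) (slab d) := by
    refine hDi.abs.mono' ?_ ?_
    · have h2 := h.meas_density
      exact ((hDi.1.sub (h2.mul (hg.measurable.comp measurable_snd)).aestronglyMeasurable).sup
        aestronglyMeasurable_const)
    · filter_upwards with p
      rw [norm_of_nonneg (le_max_right _ _)]
      refine max_le ?_ (abs_nonneg _)
      have := mul_nonneg (h.density_nonneg p) (hg0 p.2)
      have := le_abs_self (fderiv ℝ φ p (w p, σ p))
      linarith
  refine le_of_forall_pos_le_add fun κ hκ => ?_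
  let Ψ := fun p => softPos κ (φ p - b p.2)
  have hΨ : ContDiff ℝ 1 Ψ := (contDiff_softPos κ).comp (hφ.sub (hb.comp contDiff_snd))
  have hΨc : HasCompactSupport Ψ := by
    refine hc.mono fun p hp => ?_
    rw [Function.mem_support] at hp ⊢
    contrapose! hp
    simp only [Ψ]
    rw [hp, zero_sub]
    exact softPos_of_nonpos hκ (neg_nonpos.2 (hb0 _))
  have hΨd : ∀ p, fderiv ℝ Ψ p (w p, σ p) ≤ max (fderiv ℝ φ p (w p, σ p) - σ p * g p.2) 0 := by
    intro p
    have e1 := (hφ.differentiable (by norm_num) p).hasFDerivAt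
    have e2 := (hbd p.2).comp_hasFDerivAt p (hasFDerivAt_snd (𝕜 := ℝ) (E := E d) (p := p))
    have e3 : HasFDerivAt Ψ _ p := (hasDerivAt_softPos κ _).comp_hasFDerivAt p (e1.sub e2)
    rw [e3.fderiv]
    simp only [smul_apply, sub_apply, ContinuousLinearMap.coe_snd', smul_eq_mul]
    rw [mul_comm (g p.2)]
    -- By the chain rule the derivative is c·D with c in [0,1], which is at most the positive part
    -- of D.
    set c := max 0 (min 1 ((φ p - b p.2) / κ)) with hcd
    set D := fderiv ℝ φ p (w p, σ p) - σ p * g p.2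
    have hc1 : c ≤ 1 := max_le zero_le_one (min_le_left _ _)
    calc c * D ≤ c * max D 0 := by gcongr; exact le_max_left _ _
      _ ≤ 1 * max D 0 := by gcongr
      _ = max D 0 := one_mul _
  have hle := integral_mono (h.integrable_fderiv hΨ hΨc) hposi hΨd
  rw [(h.continuity_eq Ψ hΨ hΨc)] at hle
  have h0 : ∫ x, Ψ (x, 0) ∂γ₀ ≤ ∫ x, max (φ (x, 0)) 0 ∂γ₀ := by
    refine integral_mono (integrable_slice hΨ.continuous hΨc 0 γ₀)
      (integrable_slice hφ.continuous hc 0 γ₀).pos_part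
      fun x => ?_
    simp only [Ψ, (show b 0 = 0 by simp [b]), sub_zero]
    exact softPos_le hκ _
  -- Here the mass of the final measure being at most 1 enters: subtracting the constant b 1 + κ
  -- costs no more than b 1 + κ.
  have h2 : ∫ x, φ (x, 1) ∂γ₁ - (b 1 + κ) ≤ ∫ x, Ψ (x, 1) ∂γ₁ := by
    have h3 : ∫ x, (φ (x, 1) - (b 1 + κ)) ∂γ₁ ≤ ∫ x, Ψ (x, 1) ∂γ₁ := by
      refine integral_mono ((integrable_slice hφ.continuous hc 1 γ₁).sub (integrable_const _))
        (integrable_slice hΨ.continuous hΨc 1 γ₁) fun x => ?_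
      have := sub_le_softPos hκ (φ (x, 1) - b 1)
      linarith
    rw [integral_sub (integrable_slice hφ.continuous hc 1 γ₁) (integrable_const _), integral_const,
      smul_eq_mul] at h3
    have h4 : γ₁.real univ ≤ 1 := ENNReal.toReal_le_of_le_ofReal zero_le_one (by simpa using h1)
    have h5 : γ₁.real univ * (b 1 + κ) ≤ 1 * (b 1 + κ) := by
      gcongr
      linarith [hb0 1]
    linarith
  linarith

/-- A weight on space-time, positive and integrable. -/
def weight (p : Q d) : ℝ := exp (-‖p.1‖ ^ 2)

lemma continuous_weight : Continuous (weight (d := d)) := by unfold weight; fun_prop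

lemma weight_pos (p : Q d) : 0 < weight p := Real.exp_pos _

lemma weight_le_one (p : Q d) : weight p ≤ 1 := Real.exp_le_one_iff.2 (by simp)

lemma integrable_weight : Integrable (weight (d := d)) (slab d) := by
  have h := integrable_exp_neg_sq (d := d) one_pos
  unfold slab weight
  refine (h.comp_fst timeM).congr (.of_forall fun p => ?_)
  simp

def weightM (d : ℕ) : Measure (Q d) := (slab d).withDensity fun p => ofReal (weight p)

instance : IsFiniteMeasure (weightM d) := isFiniteMeasure_withDensity_ofReal integrable_weight.2

lemma weightM_le : weightM d ≤ slab d := by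
  calc (slab d).withDensity (fun p => ofReal (weight p)) ≤ (slab d).withDensity 1 := by
        apply withDensity_mono
        filter_upwards with p
        simpa using weight_le_one p
    _ = slab d := withDensity_one

lemma integral_weightM (f : Q d → ℝ) : ∫ p, f p ∂(weightM d) = ∫ p, weight p * f p ∂slab d := by
  unfold weightM
  rw [integral_withDensity_eq_integral_toReal_smul continuous_weight.measurable.ennreal_ofReal
    (.of_forall fun _ => ofReal_lt_top)]
  apply integral_congr_ae
  filter_upwards with p
  rw [toReal_ofReal (weight_pos p).le, smul_eq_mul]

/-- The disjoint union of the initial slice and of space-time. -/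
def sumM (γ₀ : Measure (E d)) : Measure (E d ⊕ Q d) := γ₀.map Sum.inl + (weightM d).map Sum.inr

instance [IsFiniteMeasure γ₀] : IsFiniteMeasure (sumM γ₀) := by unfold sumM; infer_instance

lemma measurableEmbedding_inl {X Y : Type*} [MeasurableSpace X] [MeasurableSpace Y] :
    MeasurableEmbedding (Sum.inl : X → X ⊕ Y) :=
  ⟨Sum.inl_injective, measurable_inl, fun _ hs => measurableSet_inl_image.2 hs⟩

lemma measurableEmbedding_inr {X Y : Type*} [MeasurableSpace X] [MeasurableSpace Y] :
    MeasurableEmbedding (Sum.inr : Y → X ⊕ Y) :=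
  ⟨Sum.inr_injective, measurable_inr, fun _ hs => measurableSet_inr_image.2 hs⟩

lemma integral_sumM [IsFiniteMeasure γ₀] {f : E d ⊕ Q d → ℝ} (hf : Integrable f (sumM γ₀)) :
    ∫ z, f z ∂(sumM γ₀) = ∫ x, f (Sum.inl x) ∂γ₀ + ∫ p, weight p * f (Sum.inr p) ∂slab d := by
  have h := hf
  unfold sumM at h ⊢
  rw [integrable_add_measure] at h
  rw [integral_add_measure h.1 h.2, (MeasurableEmbedding.integral_map measurableEmbedding_inl),
    (MeasurableEmbedding.integral_map measurableEmbedding_inr), integral_weightM]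

lemma memLp_sumM [IsFiniteMeasure γ₀] {f : E d ⊕ Q d → ℝ} (hf : Measurable f)
    (h0 : MemLp (fun x => f (Sum.inl x)) 2 γ₀) (h1 : MemLp (fun p => f (Sum.inr p)) 2 (weightM d)) :
    MemLp f 2 (sumM γ₀) := by
  refine (memLp_two_iff_integrable_sq hf.aestronglyMeasurable).2 ?_
  unfold sumM
  rw [integrable_add_measure]
  constructor
  · rw [(MeasurableEmbedding.integrable_map_iff measurableEmbedding_inl)]
    exact h0.integrable_sq
  · rw [(MeasurableEmbedding.integrable_map_iff measurableEmbedding_inr)]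
    exact h1.integrable_sq

/-- A test function together with a space-time penalty `G` dominated by a function of time. -/
structure IsPenalty (φ G : Q d → ℝ) (g : ℝ → ℝ) (R : ℝ) : Prop where
  contDiff : ContDiff ℝ 1 φ
  hasCompactSupport : HasCompactSupport φ
  measurable : Measurable G
  continuous : Continuous g
  bound : HasCompactSupport g
  eq_zero : ∀ t ≤ 0, g t = 0
  nonneg : ∀ p, 0 ≤ G p
  le : ∀ p, G p ≤ g p.2
  support : ∀ p, p ∉ cyl d R → G p = 0

lemma IsPenalty.time_nonneg (h : IsPenalty φ G g R) (t : ℝ) : 0 ≤ g t := (h.nonneg (0, t)).trans (h.le (0, t))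

/-- Division by the weight turns integrals over the slab into integrals against the finite measure
`weightM`. It is harmless because the expression vanishes outside a cylinder, where ‖p.1‖ < r gives
1/weight ≤ exp(r²). -/
lemma IsPenalty.fderiv_memLp (h : IsPenalty φ G g R) (hσm : Measurable σ) (hwm : Measurable w)
    (hσ : ∀ R, MemLp σ 2 ((slab d).restrict (cyl d R)))
    (hw : ∀ R, MemLp w 2 ((slab d).restrict (cyl d R))) :
    MemLp (fun p => (fderiv ℝ φ p (w p, σ p) - σ p * G p) / weight p) 2 (slab d) := by
  obtain ⟨C, hC0, hC⟩ := exists_bound_fderiv h.contDiff h.hasCompactSupport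
  obtain ⟨C', hC'⟩ := h.continuous.bounded_above_of_compact_support h.bound
  obtain ⟨R', hR', h0⟩ := exists_cyl (h.hasCompactSupport.fderiv ℝ)
  have hmeas : Measurable fun p => (fderiv ℝ φ p (w p, σ p) - σ p * G p) / weight p := by
    exact ((measurable_fderiv_apply h.contDiff measurable_id (hwm.prodMk hσm)).sub (hσm.mul h.measurable)).div continuous_weight.measurable
  set r := max R R'
  have hr : ∀ p, p ∉ cyl d r → (fderiv ℝ φ p (w p, σ p) - σ p * G p) / weight p = 0 := by
    intro p hp
    have hsub : ∀ q, q ≤ r → p ∉ cyl d q := fun q hq hpq =>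
      hp (prod_mono (Metric.ball_subset_ball hq) le_rfl hpq)
    rw [h0 p (hsub _ (le_max_right _ _)), h.support p (hsub _ (le_max_left _ _))]
    simp
  rw [show (fun p => (fderiv ℝ φ p (w p, σ p) - σ p * G p) / weight p) =
    (cyl d r).indicator (fun p => (fderiv ℝ φ p (w p, σ p) - σ p * G p) / weight p) by
      symm; rw [indicator_eq_self]; intro p hp; by_contra hn; exact hp (hr p hn),
    memLp_indicator_iff_restrict (measurableSet_cyl r)]
  refine ((hw r).norm.add (hσ r).norm).of_le_mul (c := (C + C') * exp (r ^ 2)) hmeas.aestronglyMeasurable ?_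
  filter_upwards [ae_restrict_mem (measurableSet_cyl r)] with p hp
  have hp1 : ‖p.1‖ < r := by simpa [cyl] using hp
  have hwt : 1 / weight p ≤ exp (r ^ 2) := by
    rw [weight, one_div, ← Real.exp_neg]
    apply Real.exp_le_exp.2
    have := norm_nonneg p.1
    nlinarith
  have hG : ‖G p‖ ≤ C' := by
    rw [norm_of_nonneg (h.nonneg p)]
    exact (h.le p).trans ((le_abs_self _).trans (hC' _))
  have hD : ‖fderiv ℝ φ p (w p, σ p)‖ ≤ C * (‖w p‖ + ‖σ p‖) := by
    refine ((fderiv ℝ φ p).le_opNorm _).trans (mul_le_mul (hC p) ?_ (norm_nonneg _) hC0)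
    exact max_le (by linarith [norm_nonneg (σ p)]) (by linarith [norm_nonneg (w p)])
  have hV : 0 ≤ ‖w p‖ + ‖σ p‖ := by positivity
  have hC'0 := (norm_nonneg _).trans hG
  simp only [Pi.add_apply]
  rw [div_eq_mul_one_div, norm_mul, norm_of_nonneg (one_div_nonneg.2 (weight_pos p).le), norm_of_nonneg hV]
  calc ‖fderiv ℝ φ p (w p, σ p) - σ p * G p‖ * (1 / weight p)
      ≤ ((C + C') * (‖w p‖ + ‖σ p‖)) * exp (r ^ 2) := by
        refine mul_le_mul ?_ hwt (one_div_nonneg.2 (weight_pos p).le) (by positivity)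
        refine (norm_sub_le _ _).trans ?_
        rw [norm_mul]
        have := mul_le_mul (by linarith [norm_nonneg (w p)]) hG (norm_nonneg _) hV
        linarith
    _ = (C + C') * exp (r ^ 2) * (‖w p‖ + ‖σ p‖) := by ring

lemma IsPenalty.add {φ' G' : Q d → ℝ} {g' : ℝ → ℝ} {R' : ℝ} (h : IsPenalty φ G g R)
    (h' : IsPenalty φ' G' g' R') : IsPenalty (φ + φ') (G + G') (g + g') (max R R') where
  contDiff := h.contDiff.add h'.contDiff
  hasCompactSupport := h.hasCompactSupport.add h'.hasCompactSupport
  measurable := h.measurable.add h'.measurable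
  continuous := h.continuous.add h'.continuous
  bound := h.bound.add h'.bound
  eq_zero t ht := by simp [h.eq_zero t ht, h'.eq_zero t ht]
  nonneg p := add_nonneg (h.nonneg p) (h'.nonneg p)
  le p := add_le_add (h.le p) (h'.le p)
  support p hp := by
    have hsub : ∀ q, q ≤ max R R' → p ∉ cyl d q := fun q hq hpq =>
      hp (prod_mono (Metric.ball_subset_ball hq) le_rfl hpq)
    simp [h.support p (hsub _ (le_max_left _ _)), h'.support p (hsub _ (le_max_right _ _))]

lemma IsPenalty.smul (h : IsPenalty φ G g R) (hc : 0 ≤ c) : IsPenalty (c • φ) (c • G) (c • g) R where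
  contDiff := contDiff_const.smul h.contDiff
  hasCompactSupport := h.hasCompactSupport.smul_left
  measurable := h.measurable.const_smul c
  continuous := h.continuous.const_smul c
  bound := h.bound.smul_left
  eq_zero t ht := by simp [h.eq_zero t ht]
  nonneg p := mul_nonneg hc (h.nonneg p)
  le p := mul_le_mul_of_nonneg_left (h.le p) hc
  support p hp := by simp [h.support p hp]

lemma isPenalty_zero (hφ : ContDiff ℝ 1 φ) (hc : HasCompactSupport φ) : IsPenalty φ 0 0 0 where
  contDiff := hφ
  hasCompactSupport := hc
  measurable := measurable_const
  continuous := continuous_const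
  bound := .zero
  eq_zero _ _ := rfl
  nonneg _ := le_rfl
  le _ := le_rfl
  support _ _ := rfl

/-- `exists_multiplier_of_cone` applied to the cone of all pairs of a test function and a penalty,
with `IsFlow.integral_final_le` as its hypothesis. The multiplier on the initial slice says which
part of the initial measure is kept, the one on the slab which part of the flow. -/
lemma IsFlow.exists_multiplier [IsFiniteMeasure γ₀] [IsFiniteMeasure γ₁]
    (h : IsFlow N γ₀ γ₁ σ w) (h1 : γ₁ univ ≤ 1)
    (hσ : ∀ R, MemLp σ 2 ((slab d).restrict (cyl d R)))
    (hw : ∀ R, MemLp w 2 ((slab d).restrict (cyl d R))) :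
    ∃ (a₁ : E d → ℝ) (a₂ : Q d → ℝ), Measurable a₁ ∧ Measurable a₂ ∧
      (∀ x, a₁ x ∈ Icc (0 : ℝ) 1) ∧ (∀ p, a₂ p ∈ Icc (0 : ℝ) 1) ∧
      ∀ φ G g R, IsPenalty φ G g R → ∫ x, φ (x, 1) ∂γ₁ - ∫ t, g t ∂timeM ≤
        ∫ x, a₁ x * φ (x, 0) ∂γ₀ + ∫ p, a₂ p * (fderiv ℝ φ p (w p, σ p) - σ p * G p) ∂slab d := by
  let F : (Q d → ℝ) → (Q d → ℝ) → (E d ⊕ Q d → ℝ) := fun φ G =>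
    Sum.elim (fun x => φ (x, 0)) (fun p => (fderiv ℝ φ p (w p, σ p) - σ p * G p) / weight p)
  let C := {x | ∃ φ G g R, IsPenalty φ G g R ∧ x = (F φ G, ∫ x, φ (x, 1) ∂γ₁ - ∫ t, g t ∂timeM)}
  have hFm : ∀ φ G g R, IsPenalty φ G g R → Measurable (F φ G) := by
    intro φ G g R hP
    refine measurable_fun_sum ?_ ?_
    · exact (hP.contDiff.continuous.comp (by fun_prop : Continuous fun x => (x, (0 : ℝ)))).measurable
    · have h3 := measurable_fderiv_apply hP.contDiff measurable_id (h.meas_flux.prodMk h.meas_density)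
      exact (h3.sub (h.meas_density.mul hP.measurable)).div continuous_weight.measurable
  have hFL : ∀ φ G g R, IsPenalty φ G g R → MemLp (F φ G) 2 (sumM γ₀) := by
    intro φ G g R hP
    refine memLp_sumM (hFm φ G g R hP) ?_ ?_
    · obtain ⟨B, hB⟩ := hP.contDiff.continuous.bounded_above_of_compact_support hP.hasCompactSupport
      exact MemLp.of_bound (hP.contDiff.continuous.comp (by fun_prop)).aestronglyMeasurable B
        (.of_forall fun x => hB _)
    · exact (hP.fderiv_memLp h.meas_density h.meas_flux hσ hw).mono_measure weightM_le
  have hdiff : ∀ (φ G : Q d → ℝ) g R, IsPenalty φ G g R → ∀ p, DifferentiableAt ℝ φ p :=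
    fun φ G g R hP p => hP.contDiff.differentiable (by norm_num) p
  have hgi : ∀ (φ G : Q d → ℝ) g R, IsPenalty φ G g R → Integrable g timeM := by
    intro φ G g R hP
    obtain ⟨B, hB⟩ := hP.continuous.bounded_above_of_compact_support hP.bound
    exact Integrable.of_bound hP.continuous.aestronglyMeasurable B (.of_forall hB)
  have key : ∃ a : E d ⊕ Q d → ℝ, Measurable a ∧ (∀ z, a z ∈ Icc (0 : ℝ) 1) ∧
    ∀ x ∈ C, x.2 ≤ ∫ z, a z * x.1 z ∂(sumM γ₀) := by
    refine exists_multiplier_of_cone (sumM γ₀) C ?_ ?_ ?_ ?_ ?_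
    · refine ⟨0, 0, 0, 0, isPenalty_zero contDiff_const .zero, ?_⟩
      ext z
      · rcases z with x | p <;> simp [F]
      · simp
    · rintro _ ⟨φ, G, g, R, hP, rfl⟩ _ ⟨φ', G', g', R', hP', rfl⟩
      refine ⟨φ + φ', G + G', g + g', _, hP.add hP', ?_⟩
      ext z
      · rcases z with x | p
        · simp [F]
        · simp only [F, Prod.fst_add, Pi.add_apply, Sum.elim_inr]
          rw [fderiv_add (hdiff φ G g R hP p) (hdiff φ' G' g' R' hP' p), add_apply]
          ring
      · simp
        rw [integral_add (integrable_slice hP.contDiff.continuous hP.hasCompactSupport 1 γ₁)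
          (integrable_slice hP'.contDiff.continuous hP'.hasCompactSupport 1 γ₁),
          integral_add (hgi φ G g R hP) (hgi φ' G' g' R' hP')]
        ring
    · rintro c hc _ ⟨φ, G, g, R, hP, rfl⟩
      refine ⟨c • φ, c • G, c • g, R, hP.smul hc.le, ?_⟩
      ext z
      · rcases z with x | p
        · simp [F]
        · simp only [F, Prod.smul_fst, Pi.smul_apply, Sum.elim_inr, smul_eq_mul]
          rw [fderiv_const_smul (hdiff φ G g R hP p), smul_apply, smul_eq_mul]
          ring
      · simp
        rw [integral_const_mul, integral_const_mul]
        ring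
    · rintro _ ⟨φ, G, g, R, hP, rfl⟩
      exact hFL φ G g R hP
    · rintro _ ⟨φ, G, g, R, hP, rfl⟩
      have hI := ((hFL φ G g R hP).integrable (by norm_num)).pos_part
      have hI2 := hI
      unfold sumM at hI2
      rw [integrable_add_measure, measurableEmbedding_inr.integrable_map_iff] at hI2
      rw [integral_sumM hI]
      have hkey := h.integral_final_le h1 hP.contDiff hP.hasCompactSupport hP.continuous
        hP.time_nonneg hP.eq_zero
      -- Since G ≤ g p.2 and σ ≥ 0, passing from g to G only enlarges the positive part.
      have hle : ∫ p, max (fderiv ℝ φ p (w p, σ p) - σ p * g p.2) 0 ∂slab d ≤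
        ∫ p, weight p * max (F φ G (Sum.inr p)) 0 ∂slab d := by
        refine integral_mono_of_nonneg (.of_forall fun p => le_max_right _ _) ?_ (.of_forall fun p => ?_)
        · have h3 := hI2.2
          unfold weightM at h3
          rw [integrable_withDensity_iff continuous_weight.measurable.ennreal_ofReal
            (.of_forall fun _ => ofReal_lt_top)] at h3
          refine h3.congr (.of_forall fun p => ?_)
          simp
          rw [toReal_ofReal (weight_pos p).le, mul_comm]
        · simp only [F, Sum.elim_inr]
          rw [mul_max_of_nonneg _ _ (weight_pos p).le, mul_zero, mul_div_cancel₀ _ (weight_pos p).ne']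
          gcongr
          · exact h.density_nonneg p
          · exact hP.le p
      simp only [F, Sum.elim_inl] at hle ⊢
      linarith
  obtain ⟨a, ham, ha, hx⟩ := key
  refine ⟨fun x => a (Sum.inl x), fun p => a (Sum.inr p), ham.comp measurable_inl,
    ham.comp measurable_inr, fun x => ha _, fun p => ha _, fun φ G g R hP => ?_⟩
  refine (hx _ ⟨φ, G, g, R, hP, rfl⟩).trans_eq ?_
  have hint : Integrable (fun z => a z * F φ G z) (sumM γ₀) := by
    refine ((hFL φ G g R hP).integrable (by norm_num)).mono
      (ham.mul (hFm φ G g R hP)).aestronglyMeasurable (.of_forall fun z => ?_)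
    rw [norm_mul, norm_of_nonneg (ha z).1]
    exact mul_le_of_le_one_left (norm_nonneg _) (ha z).2
  rw [integral_sumM hint]
  congr 1
  apply integral_congr_ae
  filter_upwards with p
  have := (weight_pos p).ne'
  simp only [F, Sum.elim_inr]
  field_simp

/-- Inner and outer regularity. The admissible functions vanish for t ≤ 0, so that half-line has to
be null for κ separately. -/
lemma measure_le_of_continuous_le {κ : Measure ℝ} [IsFiniteMeasure κ] (hκ : κ (Iic 0) = 0)
    (h : ∀ g : ℝ → ℝ, Continuous g → HasCompactSupport g → (∀ t, g t ∈ Icc (0 : ℝ) 1) →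
      (∀ t ≤ 0, g t = 0) → ∫⁻ t, ofReal (g t) ∂κ ≤ ∫⁻ t, ofReal (g t) ∂timeM)
    {S : Set ℝ} (hS : MeasurableSet S) : κ S ≤ timeM S := by
  have hcomp : ∀ K, IsCompact K → K ⊆ Ioi 0 → κ K ≤ timeM K := by
    intro K hK hK0
    refine ENNReal.le_of_forall_pos_le_add fun δ hδ _ => ?_
    have hδ' : (δ : ℝ≥0∞) ≠ 0 := by simpa using hδ.ne'
    obtain ⟨U, hU, hUo, hUle⟩ := K.exists_isOpen_le_add timeM hδ'
    obtain ⟨f, hf1, hf0, hfc, hf01⟩ := exists_continuous_one_zero_of_isCompact hK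
      (hUo.inter isOpen_Ioi).isClosed_compl
      (disjoint_compl_right_iff_subset.2 (subset_inter hU hK0))
    have hfz : ∀ t, t ∉ U ∩ Ioi 0 → f t = 0 := fun t ht => hf0 ht
    calc κ K = ∫⁻ t, K.indicator 1 t ∂κ := (lintegral_indicator_one hK.measurableSet).symm
      _ ≤ ∫⁻ t, ofReal (f t) ∂κ := by
        refine lintegral_mono fun t => ?_
        by_cases ht : t ∈ K
        · simp [ht, hf1 ht]
        · simp [ht]
      _ ≤ ∫⁻ t, ofReal (f t) ∂timeM :=
        h f f.continuous hfc hf01 fun t ht => hfz t fun h' => not_lt.2 ht h'.2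
      _ ≤ ∫⁻ t, U.indicator 1 t ∂timeM := by
        refine lintegral_mono fun t => ?_
        by_cases ht : t ∈ U
        · simpa [ht] using (hf01 t).2
        · simp [ht, hfz t fun h' => ht h'.1]
      _ = timeM U := lintegral_indicator_one hUo.measurableSet
      _ ≤ _ := hUle
  have h1 : κ S ≤ κ (S ∩ Ioi 0) := by
    have : S ⊆ (S ∩ Ioi 0) ∪ Iic 0 := fun t ht => by
      rcases lt_or_ge 0 t with h | h
      · exact Or.inl ⟨ht, h⟩
      · exact Or.inr h
    calc κ S ≤ κ (S ∩ Ioi 0) + κ (Iic 0) := (measure_mono this).trans (measure_union_le _ _)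
      _ = _ := by rw [hκ, add_zero]
  refine h1.trans ?_
  rw [(hS.inter measurableSet_Ioi).measure_eq_iSup_isCompact_of_ne_top (measure_ne_top _ _)]
  refine iSup₂_le fun K hK => iSup_le fun hKc => (hcomp K hKc (hK.trans inter_subset_right)).trans ?_
  exact measure_mono (hK.trans inter_subset_left)

lemma lintegral_slab {f : Q d → ℝ≥0∞} (hf : Measurable f) :
    ∫⁻ p, f p ∂slab d = ∫⁻ t, (∫⁻ x, f (x, t)) ∂timeM :=
  lintegral_prod_symm' f hf

/-- A flow whose density is penalized by every function of time has mass at most one. -/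
lemma mass_le_of_penalty (hσm : Measurable σ) (hσ0 : ∀ p, 0 ≤ σ p)
    (hσ : ∀ R, IntegrableOn σ (cyl d R) (slab d))
    (h : ∀ G g R, IsPenalty (0 : Q d → ℝ) G g R → ∫ p, σ p * G p ∂slab d ≤ ∫ t, g t ∂timeM) :
    ∀ᵐ t ∂timeM, ∫⁻ x, ofReal (σ (x, t)) ≤ 1 := by
  have key : ∀ k : ℕ, ∀ᵐ t ∂timeM, ∫⁻ x in Metric.ball 0 k, ofReal (σ (x, t)) ≤ 1 := by
    intro k
    let f : Q d → ℝ≥0∞ := (cyl d k).indicator fun p => ofReal (σ p)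
    have hf : Measurable f := hσm.ennreal_ofReal.indicator (measurableSet_cyl _)
    let ρ : ℝ → ℝ≥0∞ := fun t => ∫⁻ x, f (x, t)
    have hρ : Measurable ρ := hf.lintegral_prod_left'
    have hρe : ∀ t, ρ t = ∫⁻ x in Metric.ball 0 k, ofReal (σ (x, t)) := by
      intro t
      rw [← lintegral_indicator Metric.isOpen_ball.measurableSet]
      apply lintegral_congr
      intro x
      by_cases hx : x ∈ Metric.ball (0 : E d) k <;> simp [f, cyl, hx]
    have hfin : ∫⁻ t, ρ t ∂timeM ≠ ⊤ := by
      rw [← lintegral_slab hf, lintegral_indicator (measurableSet_cyl _)]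
      exact (hσ k).lintegral_lt_top.ne
    let κ := timeM.withDensity ρ
    have := isFiniteMeasure_withDensity hfin
    have hκ : ∀ S, MeasurableSet S → κ S ≤ timeM S := by
      intro S hS
      refine measure_le_of_continuous_le ?_ ?_ hS
      · refine withDensity_absolutelyContinuous _ _ ?_
        have : Iic (0 : ℝ) ∩ Icc 0 1 ⊆ {0} := fun t ht => le_antisymm ht.1 ht.2.1
        unfold timeM
        rw [Measure.restrict_apply measurableSet_Iic]
        exact measure_mono_null this (by simp)
      · intro g hg hgc hg01 hgz
        let G : Q d → ℝ := (cyl d k).indicator fun p => g p.2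
        have hP : IsPenalty 0 G g k :=
          { contDiff := contDiff_const
            hasCompactSupport := .zero
            measurable := (hg.measurable.comp measurable_snd).indicator (measurableSet_cyl _)
            continuous := hg
            bound := hgc
            eq_zero := hgz
            nonneg := fun p => indicator_nonneg (fun p _ => (hg01 p.2).1) p
            le := fun p => indicator_le_self' (fun p _ => (hg01 p.2).1) p
            support := fun p hp => indicator_of_notMem hp _ }
        have hgi : Integrable g timeM := Integrable.of_bound hg.aestronglyMeasurable 1 (.of_forall fun t => by
            rw [norm_of_nonneg (hg01 t).1]; exact (hg01 t).2)
        have hGi : Integrable (fun p => σ p * G p) (slab d) := by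
          have h1 : (fun p => σ p * G p) = (cyl d k).indicator fun p => g p.2 * σ p := by
            ext p
            by_cases hp : p ∈ cyl d k <;> simp [G, hp, mul_comm]
          rw [h1, integrable_indicator_iff (measurableSet_cyl _)]
          refine (hσ k).bdd_mul (c := 1) (hg.comp continuous_snd).aestronglyMeasurable
            (.of_forall fun p => ?_)
          rw [norm_of_nonneg (hg01 p.2).1]
          exact (hg01 p.2).2
        calc ∫⁻ t, ofReal (g t) ∂κ
            = ∫⁻ t, ρ t * ofReal (g t) ∂timeM :=
              lintegral_withDensity_eq_lintegral_mul _ hρ hg.measurable.ennreal_ofReal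
          _ = ∫⁻ t, (∫⁻ x, ofReal (σ (x, t) * G (x, t))) ∂timeM := by
            apply lintegral_congr
            intro t
            have e : ρ t * ofReal (g t) = ∫⁻ x, f (x, t) * ofReal (g t) :=
              (lintegral_mul_const _ (hf.comp (measurable_id.prodMk measurable_const))).symm
            rw [e]
            apply lintegral_congr
            intro x
            by_cases hx : (x, t) ∈ cyl d k
            · simp [f, G, hx, ofReal_mul (hσ0 _)]
            · simp [f, G, hx]
          _ = ∫⁻ p, ofReal (σ p * G p) ∂slab d :=
            (lintegral_slab (hσm.mul hP.measurable).ennreal_ofReal).symm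
          _ = ofReal (∫ p, σ p * G p ∂slab d) :=
            (ofReal_integral_eq_lintegral_ofReal hGi (.of_forall fun p =>
              mul_nonneg (hσ0 p) (hP.nonneg p))).symm
          _ ≤ ofReal (∫ t, g t ∂timeM) := ofReal_le_ofReal (h G g k hP)
          _ = _ := ofReal_integral_eq_lintegral_ofReal hgi (.of_forall fun t => (hg01 t).1)
    have := ae_le_of_forall_setLIntegral_le_of_sigmaFinite (μ := timeM) (g := fun _ => 1) hρ fun S hS _ => by
        rw [← withDensity_apply _ hS, setLIntegral_one]
        exact hκ S hS
    filter_upwards [this] with t ht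
    rwa [← hρe]
  filter_upwards [ae_all_iff.2 key] with t ht
  have hU : (⋃ k : ℕ, Metric.ball (0 : E d) k) = univ := by simp
  rw [← setLIntegral_univ, ← hU, setLIntegral_iUnion_of_directed]
  · exact iSup_le ht
  · exact (monotone_nat_of_le_succ fun k => Metric.ball_subset_ball (by simp)).directed_le

/-- The multiplier inequality for φ and -φ without penalty gives the continuity equation for the
reduced flow; for φ = 0 and arbitrary penalties it gives the mass bound 1. -/
lemma IsFlow.exists_truncation_of_memLp [IsFiniteMeasure γ₀] [IsFiniteMeasure γ₁]
    (h : IsFlow N γ₀ γ₁ σ w) (h1 : γ₁ univ ≤ 1)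
    (hσ : ∀ R, MemLp σ 2 ((slab d).restrict (cyl d R)))
    (hw : ∀ R, MemLp w 2 ((slab d).restrict (cyl d R))) :
    ∃ (u : Measure (E d)) (a : Q d → ℝ), u ≤ γ₀ ∧ (∀ p, a p ∈ Icc (0 : ℝ) 1) ∧
      IsFlow 1 u γ₁ (fun p => a p * σ p) (fun p => a p • w p) := by
  obtain ⟨a₁, a, ham₁, ham, ha₁, ha, hle⟩ := h.exists_multiplier h1 hσ hw
  have hσm := h.meas_density
  have hσa : ∀ R, IntegrableOn (fun p => a p * σ p) (cyl d R) (slab d) := fun R =>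
    (h.int_density R).bdd_mul ham.aestronglyMeasurable
      (.of_forall fun p => by rw [norm_of_nonneg (ha p).1]; exact (ha p).2)
  have hσa0 : ∀ p, 0 ≤ a p * σ p := fun p => mul_nonneg (ha p).1 (h.density_nonneg p)
  refine ⟨γ₀.withDensity fun x => ofReal (a₁ x), a, ?_, ha, ?_⟩
  · calc γ₀.withDensity (fun x => ofReal (a₁ x)) ≤ γ₀.withDensity 1 := by
          apply withDensity_mono
          filter_upwards with x
          simpa using (ha₁ x).2
      _ = γ₀ := withDensity_one
  · refine ⟨ham.mul hσm, ham.smul h.meas_flux, hσa0, ?_, hσa, fun R => ?_, fun φ hφ hc => ?_⟩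
    · refine mass_le_of_penalty (ham.mul hσm) hσa0 hσa fun G g R hP => ?_
      have := hle 0 G g R hP
      simp only [Pi.zero_apply, integral_zero, mul_zero, zero_sub, zero_add, fderiv_zero,
        zero_apply, mul_neg, integral_neg, neg_le_neg_iff] at this
      refine (integral_congr_ae (.of_forall fun p => ?_)).trans_le this
      simp
      ring
    · exact (h.int_flux R).bdd_smul 1 ham.aestronglyMeasurable
        (.of_forall fun p => by rw [norm_of_nonneg (ha p).1]; exact (ha p).2)
    · have e1 := hle φ 0 0 0 (isPenalty_zero hφ hc)
      have e2 := hle (-φ) 0 0 0 (isPenalty_zero hφ.neg hc.neg)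
      have e3 : ∀ p, fderiv ℝ (-φ) p (w p, σ p) = - fderiv ℝ φ p (w p, σ p) := by
        intro p
        rw [fderiv_neg, neg_apply]
      simp only [Pi.zero_apply, integral_zero, sub_zero, mul_zero, Pi.neg_apply, e3, mul_neg,
        integral_neg] at e1 e2
      rw [integral_withDensity_eq_integral_toReal_smul ham₁.ennreal_ofReal
        (.of_forall fun _ => ofReal_lt_top)]
      have e4 : ∀ p, fderiv ℝ φ p (a p • w p, a p * σ p) = a p * fderiv ℝ φ p (w p, σ p) := by
        intro p
        rw [← smul_eq_mul (a p) (σ p), ← Prod.smul_mk, map_smul, smul_eq_mul]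
      simp only [e4, toReal_ofReal (ha₁ _).1, smul_eq_mul]
      linarith

/-- Locally bounded density and finite action put density and flux in L² locally; the reduced flow
has no larger action by `IsMobility.actE_smul_le`. -/
lemma IsFlow.exists_truncation [IsFiniteMeasure γ₀] [IsFiniteMeasure γ₁]
    (hm : IsMobility m) (h : IsFlow N γ₀ γ₁ σ w) (h1 : γ₁ univ ≤ 1)
    (hσ : ∀ R, ∃ C, ∀ᵐ p ∂((slab d).restrict (cyl d R)), σ p ≤ C) (hA : flowAction m σ w ≠ ⊤) :
    ∃ u ≤ γ₀, flowCost m 1 u γ₁ ≤ flowAction m σ w := by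
  have hfin : ∀ R, IsFiniteMeasure ((slab d).restrict (cyl d R)) := fun R =>
    ⟨by rw [Measure.restrict_apply_univ]; exact slab_cyl_lt_top R⟩
  have hσ2 : ∀ R, MemLp σ 2 ((slab d).restrict (cyl d R)) := by
    intro R
    obtain ⟨C, hC⟩ := hσ R
    refine MemLp.of_bound h.meas_density.aestronglyMeasurable C ?_
    filter_upwards [hC] with p hp
    rwa [norm_of_nonneg (h.density_nonneg p)]
  have hw2 : ∀ R, MemLp w 2 ((slab d).restrict (cyl d R)) := by
    intro R
    obtain ⟨C, hC⟩ := hσ R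
    refine (memLp_two_iff_integrable_sq_norm h.meas_flux.aestronglyMeasurable).2 ?_
    refine ⟨(h.meas_flux.norm.pow_const 2).aestronglyMeasurable, ?_⟩
    have e1 : ∀ᵐ p ∂((slab d).restrict (cyl d R)),
      ofReal (‖w p‖ ^ 2) ≤ ofReal (m (max C 0)) * actE m (σ p) (w p) := by
      filter_upwards [hC] with p hp
      rw [hm.ofReal_normSq_eq (σ p)]
      gcongr
      exact hm.monotone (hp.trans (le_max_left _ _))
    rw [hasFiniteIntegral_iff_ofReal (.of_forall fun p => by positivity)]
    calc ∫⁻ p in cyl d R, ofReal (‖w p‖ ^ 2) ∂slab d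
        ≤ ∫⁻ p in cyl d R, ofReal (m (max C 0)) * actE m (σ p) (w p) ∂slab d := lintegral_mono_ae e1
      _ ≤ ∫⁻ p, ofReal (m (max C 0)) * actE m (σ p) (w p) ∂slab d :=
        setLIntegral_le_lintegral _ _
      _ = ofReal (m (max C 0)) * flowAction m σ w :=
        lintegral_const_mul _ (hm.measurable_actE h.meas_density h.meas_flux)
      _ < ⊤ := mul_lt_top ofReal_lt_top hA.lt_top
  obtain ⟨u, a, hu, ha, hF⟩ := h.exists_truncation_of_memLp h1 hσ2 hw2
  exact ⟨u, hu, (flowCost_le hF).trans (lintegral_mono fun p =>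
    hm.actE_smul_le (ha p).1 (ha p).2 (h.density_nonneg p) _)⟩

/-! ### Convolution of Radon measures and vector measures with the bump. -/

section

variable {F : Type*} [NormedAddCommGroup F] {μ : Measure (E d)} {θ : E d → F}

lemma locallyIntegrable_of_norm_le [IsLocallyFiniteMeasure μ] (hθm : AEStronglyMeasurable θ μ)
    (hθ : ∀ᵐ y ∂μ, ‖θ y‖ ≤ 1) : LocallyIntegrable θ μ := by
  have h : LocallyIntegrable (fun _ => (1 : ℝ)) μ := locallyIntegrable_const 1
  refine h.mono hθm ?_
  filter_upwards [hθ] with y hy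
  simpa using hy

variable [InnerProductSpace ℝ F]

/-- The convolution of the vector measure `θ μ` with the bump of radius `ε`. -/
def blur (ε : ℝ) (μ : Measure (E d)) (θ : E d → F) (x : E d) : F := ∫ y, bumpK ε (x - y) • θ y ∂μ

lemma continuous_blur [CompleteSpace F] [IsLocallyFiniteMeasure μ] (hε : 0 < ε)
    (hθm : AEStronglyMeasurable θ μ) (hθ : ∀ᵐ y ∂μ, ‖θ y‖ ≤ 1) : Continuous (blur ε μ θ) := by
  have := (hasCompactSupport_bumpK hε).continuous_convolution_right
    (ContinuousLinearMap.lsmul ℝ ℝ : ℝ →L[ℝ] F →L[ℝ] F).flip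
    (locallyIntegrable_of_norm_le hθm hθ) (continuous_bumpK ε)
  refine this.congr fun x => ?_
  simp [MeasureTheory.convolution, blur]

lemma bumpK_sub_eq_zero (hε : 0 < ε) {y : E d} (hx : x ∈ Metric.ball (0 : E d) R)
    (hy : y ∉ Metric.ball (0 : E d) (R + ε)) : bumpK ε (x - y) = 0 := by
  apply bumpK_eq_zero hε
  simp at hx hy
  have := norm_sub_norm_le y x
  rw [norm_sub_rev] at this
  linarith

lemma blur_eq_setIntegral (hε : 0 < ε) (hx : x ∈ Metric.ball (0 : E d) R) :
    blur ε μ θ x = ∫ y in Metric.ball 0 (R + ε), bumpK ε (x - y) • θ y ∂μ := by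
  unfold blur
  rw [setIntegral_eq_integral_of_forall_compl_eq_zero]
  intro y hy
  rw [bumpK_sub_eq_zero hε hx hy, zero_smul]

lemma norm_blur_le [IsLocallyFiniteMeasure μ] (hε : 0 < ε) (hθ : ∀ᵐ y ∂μ, ‖θ y‖ ≤ 1)
    (hx : x ∈ Metric.ball (0 : E d) R) :
    ‖blur ε μ θ x‖ ≤ (ε ^ d)⁻¹ * bumpMax d * μ.real (Metric.ball 0 (R + ε)) := by
  rw [blur_eq_setIntegral hε hx]
  refine norm_setIntegral_le_of_norm_le_const_ae measure_ball_lt_top ?_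
  filter_upwards [ae_restrict_of_ae hθ] with y hy
  rw [norm_smul, norm_of_nonneg (bumpK_nonneg hε.le _)]
  calc bumpK ε (x - y) * ‖θ y‖ ≤ ((ε ^ d)⁻¹ * bumpMax d) * 1 := by
        refine mul_le_mul (bumpK_le hε _) hy (norm_nonneg _) ?_
        exact mul_nonneg (by positivity) bumpMax_pos.le
    _ = _ := mul_one _

lemma integrable_bumpK_smul [IsLocallyFiniteMeasure μ] (hε : 0 < ε)
    (hθm : AEStronglyMeasurable θ μ) (hθ : ∀ᵐ y ∂μ, ‖θ y‖ ≤ 1) (x : E d) :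
    Integrable (fun y => bumpK ε (x - y) • θ y) μ := by
  refine (locallyIntegrable_of_norm_le hθm hθ).integrable_smul_left_of_hasCompactSupport
    (by have := continuous_bumpK (d := d) ε; fun_prop) ?_
  exact (hasCompactSupport_bumpK hε).comp_homeomorph (Homeomorph.subLeft x)

/-- Fubini's theorem moves the kernel from the measure to the field; it applies since A has compact
support and the kernel has range ε. -/
lemma integral_inner_blur [CompleteSpace F] [IsLocallyFiniteMeasure μ] (hε : 0 < ε)
    (hθm : StronglyMeasurable θ) (hθ : ∀ᵐ y ∂μ, ‖θ y‖ ≤ 1) {A : E d → F} (hA : Continuous A)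
    (hAc : HasCompactSupport A) :
    ∫ x, inner ℝ (A x) (blur ε μ θ x) = ∫ y, inner ℝ (∫ x, bumpK ε (x - y) • A x) (θ y) ∂μ := by
  obtain ⟨R, hR⟩ := hAc.isBounded.subset_ball 0
  obtain ⟨C, hC⟩ := hA.bounded_above_of_compact_support hAc
  have hA0 : ∀ x, x ∉ Metric.ball (0 : E d) R → A x = 0 := fun x hx => by
    by_contra h
    exact hx (hR (subset_tsupport _ h))
  have e1 : ∀ x, inner ℝ (A x) (blur ε μ θ x) = ∫ y, inner ℝ (A x) (bumpK ε (x - y) • θ y) ∂μ := by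
    intro x
    unfold blur
    rw [integral_inner (integrable_bumpK_smul hε hθm.aestronglyMeasurable hθ x)]
  have e2 : ∀ y, inner ℝ (∫ x, bumpK ε (x - y) • A x) (θ y) = ∫ x, inner ℝ (A x) (bumpK ε (x - y) • θ y) := by
    intro y
    have hi : Integrable fun x => bumpK ε (x - y) • A x := by
      refine Continuous.integrable_of_hasCompactSupport ?_ hAc.smul_left
      have := continuous_bumpK (d := d) ε
      fun_prop
    rw [real_inner_comm, ← integral_inner hi]
    congr 1
    ext x
    rw [inner_smul_right, inner_smul_right, real_inner_comm]
  simp_rw [e1, e2]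
  apply integral_integral_swap
  have hm : AEStronglyMeasurable (Function.uncurry fun x y => inner ℝ (A x) (bumpK ε (x - y) • θ y))
    ((volume : Measure (E d)).prod μ) := by
    have h1 := continuous_bumpK (d := d) ε
    have h2 : Continuous fun p : E d × E d => bumpK ε (p.1 - p.2) := by fun_prop
    have h3 : StronglyMeasurable fun p : E d × E d => θ p.2 := hθm.comp_measurable measurable_snd
    have h4 : StronglyMeasurable fun p : E d × E d => A p.1 := (hA.comp continuous_fst).stronglyMeasurable
    exact (h4.inner (h2.stronglyMeasurable.smul h3)).aestronglyMeasurable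
  set S : Set (E d × E d) := Metric.ball 0 R ×ˢ Metric.ball 0 (R + ε)
  rw [← integrableOn_iff_integrable_of_support_subset (s := S)]
  · refine Measure.integrableOn_of_bounded (M := C * ((ε ^ d)⁻¹ * bumpMax d)) ?_ hm ?_
    · rw [Measure.prod_prod]
      exact (mul_lt_top measure_ball_lt_top measure_ball_lt_top).ne
    · filter_upwards [ae_restrict_of_ae (Measure.quasiMeasurePreserving_snd.ae hθ)] with p hp
      refine (norm_inner_le_norm _ _).trans ?_
      rw [norm_smul, norm_of_nonneg (bumpK_nonneg hε.le _)]
      have h0 : 0 ≤ C := (norm_nonneg _).trans (hC 0)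
      have h1 := bumpK_le hε (p.1 - p.2)
      have h2 := bumpK_nonneg hε.le (p.1 - p.2)
      refine mul_le_mul (hC _) ?_ (by positivity) h0
      calc bumpK ε (p.1 - p.2) * ‖θ p.2‖ ≤ bumpK ε (p.1 - p.2) * 1 := by gcongr
        _ ≤ _ := by rwa [mul_one]
  · intro p hp
    by_contra h
    apply hp
    by_cases h1 : p.1 ∈ Metric.ball (0 : E d) R
    · simp [Function.uncurry, bumpK_sub_eq_zero hε h1 (fun h2 => h ⟨h1, h2⟩)]
    · simp [Function.uncurry, hA0 _ h1]

end

/-! ### Weak derivatives in time and boundary values. -/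

/-- A smooth cutoff near the initial time. -/
def edge (n : ℕ) (t : ℝ) : ℝ := smoothTransition (n * t - 1)

lemma contDiff_edge (n : ℕ) : ContDiff ℝ 1 (edge n) := by exact smoothTransition.contDiff.comp (by fun_prop)

lemma deriv_edge_nonneg (n : ℕ) (t : ℝ) : 0 ≤ deriv (edge n) t := by
  refine Monotone.deriv_nonneg fun x y h => ?_
  exact smoothTransition.monotone (by gcongr)

lemma edge_of_le (h : n * t ≤ 1) : edge n t = 0 := smoothTransition.zero_of_nonpos (by linarith)

lemma edge_of_ge (h : 2 ≤ n * t) : edge n t = 1 := smoothTransition.one_of_one_le (by linarith)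

lemma deriv_edge_of_gt (h : 2 < n * t) : deriv (edge n) t = 0 := by
  have : edge n =ᶠ[𝓝 t] fun _ => 1 := by
    have hc : Continuous fun t => (n : ℝ) * t := by fun_prop
    filter_upwards [hc.continuousAt.eventually (lt_mem_nhds h)] with s hs
    exact edge_of_ge hs.le
  rw [this.deriv_eq, deriv_const]

lemma integral_timeM_eq (f : ℝ → ℝ) : ∫ t, f t ∂timeM = ∫ t in (0 : ℝ)..1, f t := by
  rw [intervalIntegral.integral_of_le zero_le_one]
  unfold timeM
  rw [Measure.restrict_congr_set Ioc_ae_eq_Icc]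

lemma integral_deriv_edge (hn : 2 ≤ n) : ∫ t, deriv (edge n) t ∂timeM = 1 := by
  rw [integral_timeM_eq, intervalIntegral.integral_deriv_eq_sub]
  · rw [edge_of_ge (by simpa using hn), edge_of_le (by simp), sub_zero]
  · exact fun t _ => (contDiff_edge n).differentiable (by norm_num) t
  · exact ((contDiff_edge n).continuous_deriv (by norm_num)).intervalIntegrable _ _

lemma integrable_timeM {f : ℝ → ℝ} (hf : ContinuousOn f (Icc 0 1)) :
    Integrable f timeM := hf.integrableOn_compact isCompact_Icc

/-- The derivatives of the cutoffs form an approximate identity at time 0: they are nonnegative,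
have integral one for n ≥ 2 and vanish for t > 2/n. -/
lemma tendsto_integral_deriv_edge {f : ℝ → ℝ} (hf : ContinuousOn f (Icc 0 1)) :
    Tendsto (fun n => ∫ t, deriv (edge n) t * f t ∂timeM) atTop (𝓝 (f 0)) := by
  rw [Metric.tendsto_atTop]
  intro η hη
  obtain ⟨δ, hδ, hδf⟩ := Metric.continuousWithinAt_iff.1 (hf 0 (by simp)) (η / 2) (by positivity)
  obtain ⟨n₀, hn₀⟩ := exists_nat_gt (2 / δ)
  refine ⟨max n₀ 2, fun n hn => ?_⟩
  have hnδ : 2 < n * δ := by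
    have : (n₀ : ℝ) ≤ n := by exact_mod_cast (le_max_left _ _).trans hn
    rw [div_lt_iff₀ hδ] at hn₀
    nlinarith
  have hd := (contDiff_edge n).continuous_deriv (by norm_num)
  have hI := integral_deriv_edge ((le_max_right _ _).trans hn)
  have i1 : Integrable (fun t => deriv (edge n) t * f t) timeM := integrable_timeM (hd.continuousOn.mul hf)
  have i2 := integrable_timeM hd.continuousOn
  have e : (∫ t, deriv (edge n) t * f t ∂timeM) - f 0 = ∫ t, deriv (edge n) t * (f t - f 0) ∂timeM := by
    simp_rw [mul_sub]
    rw [integral_sub i1 (i2.mul_const _), integral_mul_const, hI, one_mul]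
  rw [dist_eq, e, ← norm_eq_abs]
  calc ‖∫ t, deriv (edge n) t * (f t - f 0) ∂timeM‖
      ≤ ∫ t, deriv (edge n) t * (η / 2) ∂timeM := by
        refine norm_integral_le_of_norm_le (i2.mul_const _) ?_
        filter_upwards [ae_timeM] with t ht
        rw [norm_mul, norm_of_nonneg (deriv_edge_nonneg n t)]
        by_cases htn : 2 < n * t
        · rw [deriv_edge_of_gt htn]; simp
        · refine mul_le_mul_of_nonneg_left ?_ (deriv_edge_nonneg n t)
          have htδ : t < δ := by
            by_contra! h
            exact htn (hnδ.trans_le (by gcongr))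
          have := hδf (Ioo_subset_Icc_self ht) (by rw [dist_eq, sub_zero, abs_of_pos ht.1]; exact htδ)
          exact this.le
    _ = η / 2 := by rw [integral_mul_const, hI, one_mul]
    _ < η := by linarith

/-- A function whose weak derivative on `(0, 1)` is `H` and which is continuous on `[0, 1]`
satisfies the fundamental theorem of calculus. -/
lemma integral_eq_sub_of_weak_deriv {f H : ℝ → ℝ} (hf : ContinuousOn f (Icc 0 1)) (hH : Integrable H timeM)
    (h : ∀ η : ℝ → ℝ, ContDiff ℝ 1 η → HasCompactSupport η → tsupport η ⊆ Ioo 0 1 →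
      ∫ t, (η t * H t + deriv η t * f t) ∂timeM = 0) :
    ∫ t, H t ∂timeM = f 1 - f 0 := by
  -- Equal to 1 in the middle and to 0 near both ends; from n = 3 on, the two transitions do not
  -- overlap.
  let η := fun n t => edge n t + edge n (1 - t) - 1
  have hη : ∀ n, ContDiff ℝ 1 (η n) := fun n =>
    ((contDiff_edge n).add ((contDiff_edge n).comp (by fun_prop))).sub contDiff_const
  have hη0 : ∀ n : ℕ, 3 ≤ n → ∀ t, t ∉ Icc (1 / (n : ℝ)) (1 - 1 / n) → η n t = 0 := by
    intro n hn t ht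
    have hn0 : (0 : ℝ) < n := by positivity
    have hn3 : (3 : ℝ) ≤ n := by exact_mod_cast hn
    rw [mem_Icc, not_and_or, not_le, not_le] at ht
    simp only [η]
    rcases ht with ht | ht
    · rw [lt_div_iff₀ hn0] at ht
      rw [edge_of_le (by linarith), edge_of_ge (by rw [mul_sub]; linarith)]
      ring
    · have : n * (1 - t) ≤ 1 := by
        have h1 : 1 - t ≤ 1 / n := by linarith
        rwa [le_div_iff₀ hn0, mul_comm] at h1
      rw [edge_of_ge (by rw [mul_sub] at this; linarith), edge_of_le this]
      ring
  have hsub : ∀ n : ℕ, 3 ≤ n → tsupport (η n) ⊆ Icc (1 / (n : ℝ)) (1 - 1 / n) := by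
    intro n hn
    refine closure_minimal (fun t ht => ?_) isClosed_Icc
    by_contra h'
    exact ht (hη0 n hn t h')
  have hd : ∀ n, Continuous (deriv (edge n)) := fun n => (contDiff_edge n).continuous_deriv (by norm_num)
  have hηd : ∀ n t, deriv (η n) t = deriv (edge n) t - deriv (edge n) (1 - t) := by
    intro n t
    have h3 := (((contDiff_edge n).differentiable (by norm_num) _).hasDerivAt).comp_const_sub 1 t
    have h4 := ((((contDiff_edge n).differentiable (by norm_num) t).hasDerivAt).add h3).sub_const 1
    refine h4.deriv.trans ?_
    ring
  have hf' : ContinuousOn (fun t => f (1 - t)) (Icc 0 1) :=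
    hf.comp (by fun_prop) fun t ht => ⟨by linarith [ht.2], by linarith [ht.1]⟩
  have e1 : ∀ n, ∫ t, deriv (edge n) (1 - t) * f t ∂timeM = ∫ t, deriv (edge n) t * f (1 - t) ∂timeM := by
    intro n
    rw [integral_timeM_eq, integral_timeM_eq]
    have h := intervalIntegral.integral_comp_sub_left (a := 0) (b := 1)
      (fun t => deriv (edge n) (1 - t) * f t) 1
    simp at h
    exact h.symm
  have key : ∀ᶠ n in atTop, ∫ t, η n t * H t ∂timeM =
    ∫ t, deriv (edge n) t * f (1 - t) ∂timeM - ∫ t, deriv (edge n) t * f t ∂timeM := by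
    filter_upwards [eventually_ge_atTop 3] with n hn
    have hn0 : (0 : ℝ) < n := by positivity
    have hc := isCompact_Icc.of_isClosed_subset (isClosed_tsupport _) (hsub n hn)
    have h1 := h (η n) (hη n) hc ((hsub n hn).trans fun t ht =>
      ⟨(by positivity : (0 : ℝ) < 1 / n).trans_le ht.1,
        ht.2.trans_lt (by linarith [(by positivity : (0 : ℝ) < 1 / n)])⟩)
    have i1 := integrable_bounded_mul (hη n).continuous hc hH
    have i2 : Integrable (fun t => deriv (edge n) t * f t) timeM :=
      integrable_timeM ((hd n).continuousOn.mul hf)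
    have i3 : Integrable (fun t => deriv (edge n) (1 - t) * f t) timeM :=
      integrable_timeM (((hd n).comp (by fun_prop)).continuousOn.mul hf)
    have i4 : Integrable (fun t => deriv (edge n) t * f t - deriv (edge n) (1 - t) * f t) timeM := i2.sub i3
    simp only [hηd, sub_mul] at h1
    rw [integral_add i1 i4, integral_sub i2 i3, e1] at h1
    linarith
  have l1 : Tendsto (fun n => ∫ t, η n t * H t ∂timeM) atTop (𝓝 (∫ t, H t ∂timeM)) := by
    refine tendsto_integral_of_dominated_convergence (fun t => 1 * ‖H t‖)
      (fun n => ((hη n).continuous.aestronglyMeasurable).mul hH.1) (hH.norm.const_mul 1) ?_ ?_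
    · intro n
      filter_upwards with t
      rw [norm_mul]
      gcongr
      have h1 := smoothTransition.nonneg (n * t - 1)
      have h2 := smoothTransition.le_one (n * t - 1)
      have h3 := smoothTransition.nonneg (n * (1 - t) - 1)
      have h4 := smoothTransition.le_one (n * (1 - t) - 1)
      rw [norm_eq_abs, abs_le]
      constructor <;> simp only [η, edge] <;> linarith
    · filter_upwards [ae_timeM] with t ht
      refine tendsto_const_nhds.congr' ?_
      have h1 := tendsto_natCast_atTop_atTop.atTop_mul_const ht.1
      have h2 := tendsto_natCast_atTop_atTop (R := ℝ).atTop_mul_const (sub_pos.2 ht.2)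
      filter_upwards [h1.eventually_ge_atTop 2, h2.eventually_ge_atTop 2] with n hn1 hn2
      simp only [η]
      rw [edge_of_ge hn1, edge_of_ge hn2]
      ring
  have l2 := (tendsto_integral_deriv_edge hf').sub (tendsto_integral_deriv_edge hf)
  rw [sub_zero] at l2
  exact tendsto_nhds_unique l1 (l2.congr' (key.mono fun n hn => hn.symm))

/-! ### Measurability in time and the action of a mollified pair. -/

instance (ν : VectorRadon d) : IsLocallyFiniteMeasure ν.variation := ν.locallyFinite

lemma VectorRadon.norm_dir_le (ν : VectorRadon d) : ∀ᵐ y ∂ν.variation, ‖ν.dir y‖ ≤ 1 :=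
  ν.norm_dir.mono fun _ h => h.le

/-- A Borel family is given by its values on bounded sets; simple functions carry measurability over
to integrals of continuous functions. -/
lemma measurable_setIntegral_simpleFunc_smul {ν : ℝ → VectorRadon d}
    (hν : ∀ B : Set (E d), MeasurableSet B → Bornology.IsBounded B →
      Measurable (fun t : Icc (0 : ℝ) 1 => (ν t).eval B)) (R : ℝ) (f : SimpleFunc (E d) ℝ) :
    Measurable fun t : Icc (0 : ℝ) 1 => ∫ y in Metric.ball 0 R, f y • (ν t).dir y ∂(ν t).variation := by
  induction f using SimpleFunc.induction with
  | const c hs =>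
    rename_i s
    have : (fun t : Icc 0 1 => ∫ y in Metric.ball 0 R,
      (SimpleFunc.piecewise s hs (SimpleFunc.const _ c) (SimpleFunc.const _ 0)) y • (ν t).dir y
        ∂(ν t).variation) = fun t : Icc (0 : ℝ) 1 => c • (ν t).eval (Metric.ball 0 R ∩ s) := by
      ext1 t
      unfold VectorRadon.eval
      rw [← integral_smul, inter_comm, ← Measure.restrict_restrict hs, ← integral_indicator hs]
      congr 1
      ext1 y
      by_cases hy : y ∈ s <;> simp [hy]
    rw [this]
    exact (hν _ (Metric.isOpen_ball.measurableSet.inter hs)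
      (Metric.isBounded_ball.subset inter_subset_left)).const_smul c
  | add hd hf hg =>
    rename_i f g
    have hi : ∀ (f : SimpleFunc (E d) ℝ) (t : Icc (0 : ℝ) 1),
      Integrable (fun y => f y • (ν t).dir y) ((ν t).variation.restrict (Metric.ball 0 R)) := by
      intro f t
      obtain ⟨C, hC⟩ := f.exists_forall_norm_le
      refine Measure.integrableOn_of_bounded (M := C) measure_ball_lt_top.ne
        (f.measurable.smul (ν t).measurable_dir).aestronglyMeasurable ?_
      filter_upwards [ae_restrict_of_ae (ν t).norm_dir] with y hy
      rw [norm_smul, hy, mul_one]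
      exact hC y
    have : (fun t : Icc (0 : ℝ) 1 => ∫ y in Metric.ball 0 R, (f + g) y • (ν t).dir y
      ∂(ν t).variation) = fun t : Icc (0 : ℝ) 1 =>
      (∫ y in Metric.ball 0 R, f y • (ν t).dir y ∂(ν t).variation) +
        ∫ y in Metric.ball 0 R, g y • (ν t).dir y ∂(ν t).variation := by
      ext1 t
      rw [← integral_add (hi f t) (hi g t)]
      congr 1
      ext1 y
      rw [SimpleFunc.coe_add, Pi.add_apply, add_smul]
    rw [this]
    exact hf.add hg

lemma measurable_integral_smul_dir {ν : ℝ → VectorRadon d}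
    (hν : ∀ B : Set (E d), MeasurableSet B → Bornology.IsBounded B →
      Measurable (fun t : Icc (0 : ℝ) 1 => (ν t).eval B)) (hf : Continuous f)
    (hfc : HasCompactSupport f) :
    Measurable fun t : Icc (0 : ℝ) 1 => ∫ y, f y • (ν t).dir y ∂(ν t).variation := by
  obtain ⟨R, hR⟩ := hfc.isBounded.subset_ball 0
  obtain ⟨C, hC⟩ := hf.bounded_above_of_compact_support hfc
  have h0 : ∀ y, y ∉ Metric.ball (0 : E d) R → f y = 0 := fun y hy => by
    by_contra h
    exact hy (hR (subset_tsupport _ h))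
  let s := hf.stronglyMeasurable.approxBounded C
  refine measurable_of_tendsto_metrizable (fun n => measurable_setIntegral_simpleFunc_smul hν R (s n)) ?_
  rw [tendsto_pi_nhds]
  intro t
  rw [← setIntegral_eq_integral_of_forall_compl_eq_zero (fun y hy => by rw [h0 y hy, zero_smul])]
  have hC0 : 0 ≤ C := (norm_nonneg _).trans (hC 0)
  have hfin : IsFiniteMeasure ((ν t).variation.restrict (Metric.ball 0 R)) :=
    ⟨by rw [Measure.restrict_apply_univ]; exact measure_ball_lt_top⟩
  refine tendsto_integral_of_dominated_convergence (fun _ => C)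
    (fun n => ((s n).measurable.smul (ν t).measurable_dir).aestronglyMeasurable)
    (integrable_const _) (fun n => ?_) (.of_forall fun y => ?_)
  · filter_upwards [ae_restrict_of_ae (ν t).norm_dir] with y hy
    rw [norm_smul, hy, mul_one]
    exact hf.stronglyMeasurable.norm_approxBounded_le hC0 n y
  · exact (hf.stronglyMeasurable.tendsto_approxBounded_of_norm_le (hC y)).smul_const _

section

variable {F : Type*} [NormedAddCommGroup F] [NormedSpace ℝ F]

lemma integral_bumpK_sub_smul (hε : 0 < ε) (f : E d → F) (x : E d) :
    ∫ y, bumpK ε (x - y) • f y = ∫ z, f (x - z) ∂bumpLaw d ε := by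
  rw [bumpLaw_eq_withDensity hε,
    integral_withDensity_eq_integral_toReal_smul (continuous_bumpK ε).measurable.ennreal_ofReal
      (.of_forall fun _ => ofReal_lt_top),
    ← integral_sub_left_eq_self (fun y => bumpK ε (x - y) • f y) volume x]
  apply integral_congr_ae
  filter_upwards with z
  rw [sub_sub_cancel, toReal_ofReal (bumpK_nonneg hε.le _)]

lemma integrable_bumpLaw_sub (hε : 0 < ε) (hf : Integrable fun y => bumpK ε (x - y) * f y) :
    Integrable (fun z => f (x - z)) (bumpLaw d ε) := by
  rw [bumpLaw_eq_withDensity hε, integrable_withDensity_iff (continuous_bumpK ε).measurable.ennreal_ofReal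
      (.of_forall fun _ => ofReal_lt_top)]
  have := hf.comp_sub_left x
  refine this.congr (.of_forall fun z => ?_)
  simp only
  rw [sub_sub_cancel, toReal_ofReal (bumpK_nonneg hε.le _), mul_comm]

/-- The singular part of μ only adds to the mollified density, which lowers the action as m is
monotone. For the absolutely continuous parts it is Jensen's inequality and translation invariance.
-/
lemma lintegral_actE_blur_le (hm : IsMobility m) (hε : 0 < ε) (μ : Measure (E d))
    [IsLocallyFiniteMeasure μ] (ν : VectorRadon d) :
    ∫⁻ x, actE m (blur ε μ (fun _ => (1 : ℝ)) x) (blur ε ν.variation ν.dir x) ≤ action m μ ν := by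
  unfold action
  split_ifs with h
  swap
  · exact le_top
  set s : E d → ℝ := fun x => (μ.rnDeriv volume x).toReal
  have hϱ : Measurable ν.density := (Measure.measurable_rnDeriv _ _).ennreal_toReal.smul ν.measurable_dir
  have e1 : ∀ x, blur ε ν.variation ν.dir x = ∫ z, ν.density (x - z) ∂bumpLaw d ε := by
    intro x
    rw [← integral_bumpK_sub_smul hε]
    unfold blur
    conv_lhs => rw [← (Measure.withDensity_rnDeriv_eq _ _ h)]
    rw [integral_withDensity_eq_integral_toReal_smul (Measure.measurable_rnDeriv _ _)
      (Measure.rnDeriv_lt_top _ _)]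
    apply integral_congr_ae
    filter_upwards with y
    rw [VectorRadon.density, smul_comm]
  have e2 : ∀ x, Integrable (fun z => s (x - z)) (bumpLaw d ε) ∧
    ∫ z, s (x - z) ∂bumpLaw d ε ≤ blur ε μ (fun _ => (1 : ℝ)) x := by
    intro x
    have hle := Measure.withDensity_rnDeriv_le μ (volume : Measure (E d))
    have i1 : Integrable (fun y => bumpK ε (x - y) • (1 : ℝ)) μ :=
      integrable_bumpK_smul hε aestronglyMeasurable_const (by simp) x
    have i2 := i1.mono_measure hle
    rw [integrable_withDensity_iff (Measure.measurable_rnDeriv _ _) (Measure.rnDeriv_lt_top _ _)] at i2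
    refine ⟨integrable_bumpLaw_sub hε (by simpa using i2), ?_⟩
    rw [← integral_bumpK_sub_smul hε]
    have h3 := integral_mono_measure hle (.of_forall fun y => by simpa using bumpK_nonneg hε.le (x - y)) i1
    unfold blur
    refine Eq.trans_le ?_ h3
    rw [integral_withDensity_eq_integral_toReal_smul (Measure.measurable_rnDeriv _ _)
      (Measure.rnDeriv_lt_top _ _)]
    apply integral_congr_ae
    filter_upwards with y
    ring
  calc ∫⁻ x, actE m (blur ε μ (fun _ => (1 : ℝ)) x) (blur ε ν.variation ν.dir x)
      ≤ ∫⁻ x, ∫⁻ z, actE m (s (x - z)) (ν.density (x - z)) ∂bumpLaw d ε := by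
        refine lintegral_mono fun x => ?_
        rw [e1 x]
        refine (hm.actE_anti (e2 x).2 _).trans ?_
        exact hm.jensen _ (e2 x).1 (fun z => ENNReal.toReal_nonneg)
          (hϱ.comp (by fun_prop : Measurable fun z => x - z)).aemeasurable
    _ = ∫⁻ z, (∫⁻ x, actE m (s (x - z)) (ν.density (x - z))) ∂bumpLaw d ε := by
      refine lintegral_lintegral_swap ?_
      exact ((hm.measurable_actE ((Measure.measurable_rnDeriv _ _).ennreal_toReal) hϱ).comp
        (by fun_prop : Measurable fun p : E d × E d => p.1 - p.2)).aemeasurable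
    _ = ∫⁻ x, actE m (s x) (ν.density x) := by
      have h4 : ∀ z, ∫⁻ x, actE m (s (x - z)) (ν.density (x - z)) =
        ∫⁻ x, actE m (s x) (ν.density x) := fun z =>
        lintegral_sub_right_eq_self (fun x => actE m (s x) (ν.density x)) z
      exact (lintegral_congr h4).trans (by simp)

end

lemma integral_bumpK_mul_eq_shift (hε : 0 < ε) (y : E d) (hf : Continuous f) :
    ∫ x, bumpK ε (x - y) * f x = ∫ z, f (y + z) ∂bumpLaw d ε := by
  rw [integral_bumpK_mul hε y f hf, integral_bumpLaw_eq ε (by fun_prop)]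

lemma contDiff_slice (hφ : ContDiff ℝ 1 φ) (t : ℝ) : ContDiff ℝ 1 fun y => φ (y, t) := hφ.comp (by fun_prop)

lemma continuous_gradient_slice (hφ : ContDiff ℝ 1 φ) (t : ℝ) :
    Continuous fun x => gradient (fun y => φ (y, t)) x := by
  exact (InnerProductSpace.toDual ℝ (E d)).symm.continuous.comp
    ((contDiff_slice hφ t).continuous_fderiv (by norm_num))

lemma hasCompactSupport_gradient_slice (hc : HasCompactSupport φ) (t : ℝ) :
    HasCompactSupport fun x => gradient (fun y => φ (y, t)) x := by
  exact ((hasCompactSupport_slice hc t).fderiv ℝ).comp_left (map_zero _)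

lemma inner_gradient_slice (hφ : ContDiff ℝ 1 φ) (x v : E d) (t : ℝ) :
    inner ℝ (gradient (fun y => φ (y, t)) x) v = fderiv ℝ φ (x, t) (v, 0) := by
  rw [fderiv_apply_eq hφ, mul_zero, zero_add]

lemma deriv_slice (hφ : ContDiff ℝ 1 φ) (x : E d) (t : ℝ) :
    deriv (fun r => φ (x, r)) t = fderiv ℝ φ (x, t) (0, 1) := by
  rw [fderiv_apply_eq hφ, inner_zero_right, add_zero, mul_one]

lemma continuous_fderiv_apply_slice (hφ : ContDiff ℝ 1 φ) (v : E d) (r t : ℝ) :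
    Continuous fun x => fderiv ℝ φ (x, t) (v, r) := by
  have hcont := hφ.continuous_fderiv one_ne_zero
  exact (hcont.comp (by fun_prop : Continuous fun x => (x, t))).clm_apply continuous_const

lemma hasCompactSupport_fderiv_apply_slice (hc : HasCompactSupport φ) (v : E d) (r t : ℝ) :
    HasCompactSupport fun x => fderiv ℝ φ (x, t) (v, r) := by
  refine HasCompactSupport.of_support_subset_isCompact
    ((hc.fderiv ℝ).isCompact.image continuous_fst) fun y hy => ⟨(y, t), subset_tsupport _ ?_, rfl⟩
  rw [Function.mem_support] at hy ⊢
  exact fun h => hy (by rw [h]; rfl)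

lemma deriv_avg_slice (hε : 0 < ε) (hφ : ContDiff ℝ 1 φ) (hc : HasCompactSupport φ) (y : E d)
    (t : ℝ) : deriv (fun r => avg (bumpLaw d ε) φ (y, r)) t =
      ∫ x, bumpK ε (x - y) • deriv (fun r => φ (x, r)) t := by
  rw [deriv_slice (contDiff_avg hφ hc), fderiv_avg hφ hc]
  simp only [deriv_slice hφ, smul_eq_mul]
  rw [integral_bumpK_mul_eq_shift hε y (continuous_fderiv_apply_slice hφ 0 1 t)]

lemma gradient_avg_slice (hε : 0 < ε) (hφ : ContDiff ℝ 1 φ) (hc : HasCompactSupport φ) (y : E d)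
    (t : ℝ) : gradient (fun z => avg (bumpLaw d ε) φ (z, t)) y =
      ∫ x, bumpK ε (x - y) • gradient (fun z => φ (z, t)) x := by
  refine ext_inner_right ℝ fun v => ?_
  have hi : Integrable fun x => bumpK ε (x - y) • gradient (fun z => φ (z, t)) x := by
    have h1 : Continuous fun x => bumpK ε (x - y) := (continuous_bumpK ε).comp (by fun_prop)
    have h2 := (hasCompactSupport_bumpK hε).comp_homeomorph (Homeomorph.subRight y)
    exact (h1.smul (continuous_gradient_slice hφ t)).integrable_of_hasCompactSupport h2.smul_right
  rw [inner_gradient_slice (contDiff_avg hφ hc), fderiv_avg hφ hc, real_inner_comm, ← integral_inner hi]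
  simp only [inner_smul_right]
  simp only [real_inner_comm _ v, inner_gradient_slice hφ]
  rw [integral_bumpK_mul_eq_shift hε y (continuous_fderiv_apply_slice hφ v 0 t)]

/-! ### The flow obtained by mollifying a continuity path. -/

section

variable {μ : ℝ → Measure (E d)} {ν : ℝ → VectorRadon d}

/-- The density of the mollified path. -/
def pathDensity (ε : ℝ) (μ : ℝ → Measure (E d)) (p : Q d) : ℝ :=
  (Icc (0 : ℝ) 1).indicator (fun t => blur ε (μ t) (fun _ => (1 : ℝ)) p.1) p.2

/-- The flux of the mollified path. -/
def pathFlux (ε : ℝ) (ν : ℝ → VectorRadon d) (p : Q d) : E d :=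
  (Icc (0 : ℝ) 1).indicator (fun t => blur ε (ν t).variation (ν t).dir p.1) p.2

lemma measurable_indicator_of_restrict {F : Type*} [MeasurableSpace F] [Zero F] {s : Set ℝ}
    (hs : MeasurableSet s) {f : ℝ → F} (hf : Measurable fun t : s => f t) :
    Measurable (s.indicator f) := by
  refine measurable_of_restrict_of_restrict_compl hs ?_ ?_
  · convert hf using 1
    ext t
    simp
  · convert measurable_const (a := (0 : F)) using 1
    ext t
    simpa using fun h => absurd h t.2

lemma IsContinuityPath.continuousOn_blur (hP : IsContinuityPath γ₀ γ₁ μ ν) (hε : 0 < ε)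
    (x : E d) : ContinuousOn (fun t => blur ε (μ t) (fun _ => (1 : ℝ)) x) (Icc 0 1) := by
  have := hP.weakStar_continuous (fun y => bumpK ε (x - y)) (by have := continuous_bumpK (d := d) ε; fun_prop)
    ((hasCompactSupport_bumpK hε).comp_homeomorph (Homeomorph.subLeft x))
  simpa [blur] using this

/-- Joint measurability from continuity in x and measurability in t. -/
lemma IsContinuityPath.measurable_pathDensity (hP : IsContinuityPath γ₀ γ₁ μ ν) (hε : 0 < ε) :
    Measurable (pathDensity ε μ) := by
  refine measurable_uncurry_of_continuous_of_measurable (u := fun (x : E d) t =>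
    (Icc 0 1).indicator (fun t => blur ε (μ t) (fun _ => 1) x) t) ?_ ?_
  · intro t
    by_cases ht : t ∈ Icc 0 1
    · have := hP.locallyFinite t ht
      simp only [indicator_of_mem ht]
      exact continuous_blur hε aestronglyMeasurable_const (by simp)
    · simp only [indicator_of_notMem ht]
      exact continuous_const
  · intro x
    exact measurable_indicator_of_restrict measurableSet_Icc
      (continuousOn_iff_continuous_domRestrict.1 (hP.continuousOn_blur hε x)).measurable

lemma IsContinuityPath.measurable_pathFlux (hP : IsContinuityPath γ₀ γ₁ μ ν) (hε : 0 < ε) :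
    Measurable (pathFlux ε ν) := by
  refine measurable_uncurry_of_continuous_of_measurable (u := fun (x : E d) t =>
    (Icc 0 1).indicator (fun t => blur ε (ν t).variation (ν t).dir x) t) ?_ ?_
  · intro t
    by_cases ht : t ∈ Icc 0 1
    · simp only [indicator_of_mem ht]
      exact continuous_blur hε (ν t).measurable_dir.aestronglyMeasurable (ν t).norm_dir_le
    · simp only [indicator_of_notMem ht]
      exact continuous_const
  · intro x
    exact measurable_indicator_of_restrict measurableSet_Icc (measurable_integral_smul_dir hP.borel_family
        (by have := continuous_bumpK (d := d) ε; fun_prop)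
        ((hasCompactSupport_bumpK hε).comp_homeomorph (Homeomorph.subLeft x)))

lemma pathDensity_nonneg (hε : 0 < ε) (p : Q d) : 0 ≤ pathDensity ε μ p :=
  indicator_nonneg (fun t _ => integral_nonneg fun y => by simpa using bumpK_nonneg hε.le (p.1 - y)) _

/-- By weak* continuity the integrals of a cutoff are bounded on [0,1], so balls have uniformly
bounded mass even if the total mass is infinite. This local bound is what the truncation of the flow
requires. -/
lemma IsContinuityPath.exists_pathDensity_le (hP : IsContinuityPath γ₀ γ₁ μ ν) (hε : 0 < ε)
    (R : ℝ) : ∃ C, 0 ≤ C ∧ ∀ p ∈ cyl d R, pathDensity ε μ p ≤ C := by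
  obtain ⟨χ, hχ1, -, hχc, hχ01⟩ := exists_continuous_one_zero_of_isCompact
    (isCompact_closedBall (0 : E d) (R + ε)) isClosed_empty (disjoint_empty _)
  obtain ⟨B, hB⟩ := isCompact_Icc.exists_bound_of_continuousOn (hP.weakStar_continuous χ χ.continuous hχc)
  have hB0 := (norm_nonneg _).trans (hB 0 (by simp))
  have hK0 : 0 ≤ (ε ^ d)⁻¹ * bumpMax d := mul_nonneg (by positivity) bumpMax_pos.le
  refine ⟨(ε ^ d)⁻¹ * bumpMax d * B, by positivity, fun p hp => ?_⟩
  unfold pathDensity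
  by_cases ht : p.2 ∈ Icc (0 : ℝ) 1
  · have := hP.locallyFinite _ ht
    rw [indicator_of_mem ht]
    calc blur ε (μ p.2) (fun _ => (1 : ℝ)) p.1 ≤ ∫ y, (ε ^ d)⁻¹ * bumpMax d * χ y ∂(μ p.2) := by
          refine integral_mono (integrable_bumpK_smul hε aestronglyMeasurable_const (by simp) _)
            ((χ.continuous.integrable_of_hasCompactSupport hχc).const_mul _) fun y => ?_
          simp
          by_cases hy : y ∈ Metric.ball (0 : E d) (R + ε)
          · have h1 : χ y = 1 := hχ1 (Metric.ball_subset_closedBall hy)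
            rw [h1, mul_one]
            exact bumpK_le hε _
          · rw [bumpK_sub_eq_zero hε hp.1 hy]
            exact mul_nonneg hK0 (hχ01 y).1
      _ = (ε ^ d)⁻¹ * bumpMax d * ∫ y, χ y ∂(μ p.2) := integral_const_mul _ _
      _ ≤ _ := by
        gcongr
        exact (le_abs_self _).trans (hB _ ht)
  · rw [indicator_of_notMem ht]
    positivity

lemma IsContinuityPath.integrableOn_pathDensity (hP : IsContinuityPath γ₀ γ₁ μ ν) (hε : 0 < ε)
    (R : ℝ) : IntegrableOn (pathDensity ε μ) (cyl d R) (slab d) := by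
  obtain ⟨C, hC0, hC⟩ := hP.exists_pathDensity_le hε R
  refine Measure.integrableOn_of_bounded (M := C) (slab_cyl_lt_top R).ne
    (hP.measurable_pathDensity hε).aestronglyMeasurable ?_
  filter_upwards [ae_restrict_mem (measurableSet_cyl R)] with p hp
  rw [norm_of_nonneg (pathDensity_nonneg hε p)]
  exact hC p hp

lemma IsContinuityPath.integrableOn_pathFlux (hP : IsContinuityPath γ₀ γ₁ μ ν) (hε : 0 < ε)
    (R : ℝ) : IntegrableOn (pathFlux ε ν) (cyl d R) (slab d) := by
  have hm := hP.measurable_pathFlux hε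
  refine ⟨hm.aestronglyMeasurable, ?_⟩
  unfold HasFiniteIntegral
  set c := ofReal ((ε ^ d)⁻¹ * bumpMax d)
  have hK0 : 0 ≤ (ε ^ d)⁻¹ * bumpMax d := mul_nonneg (by positivity) bumpMax_pos.le
  set r := max (R + ε) 1
  rw [← lintegral_indicator (measurableSet_cyl R), lintegral_slab (hm.enorm.indicator (measurableSet_cyl R))]
  calc ∫⁻ t, (∫⁻ x, (cyl d R).indicator (fun p => ‖pathFlux ε ν p‖ₑ) (x, t)) ∂timeM
      ≤ ∫⁻ t, (c * volume (Metric.ball (0 : E d) R)) * (ν t).variation (Metric.ball 0 r) ∂timeM := by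
        refine lintegral_mono fun t => ?_
        calc ∫⁻ x, (cyl d R).indicator (fun p => ‖pathFlux ε ν p‖ₑ) (x, t)
            ≤ ∫⁻ x, (Metric.ball (0 : E d) R).indicator
              (fun _ => c * (ν t).variation (Metric.ball 0 r)) x := by
              refine lintegral_mono fun x => ?_
              by_cases hx : x ∈ Metric.ball (0 : E d) R
              · rw [indicator_of_mem (show (x, t) ∈ cyl d R from ⟨hx, mem_univ _⟩), indicator_of_mem hx]
                refine (enorm_indicator_le_enorm_self _ _).trans ?_
                rw [← ofReal_norm]
                refine (ofReal_le_ofReal (norm_blur_le hε (ν t).norm_dir_le hx)).trans ?_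
                rw [ofReal_mul hK0, Measure.real, ENNReal.ofReal_toReal measure_ball_lt_top.ne]
                gcongr
                exact le_max_left _ _
              · rw [indicator_of_notMem (fun h : (x, t) ∈ cyl d R => hx h.1), indicator_of_notMem hx]
          _ = _ := by
            rw [lintegral_indicator Metric.isOpen_ball.measurableSet, setLIntegral_const]
            ring
    _ = (c * volume (Metric.ball (0 : E d) R)) * ∫⁻ t, (ν t).variation (Metric.ball 0 r) ∂timeM :=
      lintegral_const_mul' _ _ (mul_ne_top ofReal_ne_top measure_ball_lt_top.ne)
    _ < ⊤ := mul_lt_top (mul_lt_top ofReal_lt_top measure_ball_lt_top)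
      (hP.flux_finite r (by positivity))

lemma IsContinuityPath.integral_deriv_mul_pathDensity (hP : IsContinuityPath γ₀ γ₁ μ ν)
    (hε : 0 < ε) {A : E d → ℝ} (hA : Continuous A) (hAc : HasCompactSupport A)
    (ht : t ∈ Icc (0 : ℝ) 1) :
    ∫ x, A x * pathDensity ε μ (x, t) = ∫ y, (∫ x, bumpK ε (x - y) • A x) ∂(μ t) := by
  have := hP.locallyFinite t ht
  have h := integral_inner_blur (μ := μ t) hε (stronglyMeasurable_const (b := 1)) (by simp) hA hAc
  simp only [pathDensity, indicator_of_mem ht]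
  simpa [mul_comm] using h

lemma integral_inner_pathFlux (hε : 0 < ε) {A : E d → E d} (hA : Continuous A)
    (hAc : HasCompactSupport A) (ht : t ∈ Icc (0 : ℝ) 1) :
    ∫ x, inner ℝ (A x) (pathFlux ε ν (x, t)) = (ν t).pairing fun y => ∫ x, bumpK ε (x - y) • A x := by
  have h := integral_inner_blur hε (ν t).measurable_dir.stronglyMeasurable (ν t).norm_dir_le hA hAc
  simp only [pathFlux, indicator_of_mem ht]
  exact h

end

section

variable {μ : ℝ → Measure (E d)} {ν : ℝ → VectorRadon d}

lemma IsTestFunction.avg (hφ : IsTestFunction φ) (hε : 0 < ε) : IsTestFunction (avg (bumpLaw d ε) φ) where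
  contDiff := contDiff_avg hφ.contDiff hφ.hasCompactSupport
  hasCompactSupport := hasCompactSupport_avg hφ.hasCompactSupport (ae_bumpLaw_norm_le hε.le)
  tsupport_subset := by
    have hK := hφ.hasCompactSupport.isCompact.image continuous_snd
    have hsub : Prod.snd '' tsupport φ ⊆ Ioo 0 1 := by
      rintro _ ⟨p, hp, rfl⟩
      exact (hφ.tsupport_subset hp).2
    refine (closure_minimal (fun p hp => ?_) (isClosed_univ.prod hK.isClosed)).trans (prod_mono le_rfl hsub)
    refine ⟨mem_univ _, ?_⟩
    by_contra h
    apply hp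
    apply integral_eq_zero_of_ae
    filter_upwards with z
    by_contra h1
    exact h ⟨_, subset_tsupport _ h1, rfl⟩

/-- The averaged test function is again a test function vanishing near times 0 and 1, and the
mollification is adjoint to the average. -/
lemma IsContinuityPath.integral_fderiv_eq_zero (hP : IsContinuityPath γ₀ γ₁ μ ν) (hε : 0 < ε)
    (hψ : IsTestFunction ψ) :
    ∫ p, fderiv ℝ ψ p (pathFlux ε ν p, pathDensity ε μ p) ∂slab d = 0 := by
  have hσm := hP.measurable_pathDensity hε
  have hwm := hP.measurable_pathFlux hε
  have hσ := hP.integrableOn_pathDensity hε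
  have hw := hP.integrableOn_pathFlux hε
  have hφ := hψ.contDiff
  have hc := hψ.hasCompactSupport
  have i1 := integrable_fderiv_apply hσm measurable_const hσ (fun R => integrableOn_zero) hφ hc
  have i2 := integrable_fderiv_apply measurable_const hwm (fun R => integrableOn_zero) hw hφ hc
  have e0 : ∀ p, fderiv ℝ ψ p (pathFlux ε ν p, pathDensity ε μ p) =
    fderiv ℝ ψ p (0, pathDensity ε μ p) + fderiv ℝ ψ p (pathFlux ε ν p, 0) := by
    intro p
    rw [← map_add]
    simp
  simp_rw [e0]
  rw [integral_add i1 i2]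
  refine Eq.trans ?_ (hP.continuity_eq _ (hψ.avg hε))
  congr 1
  · unfold slab at i1 ⊢
    rw [integral_prod_symm _ i1]
    refine setIntegral_congr_fun measurableSet_Icc fun t ht => ?_
    simp only [deriv_avg_slice hε hφ hc]
    rw [← hP.integral_deriv_mul_pathDensity hε ?_ ?_ ht]
    · apply integral_congr_ae
      filter_upwards with x
      rw [fderiv_apply_eq hφ, inner_zero_right, add_zero]
    · simp only [deriv_slice hφ]
      exact continuous_fderiv_apply_slice hφ 0 1 t
    · simp only [deriv_slice hφ]
      exact hasCompactSupport_fderiv_apply_slice hc 0 1 t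
  · unfold slab at i2 ⊢
    rw [integral_prod_symm _ i2]
    refine setIntegral_congr_fun measurableSet_Icc fun t ht => ?_
    simp only [gradient_avg_slice hε hφ hc]
    rw [← integral_inner_pathFlux hε (continuous_gradient_slice hφ t)
      (hasCompactSupport_gradient_slice hc t) ht]
    apply integral_congr_ae
    filter_upwards with x
    rw [fderiv_apply_eq hφ, mul_zero, zero_add]

lemma isTestFunction_time_mul (hψ : ContDiff ℝ 1 ψ) (hc : HasCompactSupport ψ)
    {η : ℝ → ℝ} (hη : ContDiff ℝ 1 η) (hηs : tsupport η ⊆ Ioo 0 1) :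
    IsTestFunction fun p : Q d => η p.2 * ψ p where
  contDiff := (hη.comp contDiff_snd).mul hψ
  hasCompactSupport := hc.mul_left
  tsupport_subset := by
    refine (closure_minimal (fun p hp => ?_)
      (isClosed_univ.prod (isClosed_tsupport _))).trans (prod_mono le_rfl hηs)
    exact ⟨mem_univ _, subset_tsupport _ (left_ne_zero_of_mul hp)⟩

lemma fderiv_time_mul (hψ : ContDiff ℝ 1 ψ) {η : ℝ → ℝ} (hη : ContDiff ℝ 1 η)
    (p : Q d) (v : E d) (r : ℝ) : fderiv ℝ (fun p : Q d => η p.2 * ψ p) p (v, r) =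
      η p.2 * fderiv ℝ ψ p (v, r) + deriv η p.2 * (ψ p * r) := by
  have h1 := (hψ.differentiable (by norm_num) p).hasFDerivAt
  have h2 := (hη.differentiable (by norm_num) p.2).hasDerivAt.comp_hasFDerivAt p (hasFDerivAt_snd (𝕜 := ℝ))
  have h3 : HasFDerivAt (fun p => η p.2 * ψ p) _ p := h2.mul h1
  rw [h3.fderiv]
  simp
  ring

lemma IsContinuityPath.continuousOn_integral_mul_pathDensity
    (hP : IsContinuityPath γ₀ γ₁ μ ν) (hε : 0 < ε) (hψ : Continuous ψ)
    (hc : HasCompactSupport ψ) :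
    ContinuousOn (fun t => ∫ x, ψ (x, t) * pathDensity ε μ (x, t)) (Icc 0 1) := by
  obtain ⟨R, hR, h0⟩ := exists_cyl hc
  obtain ⟨C, hC⟩ := hψ.bounded_above_of_compact_support hc
  obtain ⟨B, hB0, hB⟩ := hP.exists_pathDensity_le hε R
  refine continuousOn_of_dominated (bound := (Metric.ball 0 R).indicator fun _ => C * B)
    (fun t _ => ?_) (fun t _ => .of_forall fun x => ?_) ?_
    (.of_forall fun x => ?_)
  · have h2 : Measurable fun x => pathDensity ε μ (x, t) :=
      (hP.measurable_pathDensity hε).comp (measurable_id.prodMk measurable_const)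
    exact (((hψ.comp (by fun_prop)).measurable).mul h2).aestronglyMeasurable
  · by_cases hx : x ∈ Metric.ball 0 R
    · rw [indicator_of_mem hx, norm_mul, norm_of_nonneg (pathDensity_nonneg hε _)]
      exact mul_le_mul (hC _) (hB _ ⟨hx, mem_univ _⟩) (pathDensity_nonneg hε _) ((norm_nonneg _).trans (hC 0))
    · rw [indicator_of_notMem hx, h0 (x, t) fun h => hx h.1]
      simp
  · rw [integrable_indicator_iff Metric.isOpen_ball.measurableSet]
    exact integrableOn_const measure_ball_lt_top.ne
  · refine (hψ.comp (by fun_prop : Continuous fun t => (x, t))).continuousOn.mul ?_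
    refine (hP.continuousOn_blur hε x).congr fun t ht => ?_
    simp [pathDensity, ht]

lemma IsContinuityPath.integral_mul_pathDensity_eq (hP : IsContinuityPath γ₀ γ₁ μ ν)
    (hε : 0 < ε) (hψ : ContDiff ℝ 1 ψ) (hc : HasCompactSupport ψ)
    (ht : t ∈ Icc (0 : ℝ) 1) [IsFiniteMeasure (μ t)] :
    ∫ x, ψ (x, t) * pathDensity ε μ (x, t) = ∫ x, ψ (x, t) ∂(mollify ε (μ t)) := by
  rw [hP.integral_deriv_mul_pathDensity hε (A := fun x => ψ (x, t)) (hψ.continuous.comp (by fun_prop))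
    (hasCompactSupport_slice hc t) ht, ← integral_avg_eq hψ hc t]
  congr 1
  ext1 y
  exact integral_bumpK_mul_eq_shift hε y (hψ.continuous.comp (by fun_prop))

/-- No mass bound is available, hence ⊤. The equation of the path is tested only with functions
vanishing near the end times; the end measures are recovered from the continuity in time of the
pairing, by `integral_eq_sub_of_weak_deriv`. -/
lemma IsContinuityPath.isFlow [IsFiniteMeasure γ₀] [IsFiniteMeasure γ₁]
    (hP : IsContinuityPath γ₀ γ₁ μ ν) (hε : 0 < ε) :
    IsFlow ⊤ (mollify ε γ₀) (mollify ε γ₁) (pathDensity ε μ) (pathFlux ε ν) where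
  meas_density := hP.measurable_pathDensity hε
  meas_flux := hP.measurable_pathFlux hε
  density_nonneg := pathDensity_nonneg hε
  mass_le := .of_forall fun _ => le_top
  int_density := hP.integrableOn_pathDensity hε
  int_flux := hP.integrableOn_pathFlux hε
  continuity_eq ψ hψ hc := by
    set σ := pathDensity ε μ
    have hσm := hP.measurable_pathDensity hε
    have iD := integrable_fderiv_apply hσm (hP.measurable_pathFlux hε) (hP.integrableOn_pathDensity hε)
      (hP.integrableOn_pathFlux hε) hψ hc
    have iS : Integrable (fun p => ψ p * σ p) (slab d) := by
      obtain ⟨R, hR, h0⟩ := exists_cyl hc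
      obtain ⟨C, hC⟩ := hψ.continuous.bounded_above_of_compact_support hc
      refine integrable_of_cyl (R := R) (C := C) (hP.integrableOn_pathDensity hε R).norm
        (hψ.continuous.measurable.mul hσm).aestronglyMeasurable (fun p => ?_) fun p hp => ?_
      · rw [norm_mul]
        gcongr
        exact hC p
      · rw [h0 p hp, zero_mul]
    have hf := hP.continuousOn_integral_mul_pathDensity hε hψ.continuous hc
    have key := integral_eq_sub_of_weak_deriv hf iD.integral_prod_right fun η hη hηc hηs => ?_
    · have f0 : IsFiniteMeasure (μ 0) := by rw [hP.init]; infer_instance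
      have f1 : IsFiniteMeasure (μ 1) := by rw [hP.final]; infer_instance
      have e1 := hP.integral_mul_pathDensity_eq hε hψ hc (t := 1) (by simp)
      have e0 := hP.integral_mul_pathDensity_eq hε hψ hc (t := 0) (by simp)
      rw [e1, e0, hP.init, hP.final] at key
      rw [← key]
      unfold slab at iD ⊢
      rw [integral_prod_symm _ iD]
    · have iZ := integrable_fderiv_apply hσm (hP.measurable_pathFlux hε) (hP.integrableOn_pathDensity hε)
        (hP.integrableOn_pathFlux hε) (isTestFunction_time_mul hψ hc hη hηs).contDiff
        (isTestFunction_time_mul hψ hc hη hηs).hasCompactSupport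
      rw [← (hP.integral_fderiv_eq_zero hε (isTestFunction_time_mul hψ hc hη hηs))]
      unfold slab at iZ iD iS ⊢
      rw [integral_prod_symm _ iZ]
      apply integral_congr_ae
      filter_upwards [iD.prod_left_ae, iS.prod_left_ae] with t ht1 ht2
      simp only [fderiv_time_mul hψ hη]
      rw [integral_add (ht1.const_mul _) (ht2.const_mul _), integral_const_mul, integral_const_mul]

lemma IsContinuityPath.flowAction_le (hm : IsMobility m) (hP : IsContinuityPath γ₀ γ₁ μ ν) (hε : 0 < ε) :
    flowAction m (pathDensity ε μ) (pathFlux ε ν) ≤ ∫⁻ t in Icc (0 : ℝ) 1, action m (μ t) (ν t) := by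
  unfold flowAction
  rw [lintegral_slab (hm.measurable_actE (hP.measurable_pathDensity hε) (hP.measurable_pathFlux hε))]
  unfold timeM
  refine setLIntegral_mono' measurableSet_Icc fun t ht => ?_
  have := hP.locallyFinite t ht
  refine le_trans (le_of_eq ?_) (lintegral_actE_blur_le hm hε (μ t) (ν t))
  simp [pathDensity, pathFlux, ht]

end

/-! ### The relaxed minimization problem over subprobability measures. -/

section

/-- The data of a minimization problem `γ ↦ a W² (γ, ref) + b ‖γ‖²`. -/
structure Problem (d : ℕ) where
  m : ℝ → ℝ
  q : ℝ
  a : ℝ≥0∞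
  b : ℝ≥0∞
  ref : Measure (E d)
  mobility : IsMobility m
  one_lt : 1 < q
  a_ne_zero : a ≠ 0
  a_ne_top : a ≠ ⊤
  b_ne_zero : b ≠ 0
  b_ne_top : b ≠ ⊤
  isProb : IsProbabilityMeasure ref
  energy_lt : energy q ref < ⊤

lemma mid_univ_le (h : γ univ ≤ 1) (h' : γ' univ ≤ 1) : mid γ γ' univ ≤ 1 := by
  calc 2⁻¹ * (γ univ + γ' univ) ≤ 2⁻¹ * (1 + 1) := by gcongr
    _ = 1 := by rw [one_add_one_eq_two]; exact ENNReal.inv_mul_cancel (by simp) (by simp)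

lemma tendsto_inv_add_one : Tendsto (fun n : ℕ => ((n : ℝ≥0∞) + 1)⁻¹) atTop (𝓝 0) :=
  (ENNReal.tendsto_inv_nat_nhds_zero.comp (tendsto_add_atTop_nat 1)).congr fun n => by simp

namespace Problem

variable (P : Problem d)

instance : IsProbabilityMeasure P.ref := P.isProb

lemma q_pos : 0 < P.q := one_pos.trans P.one_lt

/-- The functional, at the level of flows. -/
def total (γ : Measure (E d)) : ℝ≥0∞ := P.a * flowCost P.m 1 γ P.ref + P.b * energy P.q γ

/-- The infimum of the functional over subprobability measures. -/
def value : ℝ≥0∞ := ⨅ (γ : Measure (E d)) (_ : γ univ ≤ 1), P.total γ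

lemma value_le (h : γ univ ≤ 1) : P.value ≤ P.total γ := iInf₂_le γ h

variable {P}

/-- Go to the mollification of ρ in time 1 - x, and from there to ρ in time x. The mollification
radius is chosen so that the second piece has action of order x², which costs order x after
rescaling time. -/
lemma flowCost_bridge {ρ : Measure (E d)} [IsFiniteMeasure ρ] (hρ : ρ univ ≤ 1) {x : ℝ}
    (hx : 0 < x) (hx1 : x < 1) :
    flowCost P.m 1 u ρ ≤ ofReal (1 - x)⁻¹ * flowCost P.m 1 u (mollify ((x ^ 2) ^ (P.q / 2)) ρ) +
      ofReal (connectConst d P.m P.q) * ofReal x * energy P.q ρ := by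
  have hcon := flowCost_mollify_le P.mobility P.q_pos (by positivity : 0 < x ^ 2) ρ hρ
  rw [flowCost_comm P.mobility] at hcon
  refine (flowCost_concat_le (γ₁ := mollify ((x ^ 2) ^ (P.q / 2)) ρ) P.mobility (κ := 1 - x)
    (by linarith) (by linarith)).trans ?_
  rw [sub_sub_cancel]
  refine add_le_add le_rfl ?_
  have hmul : ofReal x⁻¹ * ofReal (x ^ 2) = ofReal x := by
    rw [← ofReal_mul (by positivity)]
    congr 1
    field_simp
  set C := ofReal (connectConst d P.m P.q)
  calc ofReal x⁻¹ * flowCost P.m 1 (mollify ((x ^ 2) ^ (P.q / 2)) ρ) ρ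
      ≤ ofReal x⁻¹ * (C * ofReal (x ^ 2) * energy P.q ρ) := by gcongr
    _ = C * (ofReal x⁻¹ * ofReal (x ^ 2)) * energy P.q ρ := by ring
    _ = _ := by rw [hmul]

/-- A mollified flow with locally bounded density that starts at a mollification of `u` yields
competitors below a mollification of `u`. -/
lemma exists_competitor [IsFiniteMeasure u] (hA : A ≠ ⊤)
    (h : ∀ ε : ℝ, 0 < ε → ∃ N σ w, IsFlow N (mollify ε u) (mollify ε P.ref) σ w ∧
      (∀ R, ∃ C, ∀ᵐ p ∂((slab d).restrict (cyl d R)), σ p ≤ C) ∧ flowAction P.m σ w ≤ A)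
    (hB : P.a * A + P.b * energy P.q u < B) {ε₀ : ℝ} (hε₀ : 0 < ε₀) :
    ∃ ε ∈ Ioo 0 ε₀, ∃ u' ≤ mollify ε u, P.total u' < B := by
  have hq := P.q_pos
  set C := ofReal (connectConst d P.m P.q)
  have hlim : Tendsto (fun x => P.a * (ofReal (1 - x)⁻¹ * A +
    C * ofReal x * energy P.q P.ref) + P.b * energy P.q u) (𝓝[>] 0)
    (𝓝 (P.a * (ofReal (1 - 0)⁻¹ * A + C * ofReal 0 * energy P.q P.ref) + P.b * energy P.q u)) := by
    refine Tendsto.add (ENNReal.Tendsto.const_mul (Tendsto.add ?_ ?_) (Or.inr P.a_ne_top)) tendsto_const_nhds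
    · refine ENNReal.Tendsto.mul_const ?_ (Or.inr hA)
      refine (continuous_ofReal.tendsto _).comp ?_
      refine Tendsto.mono_left ?_ nhdsWithin_le_nhds
      exact (tendsto_const_nhds.sub tendsto_id).inv₀ (by norm_num)
    · refine ENNReal.Tendsto.mul_const (ENNReal.Tendsto.const_mul ?_ (Or.inr ofReal_ne_top))
        (Or.inr P.energy_lt.ne)
      exact (continuous_ofReal.tendsto _).mono_left nhdsWithin_le_nhds
  simp at hlim
  have hpow : Tendsto (fun x : ℝ => (x ^ 2) ^ (P.q / 2)) (𝓝[>] 0) (𝓝 0) := by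
    have : Continuous fun x : ℝ => (x ^ 2) ^ (P.q / 2) :=
      (continuous_pow 2).rpow_const fun x => Or.inr (by positivity)
    have h0 := this.tendsto 0
    simp at h0
    rw [zero_rpow (by positivity)] at h0
    exact h0.mono_left nhdsWithin_le_nhds
  have hlt : ∀ᶠ x : ℝ in 𝓝[>] 0, x < 1 := nhdsWithin_le_nhds (Iio_mem_nhds one_pos)
  -- A single small x serves as the duration of the bridge and determines the mollification radius
  -- ε.
  obtain ⟨x, hxB, hxε, hx1, hx0⟩ := ((hlim.eventually (gt_mem_nhds hB)).and
    ((hpow.eventually (gt_mem_nhds hε₀)).and (hlt.and self_mem_nhdsWithin))).exists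
  set ε := (x ^ 2) ^ (P.q / 2)
  have hε : 0 < ε := by positivity
  obtain ⟨N, σ, w, hF, hσ, hact⟩ := h ε hε
  -- The truncated flow ends in the mollification of the reference measure; the bridge then leads to
  -- the reference measure itself.
  obtain ⟨u', hu', hcost⟩ := hF.exists_truncation P.mobility (by rw [mollify_univ]; simp) hσ
    (hact.trans_lt hA.lt_top).ne
  refine ⟨ε, ⟨hε, hxε⟩, u', hu', lt_of_le_of_lt ?_ hxB⟩
  unfold total
  have he : energy P.q u' ≤ energy P.q u := (energy_mono hu').trans (energy_mollify_le _ _ _)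
  gcongr
  refine (flowCost_bridge (by simp) hx0 hx1).trans ?_
  gcongr
  exact hcost.trans hact

lemma value_le_of_flows [IsFiniteMeasure u] (hu : u univ ≤ 1) (hA : A ≠ ⊤)
    (h : ∀ ε : ℝ, 0 < ε → ∃ N σ w, IsFlow N (mollify ε u) (mollify ε P.ref) σ w ∧
      (∀ R, ∃ C, ∀ᵐ p ∂((slab d).restrict (cyl d R)), σ p ≤ C) ∧ flowAction P.m σ w ≤ A) :
    P.value ≤ P.a * A + P.b * energy P.q u := by
  refine le_of_forall_gt fun B hB => ?_
  obtain ⟨ε, hε, u', hu', hlt⟩ := exists_competitor hA h hB one_pos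
  refine (P.value_le ?_).trans_lt hlt
  exact (hu' univ).trans (by rwa [mollify_univ])

/-- The reference measure is a competitor. It may be singular, so standing still need not be a flow
with densities; instead it is spread to its mollification and brought back. -/
lemma value_lt_top : P.value < ⊤ := by
  refine (P.value_le (γ := P.ref) (by simp)).trans_lt ?_
  refine add_lt_top.2 ⟨mul_lt_top P.a_ne_top.lt_top ?_, mul_lt_top P.b_ne_top.lt_top P.energy_lt⟩
  have hcon := flowCost_mollify_le P.mobility P.q_pos one_pos P.ref (N := 1) (by simp)
  have hcon' := hcon
  rw [flowCost_comm P.mobility] at hcon'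
  have hfin : ofReal (connectConst d P.m P.q) * ofReal 1 * energy P.q P.ref < ⊤ :=
    mul_lt_top (mul_lt_top ofReal_lt_top ofReal_lt_top) P.energy_lt
  refine (flowCost_concat_le (γ₁ := mollify (1 ^ (P.q / 2)) P.ref) P.mobility (κ := 1 / 2)
    (by norm_num) (by norm_num)).trans_lt ?_
  exact add_lt_top.2 ⟨mul_lt_top ofReal_lt_top (hcon.trans_lt hfin),
    mul_lt_top ofReal_lt_top (hcon'.trans_lt hfin)⟩

/-- The defect of convexity of the functional controls the distance of heat regularizations. -/
lemma energyDist_le (h : γ univ ≤ 1) (h' : γ' univ ≤ 1) :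
    P.b * energyDist P.q γ γ' + 4 * P.value ≤ 2 * (P.total γ + P.total γ') := by
  have f : IsFiniteMeasure γ := ⟨h.trans_lt one_lt_top⟩
  have f' : IsFiniteMeasure γ' := ⟨h'.trans_lt one_lt_top⟩
  have h1 := P.value_le (mid_univ_le h h')
  have h2 : P.total (mid γ γ') + P.b * (4⁻¹ * energyDist P.q γ γ') ≤ 2⁻¹ * (P.total γ + P.total γ') := by
    unfold total
    have e := energy_mid (q := P.q) γ γ'
    have c := flowCost_midpoint_le (N := 1) (γ₀ := γ) (γ₀' := γ') (γ₁ := P.ref) P.mobility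
    calc P.a * flowCost P.m 1 (mid γ γ') P.ref + P.b * energy P.q (mid γ γ') +
        P.b * (4⁻¹ * energyDist P.q γ γ')
        = P.a * flowCost P.m 1 (mid γ γ') P.ref + P.b * (energy P.q (mid γ γ') +
          4⁻¹ * energyDist P.q γ γ') := by ring
      _ ≤ P.a * (2⁻¹ * (flowCost P.m 1 γ P.ref + flowCost P.m 1 γ' P.ref)) +
        P.b * (2⁻¹ * (energy P.q γ + energy P.q γ')) := by rw [e]; gcongr
      _ = _ := by ring
  have e2 : (4 : ℝ≥0∞) * 2⁻¹ = 2 := by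
    rw [show (4 : ℝ≥0∞) = 2 * 2 by norm_num, mul_assoc, ENNReal.mul_inv_cancel (by simp) (by simp), mul_one]
  calc P.b * energyDist P.q γ γ' + 4 * P.value
      ≤ (4 * 4⁻¹) * (P.b * energyDist P.q γ γ') + 4 * P.total (mid γ γ') := by
        rw [(ENNReal.mul_inv_cancel (by simp) (by simp)), one_mul]; gcongr
    _ = 4 * (P.total (mid γ γ') + P.b * (4⁻¹ * energyDist P.q γ γ')) := by ring
    _ ≤ 4 * (2⁻¹ * (P.total γ + P.total γ')) := by gcongr
    _ = (4 * 2⁻¹) * (P.total γ + P.total γ') := by ring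
    _ = _ := by rw [e2]

end Problem

end

/-! ### Limits in the energy distance. -/

section

/-- The bound on the masses extends vague convergence to test functions vanishing at infinity, such
as Gaussians. -/
lemma tendsto_integral_of_vague {ι : Type*} {l : Filter ι} {κ : ι → Measure (E d)}
    {μ : Measure (E d)} (hκ : ∀ i, κ i univ ≤ 1) (hμ : μ univ ≤ 1)
    (h : ∀ f : E d → ℝ, Continuous f → HasCompactSupport f →
      Tendsto (fun i => ∫ x, f x ∂κ i) l (𝓝 (∫ x, f x ∂μ)))
    (hf : Continuous f) (hf0 : Tendsto f (cocompact (E d)) (𝓝 0)) :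
    Tendsto (fun i => ∫ x, f x ∂κ i) l (𝓝 (∫ x, f x ∂μ)) := by
  rw [Metric.tendsto_nhds]
  intro η hη
  have hK := hf0.eventually (Metric.ball_mem_nhds 0 (by positivity : 0 < η / 4))
  rw [Filter.eventually_iff, mem_cocompact] at hK
  obtain ⟨K, hKc, hK⟩ := hK
  obtain ⟨χ, hχ1, -, hχc, hχ01⟩ := exists_continuous_one_zero_of_isCompact hKc isClosed_empty
    (disjoint_empty _)
  have hg : Continuous fun x => χ x * f x := χ.continuous.mul hf
  have hgc : HasCompactSupport fun x => χ x * f x := hχc.mul_right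
  have hd : ∀ x, |f x - χ x * f x| ≤ η / 4 := by
    intro x
    by_cases hx : x ∈ K
    · have : χ x = 1 := hχ1 hx
      rw [this, one_mul, sub_self, abs_zero]
      positivity
    · have h1 : |f x| < η / 4 := by simpa using hK hx
      have h2 := hχ01 x
      rw [show f x - χ x * f x = (1 - χ x) * f x by ring, abs_mul, abs_of_nonneg (by linarith [h2.2])]
      calc (1 - χ x) * |f x| ≤ 1 * |f x| := by gcongr; linarith [h2.1]
        _ ≤ _ := by rw [one_mul]; exact h1.le
  have hsub : ∀ ρ : Measure (E d), ρ univ ≤ 1 →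
    |∫ x, f x ∂ρ - ∫ x, χ x * f x ∂ρ| ≤ η / 4 := by
    intro ρ hρ
    have : IsFiniteMeasure ρ := ⟨hρ.trans_lt one_lt_top⟩
    obtain ⟨B, hB⟩ := hg.bounded_above_of_compact_support hgc
    have i1 : Integrable (fun x => χ x * f x) ρ := hg.integrable_of_hasCompactSupport hgc
    have i2 : Integrable f ρ := Integrable.of_bound hf.aestronglyMeasurable (B + η / 4)
      (.of_forall fun x => by
        have := hd x
        have h3 := hB x
        rw [norm_eq_abs] at h3 ⊢
        have h4 := abs_sub_abs_le_abs_sub (f x) (χ x * f x)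
        linarith)
    rw [← integral_sub i2 i1, ← norm_eq_abs]
    refine (norm_integral_le_of_norm_le_const (.of_forall hd)).trans ?_
    have : ρ.real univ ≤ 1 := ENNReal.toReal_le_of_le_ofReal zero_le_one (by simpa using hρ)
    calc η / 4 * ρ.real univ ≤ η / 4 * 1 := by gcongr
      _ = _ := mul_one _
  filter_upwards [(h _ hg hgc).eventually (Metric.ball_mem_nhds _ (by positivity : 0 < η / 4))] with i hi
  rw [dist_eq] at hi
  rw [dist_eq]
  have h1 := hsub (κ i) (hκ i)
  have h2 := hsub μ hμ
  rw [abs_le] at h1 h2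
  rw [abs_lt] at hi ⊢
  constructor <;> linarith [hi.1, hi.2, h1.1, h1.2, h2.1, h2.2]

lemma tendsto_gaus_cocompact (hr : 0 < r) (x : E d) :
    Tendsto (fun y => gaus r (x - y)) (cocompact (E d)) (𝓝 0) := by
  have h1 := (Homeomorph.subLeft x).isClosedEmbedding.tendsto_cocompact
  have h2 := (tendsto_pow_atTop two_ne_zero).comp (tendsto_norm_cocompact_atTop.comp h1)
  have h3 : Tendsto (fun y => -(1 / (4 * r)) * ‖x - y‖ ^ 2) (cocompact (E d)) atBot :=
    h2.const_mul_atTop_of_neg (by have : 0 < 1 / (4 * r) := by positivity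
                                  linarith)
  have h4 := (Real.tendsto_exp_atBot.comp h3).const_mul (r ^ (-(d : ℝ) / 2))
  rw [mul_zero] at h4
  exact h4

lemma tendsto_heat_of_vague {ι : Type*} {l : Filter ι} {κ : ι → Measure (E d)}
    {μ : Measure (E d)} (hκ : ∀ i, κ i univ ≤ 1) (hμ : μ univ ≤ 1)
    (h : ∀ f : E d → ℝ, Continuous f → HasCompactSupport f →
      Tendsto (fun i => ∫ x, f x ∂κ i) l (𝓝 (∫ x, f x ∂μ)))
    (q : ℝ) (hp : 0 < p.2) :
    Tendsto (fun i => heat q (κ i) p) l (𝓝 (heat q μ p)) :=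
  tendsto_integral_of_vague hκ hμ h ((continuous_gaus _).comp (by fun_prop))
    (tendsto_gaus_cocompact (by positivity) p.1)

section

variable {X F : Type*} [MeasurableSpace X] {μ : Measure X} [NormedAddCommGroup F]

lemma sq_eLpNorm_two (f : X → F) : eLpNorm f 2 μ ^ 2 = ∫⁻ x, ofReal (‖f x‖ ^ 2) ∂μ := by
  rw [eLpNorm_eq_lintegral_rpow_enorm_toReal (by simp) (by simp), ← rpow_natCast, ← rpow_mul]
  norm_num

lemma tendsto_zero_of_sq_tendsto_zero {ι : Type*} {l : Filter ι} {f : ι → ℝ≥0∞}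
    (h : Tendsto (fun i => f i ^ 2) l (𝓝 0)) : Tendsto f l (𝓝 0) := by
  have := (ENNReal.continuous_rpow_const (y := (1 / 2))).tendsto 0 |>.comp h
  rw [ENNReal.zero_rpow_of_pos (by norm_num)] at this
  refine this.congr fun i => ?_
  simp
  rw [← rpow_natCast, ← rpow_mul]
  norm_num

lemma exists_limit_of_cauchy [CompleteSpace F] {f : ℕ → X → F} (hf : ∀ n, MemLp (f n) 2 μ)
    (hc : Tendsto (fun p : ℕ × ℕ => eLpNorm (f p.1 - f p.2) 2 μ ^ 2) atTop (𝓝 0)) :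
    ∃ g : X → F, StronglyMeasurable g ∧ MemLp g 2 μ ∧
      Tendsto (fun n => eLpNorm (f n - g) 2 μ) atTop (𝓝 0) := by
  have hcs : CauchySeq fun n => (hf n).toLp := by
    rw [Lp.cauchySeq_Lp_iff_cauchySeq_eLpNorm]
    refine (tendsto_zero_of_sq_tendsto_zero hc).congr fun p => eLpNorm_congr_ae ?_
    exact ((hf p.1).coeFn_toLp.sub (hf p.2).coeFn_toLp).symm
  obtain ⟨g, hg⟩ := cauchySeq_tendsto_of_complete hcs
  refine ⟨g, Lp.stronglyMeasurable g, Lp.memLp g, ?_⟩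
  rw [Lp.tendsto_Lp_iff_tendsto_eLpNorm'] at hg
  refine hg.congr fun n => eLpNorm_congr_ae ?_
  exact (hf n).coeFn_toLp.sub EventuallyEq.rfl

lemma exists_subseq_ae_tendsto {f : ℕ → X → F} {g : X → F}
    (hf : ∀ n, AEStronglyMeasurable (f n) μ) (hg : AEStronglyMeasurable g μ)
    (h : Tendsto (fun n => eLpNorm (f n - g) 2 μ) atTop (𝓝 0)) :
    ∃ φ : ℕ → ℕ, StrictMono φ ∧ ∀ᵐ x ∂μ, Tendsto (fun k => f (φ k) x) atTop (𝓝 (g x)) :=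
  (tendstoInMeasure_of_tendsto_eLpNorm (by simp) hf hg h).exists_seq_tendsto_ae

end

lemma energyDist_eq (u v : Measure (E d)) :
    energyDist q u v = eLpNorm (heat q u - heat q v) 2 (scaleM d q) ^ 2 := by
  rw [sq_eLpNorm_two]
  simp [energyDist]

lemma memLp_heat [IsFiniteMeasure u] (h : energy q u < ⊤) : MemLp (heat q u) 2 (scaleM d q) := by
  refine ⟨(measurable_heat q u).aestronglyMeasurable, ?_⟩
  have : eLpNorm (heat q u) 2 (scaleM d q) ^ 2 < ⊤ := by
    rw [sq_eLpNorm_two]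
    simpa [energy] using h
  by_contra hn
  simp [hn] at this

/-- Convergence in energy implies vague convergence, up to a subsequence. -/
lemma exists_subseq_vague {γ : ℕ → Measure (E d)} (hγ : ∀ n, γ n univ ≤ 1) (hγ' : γ' univ ≤ 1)
    (h : Tendsto (fun n => energyDist q (γ n) γ') atTop (𝓝 0)) :
    ∃ φ : ℕ → ℕ, StrictMono φ ∧
      (∀ᵐ p ∂scaleM d q, Tendsto (fun k => heat q (γ (φ k)) p) atTop (𝓝 (heat q γ' p))) ∧
      ∀ f : E d → ℝ, Continuous f → HasCompactSupport f →
        Tendsto (fun k => ∫ x, f x ∂(γ (φ k))) (hyperfilter ℕ : Filter ℕ) (𝓝 (∫ x, f x ∂γ')) := by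
  have f' : IsFiniteMeasure γ' := ⟨hγ'.trans_lt one_lt_top⟩
  have ff : ∀ n, IsFiniteMeasure (γ n) := fun n => ⟨(hγ n).trans_lt one_lt_top⟩
  simp only [energyDist_eq] at h
  obtain ⟨φ, hφ, hae⟩ := exists_subseq_ae_tendsto (fun n => (measurable_heat q (γ n)).aestronglyMeasurable)
    (measurable_heat q γ').aestronglyMeasurable (tendsto_zero_of_sq_tendsto_zero h)
  obtain ⟨ρ, hρ, hlim⟩ := exists_vague_limit (hyperfilter ℕ) (fun k => γ (φ k)) one_ne_top fun k => hγ _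
  have fρ : IsFiniteMeasure ρ := ⟨hρ.trans_lt one_lt_top⟩
  have heq : ρ = γ' := by
    refine eq_of_energyDist_eq_zero (q := q) ?_
    refine (lintegral_congr_ae ?_).trans lintegral_zero
    filter_upwards [hae, ae_snd_pos_scaleM q] with p hp hp0
    have h1 := tendsto_heat_of_vague (fun k => hγ (φ k)) hρ hlim q hp0
    rw [tendsto_nhds_unique h1 (hp.mono_left Nat.hyperfilter_le_atTop)]
    simp
  rw [heq] at hlim
  exact ⟨φ, hφ, hae, hlim⟩

/-- The regularizations converge in L²; to see that the limit is the regularization of a measure,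
take a vague limit along an ultrafilter. Mass can be lost, hence the relaxation to subprobability
measures. -/
lemma exists_energy_limit {γ : ℕ → Measure (E d)} (hγ : ∀ n, γ n univ ≤ 1) (he : ∀ n, energy q (γ n) < ⊤)
    (hc : Tendsto (fun p : ℕ × ℕ => energyDist q (γ p.1) (γ p.2)) atTop (𝓝 0)) :
    ∃ γ' : Measure (E d), γ' univ ≤ 1 ∧ Tendsto (fun n => energyDist q (γ n) γ') atTop (𝓝 0) := by
  have ff : ∀ n, IsFiniteMeasure (γ n) := fun n => ⟨(hγ n).trans_lt one_lt_top⟩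
  simp only [energyDist_eq] at hc
  obtain ⟨g, hgm, hgL, hg⟩ := exists_limit_of_cauchy (fun n => memLp_heat (he n)) hc
  obtain ⟨φ, hφ, hae⟩ := exists_subseq_ae_tendsto
    (fun n => (measurable_heat q (γ n)).aestronglyMeasurable) hgm.aestronglyMeasurable hg
  obtain ⟨ρ, hρ, hlim⟩ := exists_vague_limit (hyperfilter ℕ) (fun k => γ (φ k)) one_ne_top fun k => hγ _
  refine ⟨ρ, hρ, ?_⟩
  have heq : heat q ρ =ᵐ[scaleM d q] g := by
    filter_upwards [hae, ae_snd_pos_scaleM q] with p hp hp0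
    exact tendsto_nhds_unique (tendsto_heat_of_vague (fun k => hγ (φ k)) hρ hlim q hp0)
      (hp.mono_left Nat.hyperfilter_le_atTop)
  simp only [energyDist_eq]
  have h1 : ∀ n, eLpNorm (heat q (γ n) - heat q ρ) 2 (scaleM d q) =
    eLpNorm (heat q (γ n) - g) 2 (scaleM d q) := fun n =>
    eLpNorm_congr_ae (EventuallyEq.rfl.sub heq)
  simp only [h1]
  have := ((ENNReal.continuous_pow 2).tendsto 0).comp hg
  simpa [Function.comp_def] using this

namespace Problem

variable {P : Problem d}

/-- By `Problem.energyDist_le`, the distance is at most a multiple of the convexity defect, which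
vanishes in the limit when both families minimize. -/
lemma tendsto_energyDist {ι : Type*} {l : Filter ι} {γ γ' : ι → Measure (E d)}
    (hγ : ∀ i, γ i univ ≤ 1) (hγ' : ∀ i, γ' i univ ≤ 1)
    (h : Tendsto (fun i => P.total (γ i)) l (𝓝 P.value))
    (h' : Tendsto (fun i => P.total (γ' i)) l (𝓝 P.value)) :
    Tendsto (fun i => energyDist P.q (γ i) (γ' i)) l (𝓝 0) := by
  have h4v : 4 * P.value ≠ ⊤ := mul_ne_top (by simp) P.value_lt_top.ne
  have hlim : Tendsto (fun i => P.b⁻¹ * (2 * (P.total (γ i) + P.total (γ' i)) - 4 * P.value)) l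
      (𝓝 (P.b⁻¹ * (2 * (P.value + P.value) - 4 * P.value))) := by
    refine ENNReal.Tendsto.const_mul ?_ (Or.inr (ENNReal.inv_ne_top.2 P.b_ne_zero))
    exact ENNReal.Tendsto.sub (ENNReal.Tendsto.const_mul (h.add h') (Or.inr (by simp)))
      tendsto_const_nhds (Or.inr h4v)
  have h0 : P.b⁻¹ * (2 * (P.value + P.value) - 4 * P.value) = 0 := by
    rw [← two_mul, ← mul_assoc, show (2 : ℝ≥0∞) * 2 = 4 by norm_num, tsub_self, mul_zero]
  rw [h0] at hlim
  refine tendsto_zero_of_le hlim fun i => ?_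
  have := energyDist_le (P := P) (hγ i) (hγ' i)
  have h2 := ENNReal.le_sub_of_add_le_right h4v this
  calc energyDist P.q (γ i) (γ' i) = P.b⁻¹ * (P.b * energyDist P.q (γ i) (γ' i)) := by
        rw [← mul_assoc, ENNReal.inv_mul_cancel P.b_ne_zero P.b_ne_top, one_mul]
    _ ≤ _ := by gcongr

lemma exists_total_lt (h : P.value < B) : ∃ γ : Measure (E d), γ univ ≤ 1 ∧ P.total γ < B := by
  unfold value at h
  simp only [iInf_lt_iff, exists_prop] at h
  exact h

variable (P) in
/-- `γ` is the limit of all minimizing sequences of subprobability measures. -/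
def IsLimit (γ : Measure (E d)) : Prop := γ univ ≤ 1 ∧ ∀ γ' : ℕ → Measure (E d), (∀ n, γ' n univ ≤ 1) →
      Tendsto (fun n => P.total (γ' n)) atTop (𝓝 P.value) →
      Tendsto (fun n => energyDist P.q (γ' n) γ) atTop (𝓝 0)

lemma tendsto_value_add : Tendsto (fun n : ℕ => P.value + ((n : ℝ≥0∞) + 1)⁻¹) atTop (𝓝 P.value) := by
  simpa using tendsto_const_nhds.add tendsto_inv_add_one

variable (P) in
lemma exists_limit : ∃ γ, P.IsLimit γ := by
  have hex : ∀ n : ℕ, ∃ γ : Measure (E d), γ univ ≤ 1 ∧ P.total γ < P.value + ((n : ℝ≥0∞) + 1)⁻¹ :=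
    fun n => exists_total_lt (lt_add_right P.value_lt_top.ne (by simp))
  choose γ hγ hlt using hex
  have htot : Tendsto (fun n => P.total (γ n)) atTop (𝓝 P.value) :=
    tendsto_of_tendsto_of_tendsto_of_le_of_le tendsto_const_nhds tendsto_value_add
      (fun n => P.value_le (hγ n)) fun n => (hlt n).le
  have he : ∀ n, energy P.q (γ n) < ⊤ := by
    intro n
    have h2 := (add_lt_top.1 ((hlt n).trans_le le_top)).2
    by_contra h3
    rw [not_lt, top_le_iff] at h3
    rw [h3, mul_top P.b_ne_zero] at h2
    exact lt_irrefl _ h2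
  have ff : ∀ n, IsFiniteMeasure (γ n) := fun n => ⟨(hγ n).trans_lt one_lt_top⟩
  have hcau : Tendsto (fun p : ℕ × ℕ => energyDist P.q (γ p.1) (γ p.2)) atTop (𝓝 0) := by
    refine tendsto_energyDist (fun p => hγ _) (fun p => hγ _) ?_ ?_ <;> rw [← prod_atTop_atTop_eq]
    · exact htot.comp tendsto_fst
    · exact htot.comp tendsto_snd
  obtain ⟨γ', hγ', hlim⟩ := exists_energy_limit hγ he hcau
  refine ⟨γ', hγ', fun ρ hρ hρlim => ?_⟩
  have f' : IsFiniteMeasure γ' := ⟨hγ'.trans_lt one_lt_top⟩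
  have fρ : ∀ n, IsFiniteMeasure (ρ n) := fun n => ⟨(hρ n).trans_lt one_lt_top⟩
  have h1 := tendsto_energyDist hρ hγ hρlim htot
  have h2 : Tendsto (fun n => 2 * (energyDist P.q (ρ n) (γ n) + energyDist P.q (γ n) γ')) atTop
    (𝓝 (2 * (0 + 0))) := ENNReal.Tendsto.const_mul (h1.add hlim) (Or.inr (by simp))
  simp at h2
  exact tendsto_zero_of_le h2 fun n => energyDist_triangle _ _ _ _

end Problem

end

/-! ### Strong convergence of mollified near-minimizing flows. -/

section

/-- In a decreasing sequence of sets that are convex for a quadratic form, near-minimizers of the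
form are Cauchy. -/
lemma exists_cauchy_of_convex {X : Type*} (K : ℕ → Set X) (hK : ∀ n, (K n).Nonempty)
    (hanti : Antitone K) (Q : X → ℝ≥0∞) (hB : B ≠ ⊤) (hQ : ∀ n, ∀ x ∈ K n, Q x ≤ B)
    (D : X → X → ℝ≥0∞)
    (hmid : ∀ n, ∀ x ∈ K n, ∀ y ∈ K n, ∃ z ∈ K n, D x y + 4 * Q z ≤ 2 * (Q x + Q y)) :
    ∃ x : ℕ → X, (∀ n, x n ∈ K n) ∧ Tendsto (fun p : ℕ × ℕ => D (x p.1) (x p.2)) atTop (𝓝 0) := by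
  -- The infima over the shrinking sets increase to a finite limit J. Elements nearly attaining them
  -- have Q → J, and so have defects tending to 0.
  let I := fun n => ⨅ x ∈ K n, Q x
  have hI : Monotone I := fun n k h => biInf_mono (hanti h)
  have hIB : ∀ n, I n ≤ B := fun n => by
    obtain ⟨x, hx⟩ := hK n
    exact (iInf₂_le x hx).trans (hQ n x hx)
  have hIl := tendsto_atTop_iSup hI
  set J := ⨆ n, I n
  have hex : ∀ n : ℕ, ∃ x ∈ K n, Q x < I n + ((n : ℝ≥0∞) + 1)⁻¹ := by
    intro n
    have : I n < I n + ((n : ℝ≥0∞) + 1)⁻¹ := lt_add_right ((hIB n).trans_lt hB.lt_top).ne (by simp)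
    simpa only [I, iInf_lt_iff, exists_prop] using this
  choose x hx hlt using hex
  have hQl : Tendsto (fun n => Q (x n)) atTop (𝓝 J) := by
    have h1 := hIl.add tendsto_inv_add_one
    rw [add_zero] at h1
    exact tendsto_of_tendsto_of_tendsto_of_le_of_le hIl h1 (fun n => iInf₂_le _ (hx n)) fun n => (hlt n).le
  refine ⟨x, hx, ?_⟩
  have hmin : Tendsto (fun p : ℕ × ℕ => min p.1 p.2) atTop atTop := by
    refine tendsto_atTop.2 fun b => ?_
    filter_upwards [eventually_ge_atTop (b, b)] with p hp using le_min hp.1 hp.2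
  have l1 : Tendsto (fun p : ℕ × ℕ => Q (x p.1)) atTop (𝓝 J) := by
    rw [← prod_atTop_atTop_eq]; exact hQl.comp tendsto_fst
  have l2 : Tendsto (fun p : ℕ × ℕ => Q (x p.2)) atTop (𝓝 J) := by
    rw [← prod_atTop_atTop_eq]; exact hQl.comp tendsto_snd
  have l3 : Tendsto (fun p : ℕ × ℕ => 2 * (Q (x p.1) + Q (x p.2)) - 4 * I (min p.1 p.2)) atTop
    (𝓝 (2 * (J + J) - 4 * J)) :=
    ENNReal.Tendsto.sub (ENNReal.Tendsto.const_mul (l1.add l2) (Or.inr (by simp)))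
      (ENNReal.Tendsto.const_mul (hIl.comp hmin) (Or.inr (by simp)))
      (Or.inr (mul_ne_top (by simp) (((iSup_le hIB).trans_lt hB.lt_top).ne)))
  rw [← two_mul, ← mul_assoc, show (2 : ℝ≥0∞) * 2 = 4 by norm_num, tsub_self] at l3
  refine tendsto_zero_of_le l3 fun p => ?_
  -- Both points lie in the larger of the two sets, so their midpoint does too and its form is at
  -- least the infimum there.
  obtain ⟨z, hz, hle⟩ := hmid (min p.1 p.2) (x p.1) (hanti (min_le_left _ _) (hx _)) (x p.2)
    (hanti (min_le_right _ _) (hx _))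
  refine ENNReal.le_sub_of_add_le_right
    (mul_ne_top (by simp) ((hIB _).trans_lt hB.lt_top).ne) (le_trans ?_ hle)
  gcongr
  exact iInf₂_le _ hz

section

variable {X F : Type*} [MeasurableSpace X] {μ : Measure X} [NormedAddCommGroup F] [InnerProductSpace ℝ F]

lemma eLpNorm_parallelogram {f g h : X → F} (hf : StronglyMeasurable f)
    (hg : StronglyMeasurable g) (hh : h =ᵐ[μ] fun x => (1 / 2 : ℝ) • (f x + g x)) :
    eLpNorm (f - g) 2 μ ^ 2 + 4 * eLpNorm h 2 μ ^ 2 = 2 * (eLpNorm f 2 μ ^ 2 + eLpNorm g 2 μ ^ 2) := by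
  rw [eLpNorm_congr_ae hh]
  simp only [sq_eLpNorm_two]
  have m1 := ((hf.sub hg).norm.measurable.pow_const 2).ennreal_ofReal
  have m2 : Measurable fun x => ofReal (‖(1 / 2 : ℝ) • (f x + g x)‖ ^ 2) :=
    (((hf.add hg).const_smul (1 / 2 : ℝ)).norm.measurable.pow_const 2).ennreal_ofReal
  have m3 := (hf.norm.measurable.pow_const 2).ennreal_ofReal
  have m4 := (hg.norm.measurable.pow_const 2).ennreal_ofReal
  have m5 : Measurable fun x => ofReal (‖f x‖ ^ 2) + ofReal (‖g x‖ ^ 2) := m3.add m4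
  rw [← lintegral_const_mul _ m2, ← lintegral_add_left m1, ← lintegral_add_left m3,
    ← lintegral_const_mul _ m5]
  apply lintegral_congr
  intro x
  rw [show 4 = ofReal 4 by simp, show (2 : ℝ≥0∞) = ofReal 2 by simp,
    ← ofReal_mul (by norm_num), ← ofReal_add (by positivity) (by positivity),
    ← ofReal_add (by positivity) (by positivity), ← ofReal_mul (by norm_num)]
  congr 1
  have := parallelogram_law_with_norm ℝ (f x) (g x)
  rw [norm_smul, Pi.sub_apply, mul_pow]
  norm_num
  linarith

end

variable {F : Type*} [NormedAddCommGroup F]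

lemma moll_midpoint [NormedSpace ℝ F] (hε : 0 ≤ ε) {f g : Q d → F} (hf : StronglyMeasurable f)
    (hg : StronglyMeasurable g) (hfi : ∀ R, IntegrableOn f (cyl d R) (slab d))
    (hgi : ∀ R, IntegrableOn g (cyl d R) (slab d)) :
    moll ε (fun p => (1 / 2 : ℝ) • (f p + g p)) =ᵐ[slab d]
      fun p => (1 / 2 : ℝ) • (moll ε f p + moll ε g p) := by
  filter_upwards [ae_integrable_shift hε hf hfi, ae_integrable_shift hε hg hgi] with p h1 h2
  unfold moll
  rw [integral_smul, integral_add h1 h2]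

lemma lintegral_cyl_le {f : Q d → F} (hf : AEStronglyMeasurable f (slab d)) (R : ℝ) :
    ∫⁻ p in cyl d R, ‖f p‖ₑ ∂slab d ≤ eLpNorm f 2 (slab d) * slab d (cyl d R) ^ (1 / 2 : ℝ) := by
  have h := eLpNorm_le_eLpNorm_mul_rpow_measure_univ (μ := (slab d).restrict (cyl d R))
    (show 1 ≤ 2 by norm_num) hf.restrict
  rw [eLpNorm_one_eq_lintegral_enorm, Measure.restrict_apply_univ] at h
  norm_num at h
  refine h.trans ?_
  norm_num
  gcongr
  exact Measure.restrict_le_self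

/-- Mollified flows of bounded mass and action are bounded in `L²`. -/
lemma IsFlow.sq_eLpNorm_moll_le (hm : IsMobility m) (h : IsFlow 1 γ₀ γ₁ σ w)
    (hε : 0 < ε) : eLpNorm (moll ε σ) 2 (slab d) ^ 2 + eLpNorm (moll ε w) 2 (slab d) ^ 2 ≤
      ofReal ((ε ^ d)⁻¹ * bumpMax d) + ofReal (m ((ε ^ d)⁻¹ * bumpMax d)) * flowAction m σ w := by
  set C := (ε ^ d)⁻¹ * bumpMax d
  have hσm := h.meas_density
  have hs : ∀ᵐ p ∂slab d, moll ε σ p ≤ C := by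
    filter_upwards [ae_slab_of_ae_timeM h.mass_le] with p hp
    have := moll_le hε hσm h.density_nonneg p.1 zero_le_one (by simpa using hp)
    rwa [mul_one] at this
  have hms := (stronglyMeasurable_moll (ε := ε) hσm.stronglyMeasurable).measurable
  have hmw := (stronglyMeasurable_moll (ε := ε) h.meas_flux.stronglyMeasurable).measurable
  rw [sq_eLpNorm_two, sq_eLpNorm_two]
  refine add_le_add ?_ ?_
  · calc ∫⁻ p, ofReal (‖moll ε σ p‖ ^ 2) ∂slab d
        ≤ ∫⁻ p, ofReal C * ofReal (moll ε σ p) ∂slab d := by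
          apply lintegral_mono_ae
          filter_upwards [hs] with p hp
          have h0 := moll_nonneg (ε := ε) h.density_nonneg p
          rw [← ofReal_mul (mul_nonneg (by positivity) bumpMax_pos.le), norm_of_nonneg h0, sq]
          gcongr
      _ = ofReal C * ∫⁻ p, ofReal (moll ε σ p) ∂slab d :=
          lintegral_const_mul _ hms.ennreal_ofReal
      _ ≤ ofReal C * 1 := by
          gcongr
          rw [lintegral_slab hms.ennreal_ofReal]
          calc ∫⁻ t, (∫⁻ x, ofReal (moll ε σ (x, t))) ∂timeM ≤ ∫⁻ _, 1 ∂timeM := by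
                apply lintegral_mono_ae
                filter_upwards [h.mass_le] with t ht
                exact (lintegral_moll_le hσm h.density_nonneg t).trans ht
            _ = 1 := by simp
      _ = _ := mul_one _
  · calc ∫⁻ p, ofReal (‖moll ε w p‖ ^ 2) ∂slab d
        ≤ ∫⁻ p, ofReal (m C) * actE m (moll ε σ p) (moll ε w p) ∂slab d := by
          apply lintegral_mono_ae
          filter_upwards [hs] with p hp
          rw [hm.ofReal_normSq_eq (moll ε σ p)]
          gcongr
          exact hm.monotone hp
      _ = ofReal (m C) * flowAction m (moll ε σ) (moll ε w) :=
          lintegral_const_mul _ (hm.measurable_actE hms hmw)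
      _ ≤ _ := by
          gcongr
          exact flowAction_moll_le hm hε.le hσm h.meas_flux h.density_nonneg h.int_density

lemma memLp_of_sq_lt_top {X : Type*} [MeasurableSpace X] {μ : Measure X} {f : X → F}
    (hf : AEStronglyMeasurable f μ) (h : eLpNorm f 2 μ ^ 2 < ⊤) : MemLp f 2 μ := by
  refine ⟨hf, ?_⟩
  by_contra hn
  simp [hn] at h

lemma ae_timeM_of_ae_slab {p : Q d → Prop} (h : ∀ᵐ x ∂slab d, p x) : ∀ᵐ t ∂timeM, ∀ᵐ x, p (x, t) := by
  have h1 := Measure.ae_ae_of_ae_prod (Measure.measurePreserving_swap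
    |>.quasiMeasurePreserving.ae h)
  exact h1

end

lemma liminf_add_le {u v : ℕ → ℝ≥0∞} :
    liminf u atTop + liminf v atTop ≤ liminf (fun n => u n + v n) atTop := by
  rw [liminf_eq_iSup_iInf_of_nat, liminf_eq_iSup_iInf_of_nat, liminf_eq_iSup_iInf_of_nat,
    ENNReal.iSup_add_iSup_of_monotone]
  · refine iSup_mono fun n => le_iInf₂ fun i hi => add_le_add (iInf₂_le i hi) (iInf₂_le i hi)
  · exact fun i j h => biInf_mono fun k hk => h.trans hk
  · exact fun i j h => biInf_mono fun k hk => h.trans hk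

lemma lintegral_le_liminf_of_ae_tendsto {X : Type*} [MeasurableSpace X] {μ : Measure X}
    {f : ℕ → X → ℝ≥0∞} {g : X → ℝ≥0∞} (hf : ∀ n, Measurable (f n))
    (h : ∀ᵐ x ∂μ, Tendsto (fun n => f n x) atTop (𝓝 (g x))) :
    ∫⁻ x, g x ∂μ ≤ liminf (fun n => ∫⁻ x, f n x ∂μ) atTop := by
  refine le_trans (lintegral_mono_ae ?_) (lintegral_liminf_le hf)
  filter_upwards [h] with x hx using hx.liminf_eq.ge

lemma integrableOn_cyl_of_memLp {F : Type*} [NormedAddCommGroup F] {f : Q d → F}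
    (hf : MemLp f 2 (slab d)) (R : ℝ) : IntegrableOn f (cyl d R) (slab d) := by
  have : IsFiniteMeasure ((slab d).restrict (cyl d R)) :=
    ⟨by rw [Measure.restrict_apply_univ]; exact slab_cyl_lt_top R⟩
  exact (hf.restrict (cyl d R)).integrable (by norm_num)

/-- L² convergence of the flows passes to the weak equation, which is linear and localized in a
cylinder; the mass bound survives by Fatou's lemma. The limit density is nonnegative only almost
everywhere, so its positive part is used. -/
lemma IsFlow.of_tendsto {α : ℕ → Measure (E d)} {α' β : Measure (E d)}
    {s : ℕ → Q d → ℝ} {v : ℕ → Q d → E d} {g : Q d → ℝ}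
    (h : ∀ n, IsFlow N (α n) β (s n) (v n)) (hg : StronglyMeasurable g) (hw : StronglyMeasurable w)
    (hgL : MemLp g 2 (slab d)) (hwL : MemLp w 2 (slab d))
    (hs : Tendsto (fun n => eLpNorm (s n - g) 2 (slab d)) atTop (𝓝 0))
    (hv : Tendsto (fun n => eLpNorm (v n - w) 2 (slab d)) atTop (𝓝 0))
    (hα : ∀ ψ : Q d → ℝ, ContDiff ℝ 1 ψ → HasCompactSupport ψ →
      Tendsto (fun k => ∫ x, ψ (x, 0) ∂(α k)) (hyperfilter ℕ : Filter ℕ) (𝓝 (∫ x, ψ (x, 0) ∂α'))) :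
    IsFlow N α' β (fun p => max (g p) 0) w ∧ (fun p => max (g p) 0) =ᵐ[slab d] g := by
  obtain ⟨φ, -, hae⟩ := exists_subseq_ae_tendsto
    (fun n => (h n).meas_density.aestronglyMeasurable) hg.aestronglyMeasurable hs
  have heq : (fun p => max (g p) 0) =ᵐ[slab d] g := by
    filter_upwards [hae] with p hp
    exact max_eq_left (ge_of_tendsto' hp fun k => (h _).density_nonneg p)
  refine ⟨⟨hg.measurable.max measurable_const, hw.measurable, fun p => le_max_right _ _, ?_,
    fun R => (integrableOn_cyl_of_memLp hgL R).congr (ae_restrict_of_ae heq.symm),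
    integrableOn_cyl_of_memLp hwL, fun ψ hψ hc => ?_⟩, heq⟩
  · filter_upwards [ae_timeM_of_ae_slab hae, ae_all_iff.2 fun n => (h n).mass_le] with t ht hN
    have hlim : ∀ᵐ x, Tendsto (fun k => ofReal (s (φ k) (x, t))) atTop (𝓝 (ofReal (max (g (x, t)) 0))) := by
      filter_upwards [ht] with x hx
      simpa [ENNReal.ofReal_max, Function.comp_def] using ((continuous_ofReal.tendsto _).comp hx)
    have hm : ∀ k, Measurable fun x => ofReal (s (φ k) (x, t)) := fun k =>
      ((h (φ k)).meas_density.comp measurable_prodMk_right).ennreal_ofReal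
    refine (lintegral_le_liminf_of_ae_tendsto hm hlim).trans ?_
    exact liminf_le_of_le (by isBoundedDefault) fun b hb => by
      obtain ⟨k, hk⟩ := hb.exists
      exact hk.trans (hN _)
  · have hi : ∀ n, Integrable (fun p => fderiv ℝ ψ p (v n p, s n p)) (slab d) := fun n =>
      (h n).integrable_fderiv hψ hc
    have hi' := integrable_fderiv_apply hg.measurable hw.measurable (integrableOn_cyl_of_memLp hgL)
      (integrableOn_cyl_of_memLp hwL) hψ hc
    obtain ⟨C, hC0, hC⟩ := exists_bound_fderiv hψ hc
    obtain ⟨R, hR, h0⟩ := exists_cyl (hc.fderiv ℝ)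
    have hsm : ∀ n, StronglyMeasurable (s n - g) := fun n => (h n).meas_density.stronglyMeasurable.sub hg
    have hvm : ∀ n, StronglyMeasurable (v n - w) := fun n => (h n).meas_flux.stronglyMeasurable.sub hw
    have hL : Tendsto (fun n => ∫ p, fderiv ℝ ψ p (v n p, s n p) ∂slab d) atTop
      (𝓝 (∫ p, fderiv ℝ ψ p (w p, g p) ∂slab d)) := by
      refine tendsto_integral_of_L1 _ hi'.aestronglyMeasurable (.of_forall hi) ?_
      have hK : slab d (cyl d R) ^ (1 / 2 : ℝ) ≠ ⊤ :=
        (ENNReal.rpow_lt_top_of_nonneg (by norm_num) (slab_cyl_lt_top R).ne).ne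
      have hb : Tendsto (fun n => ofReal C * (eLpNorm (v n - w) 2 (slab d) * slab d (cyl d R) ^ (1 / 2 : ℝ) +
          eLpNorm (s n - g) 2 (slab d) * slab d (cyl d R) ^ (1 / 2 : ℝ))) atTop
        (𝓝 (ofReal C * (0 * slab d (cyl d R) ^ (1 / 2 : ℝ) + 0 * slab d (cyl d R) ^ (1 / 2 : ℝ)))) :=
        ENNReal.Tendsto.const_mul ((ENNReal.Tendsto.mul_const hv (Or.inr hK)).add
          (ENNReal.Tendsto.mul_const hs (Or.inr hK))) (Or.inr ofReal_ne_top)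
      simp only [zero_mul, add_zero, mul_zero] at hb
      refine tendsto_zero_of_le hb fun n => ?_
      calc ∫⁻ p, ‖fderiv ℝ ψ p (v n p, s n p) - fderiv ℝ ψ p (w p, g p)‖ₑ ∂slab d
          ≤ ∫⁻ p in cyl d R, ofReal C * (‖(v n - w) p‖ₑ + ‖(s n - g) p‖ₑ) ∂slab d := by
            rw [← lintegral_indicator (measurableSet_cyl R)]
            refine lintegral_mono fun p => ?_
            by_cases hp : p ∈ cyl d R
            · rw [indicator_of_mem hp, ← map_sub]
              refine ((fderiv ℝ ψ p).le_opENorm _).trans ?_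
              gcongr
              · rw [← ofReal_norm]
                exact ofReal_le_ofReal (hC p)
              · simp only [← ofReal_norm, ← ofReal_add (norm_nonneg _) (norm_nonneg _)]
                refine ofReal_le_ofReal ?_
                exact max_le_add_of_nonneg (norm_nonneg _) (norm_nonneg _)
            · simp [indicator_of_notMem hp, h0 p hp]
        _ = ofReal C * (∫⁻ p in cyl d R, ‖(v n - w) p‖ₑ ∂slab d +
          ∫⁻ p in cyl d R, ‖(s n - g) p‖ₑ ∂slab d) := by
          rw [lintegral_const_mul' _ _ ofReal_ne_top, lintegral_add_left (hvm n).enorm]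
        _ ≤ _ := by
          gcongr
          · exact lintegral_cyl_le (hvm n).aestronglyMeasurable R
          · exact lintegral_cyl_le (hsm n).aestronglyMeasurable R
    have hR := (tendsto_const_nhds (x := ∫ x, ψ (x, 1) ∂β)).sub (hα ψ hψ hc)
    simp only [(fun n => (h n).continuity_eq ψ hψ hc)] at hL
    rw [← tendsto_nhds_unique (hL.mono_left Nat.hyperfilter_le_atTop) hR]
    apply integral_congr_ae
    filter_upwards [heq] with p hp
    rw [show max (g p) 0 = g p from hp]

section

namespace Problem

variable {P : Problem d}

variable (P) in
/-- The measures and flows on which the functional is at most `B`. -/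
def sublevel (B : ℝ≥0∞) : Set (Measure (E d) × (Q d → ℝ) × (Q d → E d)) :=
  {x | x.1 univ ≤ 1 ∧ IsFlow 1 x.1 P.ref x.2.1 x.2.2 ∧
    P.a * flowAction P.m x.2.1 x.2.2 + P.b * energy P.q x.1 ≤ B}

lemma sublevel_nonempty (h : P.value < B) : (P.sublevel B).Nonempty := by
  obtain ⟨ρ, hρ, hlt⟩ := exists_total_lt h
  have h1 : flowCost P.m 1 ρ P.ref < (B - P.b * energy P.q ρ) / P.a := by
    rwa [ENNReal.lt_div_iff_mul_lt (Or.inl P.a_ne_zero) (Or.inl P.a_ne_top), lt_tsub_iff_right, mul_comm]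
  obtain ⟨σ, w, hf, ha⟩ := exists_of_flowCost_lt h1
  rw [ENNReal.lt_div_iff_mul_lt (Or.inl P.a_ne_zero) (Or.inl P.a_ne_top), lt_tsub_iff_right, mul_comm] at ha
  exact ⟨(ρ, σ, w), hρ, hf, ha.le⟩

lemma sublevel_midpoint {x y : Measure (E d) × (Q d → ℝ) × (Q d → E d)}
    (hx : x ∈ P.sublevel B) (hy : y ∈ P.sublevel B) :
    ((mid x.1 y.1, fun p => (1 / 2) * (x.2.1 p + y.2.1 p),
      fun p => (1 / 2 : ℝ) • (x.2.2 p + y.2.2 p)) : Measure (E d) × (Q d → ℝ) × _) ∈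
      P.sublevel B := by
  obtain ⟨x1, xf, xa⟩ := hx
  obtain ⟨y1, yf, ya⟩ := hy
  have : IsFiniteMeasure x.1 := ⟨x1.trans_lt one_lt_top⟩
  have : IsFiniteMeasure y.1 := ⟨y1.trans_lt one_lt_top⟩
  have hF := xf.midpoint yf
  rw [mid_self] at hF
  refine ⟨mid_univ_le x1 y1, hF, ?_⟩
  have hact := flowAction_midpoint_le (w' := y.2.2) P.mobility xf.meas_density
    xf.meas_flux xf.density_nonneg yf.density_nonneg
  have hen : energy P.q (mid x.1 y.1) ≤ 2⁻¹ * (energy P.q x.1 + energy P.q y.1) := by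
    rw [← energy_mid]; exact le_self_add
  calc _ ≤ P.a * (2⁻¹ * (flowAction P.m x.2.1 x.2.2 + flowAction P.m y.2.1 y.2.2)) +
      P.b * (2⁻¹ * (energy P.q x.1 + energy P.q y.1)) := by gcongr
    _ = 2⁻¹ * ((P.a * flowAction P.m x.2.1 x.2.2 + P.b * energy P.q x.1) +
      (P.a * flowAction P.m y.2.1 y.2.2 + P.b * energy P.q y.1)) := by ring
    _ ≤ 2⁻¹ * (B + B) := by gcongr
    _ = B := by rw [← two_mul, ← mul_assoc, ENNReal.inv_mul_cancel (by simp) (by simp), one_mul]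

variable (P) in
/-- Near-minimizing flows whose mollifications converge in `L²`. -/
lemma exists_cauchy_flows (hε : 0 < ε) : ∃ x : ℕ → Measure (E d) × (Q d → ℝ) × (Q d → E d),
  (∀ n : ℕ, x n ∈ P.sublevel (P.value + ((n : ℝ≥0∞) + 1)⁻¹)) ∧
  ∃ g w, StronglyMeasurable g ∧ StronglyMeasurable w ∧ MemLp g 2 (slab d) ∧ MemLp w 2 (slab d) ∧
    Tendsto (fun n => eLpNorm (moll ε (x n).2.1 - g) 2 (slab d)) atTop (𝓝 0) ∧
    Tendsto (fun n => eLpNorm (moll ε (x n).2.2 - w) 2 (slab d)) atTop (𝓝 0) := by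
  let K : ℕ → Set (Measure (E d) × (Q d → ℝ) × (Q d → E d)) := fun n =>
    P.sublevel (P.value + ((n : ℝ≥0∞) + 1)⁻¹)
  set C := (ε ^ d)⁻¹ * bumpMax d
  -- On all the sublevel sets considered the functional is at most `P.value + 1`, so the action is
  -- at most (P.value + 1)/a.
  set B : ℝ≥0∞ := ofReal C + ofReal (P.m C) * ((P.value + 1) / P.a)
  have hB : B ≠ ⊤ := by
    refine (add_lt_top.2 ⟨ofReal_lt_top, mul_lt_top ofReal_lt_top (ENNReal.div_lt_top ?_ P.a_ne_zero)⟩).ne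
    exact (add_lt_top.2 ⟨P.value_lt_top, one_lt_top⟩).ne
  have hm : ∀ n, ∀ x ∈ K n, StronglyMeasurable (moll ε x.2.1) ∧ StronglyMeasurable (moll ε x.2.2) :=
    fun n x hx => ⟨stronglyMeasurable_moll hx.2.1.meas_density.stronglyMeasurable,
      stronglyMeasurable_moll hx.2.1.meas_flux.stronglyMeasurable⟩
  have hQB : ∀ n, ∀ x ∈ K n, eLpNorm (moll ε x.2.1) 2 (slab d) ^ 2 +
    eLpNorm (moll ε x.2.2) 2 (slab d) ^ 2 ≤ B := by
    intro n x hx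
    refine (hx.2.1.sq_eLpNorm_moll_le P.mobility hε).trans (add_le_add le_rfl ?_)
    gcongr
    rw [ENNReal.le_div_iff_mul_le (Or.inl P.a_ne_zero) (Or.inl P.a_ne_top), mul_comm]
    refine (le_self_add.trans hx.2.2).trans ?_
    gcongr
    simp
  obtain ⟨x, hxK, hD⟩ := exists_cauchy_of_convex K
    (fun n => sublevel_nonempty (lt_add_right P.value_lt_top.ne (by simp)))
    (fun i j hij x hx => ⟨hx.1, hx.2.1, hx.2.2.trans (by gcongr)⟩) _ hB hQB
    (fun x y => eLpNorm (moll ε x.2.1 - moll ε y.2.1) 2 (slab d) ^ 2 +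
      eLpNorm (moll ε x.2.2 - moll ε y.2.2) 2 (slab d) ^ 2)
    (fun n x hx y hy => ⟨_, sublevel_midpoint hx hy, by
      have e1 := eLpNorm_parallelogram (hm n x hx).1 (hm n y hy).1
        (moll_midpoint hε.le hx.2.1.meas_density.stronglyMeasurable
          hy.2.1.meas_density.stronglyMeasurable hx.2.1.int_density
          hy.2.1.int_density)
      have e2 := eLpNorm_parallelogram (hm n x hx).2 (hm n y hy).2
        (moll_midpoint hε.le hx.2.1.meas_flux.stronglyMeasurable
          hy.2.1.meas_flux.stronglyMeasurable hx.2.1.int_flux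
          hy.2.1.int_flux)
      simp only [smul_eq_mul] at e1
      refine le_of_eq ?_
      calc _ = (eLpNorm (moll ε x.2.1 - moll ε y.2.1) 2 (slab d) ^ 2 +
          4 * eLpNorm (moll ε fun p => (1 / 2) * (x.2.1 p + y.2.1 p)) 2 (slab d) ^ 2) +
          (eLpNorm (moll ε x.2.2 - moll ε y.2.2) 2 (slab d) ^ 2 +
            4 * eLpNorm (moll ε fun p => (1 / 2 : ℝ) • (x.2.2 p + y.2.2 p)) 2 (slab d) ^ 2) := by
            ring
        _ = _ := by rw [e1, e2]; ring⟩)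
  have hsq : ∀ n, eLpNorm (moll ε (x n).2.1) 2 (slab d) ^ 2 < ⊤ ∧
    eLpNorm (moll ε (x n).2.2) 2 (slab d) ^ 2 < ⊤ := fun n =>
    add_lt_top.1 ((hQB n _ (hxK n)).trans_lt hB.lt_top)
  obtain ⟨g, hg, hgL, hgl⟩ := exists_limit_of_cauchy
    (fun n => memLp_of_sq_lt_top (hm n _ (hxK n)).1.aestronglyMeasurable (hsq n).1)
    (tendsto_zero_of_le hD fun p => le_self_add)
  obtain ⟨w, hw, hwL, hwl⟩ := exists_limit_of_cauchy
    (fun n => memLp_of_sq_lt_top (hm n _ (hxK n)).2.aestronglyMeasurable (hsq n).2)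
    (tendsto_zero_of_le hD fun p => le_add_self)
  exact ⟨x, hxK, g, w, hg, hw, hgL, hwL, hgl, hwl⟩

/-- The flows are near-minimizing, so their initial measures converge to γ. Strong L² convergence of
the mollified flows gives pointwise convergence along a subsequence, and Fatou's lemma gives lower
semicontinuity of action and energy. -/
lemma IsLimit.exists_flow (hγ : P.IsLimit γ) (hε : 0 < ε) :
    ∃ σ w, IsFlow 1 (mollify ε γ) (mollify ε P.ref) σ w ∧
      P.a * flowAction P.m σ w + P.b * energy P.q γ ≤ P.value := by
  obtain ⟨x, hx, g, w, hg, hw, hgL, hwL, hgl, hwl⟩ := P.exists_cauchy_flows hε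
  have hm := P.mobility
  have fγ : IsFiniteMeasure γ := ⟨hγ.1.trans_lt one_lt_top⟩
  have fx : ∀ n, IsFiniteMeasure (x n).1 := fun n => ⟨(hx n).1.trans_lt one_lt_top⟩
  have hE : Tendsto (fun n => energyDist P.q (x n).1 γ) atTop (𝓝 0) := by
    refine hγ.2 _ (fun n => (hx n).1) (tendsto_of_tendsto_of_tendsto_of_le_of_le tendsto_const_nhds
      tendsto_value_add (fun n => P.value_le (hx n).1) fun n => le_trans ?_ (hx n).2.2)
    unfold total
    gcongr
    exact flowCost_le (hx n).2.1
  have hms : ∀ n, StronglyMeasurable (moll ε (x n).2.1) := fun n =>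
    stronglyMeasurable_moll (hx n).2.1.meas_density.stronglyMeasurable
  have hmw : ∀ n, StronglyMeasurable (moll ε (x n).2.2) := fun n =>
    stronglyMeasurable_moll (hx n).2.1.meas_flux.stronglyMeasurable
  obtain ⟨φ₁, hφ₁, hae₁⟩ := exists_subseq_ae_tendsto (fun n => (hms n).aestronglyMeasurable)
    hg.aestronglyMeasurable hgl
  obtain ⟨φ₂, hφ₂, hae₂⟩ := exists_subseq_ae_tendsto (fun n => (hmw (φ₁ n)).aestronglyMeasurable)
    hw.aestronglyMeasurable (hwl.comp hφ₁.tendsto_atTop)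
  obtain ⟨φ₃, hφ₃, hheat, hvag⟩ := exists_subseq_vague (q := P.q) (fun n => (hx _).1) hγ.1
    (hE.comp (hφ₁.comp hφ₂).tendsto_atTop)
  let ψ := fun k => φ₁ (φ₂ (φ₃ k))
  have hψ := (hφ₁.comp (hφ₂.comp hφ₃)).tendsto_atTop
  have hF := IsFlow.of_tendsto (α' := JKO.mollify ε γ)
    (fun k => (hx (ψ k)).2.1.mollify hε.le) hg hw hgL hwL (hgl.comp hψ) (hwl.comp hψ) (by
      intro ψ hψ hc
      simp only [← integral_avg_eq hψ hc]
      have hc' := hasCompactSupport_avg hc (ae_bumpLaw_norm_le (d := d) hε.le)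
      exact hvag _ ((contDiff_avg hψ hc).continuous.comp (by fun_prop)) (hasCompactSupport_slice hc' _))
  refine ⟨_, w, hF.1, ?_⟩
  have hA : flowAction P.m (fun p => max (g p) 0) w ≤
    liminf (fun k => flowAction P.m (x (ψ k)).2.1 (x (ψ k)).2.2) atTop := by
    refine le_trans (lintegral_le_liminf_of_ae_tendsto
      (fun k => hm.measurable_actE (hms _).measurable (hmw _).measurable) ?_)
      (liminf_le_liminf (.of_forall fun k => flowAction_moll_le hm hε.le
        (hx _).2.1.meas_density (hx _).2.1.meas_flux (hx _).2.1.density_nonneg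
        (hx _).2.1.int_density))
    filter_upwards [hae₁, hae₂, hF.2] with p h1 h2 h3
    rw [show max (g p) 0 = g p from h3]
    have h1' := h1.comp (hφ₂.comp hφ₃).tendsto_atTop
    have h2' := h2.comp hφ₃.tendsto_atTop
    exact (continuous_ofReal.tendsto _).comp
      ((h2'.norm.pow 2).div ((hm.continuous.tendsto _).comp h1') (hm.pos _).ne')
  have hEn : energy P.q γ ≤ liminf (fun k => energy P.q (x (ψ k)).1) atTop := by
    refine lintegral_le_liminf_of_ae_tendsto
      (fun k => ((measurable_heat P.q _).pow_const 2).ennreal_ofReal) ?_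
    filter_upwards [hheat] with p hp
    exact (continuous_ofReal.tendsto _).comp (hp.pow 2)
  calc _ ≤ P.a * liminf (fun k => flowAction P.m (x (ψ k)).2.1 (x (ψ k)).2.2) atTop +
      P.b * liminf (fun k => energy P.q (x (ψ k)).1) atTop := by gcongr
    _ = liminf (fun k => P.a * flowAction P.m (x (ψ k)).2.1 (x (ψ k)).2.2) atTop +
      liminf (fun k => P.b * energy P.q (x (ψ k)).1) atTop := by
      rw [ENNReal.liminf_const_mul_of_ne_top P.a_ne_top, ENNReal.liminf_const_mul_of_ne_top P.b_ne_top]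
    _ ≤ _ := liminf_add_le
    _ ≤ liminf (fun k => P.value + ((ψ k : ℝ≥0∞) + 1)⁻¹) atTop :=
      liminf_le_liminf (.of_forall fun k => (hx _).2.2)
    _ = P.value := (tendsto_value_add.comp hψ).liminf_eq

/-- The flow between mollifications is completed by a bridge at each end, run in a time fraction x.
The main part is multiplied by (1-x)⁻² and the bridges cost O(x), since γ and the reference measure
have finite energy; let x → 0. -/
lemma IsLimit.total_le (hγ : P.IsLimit γ) : P.total γ ≤ P.value := by
  have fγ : IsFiniteMeasure γ := ⟨hγ.1.trans_lt one_lt_top⟩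
  set C := ofReal (connectConst d P.m P.q)
  set Eγ := energy P.q γ
  have hEγ : Eγ ≠ ⊤ := by
    -- Finiteness of the energy is read off from the flow at one arbitrary radius.
    obtain ⟨σ, w, -, h⟩ := hγ.exists_flow one_pos
    intro htop
    have := (le_add_self.trans h).trans_lt P.value_lt_top
    rw [show energy P.q γ = ⊤ from htop, mul_top P.b_ne_zero] at this
    exact lt_irrefl _ this
  have hkey : ∀ x : ℝ, 0 < x → x < 1 → P.total γ ≤ ofReal ((1 - x)⁻¹ * (1 - x)⁻¹) * P.value +
      ofReal x * (P.a * (ofReal (1 - x)⁻¹ * (C * Eγ) + C * energy P.q P.ref)) := by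
    intro x hx hx1
    set ε := (x ^ 2) ^ (P.q / 2)
    obtain ⟨σ, w, hF, hle⟩ := hγ.exists_flow (ε := ε) (by positivity)
    have h2 := flowCost_bridge (P := P) (u := mollify ε P.ref) hγ.1 hx hx1
    rw [flowCost_comm P.mobility, flowCost_comm P.mobility 1 (mollify ε P.ref)] at h2
    have h3 := flowCost_le (m := P.m) hF
    set r := ofReal (1 - x)⁻¹
    have hr : 1 ≤ r * r := by
      have : 1 ≤ r := by
        rw [← ofReal_one]
        exact ofReal_le_ofReal ((one_le_inv₀ (by linarith)).2 (by linarith))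
      calc 1 = 1 * 1 := (one_mul 1).symm
        _ ≤ r * r := by gcongr
    rw [ofReal_mul (by positivity)]
    calc P.total γ ≤ P.a * (r * (r * flowAction P.m σ w + C * ofReal x * Eγ) +
          C * ofReal x * energy P.q P.ref) + P.b * (r * r * Eγ) := by
          unfold total
          gcongr
          · refine (flowCost_bridge (P := P) (by simp) hx hx1).trans ?_
            gcongr
            refine h2.trans ?_
            gcongr
          · calc energy P.q γ = 1 * energy P.q γ := (one_mul _).symm
              _ ≤ _ := by gcongr
      _ = r * r * (P.a * flowAction P.m σ w + P.b * Eγ) +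
          ofReal x * (P.a * (r * (C * Eγ) + C * energy P.q P.ref)) := by ring
      _ ≤ _ := by gcongr
  have hlim : Tendsto (fun x : ℝ => ofReal ((1 - x)⁻¹ * (1 - x)⁻¹) * P.value +
      ofReal x * (P.a * (ofReal (1 - x)⁻¹ * (C * Eγ) + C * energy P.q P.ref)))
      (𝓝[>] 0) (𝓝 (ofReal ((1 - 0)⁻¹ * (1 - 0)⁻¹) * P.value + ofReal 0 *
        (P.a * (ofReal (1 - 0)⁻¹ * (C * Eγ) + C * energy P.q P.ref)))) := by
    have hinv : Tendsto (fun x : ℝ => (1 - x)⁻¹) (𝓝[>] 0) (𝓝 (1 - 0)⁻¹) :=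
      Tendsto.mono_left ((tendsto_const_nhds.sub tendsto_id).inv₀ (by norm_num)) nhdsWithin_le_nhds
    have hCE : C * Eγ ≠ ⊤ := mul_ne_top ofReal_ne_top hEγ
    have hCr : C * energy P.q P.ref ≠ ⊤ := mul_ne_top ofReal_ne_top P.energy_lt.ne
    refine (ENNReal.Tendsto.mul_const ((continuous_ofReal.tendsto _).comp (hinv.mul hinv))
      (Or.inr P.value_lt_top.ne)).add (ENNReal.Tendsto.mul
      ((continuous_ofReal.tendsto _).mono_left nhdsWithin_le_nhds) (Or.inr ?_)
      (ENNReal.Tendsto.const_mul ((ENNReal.Tendsto.mul_const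
        ((continuous_ofReal.tendsto _).comp hinv) (Or.inr hCE)).add tendsto_const_nhds)
        (Or.inr P.a_ne_top)) (Or.inr ofReal_ne_top))
    exact mul_ne_top P.a_ne_top (add_ne_top.2 ⟨mul_ne_top ofReal_ne_top hCE, hCr⟩)
  simp at hlim
  refine ge_of_tendsto hlim ?_
  have h1 : ∀ᶠ x : ℝ in 𝓝[>] 0, x < 1 := nhdsWithin_le_nhds (Iio_mem_nhds one_pos)
  filter_upwards [h1, self_mem_nhdsWithin] with x hx1 hx using hkey x hx hx1

end Problem

end

/-! ### Conservation of mass in dimension at most two. -/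

lemma IsFlow.integral_fderiv_fst (h : IsFlow N γ₀ γ₁ σ w) {φ : E d → ℝ} (hφ : ContDiff ℝ 1 φ)
    (hc : HasCompactSupport φ) :
    ∫ p, fderiv ℝ φ p.1 (w p) ∂slab d = ∫ x, φ x ∂γ₁ - ∫ x, φ x ∂γ₀ := by
  have h1 := h.tracePrim_one hφ hc
  rw [tracePrim_eq zero_le_one] at h1
  have h2 : ∫ s, (Iic 1).indicator (fluxRate φ w) s ∂timeM = ∫ s, fluxRate φ w s ∂timeM := by
    apply integral_congr_ae
    filter_upwards [ae_timeM] with s hs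
    exact indicator_of_mem (show s ∈ Iic 1 from hs.2.le) _
  have h3 : ∫ p, fderiv ℝ φ p.1 (w p) ∂slab d = ∫ s, fluxRate φ w s ∂timeM :=
    integral_prod_symm _ (h.integrable_fderiv_fst hφ hc)
  linarith

lemma IsFlow.lintegral_flux_le (hm : IsMobility m) (h : IsFlow N γ₀ γ₁ σ w)
    {S : Set (Q d)} : ∫⁻ p in S, ‖w p‖ₑ ∂slab d ≤ (∫⁻ p in S, actE m (σ p) (w p) ∂slab d) ^ (1 / 2 : ℝ) *
        (∫⁻ p in S, ofReal (m (σ p)) ∂slab d) ^ (1 / 2 : ℝ) := by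
  have hact := hm.measurable_actE h.meas_density h.meas_flux
  have hmσ := (hm.continuous.measurable.comp h.meas_density).ennreal_ofReal
  calc ∫⁻ p in S, ‖w p‖ₑ ∂slab d
      = ∫⁻ p in S, (actE m (σ p) (w p)) ^ (1 / 2 : ℝ) * (ofReal (m (σ p))) ^ (1 / 2 : ℝ) ∂slab d := by
        refine lintegral_congr fun p => ?_
        rw [← mul_rpow_of_nonneg _ _ (by norm_num), mul_comm, ← hm.ofReal_normSq_eq,
          ofReal_pow (norm_nonneg _), ofReal_norm, ← rpow_natCast, ← rpow_mul]
        norm_num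
    _ ≤ _ := by
      refine (ENNReal.lintegral_mul_le_Lp_mul_Lq _ Real.HolderConjugate.two_two
        (hact.pow_const _).aemeasurable (hmσ.pow_const _).aemeasurable).trans_eq ?_
      simp only [← rpow_mul]
      norm_num

lemma lintegral_density_le (h : IsFlow N γ₀ γ₁ σ w) : ∫⁻ p, ofReal (σ p) ∂slab d ≤ N := by
  rw [lintegral_slab h.meas_density.ennreal_ofReal]
  exact (lintegral_mono_ae h.mass_le).trans (by simp)

/-- In dimension at most two, flows of finite action do not lose mass at infinity. -/
lemma IsFlow.measure_univ_eq (hm : IsMobility m) (hd : d ≤ 2) (hN : N ≠ ⊤)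
    [IsFiniteMeasure γ₀] [IsFiniteMeasure γ₁] (h : IsFlow N γ₀ γ₁ σ w)
    (hA : flowAction m σ w ≠ ⊤) : γ₀ univ = γ₁ univ := by
  obtain ⟨B, hB0, hB⟩ := hm.le_linear
  have hact := hm.measurable_actE h.meas_density h.meas_flux
  have hmpos := (hm.pos 0).le
  set V := volume.real (Metric.ball (0 : E d) 1)
  have hV0 : 0 ≤ V := measureReal_nonneg
  -- By linear growth of m, the integral of m(σ) over the ball of radius R ≥ 1 is at most L·R² when
  -- d ≤ 2: volume for the constant part, total mass for the linear part.
  set L : ℝ≥0∞ := ofReal (m 0 * V) + ofReal B * N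
  have hL : L ≠ ⊤ := add_ne_top.2 ⟨ofReal_ne_top, mul_ne_top ofReal_ne_top hN⟩
  have hgrow : ∀ R : ℝ, 1 ≤ R → (∫⁻ p in cyl d R, ofReal (m (σ p)) ∂slab d) ^ (1 / 2 : ℝ) ≤
    L ^ (1 / 2 : ℝ) * ofReal R := by
    intro R hR
    have h1 : ∫⁻ p in cyl d R, ofReal (m (σ p)) ∂slab d ≤ L * ofReal (R ^ 2) := by
      calc ∫⁻ p in cyl d R, ofReal (m (σ p)) ∂slab d
          ≤ ∫⁻ p in cyl d R, (ofReal (m 0) + ofReal B * ofReal (σ p)) ∂slab d := by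
            refine lintegral_mono fun p => ?_
            rw [← ofReal_mul hB0, ← ofReal_add hmpos (mul_nonneg hB0 (h.density_nonneg p))]
            exact ofReal_le_ofReal (hB _ (h.density_nonneg p))
        _ = ofReal (m 0) * slab d (cyl d R) +
          ofReal B * ∫⁻ p in cyl d R, ofReal (σ p) ∂slab d := by
          rw [lintegral_add_left measurable_const, lintegral_const_mul' _ _ ofReal_ne_top]
          simp
        _ ≤ ofReal (m 0) * (ofReal V * ofReal (R ^ 2)) +
          ofReal B * N * 1 := by
          rw [mul_one]
          gcongr
          · have : slab d (cyl d R) = volume (Metric.ball (0 : E d) R) := by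
              unfold slab cyl
              rw [Measure.prod_prod]; simp
            rw [this, Measure.addHaar_ball_of_pos _ _ (by linarith), finrank_euclideanSpace_fin,
              ofReal_measureReal, mul_comm]
            gcongr
          · exact (setLIntegral_le_lintegral _ _).trans (lintegral_density_le h)
        _ ≤ ofReal (m 0) * (ofReal V * ofReal (R ^ 2)) +
          ofReal B * N * ofReal (R ^ 2) := by
          gcongr
          rw [← ofReal_one]
          exact ofReal_le_ofReal (one_le_pow₀ hR)
        _ = _ := by
          simp only [L]
          rw [ofReal_mul hmpos]
          ring
    refine (ENNReal.rpow_le_rpow h1 (by norm_num)).trans_eq ?_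
    rw [mul_rpow_of_nonneg _ _ (by norm_num), ofReal_pow (by linarith), ← rpow_natCast, ← rpow_mul]
    norm_num
  let χ : ContDiffBump (0 : E d) := ⟨1, 2, one_pos, by norm_num⟩
  have hχd : ContDiff ℝ 1 χ := χ.contDiff
  obtain ⟨C, hC⟩ := (hχd.continuous_fderiv (by norm_num)).bounded_above_of_compact_support
    (χ.hasCompactSupport.fderiv ℝ)
  let r : ℕ → ℝ := fun k => (k : ℝ) + 1
  have hr1 : ∀ k, 1 ≤ r k := fun k => by simp [r]
  have hr0 : ∀ k, 0 < r k := fun k => one_pos.trans_le (hr1 k)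
  have hrt : Tendsto r atTop atTop := tendsto_natCast_atTop_atTop.atTop_add tendsto_const_nhds
  -- Cutoffs at radius r², split at radius r. The gradient is O(r⁻²). Inside radius r the flux is
  -- O(r) by Cauchy-Schwarz, contributing O(1/r). Between r and 3r² the flux is O(r²) times the
  -- square root of the action outside radius r, which tends to 0.
  let φ : ℕ → E d → ℝ := fun k x => χ (((r k ^ 2)⁻¹ : ℝ) • x)
  have hφ : ∀ k, ContDiff ℝ 1 (φ k) := fun k => hχd.comp (by fun_prop)
  have hφc : ∀ k, HasCompactSupport (φ k) := fun k =>
    χ.hasCompactSupport.comp_smul (inv_ne_zero (pow_ne_zero 2 (hr0 k).ne'))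
  have hlim : ∀ (γ : Measure (E d)) [IsFiniteMeasure γ],
    Tendsto (fun k => ∫ x, φ k x ∂γ) atTop (𝓝 (γ.real univ)) := by
    intro γ _
    have : γ.real univ = ∫ x : E d, (1 : ℝ) ∂γ := by simp
    rw [this]
    refine tendsto_integral_of_dominated_convergence (fun _ => 1)
      (fun k => (hφ k).continuous.aestronglyMeasurable) (integrable_const _)
      (fun k => .of_forall fun x => ?_) (.of_forall fun x => ?_)
    · rw [norm_of_nonneg χ.nonneg]; exact χ.le_one
    · have h0 := (tendsto_inv_atTop_zero.comp ((tendsto_pow_atTop two_ne_zero).comp hrt)).smul_const x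
      have h1 := (hχd.continuous.tendsto _).comp h0
      rwa [(χ.one_of_mem_closedBall (by simp [χ]))] at h1
  let δ : ℕ → ℝ≥0∞ := fun k => ∫⁻ p in (cyl d (r k))ᶜ, actE m (σ p) (w p) ∂slab d
  have hδ : Tendsto δ atTop (𝓝 0) := by
    have hI : Tendsto (fun k => (slab d).withDensity (fun p => actE m (σ p) (w p)) (cyl d (r k))ᶜ) atTop
      (𝓝 ((slab d).withDensity (fun p => actE m (σ p) (w p)) (⋂ k, (cyl d (r k))ᶜ))) := by
      refine tendsto_measure_iInter_atTop (fun k => (measurableSet_cyl _).compl.nullMeasurableSet) ?_ ⟨0, ?_⟩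
      · intro i j hij p hp hpi
        refine hp ?_
        simp only [mem_cyl] at hpi ⊢
        exact hpi.trans_le (by simp only [r]; gcongr)
      · rw [withDensity_apply _ (measurableSet_cyl _).compl]
        exact ((setLIntegral_le_lintegral _ _).trans_lt hA.lt_top).ne
    have he : ⋂ k, (cyl d (r k))ᶜ = ∅ := by
      refine eq_empty_of_forall_notMem fun p hp => ?_
      obtain ⟨k, hk⟩ := (hrt.eventually (eventually_gt_atTop ‖p.1‖)).exists
      exact mem_iInter.1 hp k (by simp [cyl, hk])
    rw [he, measure_empty] at hI
    exact hI.congr fun k => withDensity_apply _ (measurableSet_cyl _).compl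
  have hbound : ∀ k, ‖∫ x, φ k x ∂γ₁ - ∫ x, φ k x ∂γ₀‖ₑ ≤ ofReal C *
    (flowAction m σ w ^ (1 / 2 : ℝ) * L ^ (1 / 2 : ℝ) * ofReal (r k)⁻¹ +
      δ k ^ (1 / 2 : ℝ) * (L ^ (1 / 2 : ℝ) * ofReal 3)) := by
    intro k
    have hC0 : 0 ≤ C := (norm_nonneg _).trans (hC 0)
    have hk := hr0 k
    have hfd : ∀ x, fderiv ℝ (φ k) x = ((r k ^ 2)⁻¹ : ℝ) • fderiv ℝ χ (((r k ^ 2)⁻¹ : ℝ) • x) :=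
      fun x => fderiv_comp_smul _
    rw [← h.integral_fderiv_fst (hφ k) (hφc k)]
    refine (enorm_integral_le_lintegral_enorm _).trans ?_
    calc ∫⁻ p, ‖fderiv ℝ (φ k) p.1 (w p)‖ₑ ∂slab d
        ≤ ∫⁻ p in cyl d (3 * r k ^ 2), ofReal (C * (r k ^ 2)⁻¹) * ‖w p‖ₑ ∂slab d := by
          rw [← lintegral_indicator (measurableSet_cyl _)]
          refine lintegral_mono fun p => ?_
          by_cases hp : p ∈ cyl d (3 * r k ^ 2)
          · rw [indicator_of_mem hp]
            refine ((fderiv ℝ (φ k) p.1).le_opENorm _).trans ?_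
            gcongr
            rw [← ofReal_norm, hfd, norm_smul, norm_of_nonneg (by positivity), mul_comm]
            exact ofReal_le_ofReal (by gcongr; exact hC _)
          · have : fderiv ℝ (φ k) p.1 = 0 := by
              rw [hfd]
              have hz : fderiv ℝ χ (((r k ^ 2)⁻¹ : ℝ) • p.1) = 0 := by
                refine image_eq_zero_of_notMem_tsupport fun hm' => hp ?_
                have h1 := tsupport_fderiv_subset ℝ hm'
                rw [χ.tsupport_eq, mem_closedBall_zero_iff, norm_smul,
                  norm_of_nonneg (by positivity), inv_mul_le_iff₀ (by positivity)] at h1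
                have h2 : (0 : ℝ) < r k ^ 2 := by positivity
                have h3 := h1
                simp only [mem_cyl]
                linarith
              rw [hz, smul_zero]
            simp [this]
      _ ≤ ofReal (C * (r k ^ 2)⁻¹) * ((∫⁻ p in cyl d (r k), ‖w p‖ₑ ∂slab d) +
        ∫⁻ p in (cyl d (r k))ᶜ ∩ cyl d (3 * r k ^ 2), ‖w p‖ₑ ∂slab d) := by
        rw [lintegral_const_mul' _ _ ofReal_ne_top]
        gcongr
        refine (lintegral_mono_set (fun p hp => ?_)).trans (lintegral_union_le _ _ _)
        by_cases h1 : p ∈ cyl d (r k)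
        · exact Or.inl h1
        · exact Or.inr ⟨h1, hp⟩
      _ ≤ ofReal (C * (r k ^ 2)⁻¹) * (flowAction m σ w ^ (1 / 2 : ℝ) *
        (L ^ (1 / 2 : ℝ) * ofReal (r k)) +
        δ k ^ (1 / 2 : ℝ) * (L ^ (1 / 2 : ℝ) * ofReal (3 * r k ^ 2))) := by
        gcongr
        · refine (h.lintegral_flux_le hm).trans ?_
          gcongr
          · exact setLIntegral_le_lintegral _ _
          · exact hgrow _ (hr1 k)
        · refine (h.lintegral_flux_le hm).trans ?_
          gcongr
          · exact lintegral_mono_set inter_subset_left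
          · refine le_trans ?_ (hgrow _ (by nlinarith [hr1 k]))
            gcongr
            exact inter_subset_right
      _ = ofReal C * (flowAction m σ w ^ (1 / 2 : ℝ) * L ^ (1 / 2 : ℝ) *
        (ofReal (r k ^ 2)⁻¹ * ofReal (r k)) +
        δ k ^ (1 / 2 : ℝ) * (L ^ (1 / 2 : ℝ) * (ofReal (r k ^ 2)⁻¹ * ofReal (3 * r k ^ 2)))) := by
        rw [ofReal_mul hC0]; ring
      _ = _ := by
        rw [← ofReal_mul (by positivity), ← ofReal_mul (by positivity)]
        congr 5
        · field_simp
        · field_simp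
  have hz : Tendsto (fun k => ‖∫ x, φ k x ∂γ₁ - ∫ x, φ k x ∂γ₀‖ₑ) atTop (𝓝 0) := by
    have hAL : flowAction m σ w ^ (1 / 2 : ℝ) * L ^ (1 / 2 : ℝ) ≠ ⊤ :=
      mul_ne_top (rpow_ne_top_of_nonneg (by norm_num) hA) (rpow_ne_top_of_nonneg (by norm_num) hL)
    have hL3 : L ^ (1 / 2 : ℝ) * ofReal 3 ≠ ⊤ :=
      mul_ne_top (rpow_ne_top_of_nonneg (by norm_num) hL) ofReal_ne_top
    have hinv : Tendsto (fun k => ofReal (r k)⁻¹) atTop (𝓝 0) := by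
      have := (continuous_ofReal.tendsto _).comp (tendsto_inv_atTop_zero.comp hrt)
      rwa [ofReal_zero] at this
    have hsq : Tendsto (fun k => δ k ^ (1 / 2 : ℝ)) atTop (𝓝 0) := by
      have := (ENNReal.continuous_rpow_const (y := (1 / 2 : ℝ))).tendsto 0 |>.comp hδ
      rwa [ENNReal.zero_rpow_of_pos (by norm_num)] at this
    have := ENNReal.Tendsto.const_mul (a := ofReal C) ((ENNReal.Tendsto.const_mul hinv (Or.inr hAL)).add
        (ENNReal.Tendsto.mul_const hsq (Or.inr hL3))) (Or.inr ofReal_ne_top)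
    simp only [mul_zero, zero_mul, add_zero] at this
    exact tendsto_zero_of_le this hbound
  have hz' := tendsto_nhds_unique hz ((hlim γ₁).sub (hlim γ₀)).enorm
  have h0 := enorm_eq_zero.1 hz'.symm
  exact ((measureReal_eq_measureReal_iff (measure_ne_top _ _) (measure_ne_top _ _)).1 (by linarith))

/-! ### Regularized Newtonian potentials. -/

section

variable {p : ℝ}

/-- Powers of the regularized distance to the origin. -/
def pot (R p : ℝ) (x : E d) : ℝ := (R ^ 2 + ‖x‖ ^ 2) ^ (-p)

lemma pot_pos (hR : 0 < R) (x : E d) : 0 < pot R p x := by unfold pot; positivity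

lemma sq_mul_pot (hR : 0 < R) (x : E d) : (R ^ 2 + ‖x‖ ^ 2) * pot R (p + 1) x = pot R p x := by
  have h : 0 < R ^ 2 + ‖x‖ ^ 2 := by positivity
  unfold pot
  conv_lhs => rw [← Real.rpow_one (R ^ 2 + ‖x‖ ^ 2), ← Real.rpow_mul h.le, ← rpow_add h]
  congr 1; ring

lemma pot_mul_pot (hR : 0 < R) {p' : ℝ} (x : E d) : pot R p x * pot R p' x = pot R (p + p') x := by
  unfold pot
  rw [← rpow_add (by positivity)]
  congr 1; ring

lemma contDiff_pot (hR : 0 < R) : ContDiff ℝ 1 (pot R p : E d → ℝ) := by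
  refine ContDiff.rpow_const_of_ne (contDiff_const.add (contDiff_norm_sq ℝ)) fun x => ?_
  positivity

lemma hasFDerivAt_pot (hR : 0 < R) (x : E d) :
    HasFDerivAt (pot R p) ((-2 * p * pot R (p + 1) x) • innerSL ℝ x) x := by
  have h1 := ((hasStrictFDerivAt_norm_sq x).hasFDerivAt.const_add (R ^ 2)).rpow_const (p := -p)
    (Or.inl (by positivity))
  refine h1.congr_fderiv ?_
  unfold pot
  ext v
  simp
  ring

lemma pot_le (hR : 0 < R) (hp : 0 ≤ p) (x : E d) : pot R p x ≤ R ^ (-2 * p) := by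
  unfold pot
  rw [show -2 * p = 2 * -p by ring, Real.rpow_mul hR.le, rpow_two]
  exact Real.rpow_le_rpow_of_nonpos (by positivity) (by nlinarith [norm_nonneg x]) (by linarith)

lemma pot_eq_smul (hR : 0 < R) (x : E d) : pot R p x = R ^ (-2 * p) * pot 1 p (R⁻¹ • x) := by
  unfold pot
  rw [show -2 * p = 2 * -p by ring, Real.rpow_mul hR.le, rpow_two,
    ← mul_rpow (by positivity) (by positivity), norm_smul, norm_of_nonneg (by positivity)]
  congr 1
  field_simp

lemma integrable_pot (hR : 0 < R) (hp : (d : ℝ) < 2 * p) : Integrable (pot R p : E d → ℝ) := by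
  have h1 : Integrable (pot 1 p : E d → ℝ) := by
    have := integrable_rpow_neg_one_add_norm_sq (E := E d) (μ := volume) (by simpa using hp)
    unfold pot
    convert this using 3
    · norm_num
    · ring
  have h2 := (h1.comp_smul (inv_ne_zero hR.ne')).const_mul (R ^ (-2 * p))
  exact h2.congr (.of_forall fun x => (pot_eq_smul hR x).symm)

lemma integral_pot (hR : 0 < R) : ∫ x : E d, pot R p x = R ^ ((d : ℝ) - 2 * p) * ∫ x : E d, pot 1 p x := by
  simp_rw [pot_eq_smul hR]
  rw [integral_const_mul, Measure.integral_comp_inv_smul_of_nonneg _ _ hR.le, smul_eq_mul,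
    finrank_euclideanSpace_fin, ← mul_assoc, ← Real.rpow_natCast, ← rpow_add hR]
  congr 2; ring

lemma tendsto_pot_cocompact (hp : 0 < p) : Tendsto (pot R p) (cocompact (E d)) (𝓝 0) := by
  refine (tendsto_rpow_neg_atTop hp).comp ?_
  exact tendsto_const_nhds.add_atTop ((tendsto_pow_atTop two_ne_zero).comp tendsto_norm_cocompact_atTop)

/-- The radial field with potential `pot R p`. -/
def radial (R p : ℝ) (x : E d) : E d := (-2 * p * pot R (p + 1) x) • x

lemma continuous_radial (hR : 0 < R) : Continuous (radial R p : E d → E d) :=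
  ((contDiff_pot hR).continuous.const_mul _).smul continuous_id

lemma fderiv_pot (hR : 0 < R) (x v : E d) : fderiv ℝ (pot R p) x v = inner ℝ (radial R p x) v := by
  rw [(hasFDerivAt_pot hR x).fderiv, radial, inner_smul_left]
  simp

lemma sq_norm_radial_le (hR : 0 < R) (x : E d) : ‖radial R p x‖ ^ 2 ≤ 4 * p ^ 2 * pot R (2 * p + 1) x := by
  have h1 : ‖x‖ ^ 2 * (pot R (p + 1) x * pot R (p + 1) x) ≤ pot R (2 * p + 1) x := by
    rw [pot_mul_pot hR, ← sq_mul_pot (p := 2 * p + 1) hR x, show p + 1 + (p + 1) = 2 * p + 1 + 1 by ring]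
    have := pot_pos (p := 2 * p + 1 + 1) hR x
    gcongr
    nlinarith
  unfold radial
  rw [norm_smul, mul_pow, norm_eq_abs, sq_abs]
  nlinarith [sq_nonneg p]

/-- The potential `pot R ((d - 2) / 2)` is superharmonic. -/
lemma integral_fderiv_radial (hR : 0 < R) {φ : E d → ℝ} (hφ : ContDiff ℝ 1 φ)
    (hc : HasCompactSupport φ) (hp : 2 * (p + 1) = d) :
    ∫ x, fderiv ℝ φ x (radial R p x) = ∫ x, φ x * (2 * p * d * R ^ 2 * pot R (p + 2) x) := by
  set f : Fin d → E d → ℝ := fun i x => -2 * p * pot R (p + 1) x * x i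
  have hpc : ContDiff ℝ 1 (pot R (p + 1) : E d → ℝ) := contDiff_pot hR
  have hf : ∀ i, ContDiff ℝ 1 (f i) := fun i => (contDiff_const.mul hpc).mul (by fun_prop)
  let e : Fin d → E d := fun i => EuclideanSpace.single i 1
  have hrad : ∀ x, radial R p x = ∑ i, f i x • e i := by
    intro x
    ext j
    simp [radial, f, e, Finset.sum_apply, Pi.single_apply]
  have hfe : ∀ i x, fderiv ℝ (f i) x (e i) =
      -2 * p * pot R (p + 1) x + 4 * p * (p + 1) * pot R (p + 2) x * x i ^ 2 := by
    intro i x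
    have h1 : HasFDerivAt (fun x => x i) (EuclideanSpace.proj (𝕜 := ℝ) i) x :=
      (EuclideanSpace.proj (𝕜 := ℝ) i : E d →L[ℝ] ℝ).hasFDerivAt
    have h2 := ((hasFDerivAt_pot (p := p + 1) hR x).const_mul (-2 * p)).mul h1
    have h3 : HasFDerivAt (f i) _ x := h2
    rw [h3.fderiv]
    simp [e, EuclideanSpace.inner_single_right]
    ring
  have hcont := hφ.continuous_fderiv one_ne_zero
  have hi1 : ∀ i, Integrable fun x => f i x * fderiv ℝ φ x (e i) := fun i =>
    ((hf i).continuous.mul (hcont.clm_apply continuous_const)).integrable_of_hasCompactSupport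
      ((hc.fderiv_apply (𝕜 := ℝ) (e i)).mul_left)
  have hi2 : ∀ i, Integrable fun x => fderiv ℝ (f i) x (e i) * φ x := fun i =>
    ((((hf i).continuous_fderiv (by norm_num)).clm_apply continuous_const).mul
      hφ.continuous).integrable_of_hasCompactSupport hc.mul_left
  have hi3 : ∀ i, Integrable fun x => f i x * φ x := fun i =>
    ((hf i).continuous.mul hφ.continuous).integrable_of_hasCompactSupport hc.mul_left
  calc ∫ x, fderiv ℝ φ x (radial R p x) = ∫ x, ∑ i, f i x * fderiv ℝ φ x (e i) := by
        refine integral_congr_ae (.of_forall fun x => ?_)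
        simp only [hrad, map_sum, map_smul, smul_eq_mul]
    _ = ∑ i, -∫ x, fderiv ℝ (f i) x (e i) * φ x := by
        rw [integral_finsetSum _ fun i _ => hi1 i]
        exact sum_congr rfl fun i _ => integral_mul_fderiv_eq_neg_fderiv_mul_of_integrable
          (hi2 i) (hi1 i) (hi3 i) (fun x _ => (hf i).differentiable (by norm_num) x)
          fun x _ => hφ.differentiable (by norm_num) x
    _ = -∫ x, ∑ i, fderiv ℝ (f i) x (e i) * φ x := by
        rw [Finset.sum_neg_distrib, integral_finsetSum _ fun i _ => hi2 i]
    _ = _ := by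
        rw [← integral_neg]
        refine integral_congr_ae (.of_forall fun x => ?_)
        simp only [hfe]
        -- With 2(p+1) = d the terms containing ‖x‖² cancel, and the part with R² remains.
        rw [← Finset.sum_mul, Finset.sum_add_distrib, ← Finset.mul_sum, ← Finset.mul_sum,
          show ∑ i, x i ^ 2 = ‖x‖ ^ 2 by rw [EuclideanSpace.real_norm_sq_eq],
          ← sq_mul_pot (p := p + 1) hR x]
        simp
        rw [show p + 1 + 1 = p + 2 by ring, ← hp]
        ring

end

/-! ### Testing flows with functions that vanish at infinity. -/

/-- A cutoff from below: zero on `[0,1]` and the identity on `[2,∞)`. -/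
def lowCut (s : ℝ) : ℝ := s * smoothTransition (s - 1)

lemma contDiff_lowCut : ContDiff ℝ 1 lowCut :=
  contDiff_id.mul (smoothTransition.contDiff.comp (contDiff_id.sub contDiff_const))

lemma lowCut_of_le {s : ℝ} (h : s ≤ 1) : lowCut s = 0 := by
  simp [lowCut, smoothTransition.zero_of_nonpos (sub_nonpos.2 h)]

lemma lowCut_of_ge {s : ℝ} (h : 2 ≤ s) : lowCut s = s := by
  simp [lowCut, smoothTransition.one_of_one_le (by linarith : 1 ≤ s - 1)]

lemma deriv_lowCut_of_gt {s : ℝ} (h : 2 < s) : deriv lowCut s = 1 := by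
  have : lowCut =ᶠ[𝓝 s] id := by filter_upwards [Ioi_mem_nhds h] with y hy using lowCut_of_ge (le_of_lt hy)
  rw [this.deriv_eq, deriv_id]

lemma exists_deriv_lowCut_le : ∃ C, ∀ s, 0 ≤ s → |deriv lowCut s| ≤ C := by
  obtain ⟨C, hC⟩ := isCompact_Icc.exists_bound_of_continuousOn
    (contDiff_lowCut.continuous_deriv le_rfl).continuousOn
  refine ⟨max C 1, fun s hs => ?_⟩
  by_cases h : s ≤ 2
  · exact (hC s ⟨hs, h⟩).trans (le_max_left _ _)
  · rw [deriv_lowCut_of_gt (not_le.1 h), abs_one]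
    exact le_max_right _ _

/-- Flows can be tested with functions vanishing at infinity. -/
lemma IsFlow.integral_fderiv_of_decay [IsFiniteMeasure γ₀] [IsFiniteMeasure γ₁]
    (h : IsFlow N γ₀ γ₁ σ w) (hf : ContDiff ℝ 1 f) (hpos : ∀ x, 0 < f x)
    (hM : ∀ x, f x ≤ M)
    (hf0 : Tendsto f (cocompact (E d)) (𝓝 0))
    (hi : Integrable (fun p => fderiv ℝ f p.1 (w p)) (slab d)) :
    ∫ p, fderiv ℝ f p.1 (w p) ∂slab d = ∫ x, f x ∂γ₁ - ∫ x, f x ∂γ₀ := by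
  obtain ⟨C, hC⟩ := exists_deriv_lowCut_le
  let r : ℕ → ℝ := fun k => (k : ℝ) + 1
  have hr : ∀ k, 0 < r k := fun k => by positivity
  -- It vanishes where f ≤ 1/r k, hence has compact support, and equals f where f ≥ 2/r k. Its
  -- derivative is a bounded multiple of that of f.
  let g := fun k x => (r k)⁻¹ * lowCut (r k * f x)
  have hg : ∀ k, ContDiff ℝ 1 (g k) := fun k =>
    contDiff_const.mul (contDiff_lowCut.comp (contDiff_const.mul hf))
  have hgc : ∀ k, HasCompactSupport (g k) := by
    intro k
    have h1 := hf0.eventually (gt_mem_nhds (inv_pos.2 (hr k)))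
    rw [Filter.eventually_iff, mem_cocompact] at h1
    obtain ⟨K, hK, hK'⟩ := h1
    refine HasCompactSupport.intro hK fun x hx => ?_
    have h2 : f x < (r k)⁻¹ := hK' hx
    rw [lt_inv_comm₀ (hpos x) (hr k), ← one_div, lt_div_iff₀ (hpos x)] at h2
    simp only [g]
    rw [lowCut_of_le h2.le, mul_zero]
  have hgd : ∀ k x v, fderiv ℝ (g k) x v = deriv lowCut (r k * f x) * fderiv ℝ f x v := by
    intro k x v
    have h1 := (hf.differentiable (by norm_num) x).hasFDerivAt.const_mul (r k)
    have h2 := (contDiff_lowCut.differentiable (by norm_num) (r k * f x)).hasDerivAt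
    have h3 := h2.comp_hasFDerivAt x h1
    have h4 : HasFDerivAt (g k) _ x := h3.const_mul (r k)⁻¹
    rw [h4.fderiv]
    simp
    have := (hr k).ne'
    field_simp
  have hlarge : ∀ x, ∀ᶠ k in atTop, 2 < r k * f x := fun x =>
    ((tendsto_natCast_atTop_atTop.atTop_add tendsto_const_nhds).atTop_mul_const (hpos x)).eventually
      (eventually_gt_atTop 2)
  have hlim : ∀ (γ : Measure (E d)) [IsFiniteMeasure γ],
    Tendsto (fun k => ∫ x, g k x ∂γ) atTop (𝓝 (∫ x, f x ∂γ)) := by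
    intro γ _
    have hfi : Integrable f γ := by
      refine Integrable.of_bound hf.continuous.aestronglyMeasurable M (.of_forall fun x => ?_)
      rw [norm_of_nonneg (hpos x).le]
      exact hM x
    refine tendsto_integral_of_dominated_convergence f (fun k => (hg k).continuous.aestronglyMeasurable) hfi
      (fun k => .of_forall fun x => ?_) (.of_forall fun x => ?_)
    · have h0 := hr k
      have h1 := hpos x
      have h2 := smoothTransition.nonneg (r k * f x - 1)
      have h4 : g k x = f x * smoothTransition (r k * f x - 1) := by simp only [g, lowCut]; field_simp
      rw [h4, norm_of_nonneg (by positivity)]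
      exact mul_le_of_le_one_right h1.le (smoothTransition.le_one (r k * f x - 1))
    · refine tendsto_const_nhds.congr' ?_
      filter_upwards [hlarge x] with k hk
      simp only [g]
      rw [lowCut_of_ge hk.le, inv_mul_cancel_left₀ (hr k).ne']
  have hL : Tendsto (fun k => ∫ p, fderiv ℝ (g k) p.1 (w p) ∂slab d) atTop
    (𝓝 (∫ p, fderiv ℝ f p.1 (w p) ∂slab d)) := by
    refine tendsto_integral_of_dominated_convergence (fun p => C * ‖fderiv ℝ f p.1 (w p)‖)
      (fun k => (h.integrable_fderiv_fst (hg k) (hgc k)).aestronglyMeasurable) (hi.norm.const_mul C)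
      (fun k => .of_forall fun p => ?_) (.of_forall fun p => ?_)
    · rw [hgd, norm_mul]
      gcongr
      exact hC _ (mul_nonneg (hr k).le (hpos _).le)
    · refine tendsto_const_nhds.congr' ?_
      filter_upwards [hlarge p.1] with k hk
      rw [hgd, deriv_lowCut_of_gt hk, one_mul]
  simp only [h.integral_fderiv_fst (hg _) (hgc _)] at hL
  exact tendsto_nhds_unique hL ((hlim γ₁).sub (hlim γ₀))

/-! ### Perturbing a flow by mass that is carried off to infinity. -/

/-- The measure with density `ρ`. -/
def densityM (ρ : E d → ℝ) : Measure (E d) := volume.withDensity fun x => ofReal (ρ x)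

lemma integral_densityM (hρ : Continuous ρ) (hρ0 : ∀ x, 0 ≤ ρ x) (f : E d → ℝ) :
    ∫ x, f x ∂(densityM ρ) = ∫ x, ρ x * f x := by
  unfold densityM
  rw [integral_withDensity_eq_integral_toReal_smul hρ.measurable.ennreal_ofReal (by simp)]
  simp [toReal_ofReal (hρ0 _)]

lemma densityM_univ (hρi : Integrable ρ) (hρ0 : ∀ x, 0 ≤ ρ x) : densityM ρ univ = ofReal (∫ x, ρ x) := by
  unfold densityM
  rw [withDensity_apply _ MeasurableSet.univ, Measure.restrict_univ,
    ofReal_integral_eq_lintegral_ofReal hρi (.of_forall hρ0)]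

/-- The added density (1-t)ρ decreases at the rate ρ. As F has weak divergence -ρ, the flux -F
accounts for this loss, so the initial measure gains ρ and the final measure is unchanged. -/
lemma IsFlow.add_source [IsFiniteMeasure γ₀] (h : IsFlow N γ₀ γ₁ σ w) {F : E d → E d}
    (hρ : Continuous ρ) (hρ0 : ∀ x, 0 ≤ ρ x) (hρi : Integrable ρ) (hF : Continuous F)
    (hdiv : ∀ φ : E d → ℝ, ContDiff ℝ 1 φ → HasCompactSupport φ → ∫ x, fderiv ℝ φ x (F x) = ∫ x, φ x * ρ x) :
    IsFlow (N + ofReal (∫ x, ρ x)) (γ₀ + densityM ρ) γ₁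
      (fun p => σ p + max (1 - p.2) 0 * ρ p.1) (fun p => w p - F p.1) := by
  have hs : Continuous fun p : Q d => max (1 - p.2) 0 * ρ p.1 := by fun_prop
  have hv : Continuous fun p : Q d => F p.1 := by fun_prop
  have hloc : ∀ {V : Type} [NormedAddCommGroup V] {f : Q d → V} (_ : Continuous f) R,
    IntegrableOn f (cyl d R) (slab d) := by
    intro V _ f hf R
    have h1 : IntegrableOn f (Metric.closedBall 0 R ×ˢ Icc (0 : ℝ) 1)
      ((volume : Measure (E d)).prod (volume : Measure ℝ)) :=
      hf.continuousOn.integrableOn_compact ((isCompact_closedBall _ _).prod isCompact_Icc)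
    have h2 : (slab d).restrict (cyl d R) =
      ((volume : Measure (E d)).prod (volume : Measure ℝ)).restrict (Metric.ball 0 R ×ˢ Icc (0 : ℝ) 1) := by
      unfold slab timeM cyl
      rw [← Measure.prod_restrict, ← Measure.prod_restrict, Measure.restrict_univ]
    unfold IntegrableOn
    rw [h2]
    exact h1.mono_set (prod_mono_left Metric.ball_subset_closedBall)
  refine ⟨h.meas_density.add hs.measurable, h.meas_flux.sub hv.measurable,
    fun p => add_nonneg (h.density_nonneg p) (mul_nonneg (le_max_right _ _) (hρ0 _)), ?_,
    fun R => (h.int_density R).add (hloc hs R), fun R => (h.int_flux R).sub (hloc hv R),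
    fun ψ hψ hc => ?_⟩
  · filter_upwards [h.mass_le, ae_timeM] with t ht ht'
    rw [ofReal_integral_eq_lintegral_ofReal hρi (.of_forall hρ0)]
    have hm1 : Measurable fun x => ofReal (σ (x, t)) :=
      (h.meas_density.comp measurable_prodMk_right).ennreal_ofReal
    refine le_trans ?_ (add_le_add ht le_rfl)
    rw [← lintegral_add_left hm1]
    refine lintegral_mono fun x => ?_
    rw [← ofReal_add (h.density_nonneg _) (hρ0 x)]
    refine ofReal_le_ofReal (add_le_add le_rfl (mul_le_of_le_one_left (hρ0 x) ?_))
    exact max_le (by linarith [ht'.1]) zero_le_one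
  · have hi1 := h.integrable_fderiv hψ hc
    have hi2 : Integrable (fun p : Q d => fderiv ℝ ψ p (F p.1, 0)) (slab d) :=
      integrable_fderiv_apply measurable_const hv.measurable (hloc continuous_const) (hloc hv) hψ hc
    have hi3 : Integrable (fun p : Q d => fderiv ℝ ψ p (0, max (1 - p.2) 0 * ρ p.1)) (slab d) :=
      integrable_fderiv_apply hs.measurable measurable_const (hloc hs) (hloc continuous_const) hψ hc
    have hi4 : Integrable (fun p : Q d => ψ p * ρ p.1) (slab d) := by
      obtain ⟨R, hR, h0⟩ := exists_cyl hc
      rw [← integrableOn_iff_integrable_of_support_subset]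
      · exact hloc (hψ.continuous.mul (by fun_prop)) R
      · intro p hp
        by_contra h'
        exact hp (by simp [h0 p h'])
    have hdiff := hψ.differentiable (by norm_num)
    have e2 : ∫ p, fderiv ℝ ψ p (F p.1, 0) ∂slab d = ∫ p, ψ p * ρ p.1 ∂slab d := by
      unfold slab at hi2 hi4 ⊢
      rw [integral_prod_symm _ hi2, integral_prod_symm _ hi4]
      refine integral_congr_ae (.of_forall fun t => ?_)
      have hφ : ContDiff ℝ 1 fun x => ψ (x, t) := hψ.comp (by fun_prop)
      have hφc := hasCompactSupport_slice hc t
      refine Eq.trans (integral_congr_ae (.of_forall fun x => ?_)) (hdiv _ hφ hφc)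
      have h1 : HasFDerivAt (fun x => ψ (x, t)) _ x :=
        (hdiff (x, t)).hasFDerivAt.comp x (hasFDerivAt_prodMk_left x t)
      simp only [h1.fderiv]
      simp
    have e3 : ∫ p, fderiv ℝ ψ p (0, max (1 - p.2) 0 * ρ p.1) ∂slab d =
      ∫ p, ψ p * ρ p.1 ∂slab d - ∫ x, ρ x * ψ (x, 0) := by
      suffices key : ∫ p, (ψ p * ρ p.1 - fderiv ℝ ψ p (0, max (1 - p.2) 0 * ρ p.1)) ∂slab d =
        ∫ x, ρ x * ψ (x, 0) by
        rw [integral_sub hi4 hi3] at key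
        linarith
      have hi43 : Integrable (fun p : Q d => ψ p * ρ p.1 -
        fderiv ℝ ψ p (0, max (1 - p.2) 0 * ρ p.1)) (slab d) := hi4.sub hi3
      unfold slab at hi43 ⊢
      rw [integral_prod _ hi43]
      refine integral_congr_ae (.of_forall fun x => ?_)
      have hpt : ∀ t, HasDerivAt (fun t => -((1 - t) * ψ (x, t)))
        (ψ (x, t) - (1 - t) * fderiv ℝ ψ (x, t) (0, 1)) t := by
        intro t
        have h1 : HasDerivAt (fun t => ψ (x, t)) (fderiv ℝ ψ (x, t) (0, 1)) t := by
          have := (hdiff (x, t)).hasFDerivAt.comp_hasDerivAt t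
            ((hasDerivAt_const t x).prodMk (hasDerivAt_id t))
          exact this
        have h2 := (((hasDerivAt_id t).const_sub 1).mul h1).neg
        refine h2.congr_deriv ?_
        simp; ring
      have hc1 : Continuous fun t => ψ (x, t) - (1 - t) * fderiv ℝ ψ (x, t) (0, 1) := by fun_prop
      have hint := intervalIntegral.integral_eq_sub_of_hasDerivAt (a := 0) (b := 1)
        (fun t _ => hpt t) (hc1.intervalIntegrable _ _)
      rw [intervalIntegral.integral_of_le zero_le_one, ← integral_Icc_eq_integral_Ioc] at hint
      calc ∫ t, (ψ (x, t) * ρ x - fderiv ℝ ψ (x, t) (0, max (1 - t) 0 * ρ x)) ∂timeM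
          = ∫ t, ρ x * (ψ (x, t) - (1 - t) * fderiv ℝ ψ (x, t) (0, 1)) ∂timeM := by
            refine integral_congr_ae ?_
            filter_upwards [ae_timeM] with t ht
            have h1 : ((0 : E d), max (1 - t) 0 * ρ x) = ((1 - t) * ρ x) • ((0 : E d), (1 : ℝ)) := by
              rw [max_eq_left (by linarith [ht.2])]; simp
            rw [h1, map_smul, smul_eq_mul]
            ring
        _ = ρ x * ψ (x, 0) := by
          rw [integral_const_mul]
          unfold timeM
          rw [hint]
          simp
    have hb := integrable_slice hψ.continuous hc 0
    have : IsFiniteMeasure (densityM ρ) := ⟨by rw [densityM_univ hρi hρ0]; exact ofReal_lt_top⟩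
    rw [integral_add_measure (hb _) (hb _), integral_densityM hρ hρ0]
    have hsum : ∀ p : Q d, fderiv ℝ ψ p (w p - F p.1, σ p + max (1 - p.2) 0 * ρ p.1) =
      fderiv ℝ ψ p (w p, σ p) - fderiv ℝ ψ p (F p.1, 0) + fderiv ℝ ψ p (0, max (1 - p.2) 0 * ρ p.1) := by
      intro p
      rw [← map_sub, ← map_add]
      simp
    simp only [hsum]
    have hi12 : Integrable (fun p => fderiv ℝ ψ p (w p, σ p) - fderiv ℝ ψ p (F p.1, 0)) (slab d) :=
      hi1.sub hi2
    rw [integral_add hi12 hi3, integral_sub hi1 hi2, h.continuity_eq ψ hψ hc, e2, e3]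
    ring

lemma lintegral_Ioc_rpow {K : ℝ} (hT : 0 < T) (he : -1 < e) (hK : 0 ≤ K) :
    ∫⁻ t in Ioc 0 T, ofReal (t ^ e * K) = ofReal (T ^ (e + 1) / (e + 1) * K) := by
  have hi := ((intervalIntegrable_iff_integrableOn_Ioc_of_le hT.le).1
    (intervalIntegral.intervalIntegrable_rpow' he)).mul_const K
  rw [← ofReal_integral_eq_lintegral_ofReal hi, integral_mul_const,
    ← intervalIntegral.integral_of_le hT.le, integral_rpow (Or.inl he), zero_rpow (by linarith),
    sub_zero]
  filter_upwards [self_mem_ae_restrict measurableSet_Ioc] with t ht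
  have := ht.1
  positivity

lemma lintegral_Ioi_rpow {K : ℝ} (hT : 0 < T) (he : e < -1) (hK : 0 ≤ K) :
    ∫⁻ t in Ioi T, ofReal (t ^ e * K) = ofReal (T ^ (e + 1) / -(e + 1) * K) := by
  rw [← ofReal_integral_eq_lintegral_ofReal ((integrableOn_Ioi_rpow_of_lt he hT).mul_const K),
    integral_mul_const, integral_Ioi_rpow_of_lt he hT, div_neg, neg_div]
  filter_upwards [self_mem_ae_restrict measurableSet_Ioi] with t ht
  have := hT.trans ht
  positivity

/-- The increase of the squared regularization is at most 2·heat(ρ)·heat(γ+ρ), whose second factor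
has bounded integral. For t ≤ T the first factor is bounded through sup ρ, for t > T through the
decay t^(-qd/2) of the Gaussian; both powers of t are integrable on their range. -/
lemma energy_add_densityM_le (hq : 1 < q) (hd : 2 ≤ d)
    [IsFiniteMeasure γ] (hρ : Continuous ρ) (hρ0 : ∀ x, 0 ≤ ρ x) (hρi : Integrable ρ)
    (hM : ∀ x, ρ x ≤ M) (h1 : (γ + densityM ρ) univ ≤ 1) (hT : 0 < T) :
    energy q (γ + densityM ρ) ≤ energy q γ + ofReal (2 * (4 * Real.pi) ^ ((d : ℝ) / 2) *
      ((4 * Real.pi) ^ ((d : ℝ) / 2) * M * (T ^ (q - 1) / (q - 1)) +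
        T ^ (q - 1 - q * d / 2) / (q * d / 2 - (q - 1)))) := by
  set c := (4 * Real.pi) ^ ((d : ℝ) / 2)
  have hc0 : 0 ≤ c := by positivity
  have hM0 := (hρ0 0).trans (hM 0)
  have hd' : (2 : ℝ) ≤ d := by exact_mod_cast hd
  have hθ1 : densityM ρ univ ≤ 1 := (le_add_self).trans h1
  have : IsFiniteMeasure (densityM ρ) := ⟨hθ1.trans_lt one_lt_top⟩
  have hI : ∫ x, ρ x ≤ 1 := by
    rw [densityM_univ hρi hρ0] at hθ1
    simpa using hθ1
  set u := γ + densityM ρ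
  have hs : ∀ r : ℝ, smooth r (densityM ρ) = fun x => ∫ y, ρ y * gaus r (x - y) := fun r =>
    funext fun x => integral_densityM hρ hρ0 _
  have hs1 : ∀ {r : ℝ}, 0 < r → ∀ x, smooth r (densityM ρ) x ≤ c * M := by
    intro r hr x
    have hgi := (integrable_gaus (d := d) hr).comp_sub_left x
    rw [hs]
    calc ∫ y, ρ y * gaus r (x - y) ≤ ∫ y, M * gaus r (x - y) := by
          refine integral_mono_of_nonneg (.of_forall fun y =>
            mul_nonneg (hρ0 y) (gaus_nonneg hr.le _)) (hgi.const_mul M)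
            (.of_forall fun y => mul_le_mul_of_nonneg_right (hM y) (gaus_nonneg hr.le _))
      _ = c * M := by
          rw [integral_const_mul, integral_sub_left_eq_self (gaus r), integral_gaus hr, mul_comm]
  have hs2 : ∀ {r : ℝ}, 0 < r → ∀ x, smooth r (densityM ρ) x ≤ r ^ (-(d : ℝ) / 2) := by
    intro r hr x
    rw [hs]
    calc ∫ y, ρ y * gaus r (x - y) ≤ ∫ y, ρ y * r ^ (-(d : ℝ) / 2) := by
          refine integral_mono_of_nonneg (.of_forall fun y =>
            mul_nonneg (hρ0 y) (gaus_nonneg hr.le _)) (hρi.mul_const _)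
            (.of_forall fun y => mul_le_mul_of_nonneg_left (gaus_le hr.le _) (hρ0 y))
      _ = (∫ y, ρ y) * r ^ (-(d : ℝ) / 2) := integral_mul_const _ _
      _ ≤ _ := mul_le_of_le_one_left (by positivity) hI
  have hmu := measurable_heat q u
  have hmγ := measurable_heat q γ
  have hmθ := measurable_heat q (densityM ρ)
  have hprod : Measurable fun p : Q d => ofReal (2 * heat q (densityM ρ) p * heat q u p) := by fun_prop
  have hcross : ∀ {t K : ℝ}, 0 < t → 0 ≤ K → (∀ x, smooth (t ^ q) (densityM ρ) x ≤ K) →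
      ofReal (t ^ (q - 2)) * ∫⁻ x, ofReal (2 * heat q (densityM ρ) (x, t) * heat q u (x, t)) ≤
        ofReal (t ^ (q - 2) * (2 * c * K)) := by
    intro t K ht hK hb
    have hr : 0 < t ^ q := by positivity
    rw [ofReal_mul (by positivity)]
    gcongr
    calc ∫⁻ x, ofReal (2 * heat q (densityM ρ) (x, t) * heat q u (x, t))
        ≤ ∫⁻ x, ofReal (2 * K) * ofReal (smooth (t ^ q) u x) := by
          refine lintegral_mono fun x => ?_
          rw [← ofReal_mul (by positivity)]
          exact ofReal_le_ofReal (mul_le_mul_of_nonneg_right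
            (mul_le_mul_of_nonneg_left (hb x) zero_le_two) (smooth_nonneg hr.le _ _))
      _ = ofReal (2 * K) * (ofReal c * u univ) := by
          rw [lintegral_const_mul' _ _ ofReal_ne_top, lintegral_smooth hr]
      _ ≤ ofReal (2 * K) * (ofReal c * 1) := by gcongr
      _ = ofReal (2 * c * K) := by
          rw [mul_one, ← ofReal_mul (by positivity)]; congr 1; ring
  have he : 0 < q * d / 2 - (q - 1) := by nlinarith
  calc energy q u ≤ ∫⁻ p, (ofReal (heat q γ p ^ 2) +
        ofReal (2 * heat q (densityM ρ) p * heat q u p)) ∂scaleM d q := by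
        refine lintegral_mono_ae ?_
        filter_upwards [ae_snd_pos_scaleM q] with p hp
        have h2 : 0 ≤ heat q (densityM ρ) p := smooth_nonneg (by positivity) _ _
        have h3 : 0 ≤ heat q γ p := smooth_nonneg (by positivity) _ _
        have h4 : heat q u p = heat q γ p + heat q (densityM ρ) p := heat_add hp
        rw [← ofReal_add (by positivity) (by rw [h4]; positivity), h4]
        exact ofReal_le_ofReal (by nlinarith)
    _ = energy q γ + ∫⁻ t in Ioi (0 : ℝ), ofReal (t ^ (q - 2)) *
          ∫⁻ x, ofReal (2 * heat q (densityM ρ) (x, t) * heat q u (x, t)) := by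
        rw [lintegral_add_right _ hprod, lintegral_scaleM q hprod]; rfl
    _ ≤ energy q γ + ((∫⁻ t in Ioc 0 T, ofReal (t ^ (q - 2) * (2 * c * (c * M)))) +
          ∫⁻ t in Ioi T, ofReal (t ^ (q - 2 - q * d / 2) * (2 * c))) := by
        gcongr
        rw [← Ioc_union_Ioi_eq_Ioi hT.le]
        refine (lintegral_union_le _ _ _).trans (add_le_add ?_ ?_)
        · refine setLIntegral_mono' measurableSet_Ioc fun t ht => ?_
          exact hcross ht.1 (by positivity) (hs1 (rpow_pos_of_pos ht.1 _))
        · refine setLIntegral_mono' measurableSet_Ioi fun t ht => ?_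
          have ht0 := hT.trans ht
          refine (hcross ht0 (by positivity) (hs2 (rpow_pos_of_pos ht0 _))).trans_eq ?_
          rw [← Real.rpow_mul ht0.le, mul_comm (2 * c), ← mul_assoc, ← rpow_add ht0]
          congr 3; ring
    _ = _ := by
        rw [lintegral_Ioc_rpow hT (by linarith) (by positivity),
          lintegral_Ioi_rpow hT (by linarith) (by positivity),
          ← ofReal_add
            (by have : 0 < q - 2 + 1 := by linarith
                positivity)
            (by have : 0 < -(q - 2 - q * d / 2 + 1) := by linarith
                positivity)]
        rw [show q - 2 + 1 = q - 1 by ring, show q - 2 - q * d / 2 + 1 = q - 1 - q * d / 2 by ring,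
          show -(q - 1 - q * d / 2) = q * d / 2 - (q - 1) by ring]
        congr 2
        ring

lemma integrable_slab_fst (hf : Integrable f) :
    Integrable (fun p : Q d => f p.1) (slab d) ∧ ∫ p, f p.1 ∂slab d = ∫ x, f x := by
  unfold slab
  refine ⟨hf.comp_fst timeM, ?_⟩
  rw [integral_fun_fst f]
  simp

/-- The pairing of a flow with a square integrable bounded field, and the action of the flow after
subtraction of this field. -/
lemma IsFlow.flowAction_sub_le (hm : IsMobility m) (h : IsFlow 1 γ₀ γ₁ σ w)
    (hA : flowAction m σ w ≠ ⊤) {B : ℝ} (hB0 : 0 ≤ B) (hB : ∀ r, 0 ≤ r → m r ≤ m 0 + B * r)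
    {k : E d → E d} (hk : Continuous k) {G : E d → ℝ} (hGi : Integrable G)
    (hG : ∀ x, ‖k x‖ ^ 2 ≤ G x) {S : ℝ} (hS : ∀ x, ‖k x‖ ^ 2 ≤ S) (he : 0 ≤ e) (hl : 0 < l) :
    Integrable (fun p => inner ℝ (k p.1) (w p)) (slab d) ∧
    ∃ y, 0 ≤ y ∧ y ≤ (1 + l) * (flowAction m σ w).toReal - 2 * e / m 0 * ∫ p, inner ℝ (k p.1) (w p) ∂slab d +
      e ^ 2 * B * S / (l * m 0 ^ 2) + e ^ 2 / m 0 * ∫ x, G x ∧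
      flowAction m σ (fun p => w p - e • k p.1) ≤ ofReal y := by
  have hm0 := hm.pos 0
  have hS0 := (sq_nonneg _).trans (hS 0)
  have hσm := h.meas_density
  have hwm := h.meas_flux
  let α : Q d → ℝ := fun p => ‖w p‖ ^ 2 / m (σ p)
  have hα0 : ∀ p, 0 ≤ α p := fun p => by have := hm.pos (σ p); positivity
  have hαm := (hwm.norm.pow_const 2).div (hm.continuous.measurable.comp hσm)
  have hαi : Integrable α (slab d) := by
    refine ⟨hαm.aestronglyMeasurable, ?_⟩
    rw [hasFiniteIntegral_iff_ofReal (.of_forall hα0)]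
    exact hA.lt_top
  have hαI : ∫ p, α p ∂slab d = (flowAction m σ w).toReal :=
    integral_eq_lintegral_of_nonneg_ae (.of_forall hα0) hαm.aestronglyMeasurable
  have hσi : Integrable σ (slab d) := by
    refine ⟨hσm.aestronglyMeasurable, ?_⟩
    rw [hasFiniteIntegral_iff_ofReal (.of_forall h.density_nonneg)]
    exact (lintegral_density_le h).trans_lt one_lt_top
  have hσI : ∫ p, σ p ∂slab d ≤ 1 := by
    rw [integral_eq_lintegral_of_nonneg_ae (.of_forall h.density_nonneg) hσm.aestronglyMeasurable]
    exact ENNReal.toReal_le_of_le_ofReal zero_le_one (by simpa using lintegral_density_le h)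
  obtain ⟨hGi', hGI⟩ := integrable_slab_fst hGi
  have hXi : Integrable (fun p => inner ℝ (k p.1) (w p)) (slab d) := by
    refine Integrable.mono' (g := fun p => α p + (m 0 * G p.1 + B * S * σ p))
      (hαi.add ((hGi'.const_mul _).add (hσi.const_mul _)))
      ((hk.measurable.comp measurable_fst).inner hwm).aestronglyMeasurable
      (.of_forall fun p => ?_)
    refine (norm_inner_le_norm _ _).trans ?_
    have hmp := hm.pos (σ p)
    have h1 : ‖k p.1‖ * ‖w p‖ ≤ α p + m (σ p) * ‖k p.1‖ ^ 2 := by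
      have h2 : α p * m (σ p) = ‖w p‖ ^ 2 := div_mul_cancel₀ _ hmp.ne'
      have h3 : 0 ≤ (‖w p‖ - m (σ p) * ‖k p.1‖) ^ 2 := sq_nonneg _
      refine le_of_mul_le_mul_right ?_ hmp
      nlinarith
    have h5 := hB _ (h.density_nonneg p)
    have h6 := mul_le_mul_of_nonneg_left (hG p.1) hm0.le
    have h7 := mul_le_mul_of_nonneg_left (hS p.1) (mul_nonneg hB0 (h.density_nonneg p))
    nlinarith [sq_nonneg ‖k p.1‖]
  refine ⟨hXi, ?_⟩
  let f : Q d → ℝ := fun p => (1 + l) * α p - 2 * e / m 0 * inner ℝ (k p.1) (w p) +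
    e ^ 2 * B * S / (l * m 0 ^ 2) * σ p + e ^ 2 / m 0 * G p.1
  have hpt : ∀ p, ‖w p - e • k p.1‖ ^ 2 / m (σ p) ≤ f p := by
    intro p
    have hmp := hm.pos (σ p)
    have hmle := hm.monotone (h.density_nonneg p)
    have hmB := hB _ (h.density_nonneg p)
    set X := inner ℝ (k p.1) (w p)
    set W := ‖w p‖
    set K := ‖k p.1‖
    set M := m (σ p)
    set n := m 0
    have hK0 : 0 ≤ K := norm_nonneg _
    have hX : X ≤ K * W := real_inner_le_norm _ _
    have hexp : ‖w p - e • k p.1‖ ^ 2 = W ^ 2 - 2 * e * X + e ^ 2 * K ^ 2 := by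
      rw [norm_sub_sq_real, real_inner_smul_right, real_inner_comm, norm_smul, mul_pow, norm_eq_abs, sq_abs]
      ring
    -- In the cross term the weight 1/m(σ) is replaced by 1/m 0. The error, proportional to δ, is
    -- split by Young's inequality with parameter l, and δ²·m(σ) ≤ Bσ/(m 0)² by linear growth.
    set δ := 1 / n - 1 / M
    have hδ0 := sub_nonneg.2 (one_div_le_one_div_of_le hm0 hmle)
    have h1 : 2 * e * X * δ ≤ 2 * e * (K * W) * δ := by gcongr
    have h2 : 2 * e * (K * W) * δ ≤ l * (W ^ 2 / M) + e ^ 2 * K ^ 2 * (δ ^ 2 * M) / l := by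
      have : l * (W ^ 2 / M) + e ^ 2 * K ^ 2 * (δ ^ 2 * M) / l - 2 * e * (K * W) * δ =
        (l * W - e * K * δ * M) ^ 2 / (l * M) := by field_simp; ring
      have h3 : 0 ≤ (l * W - e * K * δ * M) ^ 2 / (l * M) := by positivity
      linarith
    have h3 : δ ^ 2 * M ≤ B * σ p / n ^ 2 := by
      rw [(show δ ^ 2 * M = (M - n) * ((M - n) / M) / n ^ 2 by simp only [δ]; field_simp)]
      have h5 : (M - n) / M ≤ 1 := (div_le_one hmp).2 (by linarith)
      have h6 : (M - n) * ((M - n) / M) ≤ (M - n) * 1 := mul_le_mul_of_nonneg_left h5 (sub_nonneg.2 hmle)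
      exact div_le_div_of_nonneg_right (by linarith) (by positivity)
    have h4 : e ^ 2 * K ^ 2 * (δ ^ 2 * M) / l ≤ e ^ 2 * S * (B * σ p / n ^ 2) / l := by
      have := hS p.1
      gcongr
    have h5 : e ^ 2 * K ^ 2 / M ≤ e ^ 2 * G p.1 / n := by
      have := hG p.1
      have h6 : 0 ≤ G p.1 := (sq_nonneg _).trans this
      gcongr
    have h6 : 2 * e * X * δ = 2 * e / n * X - 2 * e * X / M := by simp only [δ]; ring
    have h7 : e ^ 2 * S * (B * σ p / n ^ 2) / l = e ^ 2 * B * S / (l * n ^ 2) * σ p := by field_simp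
    rw [hexp]
    simp only [f, α]
    have h8 : (W ^ 2 - 2 * e * X + e ^ 2 * K ^ 2) / M =
      W ^ 2 / M - 2 * e * X / M + e ^ 2 * K ^ 2 / M := by ring
    have h9 : e ^ 2 * G p.1 / n = e ^ 2 / n * G p.1 := by ring
    rw [h8]
    linarith
  have hf0 : ∀ p, 0 ≤ f p := fun p => (div_nonneg (sq_nonneg _) (hm.pos _).le).trans (hpt p)
  have i1 := hαi.const_mul (1 + l)
  have i2 := hXi.const_mul (2 * e / m 0)
  have i3 := hσi.const_mul (e ^ 2 * B * S / (l * m 0 ^ 2))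
  have i4 := hGi'.const_mul (e ^ 2 / m 0)
  have i12 : Integrable (fun p => (1 + l) * α p - 2 * e / m 0 * inner ℝ (k p.1) (w p)) (slab d) := i1.sub i2
  have i123 : Integrable (fun p => (1 + l) * α p - 2 * e / m 0 * inner ℝ (k p.1) (w p) +
    e ^ 2 * B * S / (l * m 0 ^ 2) * σ p) (slab d) := i12.add i3
  have hfi : Integrable f (slab d) := i123.add i4
  refine ⟨∫ p, f p ∂slab d, integral_nonneg hf0, ?_, ?_⟩
  · have : ∫ p, f p ∂slab d = _ := integral_add i123 i4
    rw [this, integral_add i12 i3, integral_sub i1 i2]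
    simp only [integral_const_mul]
    rw [hαI, hGI]
    gcongr
    exact mul_le_of_le_one_right (by positivity) hσI
  · rw [ofReal_integral_eq_lintegral_ofReal hfi (.of_forall hf0)]
    exact lintegral_mono fun p => ofReal_le_ofReal (hpt p)

section

/-- The rescaled potentials are bounded by 1 and tend to 1 pointwise, so they measure the total mass
as R grows. -/
lemma tendsto_integral_pot [IsFiniteMeasure γ] {p : ℝ} (hp : 0 ≤ p) :
    Tendsto (fun R : ℝ => R ^ (2 * p) * ∫ x, pot R p x ∂γ) atTop (𝓝 (γ.real univ)) := by
  rw [(show γ.real univ = ∫ _ : E d, 1 ∂γ by simp)]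
  have h2 : ∀ᶠ R : ℝ in atTop, ∫ x, pot 1 p (R⁻¹ • x) ∂γ = R ^ (2 * p) * ∫ x, pot R p x ∂γ := by
    filter_upwards [eventually_gt_atTop 0] with R hR
    rw [← integral_const_mul]
    refine integral_congr_ae (.of_forall fun x => ?_)
    simp only [pot_eq_smul hR x]
    rw [← mul_assoc, ← rpow_add hR]
    simp
  refine Tendsto.congr' h2 ?_
  have hc : Continuous (pot 1 p : E d → ℝ) := (contDiff_pot one_pos).continuous
  refine tendsto_integral_filter_of_dominated_convergence (fun _ => 1)
    (.of_forall fun R => (hc.comp (by fun_prop)).aestronglyMeasurable)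
    (.of_forall fun R => .of_forall fun x => ?_) (integrable_const _)
    (.of_forall fun x => ?_)
  · rw [norm_of_nonneg (pot_pos one_pos _).le]
    simpa using pot_le one_pos hp (R⁻¹ • x)
  · have h3 := (hc.tendsto _).comp ((tendsto_inv_atTop_zero (𝕜 := ℝ)).smul_const x)
    simpa [pot, Function.comp_def] using h3

lemma IsFlow.ae_moll_le (hM : 0 ≤ M) (h : IsFlow (ofReal M) γ₀ γ₁ σ w) (hε : 0 < ε) :
    ∀ᵐ p ∂slab d, moll ε σ p ≤ (ε ^ d)⁻¹ * bumpMax d * M := by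
  filter_upwards [ae_slab_of_ae_timeM h.mass_le] with p hp
  exact moll_le hε h.meas_density h.density_nonneg p.1 hM hp

/-- The threshold T = R^(2/q) balances the two parts of the energy increment: both become
R^(-2κ)·R^(-2/q) up to constants. -/
lemma energy_gain_eq {n : ℝ} (hR : 0 < R) (hq : 0 < q) (hκ : 2 * (κ + 1) = n) :
    2 * c * (c * (e * (2 * κ * n) * R ^ (-n)) * ((R ^ (2 / q)) ^ (q - 1) / (q - 1)) +
      (R ^ (2 / q)) ^ (q - 1 - q * n / 2) / (q * n / 2 - (q - 1))) = R ^ (-(2 * κ)) *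
    (2 * c * (c * (e * (2 * κ * n)) / (q - 1) + 1 / (q * n / 2 - (q - 1))) * R ^ (-(2 / q))) := by
  have e1 : R ^ (-n) * (R ^ (2 / q)) ^ (q - 1) = R ^ (-(2 * κ)) * R ^ (-(2 / q)) := by
    rw [← Real.rpow_mul hR.le, ← rpow_add hR, ← rpow_add hR, ← hκ]
    congr 1; field_simp; ring
  have e2 : (R ^ (2 / q)) ^ (q - 1 - q * n / 2) = R ^ (-(2 * κ)) * R ^ (-(2 / q)) := by
    rw [← Real.rpow_mul hR.le, ← rpow_add hR, ← hκ]
    congr 1; field_simp; ring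
  calc _ = 2 * c * (c * (e * (2 * κ * n)) * (R ^ (-n) * (R ^ (2 / q)) ^ (q - 1)) / (q - 1) +
      (R ^ (2 / q)) ^ (q - 1 - q * n / 2) / (q * n / 2 - (q - 1))) := by ring
    _ = _ := by rw [e1, e2]; ring

/-- With l = R^(-2κ-1) both error terms of Young's inequality are R^(-2κ)·O(1/R), and the linear and
quadratic terms in e carry the same factor R^(-2κ). -/
lemma action_gain_eq {n A B X I : ℝ} (hR : 0 < R) (hκ : 2 * (κ + 1) = n) :
    R ^ (-(2 * κ) - 1) * A - 2 * e / b * X +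
      e ^ 2 * B * (4 * κ ^ 2 * R ^ (-2 * (2 * κ + 1))) / (R ^ (-(2 * κ) - 1) * b ^ 2) +
        e ^ 2 / b * (4 * κ ^ 2 * (R ^ (n - 2 * (2 * κ + 1)) * I)) =
    R ^ (-(2 * κ)) * ((A + e ^ 2 * B * (4 * κ ^ 2) / b ^ 2) * R⁻¹ -
      2 * e / b * (R ^ (2 * κ) * X) + e ^ 2 / b * (4 * κ ^ 2 * I)) := by
  have e1 : R ^ (-(2 * κ) - 1) = R ^ (-(2 * κ)) * R⁻¹ := by
    rw [sub_eq_add_neg, rpow_add hR, Real.rpow_neg_one]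
  have e2 : R ^ (-(2 * κ)) * R ^ (2 * κ) = 1 := by rw [← rpow_add hR]; simp
  have e4 : R ^ (-2 * (2 * κ + 1)) = R ^ (-(2 * κ) - 1) * (R ^ (-(2 * κ)) * R⁻¹) := by
    rw [← e1, ← rpow_add hR]; congr 1; ring
  have e5 : e ^ 2 * B * (4 * κ ^ 2 * R ^ (-2 * (2 * κ + 1))) / (R ^ (-(2 * κ) - 1) * b ^ 2) =
    e ^ 2 * B * (4 * κ ^ 2) / b ^ 2 * (R ^ (-(2 * κ)) * R⁻¹) := by
    rw [e4]
    field_simp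
  rw [e5, (show R ^ (n - 2 * (2 * κ + 1)) = R ^ (-(2 * κ)) by congr 1; linarith), e1]
  linear_combination (2 * e / b * X) * e2

namespace Problem

variable {P : Problem d}

/-- The change of the functional, when the density `e ρ` is added to a subprobability measure and
the flux is corrected by `e F`. -/
lemma value_le_add_source (h1 : γ univ ≤ 1)
    (h : IsFlow 1 γ P.ref σ w) {F : E d → E d} (hρ : Continuous ρ) (hρ0 : ∀ x, 0 ≤ ρ x)
    (hρi : Integrable ρ) (hF : Continuous F) (hu : (γ + densityM ρ) univ ≤ 1)
    (hdiv : ∀ φ : E d → ℝ, ContDiff ℝ 1 φ → HasCompactSupport φ → ∫ x, fderiv ℝ φ x (F x) = ∫ x, φ x * ρ x)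
    (hA : flowAction P.m σ (fun p => w p - F p.1) ≠ ⊤) :
    P.value ≤ P.a * flowAction P.m σ (fun p => w p - F p.1) + P.b * energy P.q (γ + densityM ρ) := by
  have fγ : IsFiniteMeasure γ := ⟨h1.trans_lt one_lt_top⟩
  have : IsFiniteMeasure (γ + densityM ρ) := ⟨hu.trans_lt one_lt_top⟩
  have hflow := h.add_source hρ hρ0 hρi hF hdiv
  have hI : 0 ≤ ∫ x, ρ x := integral_nonneg hρ0
  rw [← ofReal_one, ← ofReal_add zero_le_one hI] at hflow
  refine value_le_of_flows hu hA fun ε hε => ⟨_, _, _, hflow.mollify hε.le, fun R =>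
    ⟨_, ae_restrict_of_ae (hflow.ae_moll_le (by positivity) hε)⟩, ?_⟩
  refine (flowAction_moll_le P.mobility hε.le hflow.meas_density hflow.meas_flux
    hflow.density_nonneg hflow.int_density).trans ?_
  refine lintegral_mono fun p => P.mobility.actE_anti ?_ _
  exact le_add_of_nonneg_right (mul_nonneg (le_max_right _ _) (hρ0 _))

/-- The perturbation by e times the gradient of the potential with 2(κ+1) = d, which is
superharmonic. The condition `heZ` keeps the total mass at most one. -/
lemma value_le_add_radial (h1 : γ univ ≤ 1)
    (hf : IsFlow 1 γ P.ref σ w) (hA : flowAction P.m σ w ≠ ⊤) {B : ℝ} (hB0 : 0 ≤ B)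
    (hB : ∀ r, 0 ≤ r → P.m r ≤ P.m 0 + B * r) (hκ : 0 < κ) (hκd : 2 * (κ + 1) = d)
    (he : 0 < e) (hR : 0 < R) (hT : 0 < T) (hl : 0 < l)
    (heZ : e * (2 * κ * d * ∫ x : E d, pot 1 (κ + 2) x) ≤ 1 - γ.real univ) :
    ∃ y, 0 ≤ y ∧ y ≤ (1 + l) * (flowAction P.m σ w).toReal -
      2 * e / P.m 0 * (∫ x, pot R κ x ∂P.ref - ∫ x, pot R κ x ∂γ) +
      e ^ 2 * B * (4 * κ ^ 2 * R ^ (-2 * (2 * κ + 1))) / (l * P.m 0 ^ 2) + e ^ 2 / P.m 0 *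
        (4 * κ ^ 2 * (R ^ ((d : ℝ) - 2 * (2 * κ + 1)) * ∫ x : E d, pot 1 (2 * κ + 1) x)) ∧
      P.value ≤ P.a * ofReal y + P.b * (energy P.q γ + ofReal
        (2 * (4 * Real.pi) ^ ((d : ℝ) / 2) * ((4 * Real.pi) ^ ((d : ℝ) / 2) *
          (e * (2 * κ * d) * R ^ (-(d : ℝ))) * (T ^ (P.q - 1) / (P.q - 1)) +
            T ^ (P.q - 1 - P.q * d / 2) / (P.q * d / 2 - (P.q - 1))))) := by
  have fγ : IsFiniteMeasure γ := ⟨h1.trans_lt one_lt_top⟩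
  have hd2 : 2 ≤ d := by
    have : (2 : ℝ) < d := by linarith
    exact_mod_cast this.le
  have hS : ∀ x : E d, ‖radial R κ x‖ ^ 2 ≤ 4 * κ ^ 2 * R ^ (-2 * (2 * κ + 1)) := fun x =>
    (sq_norm_radial_le hR x).trans (mul_le_mul_of_nonneg_left (pot_le hR (by positivity) x) (by positivity))
  obtain ⟨hXi, y, hy0, hy, hyA⟩ := hf.flowAction_sub_le P.mobility hA hB0 hB
    (continuous_radial hR) ((integrable_pot hR (by linarith)).const_mul _) (sq_norm_radial_le hR) hS he.le
    hl
  simp only [← fderiv_pot hR] at hXi hy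
  rw [hf.integral_fderiv_of_decay (contDiff_pot hR) (pot_pos hR) (pot_le hR hκ.le)
    (tendsto_pot_cocompact hκ) hXi, integral_const_mul, integral_pot hR] at hy
  let ρ : E d → ℝ := fun x => e * (2 * κ * d * R ^ 2 * pot R (κ + 2) x)
  have hρc : Continuous ρ := ((contDiff_pot hR).continuous.const_mul _).const_mul _
  have hρ0 : ∀ x, 0 ≤ ρ x := fun x => by
    have := pot_pos (p := κ + 2) hR x
    positivity
  have hρi : Integrable ρ := ((integrable_pot hR (by linarith)).const_mul _).const_mul _
  -- The mass of ρ does not depend on R, as R^(d-2(κ+2)) = R⁻² cancels the factor R².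
  have hρI : ∫ x, ρ x = e * (2 * κ * d * ∫ x : E d, pot 1 (κ + 2) x) := by
    rw [integral_const_mul, integral_const_mul, integral_pot hR, show (d : ℝ) - 2 * (κ + 2) = -2 by linarith,
      Real.rpow_neg hR.le, rpow_two]
    field_simp
  have hρM : ∀ x, ρ x ≤ e * (2 * κ * d) * R ^ (-(d : ℝ)) := fun x => by
    have h2 := pot_le (p := κ + 2) hR (by positivity) x
    have h3 : R ^ 2 * R ^ (-2 * (κ + 2)) = R ^ (-(d : ℝ)) := by
      rw [← rpow_two, ← rpow_add hR]; congr 1; linarith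
    calc ρ x ≤ e * (2 * κ * d * R ^ 2 * R ^ (-2 * (κ + 2))) := by simp only [ρ]; gcongr
      _ = e * (2 * κ * d) * (R ^ 2 * R ^ (-2 * (κ + 2))) := by ring
      _ = _ := by rw [h3]
  have hu : (γ + densityM ρ) univ ≤ 1 := by
    rw [Measure.add_apply, densityM_univ hρi hρ0, hρI, ← ofReal_measureReal (measure_ne_top γ univ),
      ← ofReal_add measureReal_nonneg (hρI ▸ integral_nonneg hρ0), ← ofReal_one]
    exact ofReal_le_ofReal (by linarith)
  have hval := value_le_add_source h1 hf hρc hρ0 hρi ((continuous_radial hR).const_smul e) hu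
    (fun φ hφ hc => by
      have h2 : ∀ x, fderiv ℝ φ x (e • radial R κ x) = e * fderiv ℝ φ x (radial R κ x) := fun x => by
        rw [map_smul, smul_eq_mul]
      refine (integral_congr_ae (.of_forall h2)).trans ?_
      rw [integral_const_mul, integral_fderiv_radial hR hφ hc hκd, ← integral_const_mul]
      refine integral_congr_ae (.of_forall fun x => ?_)
      simp; ring) (hyA.trans_lt ofReal_lt_top).ne
  have hen := energy_add_densityM_le P.one_lt hd2 hρc hρ0 hρi hρM hu hT
  refine ⟨y, hy0, hy, hval.trans ?_⟩
  gcongr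
  exact hyA

/-- Up to dimension two by conservation of mass. From dimension three on, if the mass is 1 - Δ < 1,
the radial perturbation lowers the functional for large R: multiplied by R^(2κ), the change tends to
-(a·e/m 0)(2Δ - eD), while the energy increment disappears in the limit. -/
lemma measure_univ_eq_one (hd : 0 < d) (h1 : γ univ ≤ 1) (hmin : P.total γ ≤ P.value) : γ univ = 1 := by
  have fγ : IsFiniteMeasure γ := ⟨h1.trans_lt one_lt_top⟩
  have hm := P.mobility
  have htop := add_lt_top.1 (hmin.trans_lt P.value_lt_top)
  have hfc : flowCost P.m 1 γ P.ref ≠ ⊤ := fun h => by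
    rw [h, mul_top P.a_ne_zero] at htop; exact lt_irrefl _ htop.1
  have hE : energy P.q γ ≠ ⊤ := fun h => by rw [h, mul_top P.b_ne_zero] at htop; exact lt_irrefl _ htop.2
  rcases Nat.lt_or_ge 2 d with hd3 | hd2
  swap
  · obtain ⟨σ, w, hf, hA⟩ := exists_of_flowCost_lt hfc.lt_top
    rw [hf.measure_univ_eq hm hd2 one_ne_top hA.ne, measure_univ]
  by_contra hne
  have hΔ0 : 0 < 1 - γ.real univ := by
    have : γ.real univ < 1 := by
      rw [Measure.real, ← ENNReal.toReal_one, ENNReal.toReal_lt_toReal (measure_ne_top _ _) (by simp)]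
      exact lt_of_le_of_ne h1 hne
    linarith
  set Δ := 1 - γ.real univ
  have hd3' : (3 : ℝ) ≤ d := by exact_mod_cast hd3
  have hq := P.one_lt
  have hm0 := hm.pos 0
  obtain ⟨B, hB0, hB⟩ := hm.le_linear
  set κ : ℝ := (d - 2) / 2
  have hκd : 2 * (κ + 1) = d := by simp only [κ]; ring
  have hκ : 0 < κ := by linarith
  set Z : ℝ := 2 * κ * d * ∫ x : E d, pot 1 (κ + 2) x
  set D : ℝ := 4 * κ ^ 2 * ∫ x : E d, pot 1 (2 * κ + 1) x
  have hZ0 : 0 ≤ Z := mul_nonneg (by positivity) (integral_nonneg fun x => (pot_pos one_pos x).le)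
  have hD0 : 0 ≤ D := mul_nonneg (by positivity) (integral_nonneg fun x => (pot_pos one_pos x).le)
  -- Small enough for both requirements: e·Z ≤ Δ keeps the mass at most one, and e·D < 2Δ makes the
  -- limiting change negative.
  set e := Δ / (Z + D + 1)
  have he : 0 < e := by positivity
  have heq : e * (Z + D + 1) = Δ := div_mul_cancel₀ _ (by positivity)
  set c := (4 * Real.pi) ^ ((d : ℝ) / 2)
  set a := P.a.toReal
  set b := P.b.toReal
  have ha : 0 < a := ENNReal.toReal_pos P.a_ne_zero P.a_ne_top
  set A := (flowCost P.m 1 γ P.ref).toReal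
  set C₁ := A + 1 + e ^ 2 * B * (4 * κ ^ 2) / P.m 0 ^ 2
  set C₂ := 2 * c * (c * (e * (2 * κ * d)) / (P.q - 1) + 1 / (P.q * d / 2 - (P.q - 1)))
  let X : ℝ → ℝ := fun R => ∫ x, pot R κ x ∂P.ref - ∫ x, pot R κ x ∂γ
  have hlim : Tendsto (fun R => a * (C₁ * R⁻¹ - 2 * e / P.m 0 * (R ^ (2 * κ) * X R) + e ^ 2 / P.m 0 * D) +
    b * (C₂ * R ^ (-(2 / P.q)))) atTop
    (𝓝 (a * (C₁ * 0 - 2 * e / P.m 0 * Δ + e ^ 2 / P.m 0 * D) + b * (C₂ * 0))) := by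
    have hX : Tendsto (fun R => R ^ (2 * κ) * X R) atTop (𝓝 Δ) := by
      have := (tendsto_integral_pot (γ := P.ref) hκ.le).sub (tendsto_integral_pot (γ := γ) hκ.le)
      simp only [X, mul_sub]
      rwa [measureReal_def P.ref, measure_univ, ENNReal.toReal_one] at this
    exact ((((tendsto_inv_atTop_zero.const_mul _).sub (hX.const_mul _)).add_const _).const_mul _).add
      (((tendsto_rpow_neg_atTop (by have := P.q_pos; positivity)).const_mul _).const_mul _)
  have hneg : a * (C₁ * 0 - 2 * e / P.m 0 * Δ + e ^ 2 / P.m 0 * D) + b * (C₂ * 0) < 0 := by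
    have : a * (C₁ * 0 - 2 * e / P.m 0 * Δ + e ^ 2 / P.m 0 * D) + b * (C₂ * 0) =
      -(a * e / P.m 0 * (2 * Δ - e * D)) := by ring
    rw [this, neg_lt_zero]
    have : 0 < 2 * Δ - e * D := by nlinarith
    positivity
  obtain ⟨R, hRneg, hR1⟩ := ((hlim.eventually (gt_mem_nhds hneg)).and (eventually_ge_atTop 1)).exists
  have hR := one_pos.trans_le hR1
  set Φ := a * (C₁ * R⁻¹ - 2 * e / P.m 0 * (R ^ (2 * κ) * X R) + e ^ 2 / P.m 0 * D) +
    b * (C₂ * R ^ (-(2 / P.q)))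
  -- The cost is an infimum; the slack η of a nearly optimal flow is taken smaller than the gain at
  -- the radius R just fixed.
  obtain ⟨η, hη0, hη1, hηΦ⟩ : ∃ η : ℝ, 0 < η ∧ η ≤ 1 ∧ a * η + R ^ (-(2 * κ)) * Φ < 0 := by
    have hs : 0 < -(R ^ (-(2 * κ)) * Φ) := by
      have : 0 < R ^ (-(2 * κ)) := by positivity
      nlinarith
    refine ⟨min 1 (-(R ^ (-(2 * κ)) * Φ) / (2 * a)), lt_min one_pos (by positivity), min_le_left _ _, ?_⟩
    have h2 := mul_le_mul_of_nonneg_left (min_le_right 1 (-(R ^ (-(2 * κ)) * Φ) / (2 * a))) ha.le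
    have h3 : a * (-(R ^ (-(2 * κ)) * Φ) / (2 * a)) = -(R ^ (-(2 * κ)) * Φ) / 2 := by field_simp
    linarith
  obtain ⟨σ, w, hf, hact⟩ := exists_of_flowCost_lt (lt_add_right hfc (ofReal_pos.2 hη0).ne')
  have hact' : (flowAction P.m σ w).toReal ≤ A + η := by
    have := toReal_mono (add_ne_top.2 ⟨hfc, ofReal_ne_top⟩) hact.le
    rwa [toReal_add hfc ofReal_ne_top, toReal_ofReal hη0.le] at this
  obtain ⟨y, hy0, hy, hval⟩ := value_le_add_radial h1 hf (hact.trans_le le_top).ne hB0 hB hκ hκd he hR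
    (by positivity : 0 < R ^ (2 / P.q)) (by positivity : 0 < R ^ (-(2 * κ) - 1)) (by nlinarith : e * Z ≤ Δ)
  rw [energy_gain_eq hR P.q_pos hκd] at hval
  set z := R ^ (-(2 * κ)) * (C₂ * R ^ (-(2 / P.q)))
  have hqd : 0 < P.q * d / 2 - (P.q - 1) := by nlinarith
  have hy' : y ≤ A + η + R ^ (-(2 * κ)) *
    (C₁ * R⁻¹ - 2 * e / P.m 0 * (R ^ (2 * κ) * X R) + e ^ 2 / P.m 0 * D) := by
    rw [← action_gain_eq hR hκd]
    have h3 : R ^ (-(2 * κ) - 1) * (flowAction P.m σ w).toReal ≤ R ^ (-(2 * κ) - 1) * (A + 1) := by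
      gcongr; linarith
    linarith
  have hfin : (P.total γ).toReal ≤ a * y + b * ((energy P.q γ).toReal + z) := by
    have h2 : P.total γ ≤ P.a * ofReal y + P.b * (energy P.q γ + ofReal z) := by exact hmin.trans hval
    have h3 : P.a * ofReal y ≠ ⊤ := mul_ne_top P.a_ne_top ofReal_ne_top
    have h4 : energy P.q γ + ofReal z ≠ ⊤ := add_ne_top.2 ⟨hE, ofReal_ne_top⟩
    have h5 := toReal_mono (add_ne_top.2 ⟨h3, mul_ne_top P.b_ne_top h4⟩) h2
    rwa [toReal_add h3 (mul_ne_top P.b_ne_top h4), toReal_mul,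
      toReal_mul, toReal_add hE ofReal_ne_top, toReal_ofReal hy0,
      toReal_ofReal (by positivity)] at h5
  unfold total at hfin
  rw [toReal_add htop.1.ne htop.2.ne, toReal_mul, toReal_mul] at hfin
  have h6 := mul_le_mul_of_nonneg_left hy' ha.le
  have h7 : R ^ (-(2 * κ)) * Φ = a * (R ^ (-(2 * κ)) *
    (C₁ * R⁻¹ - 2 * e / P.m 0 * (R ^ (2 * κ) * X R) + e ^ 2 / P.m 0 * D)) + b * z := by grind
  linarith

end Problem

end

/-! ### Back to the modified Wasserstein distance. -/

section

namespace Problem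

variable {P : Problem d}

variable (P) in
/-- The functional, at the level of continuity paths. -/
def pathTotal (u : Measure (E d)) : ℝ≥0∞ := P.a * modifiedWasserstein P.m u P.ref ^ 2 + P.b * energy P.q u

lemma pathTotal_le [IsFiniteMeasure u] : P.pathTotal u ≤ P.total u := by
  unfold pathTotal total
  gcongr
  exact modifiedWasserstein_sq_le_flowCost P.mobility one_ne_top

/-- One nearly optimal path is mollified at every radius. The action does not increase, so one bound
`A` serves all ε. -/
lemma exists_flows_of_pathTotal_lt [IsFiniteMeasure u] (h : P.pathTotal u < B) :
    ∃ A, A ≠ ⊤ ∧ (∀ ε : ℝ, 0 < ε → ∃ N σ w, IsFlow N (mollify ε u) (mollify ε P.ref) σ w ∧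
      (∀ R, ∃ C, ∀ᵐ p ∂((slab d).restrict (cyl d R)), σ p ≤ C) ∧ flowAction P.m σ w ≤ A) ∧
      P.a * A + P.b * energy P.q u < B := by
  unfold pathTotal at h
  set W := modifiedWasserstein P.m u P.ref with hW
  have hWt : W ≠ ⊤ := fun hWt => by simp [hWt, mul_top P.a_ne_zero] at h
  have hlim : Tendsto (fun n : ℕ => P.a * (W + ((n : ℝ≥0∞) + 1)⁻¹) ^ 2 + P.b * energy P.q u) atTop
    (𝓝 (P.a * (W + 0) ^ 2 + P.b * energy P.q u)) :=
    (ENNReal.Tendsto.const_mul (((ENNReal.continuous_pow 2).tendsto _).comp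
      (tendsto_const_nhds.add tendsto_inv_add_one)) (Or.inr P.a_ne_top)).add tendsto_const_nhds
  rw [add_zero] at hlim
  obtain ⟨n, hn⟩ := (hlim.eventually (gt_mem_nhds h)).exists
  set W' := W + ((n : ℝ≥0∞) + 1)⁻¹
  have hlt : W < W' := lt_add_right hWt (by simp)
  rw [hW] at hlt
  unfold modifiedWasserstein at hlt
  simp only [iInf_lt_iff] at hlt
  obtain ⟨μ, ν, hP, hlt⟩ := hlt
  have hW't : W' ≠ ⊤ := add_ne_top.2 ⟨hWt, by simp⟩
  refine ⟨W' ^ 2, ENNReal.pow_ne_top hW't, fun ε hε => ⟨⊤, _, _, hP.isFlow hε, fun R => ?_, ?_⟩, hn⟩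
  · obtain ⟨C, -, hC⟩ := hP.exists_pathDensity_le hε R
    exact ⟨C, ae_restrict_of_forall_mem (measurableSet_cyl R) hC⟩
  · refine (hP.flowAction_le P.mobility hε).trans ?_
    have h1 := pow_le_pow_left₀ zero_le hlt.le 2
    rwa [← rpow_natCast, ← rpow_mul, show (1 / 2 : ℝ) * (2 : ℕ) = 1 by norm_num, ENNReal.rpow_one] at h1

lemma value_le_pathTotal [IsProbabilityMeasure u] : P.value ≤ P.pathTotal u := by
  refine le_of_forall_gt fun B hB => ?_
  obtain ⟨A, hA, h, hlt⟩ := exists_flows_of_pathTotal_lt hB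
  exact (value_le_of_flows (by simp) hA h).trans_lt hlt

/-- Competitors lying below ever finer mollifications of u form a minimizing sequence, so they
converge to γ. In the limit the regularizations of γ are at most those of u; both measures have mass
one, so they coincide. -/
lemma IsLimit.eq_of_pathTotal_le (hγ : P.IsLimit γ) (hγ1 : γ univ = 1) [IsProbabilityMeasure u]
    (hu : P.pathTotal u ≤ P.value) : γ = u := by
  have fγ : IsFiniteMeasure γ := ⟨hγ1.trans_lt one_lt_top⟩
  have hex : ∀ n : ℕ, ∃ ε, ε ∈ Ioo 0 ((n : ℝ) + 1)⁻¹ ∧ ∃ u' ≤ mollify ε u,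
    P.total u' < P.value + ((n : ℝ≥0∞) + 1)⁻¹ := by
    intro n
    obtain ⟨A, hA, h, hlt⟩ := exists_flows_of_pathTotal_lt
      (hu.trans_lt (lt_add_right P.value_lt_top.ne (by simp : ((n : ℝ≥0∞) + 1)⁻¹ ≠ 0)))
    exact exists_competitor hA h hlt (by positivity)
  choose ε hε u' hu' htot using hex
  have h1 : ∀ n, u' n univ ≤ 1 := fun n => (hu' n univ).trans (by rw [mollify_univ]; simp)
  have hE := hγ.2 u' h1 (tendsto_of_tendsto_of_tendsto_of_le_of_le tendsto_const_nhds tendsto_value_add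
    (fun n => P.value_le (h1 n)) fun n => (htot n).le)
  obtain ⟨φ, hφ, hheat, -⟩ := exists_subseq_vague h1 hγ.1 hE
  have hε0 : Tendsto ε atTop (𝓝 0) := by
    refine tendsto_of_tendsto_of_tendsto_of_le_of_le tendsto_const_nhds
      (tendsto_inv_atTop_zero.comp (tendsto_natCast_atTop_atTop.atTop_add
        (tendsto_const_nhds))) (fun n => (hε n).1.le) fun n => (hε n).2.le
  have hle : ∀ᵐ p ∂(scaleM d P.q), heat P.q γ p ≤ heat P.q u p := by
    filter_upwards [hheat, ae_snd_pos_scaleM P.q] with p hp hp0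
    have hr : 0 ≤ p.2 ^ P.q := by positivity
    exact le_of_tendsto_of_tendsto' hp
      (tendsto_smooth_mollify hr u p.1 (fun k => (hε (φ k)).1.le) (hε0.comp hφ.tendsto_atTop))
      fun k => smooth_mono hr (hu' (φ k)) p.1
  have : (ae (volume.restrict (Ioi (0 : ℝ)))).NeBot := by
    rw [ae_neBot]; intro h0; simpa using congrArg (fun μ => μ univ) h0
  obtain ⟨t, ht, ht0⟩ := ((ae_ae_of_ae_scaleM hle).and (ae_restrict_mem measurableSet_Ioi)).exists
  have hr : 0 < t ^ P.q := rpow_pos_of_pos ht0 _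
  refine eq_of_smooth_ae_eq hr ?_
  have hms : ∀ (v : Measure (E d)) [IsFiniteMeasure v],
    Measurable fun x => ofReal (smooth (t ^ P.q) v x) := fun v _ =>
    (continuous_smooth hr.le v).measurable.ennreal_ofReal
  have ht' : ∀ᵐ x : E d, smooth (t ^ P.q) γ x ≤ smooth (t ^ P.q) u x := ht
  -- Ordered functions with equal finite integrals agree almost everywhere.
  have h3 := ae_eq_of_ae_le_of_lintegral_le (μ := volume) (ht'.mono fun x hx => ofReal_le_ofReal hx)
    (by rw [lintegral_smooth hr]; exact mul_ne_top ofReal_ne_top (measure_ne_top _ _))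
    (hms u).aemeasurable (by rw [lintegral_smooth hr, lintegral_smooth hr, hγ1, measure_univ])
  filter_upwards [h3] with x hx
  exact (ENNReal.ofReal_eq_ofReal_iff (smooth_nonneg hr.le _ _) (smooth_nonneg hr.le _ _)).1 hx

variable (P) in
-- The limit γ closes the chain pathTotal γ ≤ total γ ≤ value ≤ pathTotal u for all probability
-- measures u; hence every minimizer has the value of γ and equals it.
lemma exists_unique_minimizer (hd : 0 < d) : ∃ γ : Measure (E d), γ ∈ probMeasures d ∧
    energy P.q γ < ⊤ ∧ IsMinOn P.pathTotal (probMeasures d) γ ∧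
    ∀ u ∈ probMeasures d, IsMinOn P.pathTotal (probMeasures d) u → u = γ := by
  obtain ⟨γ, hγ⟩ := P.exists_limit
  have hγ1 := measure_univ_eq_one hd hγ.1 hγ.total_le
  have pγ : IsProbabilityMeasure γ := ⟨hγ1⟩
  have hle := pathTotal_le.trans hγ.total_le
  refine ⟨γ, pγ, ?_, fun u (hu : IsProbabilityMeasure u) => hle.trans value_le_pathTotal,
    fun u (hu : IsProbabilityMeasure u) hmin => (hγ.eq_of_pathTotal_le hγ1 ((hmin pγ).trans hle)).symm⟩
  by_contra h
  rw [not_lt, top_le_iff] at h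
  have := (le_add_self.trans hle).trans_lt P.value_lt_top
  simp [h, mul_top P.b_ne_zero] at this

end Problem

end

/-! ### The time-discrete scheme. -/

section

variable {α s τ : ℝ} {u₀ : Measure (E d)}

/-- Concavity of r ↦ r^(1-α) for the interior coefficients, monotonicity for the last one. -/
lemma neg_coeffB_nonneg (h0 : 0 < α) (h1 : α < 1) {k i : ℕ} (hi : 0 < i) (hik : i ≤ k) :
    0 ≤ -coeffB α k i := by
  have hi1 : (1 : ℝ) ≤ i := by exact_mod_cast hi
  unfold coeffB
  rw [if_neg hi.ne']
  split_ifs with h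
  · have := (Real.concaveOn_rpow (by linarith : 0 ≤ 1 - α) (by linarith)).2
      (show (i : ℝ) - 1 ∈ Ici 0 by simpa using hi1) (show (i : ℝ) + 1 ∈ Ici 0 by simp; positivity)
      (by norm_num : (0 : ℝ) ≤ 1 / 2) (by norm_num : (0 : ℝ) ≤ 1 / 2) (by norm_num)
    simp only [smul_eq_mul] at this
    rw [show 1 / 2 * ((i : ℝ) - 1) + 1 / 2 * (i + 1) = i by ring] at this
    linarith
  · have hk1 : (1 : ℝ) ≤ k := hi1.trans (by exact_mod_cast hik)
    have := Real.rpow_le_rpow (by linarith) (by linarith : (k : ℝ) - 1 ≤ k) (by linarith : 0 ≤ 1 - α)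
    linarith

/-- The interior coefficients are differences of f j = (j+1)^(1-α) - j^(1-α), so their sum
telescopes to f 0 - f n; the last coefficient contributes f n, and f 0 = 1. -/
lemma sum_neg_coeffB (h1 : α < 1) (n : ℕ) :
    ∑ i ∈ Finset.range (n + 1), -coeffB α (n + 1) (n + 1 - i) = 1 := by
  rw [← Finset.sum_range_reflect, Finset.sum_range_succ]
  let f : ℕ → ℝ := fun j => (j + 1) ^ (1 - α) - j ^ (1 - α)
  have h2 : ∀ j ∈ Finset.range n, -coeffB α (n + 1) (n + 1 - (n + 1 - 1 - j)) = f j - f (j + 1) := by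
    intro j hj
    have hj' := Finset.mem_range.1 hj
    rw [show n + 1 - (n + 1 - 1 - j) = j + 1 by omega]
    unfold coeffB
    rw [if_neg (by omega), if_pos (by omega)]
    simp only [f]
    push_cast
    ring
  rw [sum_congr rfl h2, Finset.sum_range_sub']
  have h3 : (0 : ℝ) ^ (1 - α) = 0 := zero_rpow (by linarith)
  simp [coeffB, f, h3]

lemma timeAverage_congr {u u' : ℕ → Measure (E d)} {k : ℕ} (h : ∀ i < k, u i = u' i) :
    timeAverage α u k = timeAverage α u' k :=
  sum_congr rfl fun i hi => by rw [h i (Finset.mem_range.1 hi)]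

lemma timeAverage_mem (h0 : 0 < α) (h1 : α < 1) {u : ℕ → Measure (E d)}
    (hu : ∀ i ≤ n, u i ∈ probMeasures d ∧ energy q (u i) < ⊤) :
    timeAverage α u (n + 1) ∈ probMeasures d ∧ energy q (timeAverage α u (n + 1)) < ⊤ := by
  have hi : ∀ i ∈ Finset.range (n + 1), u i ∈ probMeasures d ∧ energy q (u i) < ⊤ := fun i hi =>
    hu i (Nat.lt_succ_iff.1 (Finset.mem_range.1 hi))
  refine ⟨⟨?_⟩, (energy_sum_lt_top q _ _ u (fun _ _ => ofReal_ne_top)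
    (fun i h => have : IsProbabilityMeasure (u i) := (hi i h).1; inferInstance) fun i h => (hi i h).2).2⟩
  unfold timeAverage
  rw [Measure.finsetSum_apply]
  calc ∑ i ∈ Finset.range (n + 1), (ofReal (-coeffB α (n + 1) (n + 1 - i)) • u i) univ
      = ∑ i ∈ Finset.range (n + 1), ofReal (-coeffB α (n + 1) (n + 1 - i)) := by
        refine sum_congr rfl fun i h => ?_
        have : IsProbabilityMeasure (u i) := (hi i h).1
        simp
    _ = 1 := by
      rw [← ENNReal.ofReal_sum_of_nonneg fun i h => neg_coeffB_nonneg h0 h1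
        (by have := Finset.mem_range.1 h; omega) (Nat.sub_le _ _), sum_neg_coeffB h1,
        ofReal_one]

/-- Every step that starts from a measure of finite energy has exactly one minimizer, again of
finite energy. -/
def UniqueSteps (d : ℕ) (m : ℝ → ℝ) (α s τ : ℝ) : Prop :=
  ∀ ubar : Measure (E d), ubar ∈ probMeasures d → energy (1 / (1 - s)) ubar < ⊤ →
    ∃ v : Measure (E d), energy (1 / (1 - s)) v < ⊤ ∧
      IsStepMinimizer m α s τ ubar v ∧ ∀ v', IsStepMinimizer m α s τ ubar v' → v' = v

/-- On probability measures the functional is that of a `Problem` with q = 1/(1-s); the factor 1/2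
and the constant relating norm and energy are put into b. -/
lemma uniqueSteps (hα : α < 1) (hs₀ : 0 < s) (hs₁ : s < min 1 ((d : ℝ) / 2)) (hτ : 0 < τ)
    (hm : IsMobility fun r => m (max r 0)) : UniqueSteps d m α s τ := by
  intro ubar hp he
  have hs1 := hs₁.trans_le (min_le_left _ _)
  have hd : 0 < d := by
    rw [← Nat.cast_pos (α := ℝ)]
    linarith [hs₁.trans_le (min_le_right _ _)]
  have hC : 0 < constC α / (2 * τ ^ α) := by
    have := Real.Gamma_pos_of_pos (by linarith : 0 < 2 - α)
    unfold constC
    positivity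
  let P : Problem d :=
    { m := fun r => m (max r 0), q := 1 / (1 - s), a := ofReal (constC α / (2 * τ ^ α)),
      b := 2⁻¹ * ofReal (energyConst d s), ref := ubar, mobility := hm,
      one_lt := by rw [lt_div_iff₀ (by linarith)]; linarith
      a_ne_zero := (ofReal_pos.2 hC).ne'
      a_ne_top := ofReal_ne_top
      b_ne_zero := mul_ne_zero (by simp) (ofReal_pos.2 (energyConst_pos hs₀ hs1)).ne'
      b_ne_top := mul_ne_top (by simp) ofReal_ne_top
      isProb := hp
      energy_lt := he }
  have hfun : EqOn (functional m α s τ ubar) P.pathTotal (probMeasures d) := by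
    intro u (hu : IsProbabilityMeasure u)
    unfold functional Problem.pathTotal
    rw [homSobolevNormSq_eq hd hs₀ hs1, ← mul_assoc,
      modifiedWasserstein_congr (m' := P.m) fun r hr => by simp only [P, max_eq_left hr]]
  have hiff : ∀ v ∈ probMeasures d, IsMinOn (functional m α s τ ubar) (probMeasures d) v ↔
    IsMinOn P.pathTotal (probMeasures d) v := fun v hv => by
    simp only [isMinOn_iff, hfun hv]
    exact forall₂_congr fun u hu => by rw [hfun hu]
  obtain ⟨γ, hγ, hE, hmin, huniq⟩ := P.exists_unique_minimizer hd
  exact ⟨γ, hE, ⟨hγ, (hiff γ hγ).2 hmin⟩, fun v hv => huniq v hv.1 ((hiff v hv.1).1 hv.2)⟩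

/-- An arbitrary minimizer coincides with the one constructed, which has finite energy; this keeps
the averages admissible in the induction. -/
lemma IsSchemeUpTo.energy_lt {u : ℕ → Measure (E d)} (hu : IsSchemeUpTo m α s τ u₀ n u)
    (H : UniqueSteps d m α s τ) (h0 : 0 < α) (h1 : α < 1) (hp : u₀ ∈ probMeasures d)
    (he : energy (1 / (1 - s)) u₀ < ⊤) :
    ∀ i ≤ n, u i ∈ probMeasures d ∧ energy (1 / (1 - s)) (u i) < ⊤ := by
  intro i
  induction i using Nat.strong_induction_on with
  | _ i ih =>
    intro hi
    rcases i with _ | j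
    · rw [hu.1]; exact ⟨hp, he⟩
    · obtain ⟨hap, hae⟩ := timeAverage_mem h0 h1 (n := j) fun i hij => ih i (by omega) (by omega)
      obtain ⟨v, hv, -, huniq⟩ := H _ hap hae
      have hmin := hu.2 (j + 1) (by omega) hi
      exact ⟨hmin.1, by rw [huniq _ hmin]; exact hv⟩

lemma IsSchemeUpTo.existsUnique {u : ℕ → Measure (E d)} (hu : IsSchemeUpTo m α s τ u₀ n u)
    (H : UniqueSteps d m α s τ) (h0 : 0 < α) (h1 : α < 1) (hp : u₀ ∈ probMeasures d)
    (he : energy (1 / (1 - s)) u₀ < ⊤) :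
    ∃! v : Measure (E d), IsStepMinimizer m α s τ (timeAverage α u (n + 1)) v := by
  obtain ⟨hap, hae⟩ := timeAverage_mem h0 h1 (hu.energy_lt H h0 h1 hp he)
  obtain ⟨v, -, hv, huniq⟩ := H _ hap hae
  exact ⟨v, hv, huniq⟩

lemma existsUnique_schemeSolution
    (H : UniqueSteps d m α s τ) (h0 : 0 < α) (h1 : α < 1) (hp : u₀ ∈ probMeasures d)
    (he : energy (1 / (1 - s)) u₀ < ⊤) :
    ∃! u : ℕ → Measure (E d), IsSchemeSolution m α s τ u₀ u := by
  classical
  let step : Measure (E d) → Measure (E d) := fun ubar =>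
    if h : ∃ v, IsStepMinimizer m α s τ ubar v then h.choose else 0
  have hstep : ∀ ubar, (∃ v, IsStepMinimizer m α s τ ubar v) →
    IsStepMinimizer m α s τ ubar (step ubar) := fun ubar h => by
    simp only [step, dif_pos h]; exact h.choose_spec
  -- `S n` is correct up to index n; later entries are irrelevant, and the solution is the diagonal.
  let S : ℕ → ℕ → Measure (E d) := fun n => n.rec (fun _ => u₀) fun n u =>
    Function.update u (n + 1) (step (timeAverage α u (n + 1)))
  have hS : ∀ n, S (n + 1) = Function.update (S n) (n + 1) (step (timeAverage α (S n) (n + 1))) :=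
    fun n => rfl
  have hstab : ∀ n k, k ≤ n → S n k = S k k := by
    intro n k hk
    induction n, hk using Nat.le_induction with
    | base => rfl
    | succ n hn ih => rw [hS, Function.update_of_ne (by omega), ih]
  have hup : ∀ n, IsSchemeUpTo m α s τ u₀ n (S n) := by
    intro n
    induction n with
    | zero => exact ⟨rfl, fun k hk hk' => by omega⟩
    | succ n ih =>
      refine ⟨by rw [hS, Function.update_of_ne (by omega)]; exact ih.1, fun k hk hkn => ?_⟩
      have havg : timeAverage α (S (n + 1)) k = timeAverage α (S n) k :=
        timeAverage_congr fun i hi => by rw [hS, Function.update_of_ne (by omega)]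
      rw [havg]
      rcases Nat.lt_or_ge n k with h | h
      · obtain rfl : k = n + 1 := by omega
        rw [hS, Function.update_self]
        exact hstep _ (ih.existsUnique H h0 h1 hp he).exists
      · rw [hS, Function.update_of_ne (by omega)]
        exact ih.2 k hk h
  refine ⟨fun k => S k k, ⟨rfl, fun k hk => ?_⟩, fun u hu => ?_⟩
  · rw [timeAverage_congr (u' := S k) fun i hi => (hstab k i hi.le).symm]
    exact (hup k).2 k hk le_rfl
  · funext k
    induction k using Nat.strong_induction_on with
    | _ k ih =>
      rcases k with _ | n
      · exact hu.1
      · have h2 : IsSchemeUpTo m α s τ u₀ n u := ⟨hu.1, fun k hk _ => hu.2 k hk⟩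
        refine (h2.existsUnique H h0 h1 hp he).unique (hu.2 (n + 1) (by omega)) ?_
        rw [timeAverage_congr (u' := S (n + 1)) fun i hi => (ih i hi).trans (hstab _ i hi.le).symm]
        exact (hup (n + 1)).2 (n + 1) (by omega) le_rfl

end

end JKO

end

theorem theorem3p1 (d : ℕ) (α s τ : ℝ) (hα₀ : 0 < α) (hα₁ : α < 1)
    (hs₀ : 0 < s) (hs₁ : s < min 1 ((d : ℝ) / 2)) (hτ : 0 < τ)
    (m : ℝ → ℝ) (hm_smooth : ContDiffOn ℝ ((⊤ : ℕ∞) : WithTop ℕ∞) m (Set.Ici 0))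
    (hm_pos : ∃ c : ℝ, 0 < c ∧ ∀ z : ℝ, 0 ≤ z → c ≤ m z)
    (hm_concave : ∀ z : ℝ, 0 ≤ z → iteratedDerivWithin 2 m (Set.Ici 0) z ≤ 0)
    (u₀ : MeasureTheory.Measure (JKO.E d)) (hu₀ : u₀ ∈ JKO.probMeasures₂ d)
    (hu₀_sobolev : JKO.homSobolevNormSq (-s) u₀ < ⊤) :
    (∀ (n : ℕ) (u : ℕ → MeasureTheory.Measure (JKO.E d)), JKO.IsSchemeUpTo m α s τ u₀ n u →
        ∃! v : MeasureTheory.Measure (JKO.E d), JKO.IsStepMinimizer m α s τ (JKO.timeAverage α u (n + 1)) v) ∧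
    (∃! u : ℕ → MeasureTheory.Measure (JKO.E d), JKO.IsSchemeSolution m α s τ u₀ u) := by
  have hs1 := hs₁.trans_le (min_le_left _ _)
  have hd : 0 < d := by
    rw [← Nat.cast_pos (α := ℝ)]
    linarith [hs₁.trans_le (min_le_right _ _)]
  have : MeasureTheory.IsProbabilityMeasure u₀ := hu₀.1
  -- The constant between norm and energy is positive, so a finite norm means finite energy.
  have he : JKO.energy (1 / (1 - s)) u₀ < ⊤ := by
    rw [JKO.homSobolevNormSq_eq hd hs₀ hs1] at hu₀_sobolev
    by_contra h
    rw [not_lt, top_le_iff] at h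
    rw [h, ENNReal.mul_top (ENNReal.ofReal_pos.2 (JKO.energyConst_pos hs₀ hs1)).ne'] at hu₀_sobolev
    exact lt_irrefl _ hu₀_sobolev
  have H := JKO.uniqueSteps hα₁ hs₀ hs₁ hτ (JKO.isMobility_max hm_smooth hm_pos hm_concave)
  exact ⟨fun n u hu => hu.existsUnique H hα₀ hα₁ hu₀.1 he, JKO.existsUnique_schemeSolution H hα₀ hα₁ hu₀.1 he⟩
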